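/- **Proposition 5.5.** Let $0\le k<p$ be integers, let $X$ be a closed oriented smooth manifold of dimension $k$, let $G$ be a (finite-dimensional) Lie group with Lie algebra $\mathfrak g$, and let $P$ be an invariant polynomial of degree $p$ on $\mathfrak g$ with complex values, i.e. a symmetric $p$-linear form $\mathfrak g^p\to\mathbb C$ invariant under $\mathrm{Ad}(G)$. (A complex Lie group is regarded as a real one. The case of interest is the polynomial $P$ of a characteristic class in $H^{2p}(BG,\mathbb Z(p))$.) *Bott–Shulman–Stasheff forms.* Let $\pi_m:G^{m+1}\to G^m$, $(g_0,\dots,g_m)\mapsto(g_0^{-1}g_1,\dots,g_{m-1}^{-1}g_m)$, be the principal bundle for the left $G$-action, let $D_j$ be its flat connection given by the section with $g_j=1$ (connection form $dg_j\,g_j^{-1}$), and let $R$ be the curvature of $\sum_{j=0}^m t_jD_j$ on the pullback of the bundle to $G^m\times\Delta_m$. Then $\omega_m=\int_{\Delta_m}P(R)$, a form of degree $2p-m$ on $G^m$. *Local simplices.* Let $\sigma_l:G^l\times\Delta_l\to G$ $(l\ge 0)$ be smooth maps, defined for group elements near $1$, with $\sigma_l(1,\dots,1;t)=1$, $\sigma_l(g_1,\dots,g_l;\delta_jt)=\sigma_{l-1}(d_j(g_1,\dots,g_l);t)$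 for $1\le j\le l$, and $\sigma_l(g_1,\dots,g_l;\delta_0t)=g_1\,\sigma_{l-1}(g_2,\dots,g_l;t)$, where $\delta_j$ are the face maps of the simplices and $d_j$ those of $BG$. Put $f_{m,q}(g_1,\dots,g_{m+q-1};t)=(g_1,\dots,g_{m-1},\sigma_q(g_m,\dots,g_{m+q-1};t))\in G^m$ for $t\in\Delta_q$. *The local cochain.* Let $N=2p-k-1$. On $N$-tuples of elements of the gauge group $Map(X,G)$ near $1$, put $$c(g_1,\dots,g_N)=\sum_{m+q=2p-k,\ 1\le m\le p}\ \int_{X\times\Delta_q}\phi_{m,q}^*\,\omega_m,\qquad \phi_{m,q}(x,t)=f_{m,q}(g_1(x),\dots,g_N(x);t).$$ Modulo $\mathbb Z(1)$ this is the explicit local cochain, with values in $\mathbb C/\mathbb Z(1)=\mathbb C^*$, for the class in $H^N(Map(X,G),\mathbb C^*)$ obtained from $P$ by transgression to the gauge group. *The form $\alpha$.* Let $q=2p-2k-1$, so that $N=q+k$, and let $[\omega_{k+1}]_1$ be the $N$-linear form on $\mathfrak g$ given by the value of $\omega_{k+1}$ at the identity of $G^{k+1}$, with the first $q$ arguments in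 the last copy of $\mathfrak g$ in $\mathfrak g^{k+1}$ and the other $k$ arguments in the copies $1,\dots,k$, in this order. For $\xi_1,\dots,\xi_N\in Map(X,\mathfrak g)$ let $$\alpha(\xi_1,\dots,\xi_N)=\frac1{q!}\,[\omega_{k+1}]_1(\xi_1,\dots,\xi_q,d\xi_{q+1}\wedge\dots\wedge d\xi_N),$$ the $k$-form on $X$ that in local coordinates $x_1,\dots,x_k$ is $$\frac1{q!}\sum_{\tau\in S_k}\varepsilon(\tau)\,[\omega_{k+1}]_1\Bigl(\xi_1,\dots,\xi_q,\frac{\partial\xi_{q+1}}{\partial x_{\tau(1)}},\dots,\frac{\partial\xi_{N}}{\partial x_{\tau(k)}}\Bigr)\,dx_1\wedge\dots\wedge dx_k .$$ *Claim.* There is an alternating $N$-linear form $\Phi$ on the Lie algebra $Map(X,\mathfrak g)$ of smooth maps (pointwise bracket), with complex values, with the following properties. 1. $\Phi$ is a Lie algebra cocycle (trivial coefficients). 2. $\Phi$ is obtained by differentiating $c$ at the identity: whenever $\gamma_1,\dots,\gamma_N$ are smooth curves in $Map(X,G)$ with $\gamma_i(0)=1$ and velocity $\gamma_i'(0)=\xi_i$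 (for instance $\gamma_i(t)=\exp(t\xi_i)$), the function $(t_1,\dots,t_N)\mapsto c(\gamma_1(t_1),\dots,\gamma_N(t_N))$ is smooth at $0$, and $$\Phi(\xi_1,\dots,\xi_N)=\Bigl[\frac{\partial^N}{\partial t_1\cdots\partial t_N}\sum_{\tau\in S_N}\varepsilon(\tau)\,c\bigl(\gamma_{\tau(1)}(t_{\tau(1)}),\dots,\gamma_{\tau(N)}(t_{\tau(N)})\bigr)\Bigr]_{t=0}.$$ 3. $\Phi$ is the skew-symmetrization of $\int_X\alpha$: $$\Phi(\xi_1,\dots,\xi_N)=\sum_{\tau\in S_N}\varepsilon(\tau)\int_X\alpha(\xi_{\tau(1)},\dots,\xi_{\tau(N)}).$$ 4. For $k=p-1$ it is, up to the factor $(-1)^{p-1}p!$, Feigin's cocycle: $\Phi(\xi_1,\dots,\xi_p)=(-1)^{p-1}\,p!\int_X\omega_p(\xi_1,d\xi_2,\dots,d\xi_p)$, where $\omega_p(v_1,\dots,v_p)$ is the value of $\omega_p$ at the identity of $G^p$ with $v_i\in\mathfrak g$ in the $i$-th copy of $\mathfrak g$, and the $d\xi_i$ are multiplied by the wedge product. 5.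 For $p=2$, $k=1$ (loop groups, $X=S^1$) it is the Kac–Moody cocycle $\Phi(\xi_1,\xi_2)=2\int_XP(\xi_1,d\xi_2)$. Conventions: fibre integrals over a simplex take the vectors of the base first, $X\times\Delta_q$ has the product orientation, and $\Delta_q$ is oriented by $dt_1\wedge\dots\wedge dt_q$. -/

import Mathlib

open scoped Manifold ContDiff Topology
open MeasureTheory

noncomputable section

namespace GaugeCocycle

/-! ### Lie groups

`G` is a real Lie group of dimension `d` (a complex Lie group is regarded as a real one). -/

/-- The model vector space `ℝⁿ`. -/
abbrev Model (n : ℕ) : Type := EuclideanSpace ℝ (Fin n)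

/-- The Lie algebra `𝔤 = T₁G`; its bracket is the one of left-invariant vector fields. -/
abbrev LieAlg (d : ℕ) (G : Type*) [TopologicalSpace G] [ChartedSpace (Model d) G] [Group G] : Type :=
  GroupLieAlgebra (𝓡 d) G

/-- The smoothness that the construction of the bracket of `𝔤` asks for. -/
instance instLieGroupMinSmoothness {d : ℕ} {G : Type*} [TopologicalSpace G]
    [ChartedSpace (Model d) G] [Group G] [LieGroup (𝓡 d) ∞ G] :
    LieGroup (𝓡 d) (minSmoothness ℝ 3) G := by
  rw [minSmoothness_of_isRCLikeNormedField]
  infer_instance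

section LieGroup

variable {d : ℕ} {G : Type*} [TopologicalSpace G] [ChartedSpace (Model d) G] [Group G]

/-- The adjoint action `Ad(g) : 𝔤 → 𝔤`, the differential at `1` of `h ↦ g h g⁻¹`. -/
def Ad (g : G) (v : LieAlg d G) : LieAlg d G :=
  mfderiv (𝓡 d) (𝓡 d) (fun h : G => g * h * g⁻¹) 1 v

/-- An invariant polynomial of degree `p` on `𝔤`, in polarised form: a symmetric `p`-linear form
that is invariant under the adjoint action. -/
def IsInvariantPolynomial {p : ℕ} (P : MultilinearMap ℝ (fun _ : Fin p => LieAlg d G) ℂ) : Prop :=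
  (∀ (τ : Equiv.Perm (Fin p)) (v : Fin p → LieAlg d G), P (fun i => v (τ i)) = P v) ∧
    ∀ (g : G) (v : Fin p → LieAlg d G), P (fun i => Ad g (v i)) = P v

/-- The pullback `dφ · φ⁻¹` under a map `φ : M → G` of the right-invariant Maurer-Cartan form of
`G`: at `x` it is the differential at `x` of `y ↦ φ(y) φ(x)⁻¹`, a map that sends `x` to `1`.
A tangent vector `v` at `g ∈ G` is identified in this way with the element `v g⁻¹` of `𝔤`. -/
def maurerCartan {E H M : Type*} [NormedAddCommGroup E] [NormedSpace ℝ E] [TopologicalSpace H]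
    (I : ModelWithCorners ℝ E H) [TopologicalSpace M] [ChartedSpace H M]
    (φ : M → G) (x : M) (w : TangentSpace I x) : LieAlg d G :=
  (mfderiv I (𝓡 d) (fun y => φ y * (φ x)⁻¹) x w : Model d)

/-! ### The standard simplex and the Bott-Shulman-Stasheff forms -/

/-- The standard simplex `Δ_q`, in the coordinates `(t₁, …, t_q)`; the remaining barycentric
coordinate is `t₀ = 1 - (t₁ + ⋯ + t_q)`. Its orientation is `dt₁ ∧ ⋯ ∧ dt_q`. -/
def simplex (q : ℕ) : Set (Fin q → ℝ) := {t | (∀ i, 0 ≤ t i) ∧ ∑ i, t i ≤ 1}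

/-- The bundle `EG → BG` in degree `m` is `G^{m+1} → G^m`,
`(g₀, …, g_m) ↦ (g₀⁻¹ g₁, …, g_{m-1}⁻¹ g_m)`, with its left `G`-action. The flat connection that is
given by the section with `g_j = 1` has the connection form `dg_j · g_j⁻¹`. Pulled back to
`G^m` along the section with `g₀ = 1`, on which `g_j = a₁ ⋯ a_j`, it becomes `0` for `j = 0` and,
for `j ≥ 1`, the form `ρ_j = d(a₁ ⋯ a_j) · (a₁ ⋯ a_j)⁻¹`, that is,
`ρ_j(v) = ∑_{i ≤ j} Ad(a₁ ⋯ a_{i-1}) v_i` on the tangent vector with components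
`v_i a_i`, `v_i ∈ 𝔤`. (In the code `j` runs through `0, …, m - 1` in place of `1, …, m`.) -/
def connForm {m : ℕ} (a : Fin m → G) (j : Fin m) (v : Fin m → LieAlg d G) : LieAlg d G :=
  ∑ i ∈ Finset.univ.filter (fun i => i ≤ j), Ad (Fin.partialProd a i.castSucc) (v i)

/-- The curvature `R = dA - ½ [A, A]` of the connection `A = ∑_j t_j ρ_j` on the pullback of the
bundle to `G^m × Δ_m`, at the point `(a, t)`, on two tangent vectors in `𝔤^m × ℝ^m`. Here
`dA = ∑_j dt_j ∧ ρ_j + ∑_j t_j dρ_j`, and `dρ_j = ½ [ρ_j, ρ_j]` because `ρ_j` is flat. -/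
def curvature {m : ℕ} (a : Fin m → G) (t : Fin m → ℝ)
    (w w' : (Fin m → LieAlg d G) × (Fin m → ℝ)) : LieAlg d G :=
  ∑ j, (w.2 j • connForm a j w'.1 - w'.2 j • connForm a j w.1)
    + ∑ j, t j • ⁅connForm a j w.1, connForm a j w'.1⁆
    - ⁅∑ j, t j • connForm a j w.1, ∑ j, t j • connForm a j w'.1⁆

/-- The Chern-Weil form `P(R) = P(R ∧ ⋯ ∧ R)`, a form of degree `2p`, where `R` is a `𝔤`-valued
alternating form of degree `2` on the vector space `W`. -/
def chernWeil {p : ℕ} (P : MultilinearMap ℝ (fun _ : Fin p => LieAlg d G) ℂ) {W : Type*}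
    (R : W → W → LieAlg d G) (w : Fin (2 * p) → W) : ℂ :=
  ((2 : ℂ) ^ p)⁻¹ * ∑ τ : Equiv.Perm (Fin (2 * p)), ((Equiv.Perm.sign τ : ℤ) : ℂ) *
    P (fun i => R (w (τ ⟨2 * i, by omega⟩)) (w (τ ⟨2 * i + 1, by omega⟩)))

/-- The Bott-Shulman-Stasheff form `ω_m = ∫_{Δ_m} P(R)`, a form of degree `n = 2p - m` on `G^m`, at
the point `a`, on `n` tangent vectors; the tangent space of `G^m` at `a` is identified with `𝔤^m` by
right translation. (A fibre integral over a simplex takes the vectors of the base first.) -/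
def bssForm {p : ℕ} (P : MultilinearMap ℝ (fun _ : Fin p => LieAlg d G) ℂ) {n m : ℕ}
    (h : n + m = 2 * p) (a : Fin m → G) (v : Fin n → Fin m → LieAlg d G) : ℂ :=
  ∫ t in simplex m, chernWeil P (curvature a t) (fun i =>
    Fin.append (fun l => ((v l, 0) : (Fin m → LieAlg d G) × (Fin m → ℝ)))
      (fun j => (0, Pi.single j 1)) (Fin.cast h.symm i))

/-! ### Local simplices in the group -/

/-- A family of germs of smooth maps `σ_l : G^l × Δ_l → G` at `(1, …, 1) × Δ_l` with
`σ_l(1, …, 1; t) = 1` (in particular `σ₀ = 1`), compatible with the faces: with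
`δ_j : Δ_l → Δ_{l+1}` the `j`-th face of the simplex,
* `σ_{l+1}(g; δ₀ t) = g₁ · σ_l(g₂, …, g_{l+1}; t)`,
* `σ_{l+1}(g; δ_j t) = σ_l(g₁, …, g_j g_{j+1}, …, g_{l+1}; t)` for `1 ≤ j ≤ l`,
* `σ_{l+1}(g; δ_{l+1} t) = σ_l(g₁, …, g_l; t)`.
Smoothness on the closed simplex means smoothness on a neighbourhood of it. The coordinates of a
chart of `G` at `1` are used on the source. (`j : Fin (l + 1)` in the code stands for
`j + 1`, and `Fin.contractNth j` is the corresponding face map of `BG`.) -/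
structure IsLocalSimplexFamily (σ : ∀ l : ℕ, (Fin l → G) → (Fin l → ℝ) → G) : Prop where
  smooth : ∀ l, ∃ W ∈ 𝓝 (fun _ : Fin l => chartAt (Model d) (1 : G) 1),
    ∃ V : Set (Fin l → ℝ), IsOpen V ∧ simplex l ⊆ V ∧
      ContMDiffOn 𝓘(ℝ, (Fin l → Model d) × (Fin l → ℝ)) (𝓡 d) ∞
        (fun z : (Fin l → Model d) × (Fin l → ℝ) =>
          σ l (fun i => (chartAt (Model d) (1 : G)).symm (z.1 i)) z.2) (W ×ˢ V)
  one : ∀ l, ∀ t ∈ simplex l, σ l (fun _ => 1) t = 1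
  face_zero : ∀ l, ∀ᶠ g in 𝓝 (fun _ : Fin (l + 1) => (1 : G)), ∀ t ∈ simplex l,
    σ (l + 1) g (Fin.cons (1 - ∑ i, t i) t) = g 0 * σ l (Fin.tail g) t
  face_succ : ∀ l, ∀ᶠ g in 𝓝 (fun _ : Fin (l + 1) => (1 : G)), ∀ t ∈ simplex l,
    ∀ j : Fin (l + 1), σ (l + 1) g (Fin.insertNth j 0 t) = σ l (Fin.contractNth j (· * ·) g) t

/-- The map `f_{m,q} : G^{m+q-1} × Δ_q → G^m`,
`(g; t) ↦ (g₁, …, g_{m-1}, σ_q(g_m, …, g_{m+q-1}; t))`. The code writes `m + 1` for `m`, and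
`N = m + q` for the number of the group elements. -/
def faceMap (σ : ∀ l : ℕ, (Fin l → G) → (Fin l → ℝ) → G) {N m q : ℕ} (h : m + q = N)
    (g : Fin N → G) (t : Fin q → ℝ) : Fin (m + 1) → G :=
  Fin.snoc (fun i : Fin m => g (Fin.cast h (Fin.castAdd q i)))
    (σ q (fun i : Fin q => g (Fin.cast h (Fin.natAdd m i))) t)

end LieGroup

/-! ### Closed oriented manifolds and integration of forms -/

section Manifold

variable {k : ℕ} {X : Type*} [TopologicalSpace X] [ChartedSpace (Model k) X]

/-- The coordinate frame `∂/∂x₁, …, ∂/∂x_k` of the chart at `x₀`, at the point with coordinates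
`z`. -/
def coordFrame (x₀ : X) (z : Model k) (j : Fin k) :
    TangentSpace (𝓡 k) ((chartAt (Model k) x₀).symm z) :=
  mfderiv (𝓡 k) (𝓡 k) (chartAt (Model k) x₀).symm z (EuclideanSpace.single j (1 : ℝ) : Model k)

/-- An orientation of the `k`-manifold `X`, given by a continuous nowhere vanishing form of degree
`k` (a frame is positive if the form is positive on it). -/
structure Orient (k : ℕ) (X : Type*) [TopologicalSpace X] [ChartedSpace (Model k) X] where
  /-- the form -/
  form : ∀ x : X, (TangentSpace (𝓡 k) x) [⋀^Fin k]→ₗ[ℝ] ℝ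
  ne_zero : ∀ x, form x ≠ 0
  continuousOn : ∀ x₀ : X, ContinuousOn
    (fun z : Model k => form ((chartAt (Model k) x₀).symm z) (coordFrame x₀ z))
    (chartAt (Model k) x₀).target

variable [T2Space X] [CompactSpace X] [IsManifold (𝓡 k) ∞ X]

/-- A smooth partition of unity subordinate to the charts of `X`. -/
def chartPartition (k : ℕ) (X : Type*) [TopologicalSpace X] [ChartedSpace (Model k) X]
    [T2Space X] [CompactSpace X] [IsManifold (𝓡 k) ∞ X] :
    SmoothPartitionOfUnity X (𝓡 k) X Set.univ :=
  (SmoothPartitionOfUnity.exists_isSubordinate_chartAt_source (𝓡 k) X).choose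

/-- The integral `∫_X α` of a `k`-form over the closed oriented `k`-manifold `X`: the sum over the
charts of the integrals of `ρ_i α(∂/∂x₁, …, ∂/∂x_k) dx₁ ⋯ dx_k`, with a minus sign wherever
the chart reverses the orientation, for a partition of unity `ρ`. -/
def integral (o : Orient k X) (α : ∀ x : X, (Fin k → TangentSpace (𝓡 k) x) → ℂ) : ℂ :=
  ∑ᶠ x₀ : X, ∫ z in (chartAt (Model k) x₀).target,
    (((chartPartition k X x₀ ((chartAt (Model k) x₀).symm z) : ℝ) *
      Real.sign (o.form ((chartAt (Model k) x₀).symm z) (coordFrame x₀ z)) : ℝ) : ℂ) *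
    α ((chartAt (Model k) x₀).symm z) (coordFrame x₀ z)

end Manifold

/-! ### The gauge group `Map(X, G)` and its Lie algebra -/

section Gauge

variable {d k p : ℕ}
  {G : Type*} [TopologicalSpace G] [ChartedSpace (Model d) G] [Group G]
  {X : Type*} [TopologicalSpace X] [ChartedSpace (Model k) X]

/-- The differential `dξ` of a map `ξ : X → 𝔤`. -/
def diff (ξ : X → LieAlg d G) (x : X) (w : TangentSpace (𝓡 k) x) : LieAlg d G :=
  (mfderiv (M' := Model d) (𝓡 k) 𝓘(ℝ, Model d) ξ x w : Model d)

/-- The `k`-form `β_{m,q} = ∫_{Δ_q} f_{m,q}^* ω_m` on `G^N`, pulled back to `X` along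
`(g₁, …, g_N) : X → G^N`; with `φ(x, t) = f_{m,q}(g₁(x), …, g_N(x); t)` this is the form
`∫_{Δ_q} φ^* ω_m` on `X`. The code writes `m + 1` for `m`. -/
def betaForm (P : MultilinearMap ℝ (fun _ : Fin p => LieAlg d G) ℂ)
    (σ : ∀ l : ℕ, (Fin l → G) → (Fin l → ℝ) → G) {N m q : ℕ} (h : m + q = N)
    (h' : k + q + (m + 1) = 2 * p) (g : Fin N → X → G) (x : X)
    (w : Fin k → TangentSpace (𝓡 k) x) : ℂ :=
  ∫ t in simplex q,
    bssForm P h' (faceMap σ h (fun i => g i x) t) (fun l i =>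
      maurerCartan ((𝓡 k).prod 𝓘(ℝ, Fin q → ℝ))
        (fun y : X × (Fin q → ℝ) => faceMap σ h (fun i => g i y.1) y.2 i) (x, t)
        (Fin.append (fun b => ((w b, 0) : TangentSpace (𝓡 k) x × (Fin q → ℝ)))
          (fun b => (0, Pi.single b 1)) l))

/-- The local cochain `c = ∑_{m + q = 2p - k, 1 ≤ m ≤ p} c_{m,q}`,
`c_{m,q}(g₁, …, g_N) = ∫_{X × Δ_q} φ_{m,q}^* ω_m`, on `N = 2p - k - 1` elements of the gauge group
(that is, `c = ∫_X η_k` for the `k`-form `η_k = ∑ β_{m,q}`). It has values in `ℂ`; modulo `ℤ(1)` it is a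
cochain with values in `ℂ* = ℂ / ℤ(1)`. The code writes `m + 1` for `m`. -/
def localCochain [T2Space X] [CompactSpace X] [IsManifold (𝓡 k) ∞ X] (hk : k < p)
    (P : MultilinearMap ℝ (fun _ : Fin p => LieAlg d G) ℂ)
    (σ : ∀ l : ℕ, (Fin l → G) → (Fin l → ℝ) → G) (o : Orient k X)
    (g : Fin (2 * p - k - 1) → X → G) : ℂ :=
  ∑ m : Fin p, integral o (betaForm P σ (m := m) (q := 2 * p - k - 1 - m)
    (by omega) (by omega) g)

/-- `γ : ℝ → Map(X, G)` is a smooth curve in the gauge group with `γ(0) = 1` and velocity `ξ` at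
`0`; for instance, `γ(t) = exp(t ξ)`. -/
def IsGaugeCurve (γ : ℝ → X → G) (ξ : X → LieAlg d G) : Prop :=
  ContMDiff (𝓘(ℝ, ℝ).prod (𝓡 k)) (𝓡 d) ∞ (fun y : ℝ × X => γ y.1 y.2) ∧
    (∀ x, γ 0 x = 1) ∧ ∀ x, maurerCartan 𝓘(ℝ, ℝ) (fun t => γ t x) 0 (1 : ℝ) = ξ x

/-- The skew-symmetrised mixed derivative at the identity of an `N`-cochain `c` of the gauge group
`[∂^N / ∂t₁ ⋯ ∂t_N  ∑_τ ε(τ) c(γ_{τ(1)}(t_{τ(1)}), …, γ_{τ(N)}(t_{τ(N)}))]` at `t = 0`,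
along curves `γ₁, …, γ_N`. -/
def skewDerivative {N : ℕ} (c : (Fin N → X → G) → ℂ) (γ : Fin N → ℝ → X → G) : ℂ :=
  iteratedFDeriv ℝ N (fun t : Fin N → ℝ => ∑ τ : Equiv.Perm (Fin N),
    ((Equiv.Perm.sign τ : ℤ) : ℂ) * c (fun i => γ (τ i) (t (τ i)))) 0 (fun i => Pi.single i 1)

/-- The `k`-form `α` on `X` attached to `ξ₁, …, ξ_N : X → 𝔤`, `N = 2p - k - 1`. With
`q = 2p - 2k - 1` and `m = k + 1` it is
`α = (1/q!) [ω_m]₁(ξ₁, …, ξ_q, dξ_{q+1} ∧ ⋯ ∧ dξ_N)`, in local coordinates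
`(1/q!) ∑_τ ε(τ) [ω_m]₁(ξ₁, …, ξ_q, ∂ξ_{q+1}/∂x_{τ(1)}, …, ∂ξ_N/∂x_{τ(k)}) dx₁ ∧ ⋯ ∧ dx_k`.
Here `[ω_m]₁`, an `N`-linear form on `𝔤`, is the value of `ω_m` at the identity of `G^m`, with the
first `q` arguments in the last copy of `𝔤` in `𝔤^m` and the other `k` arguments in the
copies `1, …, k`, in this order. -/
def alphaForm (hk : k < p) (P : MultilinearMap ℝ (fun _ : Fin p => LieAlg d G) ℂ)
    (ξ : Fin (2 * p - k - 1) → X → LieAlg d G) (x : X) (w : Fin k → TangentSpace (𝓡 k) x) : ℂ :=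
  ((Nat.factorial (2 * p - 2 * k - 1) : ℂ))⁻¹ *
    ∑ τ : Equiv.Perm (Fin k), ((Equiv.Perm.sign τ : ℤ) : ℂ) *
      bssForm P (n := 2 * p - 2 * k - 1 + k) (m := k + 1) (by omega) (fun _ => (1 : G))
        (Fin.append
          (fun i : Fin (2 * p - 2 * k - 1) =>
            (Pi.single (Fin.last k) (ξ ⟨i, by omega⟩ x) : Fin (k + 1) → LieAlg d G))
          (fun j : Fin k => Pi.single j.castSucc
            (diff (ξ ⟨2 * p - 2 * k - 1 + j, by omega⟩) x (w (τ j)))))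

/-- For `k = p - 1` the `k`-form `ω_p(ξ₁, dξ₂, …, dξ_p)` on `X`, where
`ω_p(v₁, …, v_p)` is the value of `ω_p` at the identity of `G^p` on `v₁, …, v_p ∈ 𝔤`, with `v_i` in the
`i`-th copy of `𝔤`, and the forms `dξ_i` are multiplied by the wedge product. -/
def feiginForm (hp : k + 1 = p) (P : MultilinearMap ℝ (fun _ : Fin p => LieAlg d G) ℂ)
    (ξ : Fin (2 * p - k - 1) → X → LieAlg d G) (x : X) (w : Fin k → TangentSpace (𝓡 k) x) : ℂ :=
  ∑ τ : Equiv.Perm (Fin k), ((Equiv.Perm.sign τ : ℤ) : ℂ) *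
    bssForm P (n := k + 1) (m := k + 1) (by omega) (fun _ => (1 : G))
      (fun i => Pi.single i
        ((Fin.cons (ξ ⟨0, by omega⟩ x)
          (fun j : Fin k => diff (ξ ⟨j + 1, by omega⟩) x (w (τ j))) : Fin (k + 1) → LieAlg d G) i))

/-- The `1`-form `P(ξ₁, dξ₂)` on a manifold of dimension `1`, for an invariant bilinear form `P`. -/
def kacMoodyForm (hp : p = 2) (hk : k = 1)
    (P : MultilinearMap ℝ (fun _ : Fin p => LieAlg d G) ℂ)
    (ξ : Fin (2 * p - k - 1) → X → LieAlg d G) (x : X) (w : Fin k → TangentSpace (𝓡 k) x) : ℂ :=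
  P (fun i => if (i : ℕ) = 0 then ξ ⟨0, by omega⟩ x
    else diff (ξ ⟨1, by omega⟩) x (w ⟨0, by omega⟩))

/-- The pointwise bracket on the maps `X → 𝔤`. -/
instance instLieRingMap [LieGroup (𝓡 d) ∞ G] : LieRing (X → LieAlg d G) where
  bracket a b := fun x => ⁅a x, b x⁆
  add_lie a b c := funext fun x => add_lie (a x) (b x) (c x)
  lie_add a b c := funext fun x => lie_add (a x) (b x) (c x)
  lie_self a := funext fun x => lie_self (a x)
  leibniz_lie a b c := funext fun x => leibniz_lie (a x) (b x) (c x)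

instance instLieAlgebraMap [LieGroup (𝓡 d) ∞ G] : LieAlgebra ℝ (X → LieAlg d G) where
  lie_smul r a b := funext fun x => lie_smul r (a x) (b x)

/-- The bracket of `𝔤` as a bilinear map on the model space. -/
def bracketMap (d : ℕ) (G : Type*) [TopologicalSpace G] [ChartedSpace (Model d) G] [Group G]
    [LieGroup (𝓡 d) ∞ G] : Model d →ₗ[ℝ] Model d →ₗ[ℝ] Model d :=
  LinearMap.mk₂ ℝ (fun u v => (⁅(show LieAlg d G from u), (show LieAlg d G from v)⁆ : LieAlg d G))
    (fun u v w => add_lie (L := LieAlg d G) (M := LieAlg d G) u v w)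
    (fun r u v => smul_lie (L := LieAlg d G) (M := LieAlg d G) r u v)
    (fun u v w => lie_add (L := LieAlg d G) (M := LieAlg d G) u v w)
    (fun r u v => lie_smul (L := LieAlg d G) (M := LieAlg d G) r u v)

/-- The Lie algebra `Map(X, 𝔤)` of smooth maps, with the pointwise bracket. -/
def gaugeLieAlgebra (d k : ℕ) (G : Type*) [TopologicalSpace G] [ChartedSpace (Model d) G] [Group G]
    [LieGroup (𝓡 d) ∞ G] (X : Type*) [TopologicalSpace X]
    [ChartedSpace (Model k) X] : LieSubalgebra ℝ (X → LieAlg d G) where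
  carrier := {ξ | ContMDiff (M' := Model d) (𝓡 k) 𝓘(ℝ, Model d) ∞ ξ}
  add_mem' := fun ha hb => ContMDiff.add (G := Model d) ha hb
  zero_mem' := contMDiff_const (M' := Model d)
  smul_mem' := fun c _ ha => (contDiff_const_smul (F := Model d) c).contMDiff.comp ha
  lie_mem' := fun ha hb =>
    ContMDiff.clm_apply ((bracketMap d G).toContinuousBilinearMap.contMDiff.comp ha) hb

/-- A Chevalley-Eilenberg cocycle of degree `n` of the Lie algebra `L` with trivial coefficients:
an alternating `n`-linear form `Φ` with
`∑_{i<j} (-1)^{i+j} Φ([ξ_i, ξ_j], ξ₀, …, ξ̂_i, …, ξ̂_j, …, ξ_n) = 0`. In the code the bracket stands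
in the place of `ξ_i`, which costs the sign `(-1)^i`. -/
def IsLieCocycle {L : Type*} [LieRing L] [LieAlgebra ℝ L] {n : ℕ} (Φ : L [⋀^Fin n]→ₗ[ℝ] ℂ) : Prop :=
  ∀ ξ : Fin (n + 1) → L,
    ∑ i : Fin (n + 1), ∑ j ∈ Finset.univ.filter (fun j => i < j),
      (-1 : ℂ) ^ (j : ℕ) * Φ (j.removeNth (Function.update ξ i ⁅ξ i, ξ j⁆)) = 0

end Gauge

end GaugeCocycle

end

set_option linter.unusedSectionVars false

open scoped Manifold ContDiff Topology

open MeasureTheory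

noncomputable section

namespace GaugeCocycle

/-! ### Skew-symmetrisation -/

section AltSum

variable {ι κ L : Type*} [Fintype ι] [DecidableEq ι] [Fintype κ] [DecidableEq κ]

/-! Four computations carry the theorem; throughout, r = p - k - 1 and q = 2r + 1.

The value of ω_{k+1} at the identity. The curvature of A = ∑ t_j ρ_j has no component along two
simplex directions, and its component along ∂/∂t_j and a base vector is ρ_j, which at the identity
sees only the copies 1, …, j of the Lie algebra. In a nonvanishing term of P(R, …, R) the vectors
∂/∂t_1, …, ∂/∂t_k are therefore paired with the vectors in the copies 1, …, k, in this order,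
∂/∂t_{k+1} is paired with one of the q vectors in the last copy, and the remaining 2r vectors are
paired with each other, where R is t(1 - t)[·, ·] with t = t_{k+1}. So [ω_{k+1}]_1 is a constant C
times the skew-symmetrisation, in the first q arguments, of P(ξ, [ξ, ξ], …, [ξ, ξ], ζ_1, …, ζ_k)
(`exists_structure`, `exists_bssForm_eq`). The cocycle Φ is taken to be C times the
skew-symmetrisation of ∫_X P(ξ, [ξ, ξ], …, [ξ, ξ], dξ, …, dξ) (`gaugeForm`), and its comparison with
α is a matter of counting permutations (`gaugeForm_eq_alphaForm`).

The cocycle property. By the invariance of P, bracketing all arguments with a new element z leaves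
only the terms in which a differential falls on z (`altSum_slots_ce`). After skew-symmetrisation,
the Jacobi identity and invariance show that k + 2r + 2 times their sum is a sum of exact forms
(`altSum_slotsZ`), whose integrals vanish by Stokes' theorem on X (`sum_integral_slotForm_eq_zero`).

Differentiation of the cochain. At the identity of the gauge group the maps φ_{m,q} are constant, so
their tangent vectors vanish there, and c_{m,q}, the integral of a form of degree k + q, vanishes to
order k + q (`hasLeadingTerms_betaForm`). If m ≤ k, this order exceeds N and nothing is contributed.
If m > k + 1, then c_{m,q} is zero near the identity, because only the k directions of X move the
first m - 1 factors (`bssForm_eq_zero_of_top`). For m = k + 1 the mixed derivative is the integral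
over X × Δ_q of ω_{k+1} at the identity, evaluated on differentials of the ξ_i in the first k copies
and on differentials along Δ_q of A_i ξ_i in the last copy, where A_i is the derivative of σ_q in
its i-th argument. After skew-symmetrisation the integral over Δ_q is simply the value on the ξ_i
themselves: this is Stokes' theorem on the simplex and induction on q, with the face relations of σ
making the flux through the coordinate faces vanish or cancel, while the slanted face reproduces the
case q - 1 (`IsSimplexFamily.altSum_wedgeIntegral`).

The case k = p - 1. Here r = 0, no bracket occurs, and integration by parts makes ∫_X P(ξ_1, dξ_2,
…, dξ_p) alternating, so that skew-symmetrisation multiplies it by p! (`altSum_baseIntegral`). The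
sign (-1)^(p-1) is that of the cyclic permutation relating the two orders of the arguments
(`bssForm_diagonal`). For p = 2 the constant is found by listing the permutations of four vectors
(`bssForm_two`). -/

/-- The skew-symmetrisation of a function of several variables. -/
def altSum (F : (ι → L) → ℂ) (ξ : ι → L) : ℂ :=
  ∑ τ : Equiv.Perm ι, ((Equiv.Perm.sign τ : ℤ) : ℂ) * F (fun i => ξ (τ i))

lemma sign_mul_self (τ : Equiv.Perm ι) :
    ((Equiv.Perm.sign τ : ℤ) : ℂ) * ((Equiv.Perm.sign τ : ℤ) : ℂ) = 1 := by
  rcases Int.units_eq_one_or (Equiv.Perm.sign τ) with h | h <;> simp [h]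

lemma altSum_comp_arg (F : (ι → L) → ℂ) (ξ : ι → L) (ρ : Equiv.Perm ι) :
    altSum F (fun i => ξ (ρ i)) = ((Equiv.Perm.sign ρ : ℤ) : ℂ) * altSum F ξ := by
  unfold altSum
  rw [Finset.mul_sum]
  refine Fintype.sum_equiv (Equiv.mulLeft ρ) _ _ fun τ => ?_
  simp only [Equiv.coe_mulLeft, Equiv.Perm.sign_mul, Units.val_mul, Int.cast_mul,
    Equiv.Perm.mul_apply]
  rw [← mul_assoc, ← mul_assoc, sign_mul_self, one_mul]

/-- Here the variables of the function are permuted, not the arguments, so the reindexing is by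
right multiplication. It collects summands that differ only in the numbering of their variables. -/
lemma altSum_comp (F : (ι → L) → ℂ) (ξ : ι → L) (ρ : Equiv.Perm ι) :
    altSum (fun x => F (fun i => x (ρ i))) ξ = ((Equiv.Perm.sign ρ : ℤ) : ℂ) * altSum F ξ := by
  unfold altSum
  rw [Finset.mul_sum]
  refine Fintype.sum_equiv (Equiv.mulRight ρ) _ _ fun τ => ?_
  simp only [Equiv.coe_mulRight, Equiv.Perm.sign_mul, Units.val_mul, Int.cast_mul,
    Equiv.Perm.mul_apply]
  rw [mul_comm ((Equiv.Perm.sign τ : ℤ) : ℂ) ((Equiv.Perm.sign ρ : ℤ) : ℂ), ← mul_assoc,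
    ← mul_assoc, sign_mul_self, one_mul]

lemma altSum_equiv (e : κ ≃ ι) (F : (κ → L) → ℂ) (ξ : ι → L) :
    altSum (fun x : ι → L => F (fun j => x (e j))) ξ = altSum F (fun j => ξ (e j)) := by
  unfold altSum
  refine Fintype.sum_equiv (e.symm.permCongr) _ _ fun τ => ?_
  simp [Equiv.permCongr_apply]

lemma altSum_add (F F' : (ι → L) → ℂ) (ξ : ι → L) :
    altSum (fun x => F x + F' x) ξ = altSum F ξ + altSum F' ξ := by
  simp [altSum, mul_add, Finset.sum_add_distrib]

lemma altSum_neg (F : (ι → L) → ℂ) (ξ : ι → L) :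
    altSum (fun x => - F x) ξ = - altSum F ξ := by
  simp [altSum]

lemma altSum_sum {α : Type*} (s : Finset α) (F : α → (ι → L) → ℂ) (ξ : ι → L) :
    altSum (fun x => ∑ a ∈ s, F a x) ξ = ∑ a ∈ s, altSum (F a) ξ := by
  simp only [altSum, Finset.mul_sum]
  exact Finset.sum_comm

lemma altSum_const_mul (c : ℂ) (F : (ι → L) → ℂ) (ξ : ι → L) :
    altSum (fun x => c * F x) ξ = c * altSum F ξ := by
  simp only [altSum, Finset.mul_sum]
  exact Finset.sum_congr rfl fun _ _ => by ring

lemma altSum_of_alternating (F : (ι → L) → ℂ) (ξ : ι → L)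
    (h : ∀ τ : Equiv.Perm ι, F (fun i => ξ (τ i)) = ((Equiv.Perm.sign τ : ℤ) : ℂ) * F ξ) :
    altSum F ξ = (Nat.factorial (Fintype.card ι) : ℂ) * F ξ := by
  simp only [altSum, h, ← mul_assoc, sign_mul_self, one_mul]
  simp [Fintype.card_perm]

end AltSum

/-! ### The Chevalley-Eilenberg differential of a skew-symmetrised form -/

section CE

/-- `Equiv.Perm.decomposeFin.symm (0, e)` fixes `0` and acts as `e` on the successors; these are the
permutations of the tail. -/
lemma tail_comp_decomposeFin {L : Type*} {n : ℕ} (e : Equiv.Perm (Fin n)) (π : Equiv.Perm (Fin (n + 1)))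
    (ξ : Fin (n + 1) → L) :
    Fin.tail (fun i => ξ ((π * Equiv.Perm.decomposeFin.symm (0, e)) i)) =
      fun i => Fin.tail (fun i => ξ (π i)) (e i) := by
  funext i
  simp [Fin.tail]

variable {L : Type*} [LieRing L] {n : ℕ}

/-- One term of the Chevalley-Eilenberg differential, in the order given by a permutation. -/
def ceTerm (Φ : (Fin n → L) → ℂ) (ξ : Fin (n + 1) → L) (π : Equiv.Perm (Fin (n + 1)))
    (a : Fin n) : ℂ :=
  ((Equiv.Perm.sign π : ℤ) : ℂ) *
    Φ (Function.update (Fin.tail (fun i => ξ (π i))) a ⁅ξ (π a.succ), ξ (π 0)⁆)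

lemma update_comp_perm {α β : Type*} [DecidableEq α] (y : α → β) (e : Equiv.Perm α) (a : α)
    (z : β) :
    Function.update (fun i => y (e i)) a z = fun i => Function.update y (e a) z (e i) := by
  funext i
  by_cases h : i = a
  · subst h; simp
  · rw [Function.update_of_ne h, Function.update_of_ne (fun h' => h (e.injective h'))]

variable {Φ : (Fin n → L) → ℂ}

/-- The sign of `e` occurs twice, in the sign of the product and in the alternation of `Φ`, and
cancels. -/
lemma ceTerm_mul
    (hperm : ∀ (e : Equiv.Perm (Fin n)) x,
      Φ (fun i => x (e i)) = ((Equiv.Perm.sign e : ℤ) : ℂ) * Φ x)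
    (ξ : Fin (n + 1) → L) (π : Equiv.Perm (Fin (n + 1))) (e : Equiv.Perm (Fin n))
    (a : Fin n) :
    ceTerm Φ ξ (π * Equiv.Perm.decomposeFin.symm (0, e)) a = ceTerm Φ ξ π (e a) := by
  unfold ceTerm
  rw [tail_comp_decomposeFin, update_comp_perm, hperm]
  simp only [Equiv.Perm.sign_mul, Equiv.Perm.decomposeFin.symm_sign, Equiv.Perm.mul_apply,
    Equiv.Perm.decomposeFin_symm_apply_zero, Equiv.Perm.decomposeFin_symm_apply_succ,
    Equiv.swap_self, Equiv.refl_apply, if_true, one_mul, Units.val_mul, Int.cast_mul]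
  rw [← mul_assoc, mul_assoc ((Equiv.Perm.sign π : ℤ) : ℂ), sign_mul_self, mul_one]

lemma exists_eq_mul_decomposeFin (π π' : Equiv.Perm (Fin (n + 1))) (h : π 0 = π' 0) :
    ∃ e, π' = π * Equiv.Perm.decomposeFin.symm (0, e) := by
  obtain ⟨⟨q, e⟩, he⟩ := Equiv.Perm.decomposeFin.symm.surjective (π⁻¹ * π')
  have : q = 0 := by
    have h1 := congrArg (fun f => f 0) he
    simpa [← h] using h1
  subst this
  exact ⟨e, by rw [he]; simp⟩

/-- Permutations with the same value at `0` differ by a permutation of the tail, so a term is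
determined by the ordered pair of the elements that are bracketed. -/
lemma ceTerm_congr
    (hperm : ∀ (e : Equiv.Perm (Fin n)) x,
      Φ (fun i => x (e i)) = ((Equiv.Perm.sign e : ℤ) : ℂ) * Φ x)
    (ξ : Fin (n + 1) → L) (π π' : Equiv.Perm (Fin (n + 1))) (a a' : Fin n)
    (h : π 0 = π' 0) (h' : π a.succ = π' a'.succ) : ceTerm Φ ξ π a = ceTerm Φ ξ π' a' := by
  obtain ⟨e, rfl⟩ := exists_eq_mul_decomposeFin π π' h
  rw [ceTerm_mul hperm]
  congr
  simpa using h'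

/-- The transposition changes both the sign of the permutation and the sign of the bracket; hence
the order of the pair does not matter either. -/
lemma ceTerm_swap
    (hneg : ∀ x a z, Φ (Function.update x a (-z)) = - Φ (Function.update x a z))
    (ξ : Fin (n + 1) → L) (π : Equiv.Perm (Fin (n + 1))) (a : Fin n) :
    ceTerm Φ ξ (π * Equiv.swap 0 a.succ) a = ceTerm Φ ξ π a := by
  unfold ceTerm
  have : Function.update (Fin.tail (fun i => ξ ((π * Equiv.swap 0 a.succ) i))) a
      ⁅ξ ((π * Equiv.swap 0 a.succ) a.succ), ξ ((π * Equiv.swap 0 a.succ) 0)⁆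
      = Function.update (Fin.tail (fun i => ξ (π i))) a (-⁅ξ (π a.succ), ξ (π 0)⁆) := by
    funext i
    by_cases h : i = a
    · subst h; simp
    · simp [Function.update_of_ne h, Fin.tail,
        Equiv.swap_apply_of_ne_of_ne (Fin.succ_ne_zero i) ((Fin.succ_injective _).ne h)]
  rw [this, hneg]
  simp [Equiv.Perm.sign_swap (Fin.succ_ne_zero a).symm]

/-- The inverse of `Fin.cycleRange j` puts `j` first, keeps the order of the others and has the sign
`(-1)^j`. With this representative a term takes the shape used in `IsLieCocycle`. -/
lemma ceTerm_cycleRange (ξ : Fin (n + 1) → L) (j : Fin (n + 1)) (a : Fin n) :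
    ceTerm Φ ξ (Fin.cycleRange j)⁻¹ a = (-1 : ℂ) ^ (j : ℕ) *
      Φ (j.removeNth (Function.update ξ (j.succAbove a) ⁅ξ (j.succAbove a), ξ j⁆)) := by
  have h1 : ∀ b : Fin n, (Fin.cycleRange j)⁻¹ b.succ = j.succAbove b := fun b => by
    rw [Equiv.Perm.inv_eq_iff_eq]; simp
  have h2 : (Fin.cycleRange j)⁻¹ 0 = j := by
    rw [Equiv.Perm.inv_eq_iff_eq]; simp
  unfold ceTerm
  rw [h1, h2, Fin.removeNth_update_succAbove]
  congr 1
  · simp [Fin.sign_cycleRange]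
  congr 2
  funext b
  simp only [Fin.tail, Fin.removeNth, ← h1]

/-- Every unordered pair of arguments occurs twice on the left, once with either element in the
position `0`, and the two terms agree by `ceTerm_swap`; this is the factor `2`. -/
theorem sum_ce_eq
    (hperm : ∀ (e : Equiv.Perm (Fin n)) x,
      Φ (fun i => x (e i)) = ((Equiv.Perm.sign e : ℤ) : ℂ) * Φ x)
    (hneg : ∀ x a z, Φ (Function.update x a (-z)) = - Φ (Function.update x a z))
    (ξ : Fin (n + 1) → L) :
    ∑ j : Fin (n + 1), ∑ a : Fin n, ceTerm Φ ξ (Equiv.swap 0 j) a =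
    2 * ∑ i : Fin (n + 1), ∑ j ∈ Finset.univ.filter (fun j => i < j),
      (-1 : ℂ) ^ (j : ℕ) * Φ (j.removeNth (Function.update ξ i ⁅ξ i, ξ j⁆)) := by
  set t : Fin (n + 1) → Fin (n + 1) → ℂ := fun i j =>
    (-1 : ℂ) ^ (j : ℕ) * Φ (j.removeNth (Function.update ξ i ⁅ξ i, ξ j⁆)) with ht
  have h2 : ∀ j : Fin (n + 1), (Fin.cycleRange j)⁻¹ 0 = j := fun j => by
    rw [Equiv.Perm.inv_eq_iff_eq]; simp
  have h1 : ∀ (j : Fin (n + 1)) (b : Fin n), (Fin.cycleRange j)⁻¹ b.succ = j.succAbove b :=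
    fun j b => by rw [Equiv.Perm.inv_eq_iff_eq]; simp
  have hs : ∀ j, ∑ a : Fin n, ceTerm Φ ξ (Equiv.swap 0 j) a = ∑ i ∈ Finset.univ.erase j, t i j := by
    intro j
    obtain ⟨e, he⟩ := exists_eq_mul_decomposeFin (Fin.cycleRange j)⁻¹ (Equiv.swap 0 j)
      (by rw [h2]; simp)
    have : ∑ a : Fin n, ceTerm Φ ξ (Equiv.swap 0 j) a =
        ∑ a : Fin n, ceTerm Φ ξ (Fin.cycleRange j)⁻¹ a := by
      refine Fintype.sum_equiv e _ _ fun a => ?_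
      rw [he, ceTerm_mul hperm]
    rw [this]
    simp_rw [ceTerm_cycleRange]
    refine Finset.sum_bij (fun a _ => j.succAbove a) (fun a _ => by simp [Fin.succAbove_ne])
      (fun a _ b _ h => Fin.succAbove_right_injective h) (fun i hi => ?_) (fun a _ => rfl)
    obtain ⟨a, rfl⟩ := Fin.exists_succAbove_eq (Finset.ne_of_mem_erase hi)
    exact ⟨a, Finset.mem_univ _, rfl⟩
  have hsymm : ∀ i j, i ≠ j → t i j = t j i := by
    intro i j hij
    obtain ⟨a, rfl⟩ := Fin.exists_succAbove_eq hij
    obtain ⟨b, hb⟩ := Fin.exists_succAbove_eq hij.symm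
    have e1 : t (j.succAbove a) j = ceTerm Φ ξ (Fin.cycleRange j)⁻¹ a :=
      (ceTerm_cycleRange ξ j a).symm
    have e2 : t j (j.succAbove a) = ceTerm Φ ξ (Fin.cycleRange (j.succAbove a))⁻¹ b := by
      rw [ceTerm_cycleRange, hb]
    rw [e1, e2, ← ceTerm_swap hneg]
    apply ceTerm_congr hperm
    · simp only [Equiv.Perm.mul_apply, Equiv.swap_apply_left, h1, h2]
    · simp only [Equiv.Perm.mul_apply, Equiv.swap_apply_right, h1, h2, hb]
  simp_rw [hs]
  change _ = 2 * ∑ i : Fin (n + 1), ∑ j ∈ Finset.univ.filter (fun j => i < j), t i j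
  have hsplit : ∀ j, ∑ i ∈ Finset.univ.erase j, t i j =
      ∑ i ∈ Finset.univ.filter (fun i => i < j), t i j +
      ∑ i ∈ Finset.univ.filter (fun i => j < i), t j i := by
    intro j
    have h3 : ∑ i ∈ Finset.univ.filter (fun i => j < i), t j i =
        ∑ i ∈ Finset.univ.filter (fun i => j < i), t i j :=
      Finset.sum_congr rfl fun i hi => hsymm _ _ (by simp at hi; exact hi.ne)
    rw [h3, ← Finset.sum_union]
    · congr 1
      ext i
      simp [lt_or_lt_iff_ne]
    · rw [Finset.disjoint_filter]
      intro i _ h1 h2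
      exact absurd h1 (not_lt.mpr h2.le)
  simp_rw [hsplit]
  rw [Finset.sum_add_distrib, two_mul]
  congr 1
  simp only [Finset.sum_filter]
  exact Finset.sum_comm

end CE

/-- The Chevalley-Eilenberg differential of the skew-symmetrisation of `φ` is, up to the factor `2`,
a skew-symmetrisation. -/
theorem altSum_ce {L : Type*} [LieRing L] {n : ℕ} (φ : (Fin n → L) → ℂ)
    (hneg : ∀ x a z, altSum φ (Function.update x a (-z)) = - altSum φ (Function.update x a z))
    (ξ : Fin (n + 1) → L) :
    altSum (fun x : Fin (n + 1) → L =>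
      ∑ a : Fin n, φ (Function.update (Fin.tail x) a ⁅x a.succ, x 0⁆)) ξ =
    2 * ∑ i : Fin (n + 1), ∑ j ∈ Finset.univ.filter (fun j => i < j),
      (-1 : ℂ) ^ (j : ℕ) * altSum φ (j.removeNth (Function.update ξ i ⁅ξ i, ξ j⁆)) := by
  have hperm : ∀ (e : Equiv.Perm (Fin n)) x,
      altSum φ (fun i => x (e i)) = ((Equiv.Perm.sign e : ℤ) : ℂ) * altSum φ x :=
    fun e x => altSum_comp_arg φ x e
  rw [← sum_ce_eq hperm hneg]
  -- A permutation of `Fin (n + 1)` is uniquely `Equiv.swap 0 j` followed on the right by a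
  -- permutation of the tail. The sum over the latter rebuilds `altSum φ`.
  rw [altSum, ← Equiv.sum_comp (Equiv.Perm.decomposeFin (n := n)).symm, Fintype.sum_prod_type]
  refine Finset.sum_congr rfl fun j _ => ?_
  have key : ∀ e : Equiv.Perm (Fin n), Equiv.Perm.decomposeFin.symm (j, e) =
      Equiv.swap 0 j * Equiv.Perm.decomposeFin.symm (0, e) := fun e => by
    ext i
    refine Fin.cases ?_ (fun i => ?_) i <;> simp
  simp only [ceTerm, altSum, key, tail_comp_decomposeFin, Finset.mul_sum]
  rw [Finset.sum_comm (γ := Fin n)]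
  refine Finset.sum_congr rfl fun e _ => ?_
  refine Fintype.sum_equiv e _ _ fun a => ?_
  rw [update_comp_perm]
  by_cases h : 0 = j
  · subst h; simp
  · simp [Equiv.Perm.sign_mul, h]

/-! ### The form `P(x, [x, x], …, [x, x], dx, …, dx)` -/

/-- The slots of an invariant polynomial of degree `1 + r + k`. -/
abbrev Slot (r k : ℕ) : Type := Unit ⊕ Fin r ⊕ Fin k

/-- The arguments of the form `P(x, [x, x], …, [x, x], dx, …, dx)`. -/
abbrev Arg (r k : ℕ) : Type := Unit ⊕ (Fin r ⊕ Fin r) ⊕ Fin k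

section Slots

variable {r k : ℕ} {𝔤 L : Type*} [LieRing 𝔤]

/-- The slot without bracket and derivative. -/
abbrev sU : Slot r k := Sum.inl ()
/-- The slots that hold a bracket. -/
abbrev sB (i : Fin r) : Slot r k := Sum.inr (Sum.inl i)
/-- The slots that hold a derivative. -/
abbrev sD (b : Fin k) : Slot r k := Sum.inr (Sum.inr b)
/-- The argument in the first slot. -/
abbrev aU : Arg r k := Sum.inl ()
/-- The left arguments of the brackets. -/
abbrev aL (i : Fin r) : Arg r k := Sum.inr (Sum.inl (Sum.inl i))
/-- The right arguments of the brackets. -/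
abbrev aR (i : Fin r) : Arg r k := Sum.inr (Sum.inl (Sum.inr i))
/-- The arguments that are differentiated. -/
abbrev aD (b : Fin k) : Arg r k := Sum.inr (Sum.inr b)

/-- The entries `x, [x, x], …, [x, x], dx, …, dx`. -/
def slots (ev : L → 𝔤) (D : Fin k → L → 𝔤) (y : Arg r k → L) : Slot r k → 𝔤 :=
  Sum.elim (fun _ => ev (y aU))
    (Sum.elim (fun i => ⁅ev (y (aL i)), ev (y (aR i))⁆) (fun b => D b (y (aD b))))

variable (ev : L → 𝔤) (D : Fin k → L → 𝔤)

lemma slots_unit (y : Arg r k → L) (s : Unit) : slots ev D y (Sum.inl s) = ev (y aU) := rfl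

lemma slots_bracket (y : Arg r k → L) (i : Fin r) :
    slots ev D y (Sum.inr (Sum.inl i)) = ⁅ev (y (aL i)), ev (y (aR i))⁆ := rfl

lemma slots_deriv (y : Arg r k → L) (b : Fin k) :
    slots ev D y (Sum.inr (Sum.inr b)) = D b (y (aD b)) := rfl

variable [LieAlgebra ℝ 𝔤] (M : MultilinearMap ℝ (fun _ : Slot r k => 𝔤) ℂ)

/-- The Chevalley-Eilenberg differential of `M (slots y)` before skew-symmetrisation. -/
def slotsW (b : Fin k) (x : Option (Arg r k) → L) : ℂ :=
  M (Function.update (slots ev D (fun a => x (some a))) (sD b)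
    ⁅ev (x (some (aD b))), D b (x none)⁆)

/-- The slots of the form whose differential is `slotsZ`. -/
def slotsB (b : Fin k) (x : Option (Arg r k) → L) : Slot r k → 𝔤 :=
  Function.update (slots ev D (fun a => x (some a))) (sD b) ⁅ev (x (some (aD b))), ev (x none)⁆

/-- The derivative of `M (slotsB b x)` in direction `b`, without second derivatives. -/
def slotsZ (b : Fin k) (x : Option (Arg r k) → L) : ℂ :=
  M (Function.update (slotsB ev D b x) sU (D b (x (some aU)))) +
  ∑ i, M (Function.update (slotsB ev D b x) (sB i) (⁅D b (x (some (aL i))), ev (x (some (aR i)))⁆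
      + ⁅ev (x (some (aL i))), D b (x (some (aR i)))⁆)) +
  M (Function.update (slotsB ev D b x) (sD b) (⁅D b (x (some (aD b))), ev (x none)⁆
      + ⁅ev (x (some (aD b))), D b (x none)⁆))

variable {ev D M}

/-- All the sign rules for the form with brackets come from this: find a transposition of the
arguments that carries one expression to the other. -/
lemma altSum_smul_swap {L ι : Type*} [Fintype ι] [DecidableEq ι] {F F' : (ι → L) → ℂ} {i j : ι}
    (hij : i ≠ j) (h : ∀ x, F x = F' (fun a => x (Equiv.swap i j a))) (ξ : ι → L) :
    altSum F ξ = - altSum F' ξ := by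
  rw [funext h, altSum_comp F' ξ (Equiv.swap i j), Equiv.Perm.sign_swap hij]
  simp

/-- The argument `none` is the new element z. Bracketing every argument with z acts as a derivation
on the undifferentiated slot and, by Jacobi, on the bracket slots. A differential slot satisfies
D_b[x, z] = [D_b x, z] + [x, D_b z]. The derivation terms sum to zero by invariance, and only the
terms with D_b z remain. -/
lemma altSum_slots_ce [LieRing L]
    (hev : ∀ x y, ev ⁅x, y⁆ = ⁅ev x, ev y⁆)
    (hD : ∀ b x y, D b ⁅x, y⁆ = ⁅D b x, ev y⁆ + ⁅ev x, D b y⁆)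
    (hinv : ∀ u z, ∑ s, M (Function.update u s ⁅u s, z⁆) = 0)
    (x : Option (Arg r k) → L) :
    ∑ a : Arg r k, M (slots ev D (Function.update (fun a => x (some a)) a ⁅x (some a), x none⁆))
      = ∑ b, slotsW ev D M b x := by
  have hU : ∀ z, slots ev D (Function.update (fun a => x (some a)) aU z) =
      Function.update (slots ev D (fun a => x (some a))) sU (ev z) := fun z => by
    funext s; rcases s with s | s | s <;> simp [slots_unit, slots_bracket, slots_deriv]
  have hL : ∀ i z, slots ev D (Function.update (fun a => x (some a)) (aL i) z) =
      Function.update (slots ev D (fun a => x (some a))) (sB i) ⁅ev z, ev (x (some (aR i)))⁆ :=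
    fun i z => by
      funext s; rcases s with s | s | s <;> simp [slots_unit, slots_bracket, slots_deriv, Function.update_apply]
      split_ifs with h <;> simp [h]
  have hR : ∀ i z, slots ev D (Function.update (fun a => x (some a)) (aR i) z) =
      Function.update (slots ev D (fun a => x (some a))) (sB i) ⁅ev (x (some (aL i))), ev z⁆ :=
    fun i z => by
      funext s; rcases s with s | s | s <;> simp [slots_unit, slots_bracket, slots_deriv, Function.update_apply]
      split_ifs with h <;> simp [h]
  have hDD : ∀ b z, slots ev D (Function.update (fun a => x (some a)) (aD b) z) =
      Function.update (slots ev D (fun a => x (some a))) (sD b) (D b z) :=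
    fun b z => by
      funext s; rcases s with s | s | s <;> simp [slots_unit, slots_bracket, slots_deriv, Function.update_apply]
      split_ifs with h <;> simp [h]
  have h0 := hinv (slots ev D (fun a => x (some a))) (ev (x none))
  simp only [Fintype.sum_sum_type, Finset.univ_unique, Finset.sum_singleton] at h0 ⊢
  simp only [PUnit.default_eq_unit, hU, hL, hR, hDD] at h0 ⊢
  simp only [hev, hD, M.map_update_add, slotsW, Finset.sum_add_distrib]
  have hDs : ∀ b, slots ev D (fun a => x (some a)) (sD b) = D b (x (some (aD b))) := fun b => rfl
  have hUs : slots ev D (fun a => x (some a)) sU = ev (x (some aU)) := rfl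
  -- The Jacobi identity splits the action on a bracket slot into the actions on its two arguments.
  have hB : ∀ i, ⁅slots ev D (fun a => x (some a)) (sB i), ev (x none)⁆ =
      ⁅⁅ev (x (some (aL i))), ev (x none)⁆, ev (x (some (aR i)))⁆ +
        ⁅ev (x (some (aL i))), ⁅ev (x (some (aR i))), ev (x none)⁆⁆ := fun i => by
    rw [slots_bracket, lie_lie, ← lie_skew (ev (x (some (aR i)))) ⁅_, _⁆]; abel
  simp only [hB, hDs, hUs, M.map_update_add, Finset.sum_add_distrib] at h0
  linear_combination h0

/-- The Chevalley-Eilenberg differential is a combination of derivatives. -/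
theorem altSum_slotsZ
    (hsymm : ∀ (τ : Equiv.Perm (Slot r k)) (u : Slot r k → 𝔤), M (fun s => u (τ s)) = M u)
    (hinv : ∀ u z, ∑ s, M (Function.update u s ⁅u s, z⁆) = 0)
    (ξ : Option (Arg r k) → L) :
    ∑ b, altSum (slotsZ ev D M b) ξ =
      ((k : ℂ) + 2 * r + 2) * ∑ b, altSum (slotsW ev D M b) ξ := by
  have hc1 : ∀ b, altSum (fun x : Option (Arg r k) → L => M (Function.update
      (slots ev D (fun a => x (some a))) (sD b) ⁅D b (x (some (aD b))), ev (x none)⁆)) ξ =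
      altSum (slotsW ev D M b) ξ := by
    intro b
    rw [← neg_neg (altSum (slotsW ev D M b) ξ), ← altSum_neg]
    refine altSum_smul_swap (i := none) (j := some (aD b)) (by simp) (fun x => ?_) ξ
    simp only [slotsW]
    rw [← M.map_update_neg, lie_skew]
    congr 1
    funext s
    rcases s with s | s | s <;>
      simp [slots_unit, slots_bracket, slots_deriv, Function.update_apply, Equiv.swap_apply_def]
    split_ifs <;> simp_all
  -- The three cyclic terms of the Jacobi identity become equal up to sign after
  -- skew-symmetrisation, which gives J = -2J.
  have hJ : ∀ i, altSum (fun x : Option (Arg r k) → L => M (Function.update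
      (slots ev D (fun a => x (some a))) (sB i)
        ⁅⁅ev (x (some (aL i))), ev (x (some (aR i)))⁆, ev (x none)⁆)) ξ = 0 := by
    intro i
    have h1 : altSum (fun x : Option (Arg r k) → L => M (Function.update
      (slots ev D (fun a => x (some a))) (sB i)
        ⁅⁅ev (x (some (aL i))), ev (x none)⁆, ev (x (some (aR i)))⁆)) ξ =
        - altSum (fun x : Option (Arg r k) → L => M (Function.update
      (slots ev D (fun a => x (some a))) (sB i)
        ⁅⁅ev (x (some (aL i))), ev (x (some (aR i)))⁆, ev (x none)⁆)) ξ := by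
      refine altSum_smul_swap (i := none) (j := some (aR i)) (by simp) (fun x => ?_) ξ
      congr 1
      funext s
      rcases s with s | s | s <;>
        simp [slots_unit, slots_bracket, slots_deriv, Function.update_apply, Equiv.swap_apply_def]
      split_ifs <;> simp_all
    have h2 : altSum (fun x : Option (Arg r k) → L => M (Function.update
      (slots ev D (fun a => x (some a))) (sB i)
        ⁅⁅ev (x (some (aR i))), ev (x none)⁆, ev (x (some (aL i)))⁆)) ξ =
        - altSum (fun x : Option (Arg r k) → L => M (Function.update
      (slots ev D (fun a => x (some a))) (sB i)
        ⁅⁅ev (x (some (aL i))), ev (x none)⁆, ev (x (some (aR i)))⁆)) ξ := by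
      refine altSum_smul_swap (i := some (aL i)) (j := some (aR i)) (by simp) (fun x => ?_) ξ
      congr 1
      funext s
      rcases s with s | s | s <;>
        simp [slots_unit, slots_bracket, slots_deriv, Function.update_apply, Equiv.swap_apply_def]
      split_ifs <;> simp_all
    have hj : ∀ l m z : 𝔤, ⁅⁅l, m⁆, z⁆ = ⁅⁅l, z⁆, m⁆ + - ⁅⁅m, z⁆, l⁆ := fun l m z => by
      rw [lie_lie l m z, ← lie_skew m ⁅l, z⁆, ← lie_skew l ⁅m, z⁆]; abel
    have h3 : altSum (fun x : Option (Arg r k) → L => M (Function.update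
      (slots ev D (fun a => x (some a))) (sB i)
        ⁅⁅ev (x (some (aL i))), ev (x (some (aR i)))⁆, ev (x none)⁆)) ξ =
        altSum (fun x : Option (Arg r k) → L => M (Function.update
      (slots ev D (fun a => x (some a))) (sB i)
        ⁅⁅ev (x (some (aL i))), ev (x none)⁆, ev (x (some (aR i)))⁆)) ξ -
        altSum (fun x : Option (Arg r k) → L => M (Function.update
      (slots ev D (fun a => x (some a))) (sB i)
        ⁅⁅ev (x (some (aR i))), ev (x none)⁆, ev (x (some (aL i)))⁆)) ξ := by
      rw [sub_eq_add_neg, ← altSum_neg, ← altSum_add]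
      congr 1
      funext x
      rw [hj, M.map_update_add, M.map_update_neg]
    rw [h2, h1] at h3
    linear_combination (1 / 3 : ℂ) * h3
  -- Invariance for all slots at once: the bracket slots contribute nothing by `hJ`, each
  -- differential slot contributes its `slotsW` by `hc1`, so the remaining slot must contribute
  -- minus their sum.
  have hT : altSum (fun x : Option (Arg r k) → L => M (Function.update
      (slots ev D (fun a => x (some a))) sU ⁅ev (x (some aU)), ev (x none)⁆)) ξ =
      - ∑ b, altSum (slotsW ev D M b) ξ := by
    have h0 : altSum (fun x : Option (Arg r k) → L => ∑ s, M (Function.update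
      (slots ev D (fun a => x (some a))) s
        ⁅slots ev D (fun a => x (some a)) s, ev (x none)⁆)) ξ = 0 := by
      simp only [hinv]
      simp [altSum]
    rw [altSum_sum] at h0
    simp only [Fintype.sum_sum_type, Finset.univ_unique, Finset.sum_singleton] at h0
    have e1 := Finset.sum_congr rfl (fun i (_ : i ∈ (Finset.univ : Finset (Fin r))) => hJ i)
    have e2 := Finset.sum_congr rfl (fun i (_ : i ∈ (Finset.univ : Finset (Fin k))) => hc1 i)
    simp only [Finset.sum_const_zero] at e1
    simp only [slots, Sum.elim_inl, Sum.elim_inr] at h0 e1 e2 ⊢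
    rw [e1, e2] at h0
    linear_combination h0
  -- The symmetry of `M` moves the bracket with the new element from the slot `b` to the first slot;
  -- one transposition of arguments then reduces to `hT`.
  have hA : ∀ b, altSum (fun x : Option (Arg r k) → L =>
      M (Function.update (slotsB ev D b x) sU (D b (x (some aU))))) ξ =
      ∑ b, altSum (slotsW ev D M b) ξ := by
    intro b
    rw [← neg_neg (∑ b, altSum (slotsW ev D M b) ξ), ← hT]
    refine altSum_smul_swap (i := some aU) (j := some (aD b)) (by simp) (fun x => ?_) ξ
    rw [← hsymm (Equiv.swap sU (sD b))]
    congr 1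
    funext s
    rcases s with s | s | s <;>
      simp [slots_bracket, slots_deriv, slotsB, Function.update_apply,
        Equiv.swap_apply_def]
    split_ifs <;> simp_all [slots_deriv]
  -- The two bracket slots are exchanged by the symmetry of `M`, and their four arguments are
  -- matched by two transpositions, so the sign is `+`.
  have hb2 : ∀ b i, altSum (fun x : Option (Arg r k) → L =>
      M (Function.update (slotsB ev D b x) (sB i)
        ⁅ev (x (some (aL i))), D b (x (some (aR i)))⁆)) ξ =
      altSum (slotsW ev D M b) ξ := by
    intro b i
    have : altSum (fun x : Option (Arg r k) → L =>
        slotsW ev D M b (fun a => x (Equiv.swap none (some (aR i)) a))) ξ =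
        - altSum (slotsW ev D M b) ξ :=
      altSum_smul_swap (by simp) (fun x => rfl) ξ
    rw [← neg_neg (altSum (slotsW ev D M b) ξ), ← this]
    refine altSum_smul_swap (i := some (aL i)) (j := some (aD b)) (by simp) (fun x => ?_) ξ
    rw [← hsymm (Equiv.swap (sB i) (sD b))]
    unfold slotsW
    congr 1
    funext s
    rcases s with s | s | s <;>
      simp [slots_unit, slots_bracket, slots_deriv, slotsB, Function.update_apply,
        Equiv.swap_apply_def]
    all_goals split_ifs <;> simp_all [slots_bracket, slots_deriv]
  have hb1 : ∀ b i, altSum (fun x : Option (Arg r k) → L =>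
      M (Function.update (slotsB ev D b x) (sB i)
        ⁅D b (x (some (aL i))), ev (x (some (aR i)))⁆)) ξ =
      altSum (slotsW ev D M b) ξ := by
    intro b i
    rw [← hb2 b i]
    refine neg_injective ?_
    rw [← altSum_neg]
    refine altSum_smul_swap (i := some (aL i)) (j := some (aR i)) (by simp) (fun x => ?_) ξ
    rw [← M.map_update_neg, lie_skew]
    congr 1
    funext s
    rcases s with s | s | s <;>
      simp [slots_unit, slots_bracket, slots_deriv, slotsB, Function.update_apply,
        Equiv.swap_apply_def]
    split_ifs <;> simp_all
  -- The first slot gives the full sum over `b`, each of the `r` bracket slots gives two copies of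
  -- the `b`-th term, and the slot `b` gives two more. Summation over `b` yields the factor k + 2r +
  -- 2.
  have hZ : ∀ b, altSum (slotsZ ev D M b) ξ =
      ∑ b, altSum (slotsW ev D M b) ξ + (2 * r + 2) * altSum (slotsW ev D M b) ξ := by
    intro b
    have hu : ∀ x v, M (Function.update (slotsB ev D b x) (sD b) v) =
        M (Function.update (slots ev D (fun a => x (some a))) (sD b) v) := fun x v => by
      simp [slotsB]
    unfold slotsZ
    simp only [M.map_update_add, hu, altSum_add, altSum_sum, hA, hb1, hb2, hc1]
    change _ + _ + (_ + altSum (slotsW ev D M b) ξ) = _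
    simp
    ring
  simp only [hZ, Finset.sum_add_distrib, ← Finset.mul_sum]
  simp
  ring

end Slots

/-! ### Multilinear forms on finite-dimensional spaces -/

section Multilinear

variable {d : ℕ} {S : Type*} [Fintype S]

lemma MultilinearMap.apply_eq_sum_basis [DecidableEq S]
    (M : MultilinearMap ℝ (fun _ : S => Model d) ℂ) (v : S → Model d) :
    M v = ∑ f : S → Fin d, (∏ s, v s (f s)) • M (fun s => EuclideanSpace.single (f s) (1 : ℝ)) := by
  have h : v = fun s => ∑ i, v s i • (EuclideanSpace.single i (1 : ℝ) : Model d) := by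
    funext s
    ext j
    simp [Finset.sum_apply, Pi.single_apply]
  conv_lhs => rw [h]
  rw [M.map_sum]
  exact Finset.sum_congr rfl fun f _ => M.map_smul_univ _ _

/-- A multilinear form on a finite-dimensional space, as a continuous multilinear form. -/
def toCMM (M : MultilinearMap ℝ (fun _ : S => Model d) ℂ) :
    ContinuousMultilinearMap ℝ (fun _ : S => Model d) ℂ where
  toMultilinearMap := M
  cont := by
    classical
    change Continuous fun v => M v
    rw [funext (MultilinearMap.apply_eq_sum_basis M)]
    fun_prop

end Multilinear

/-! ### Alternating forms of top degree -/

section TopForms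

variable {k : ℕ}

lemma AlternatingMap.map_linear_real (A : (Model k) [⋀^Fin k]→ₗ[ℝ] ℝ) (f : Model k →ₗ[ℝ] Model k)
    (v : Fin k → Model k) : A (fun i => f (v i)) = LinearMap.det f * A v := by
  set e := (EuclideanSpace.basisFun (Fin k) ℝ).toBasis
  rw [AlternatingMap.eq_smul_basis_det e A]
  simp only [AlternatingMap.smul_apply, smul_eq_mul]
  have := e.det_comp f v
  rw [show (fun i => f (v i)) = f ∘ v from rfl, this]
  ring

lemma AlternatingMap.map_linear_complex (A : (Model k) [⋀^Fin k]→ₗ[ℝ] ℂ)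
    (f : Model k →ₗ[ℝ] Model k) (v : Fin k → Model k) :
    A (fun i => f (v i)) = ((LinearMap.det f : ℝ) : ℂ) * A v := by
  have h1 := AlternatingMap.map_linear_real (Complex.reLm.compAlternatingMap A) f v
  have h2 := AlternatingMap.map_linear_real (Complex.imLm.compAlternatingMap A) f v
  apply Complex.ext
  · simpa using h1
  · simpa using h2

lemma AlternatingMap.eq_zero_of_basis (A : (Model k) [⋀^Fin k]→ₗ[ℝ] ℝ)
    (h : A (fun i => EuclideanSpace.single i (1 : ℝ)) = 0) : A = 0 := by
  rw [AlternatingMap.eq_smul_basis_det (EuclideanSpace.basisFun (Fin k) ℝ).toBasis A]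
  have : A (⇑(EuclideanSpace.basisFun (Fin k) ℝ).toBasis) = 0 := by
    rw [← h]; congr 1; funext i; simp
  rw [this, zero_smul]

end TopForms

/-! ### Integration by parts in a chart -/

section LocalStokes

variable {k d : ℕ}

/-- Integration by parts against the constant function `1`. -/
lemma integral_fderiv_eq_zero_of_hasCompactSupport {F : Model k → ℂ} (hF : ContDiff ℝ 1 F)
    (hc : HasCompactSupport F) (v : Model k) : ∫ z, fderiv ℝ F z v = 0 := by
  have hi : Integrable (fun z => fderiv ℝ F z v) :=
    ((hF.continuous_fderiv (by simp)).clm_apply continuous_const).integrable_of_hasCompactSupport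
      (hc.fderiv_apply (𝕜 := ℝ) v)
  have := integral_smul_fderiv_eq_neg_fderiv_smul_of_integrable (μ := volume) (𝕜 := ℝ)
    (f := fun _ : Model k => (1 : ℝ)) (g := F) (v := v) (by simp) (by simpa using hi)
    (by simpa using hF.continuous.integrable_of_hasCompactSupport hc)
    (fun x _ => by fun_prop) (fun x _ => (hF.differentiable (by simp)) x)
  simpa using this

variable {S : Type*}

/-- The entries of a multilinear form: `Y_s` itself or one of its derivatives. -/
def entries (role : S → Option (Fin k)) (Y : S → Model k → Model d) (e : Fin k → Model k)
    (z : Model k) (s : S) : Model d :=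
  (role s).elim (Y s z) (fun c => fderiv ℝ (Y s) z (e c))

lemma contDiffOn_entries {V : Set (Model k)} (hV : IsOpen V) (role : S → Option (Fin k))
    {Y : S → Model k → Model d} (hY : ∀ s, ContDiffOn ℝ ∞ (Y s) V) (e : Fin k → Model k) (s : S) :
    ContDiffOn ℝ ∞ (fun z => entries role Y e z s) V := by
  unfold entries
  cases h : role s with
  | none => simpa using hY s
  | some c => exact ((hY s).fderiv_of_isOpen hV (by simp)).clm_apply contDiffOn_const

variable [Fintype S] [DecidableEq S] (M : ContinuousMultilinearMap ℝ (fun _ : S => Model d) ℂ)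

/-- This is d² = 0: the transposition of `b` and `c` exchanges the two directions of
differentiation, under which the second derivative is symmetric, while the sign of the permutation
changes. -/
lemma sum_sign_second_derivative {V : Set (Model k)} (hV : IsOpen V)
    {role : S → Option (Fin k)} {δ : Fin k → S} (b : Fin k)
    (hrole : ∀ s c, role s = some c ↔ c ≠ b ∧ δ c = s)
    {Y : S → Model k → Model d} (hY : ∀ s, ContDiffOn ℝ ∞ (Y s) V) {z : Model k} (hz : z ∈ V)
    (e : Fin k → Model k) (c : Fin k) (hc : c ≠ b) :
    ∑ ρ : Equiv.Perm (Fin k), ((Equiv.Perm.sign ρ : ℤ) : ℂ) *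
      M (Function.update (entries role Y (fun a => e (ρ a)) z) (δ c)
        (fderiv ℝ (fun z' => entries role Y (fun a => e (ρ a)) z' (δ c)) z (e (ρ b)))) = 0 := by
  set T : Equiv.Perm (Fin k) → ℂ := fun ρ => ((Equiv.Perm.sign ρ : ℤ) : ℂ) *
      M (Function.update (entries role Y (fun a => e (ρ a)) z) (δ c)
        (fderiv ℝ (fun z' => entries role Y (fun a => e (ρ a)) z' (δ c)) z (e (ρ b))))
  have hsw : ∀ ρ, T (ρ * Equiv.swap b c) = - T ρ := by
    intro ρ
    have hrc : role (δ c) = some c := (hrole _ _).2 ⟨hc, rfl⟩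
    have h1 : ∀ e' : Fin k → Model k, (fun z' => entries role Y e' z' (δ c)) =
        fun z' => fderiv ℝ (Y (δ c)) z' (e' c) := fun e' => by
      funext z'; simp [entries, hrc]
    have hd : DifferentiableAt ℝ (fderiv ℝ (Y (δ c))) z :=
      ((((hY (δ c)).fderiv_of_isOpen hV (m := ∞) (by simp)).contDiffAt
        (hV.mem_nhds hz)).differentiableAt (by simp))
    have h2 : ∀ u v, fderiv ℝ (fun z' => fderiv ℝ (Y (δ c)) z' u) z v =
        fderiv ℝ (fderiv ℝ (Y (δ c))) z v u := fun u v => by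
      rw [fderiv_clm_apply hd (by fun_prop)]
      simp
    have hsy : IsSymmSndFDerivAt ℝ (Y (δ c)) z :=
      ((hY (δ c)).contDiffAt (hV.mem_nhds hz)).isSymmSndFDerivAt
        (by
        rw [minSmoothness_of_isRCLikeNormedField]
        exact WithTop.coe_le_coe.2 (le_top : (2 : ℕ∞) ≤ ⊤))
    simp only [T, h1, h2]
    rw [Equiv.Perm.sign_mul, Equiv.Perm.sign_swap hc.symm]
    have h3 : Function.update (entries role Y (fun a => e ((ρ * Equiv.swap b c) a)) z) (δ c)
        (fderiv ℝ (fderiv ℝ (Y (δ c))) z (e ((ρ * Equiv.swap b c) b))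
          (e ((ρ * Equiv.swap b c) c))) =
        Function.update (entries role Y (fun a => e (ρ a)) z) (δ c)
        (fderiv ℝ (fderiv ℝ (Y (δ c))) z (e (ρ b)) (e (ρ c))) := by
      funext s
      by_cases hs : s = δ c
      · subst hs
        simp only [Function.update_self, Equiv.Perm.mul_apply, Equiv.swap_apply_left,
          Equiv.swap_apply_right]
        exact hsy _ _
      · rw [Function.update_of_ne hs, Function.update_of_ne hs]
        unfold entries
        cases h : role s with
        | none => rfl
        | some a =>
          have ha := (hrole s a).1 h
          have hac : a ≠ c := fun h' => hs (by rw [← ha.2, h'])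
          simp [Equiv.swap_apply_of_ne_of_ne ha.1 hac]
    rw [h3]
    simp
  have h4 : ∑ ρ, T (ρ * Equiv.swap b c) = ∑ ρ, T ρ :=
    Fintype.sum_equiv (Equiv.mulRight (Equiv.swap b c)) _ _ fun ρ => rfl
  simp only [hsw, Finset.sum_neg_distrib] at h4
  change ∑ ρ, T ρ = 0
  linear_combination (-1 / 2 : ℂ) * h4

/-- Stokes' theorem in an open subset of `ℝᵏ`. -/
theorem integral_sum_entries_eq_zero {V K : Set (Model k)} (hV : IsOpen V) (hK : IsCompact K)
    (hKV : K ⊆ V) {ε : Model k → ℝ} (hε : ∀ z ∈ V, ∀ᶠ z' in 𝓝 z, ε z' = ε z)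
    {role : S → Option (Fin k)} {δ : Fin k → S} (hδ : Function.Injective δ) (b : Fin k)
    (hrole : ∀ s c, role s = some c ↔ c ≠ b ∧ δ c = s)
    {Y : S → Model k → Model d} (hY : ∀ s, ContDiffOn ℝ ∞ (Y s) V)
    (hsupp : ∀ z ∈ V, z ∉ K → Y (δ b) z = 0) (e : Fin k → Model k) :
    ∫ z in V, (ε z : ℂ) * ∑ s ∈ Finset.univ.filter (fun s => role s = none),
      ∑ ρ : Equiv.Perm (Fin k), ((Equiv.Perm.sign ρ : ℤ) : ℂ) *
        M (entries (Function.update role s (some b)) Y (fun a => e (ρ a)) z) = 0 := by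
  classical
  have hrb : role (δ b) = none := by
    cases h : role (δ b) with
    | none => rfl
    | some c => exact absurd (hδ ((hrole _ _).1 h).2) ((hrole _ _).1 h).1
  -- Extension by zero is smooth because the entry in the slot `δ b` vanishes off the compact set
  -- `K`. The weight `ε` is locally constant and passes through derivatives.
  set F : Equiv.Perm (Fin k) → Model k → ℂ := fun ρ =>
    V.indicator (fun z => (ε z : ℂ) * M (entries role Y (fun a => e (ρ a)) z)) with hF
  have hzero : ∀ ρ, ∀ z ∉ K, F ρ z = 0 := by
    intro ρ z hz
    by_cases hzV : z ∈ V
    · rw [hF]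
      simp only [Set.indicator_of_mem hzV]
      rw [M.map_coord_zero (δ b), mul_zero]
      simp [entries, hrb, hsupp z hzV hz]
    · simp [hF, Set.indicator_of_notMem hzV]
  have hcs : ∀ ρ, HasCompactSupport (F ρ) := fun ρ => HasCompactSupport.intro hK (hzero ρ)
  have hloc : ∀ ρ, ∀ z ∈ V, F ρ =ᶠ[𝓝 z]
      fun z' => (ε z : ℂ) * M (entries role Y (fun a => e (ρ a)) z') := by
    intro ρ z hz
    filter_upwards [hV.mem_nhds hz, hε z hz] with z' hz' h'
    simp [hF, Set.indicator_of_mem hz', h']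
  have hMsm : ∀ ρ : Equiv.Perm (Fin k), ∀ z ∈ V,
      ContDiffAt ℝ ∞ (fun z' => M (entries role Y (fun a => e (ρ a)) z')) z := by
    intro ρ z hz
    refine M.contDiff.contDiffAt.comp z (contDiffAt_pi.2 fun s => ?_)
    exact (contDiffOn_entries hV role hY _ s).contDiffAt (hV.mem_nhds hz)
  have hsm : ∀ ρ, ContDiff ℝ ∞ (F ρ) := by
    intro ρ
    rw [contDiff_iff_contDiffAt]
    intro z
    by_cases hz : z ∈ V
    · exact (contDiffAt_const.mul (hMsm ρ z hz)).congr_of_eventuallyEq (hloc ρ z hz)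
    · have : F ρ =ᶠ[𝓝 z] fun _ => 0 := by
        filter_upwards [hK.isClosed.isOpen_compl.mem_nhds (fun h => hz (hKV h))] with z' hz'
        exact hzero ρ z' hz'
      exact contDiffAt_const.congr_of_eventuallyEq this
  have hder : ∀ z ∈ V, (ε z : ℂ) * ∑ s ∈ Finset.univ.filter (fun s => role s = none),
      ∑ ρ : Equiv.Perm (Fin k), ((Equiv.Perm.sign ρ : ℤ) : ℂ) *
        M (entries (Function.update role s (some b)) Y (fun a => e (ρ a)) z) =
      ∑ ρ : Equiv.Perm (Fin k), ((Equiv.Perm.sign ρ : ℤ) : ℂ) * fderiv ℝ (F ρ) z (e (ρ b)) := by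
    intro z hz
    have h1 : ∀ ρ : Equiv.Perm (Fin k), fderiv ℝ (F ρ) z (e (ρ b)) = (ε z : ℂ) *
        ∑ s, M (Function.update (entries role Y (fun a => e (ρ a)) z) s
          (fderiv ℝ (fun z' => entries role Y (fun a => e (ρ a)) z' s) z (e (ρ b)))) := by
      intro ρ
      rw [(hloc ρ z hz).fderiv_eq]
      have hd : ∀ s, HasFDerivAt (fun z' => entries role Y (fun a => e (ρ a)) z' s)
          (fderiv ℝ (fun z' => entries role Y (fun a => e (ρ a)) z' s) z) z := fun s =>
        (((contDiffOn_entries hV role hY _ s).contDiffAt (hV.mem_nhds hz)).differentiableAt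
          (by simp)).hasFDerivAt
      have := HasFDerivAt.multilinear_comp (f := M)
        (g := fun s z' => entries role Y (fun a => e (ρ a)) z' s) hd
      have h2 := (this.const_mul (ε z : ℂ)).fderiv
      rw [h2]
      simp [ContinuousMultilinearMap.toContinuousLinearMap]
    simp_rw [h1]
    -- Leibniz rule: differentiating an undifferentiated slot gives a term of the integrand,
    -- differentiating another slot gives a second derivative, and the latter cancel in the sum over
    -- `ρ`.
    have h2 : ∀ ρ : Equiv.Perm (Fin k), ∑ s, M (Function.update
          (entries role Y (fun a => e (ρ a)) z) s
          (fderiv ℝ (fun z' => entries role Y (fun a => e (ρ a)) z' s) z (e (ρ b)))) =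
        ∑ s ∈ Finset.univ.filter (fun s => role s = none),
          M (entries (Function.update role s (some b)) Y (fun a => e (ρ a)) z) +
        ∑ c ∈ Finset.univ.filter (fun c => c ≠ b),
          M (Function.update (entries role Y (fun a => e (ρ a)) z) (δ c)
          (fderiv ℝ (fun z' => entries role Y (fun a => e (ρ a)) z' (δ c)) z (e (ρ b)))) := by
      intro ρ
      rw [← Finset.sum_filter_add_sum_filter_not Finset.univ (fun s => role s = none)]
      congr 1
      · refine Finset.sum_congr rfl fun s hs => ?_
        have hs' : role s = none := by simpa using hs
        congr 1
        funext t
        by_cases ht : t = s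
        · subst ht
          have : (fun z' => entries role Y (fun a => e (ρ a)) z' t) = Y t := by
            funext z'; simp [entries, hs']
          rw [Function.update_self, this]
          simp [entries]
        · simp [Function.update_of_ne ht, entries]
      · symm
        refine Finset.sum_bij (fun c _ => δ c) (fun c hc => ?_) (fun a _ b _ h => hδ h)
          (fun s hs => ?_) (fun c _ => rfl)
        · have hc' : c ≠ b := by simpa using hc
          simp [(hrole (δ c) c).2 ⟨hc', rfl⟩]
        · have hs' : role s ≠ none := by simpa using hs
          obtain ⟨c, hc⟩ := Option.ne_none_iff_exists'.1 hs'
          exact ⟨c, by simpa using ((hrole _ _).1 hc).1, ((hrole _ _).1 hc).2⟩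
    simp_rw [h2]
    have h3 : ∑ ρ : Equiv.Perm (Fin k), ((Equiv.Perm.sign ρ : ℤ) : ℂ) *
        ∑ c ∈ Finset.univ.filter (fun c => c ≠ b),
          M (Function.update (entries role Y (fun a => e (ρ a)) z) (δ c)
          (fderiv ℝ (fun z' => entries role Y (fun a => e (ρ a)) z' (δ c)) z (e (ρ b)))) = 0 := by
      simp only [Finset.mul_sum]
      rw [Finset.sum_comm]
      refine Finset.sum_eq_zero fun c hc => ?_
      exact sum_sign_second_derivative M hV b hrole hY hz e c (by simpa using hc)
    have h4 : ∀ A B C : Equiv.Perm (Fin k) → ℂ, ∑ ρ, A ρ * ((ε z : ℂ) * (B ρ + C ρ)) =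
        (ε z : ℂ) * ∑ ρ, A ρ * B ρ + (ε z : ℂ) * ∑ ρ, A ρ * C ρ := fun A B C => by
      rw [Finset.mul_sum, Finset.mul_sum, ← Finset.sum_add_distrib]
      exact Finset.sum_congr rfl fun ρ _ => by ring
    rw [h4, h3, mul_zero, add_zero, Finset.sum_comm]
    simp only [Finset.mul_sum]
  rw [setIntegral_congr_fun hV.measurableSet hder]
  have hfd0 : ∀ ρ, ∀ z ∉ V, fderiv ℝ (F ρ) z = 0 := by
    intro ρ z hz
    have : F ρ =ᶠ[𝓝 z] fun _ => 0 := by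
      filter_upwards [hK.isClosed.isOpen_compl.mem_nhds (fun h => hz (hKV h))] with z' hz'
      exact hzero ρ z' hz'
    rw [this.fderiv_eq]; simp
  rw [setIntegral_eq_integral_of_forall_compl_eq_zero (fun z hz => by simp [hfd0 _ z hz])]
  rw [integral_finsetSum]
  · refine Finset.sum_eq_zero fun ρ _ => ?_
    rw [integral_const_mul, integral_fderiv_eq_zero_of_hasCompactSupport
      ((hsm ρ).of_le (by simp)) (hcs ρ), mul_zero]
  · intro ρ _
    refine Integrable.const_mul ?_ _
    exact (((hsm ρ).continuous_fderiv (by simp)).clm_apply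
      continuous_const).integrable_of_hasCompactSupport ((hcs ρ).fderiv_apply (𝕜 := ℝ) _)

end LocalStokes

/-! ### The integral over a closed oriented manifold -/

lemma Real.sign_mul_eq (a b : ℝ) : Real.sign (a * b) = Real.sign a * Real.sign b := by
  rcases lt_trichotomy a 0 with ha | ha | ha <;> rcases lt_trichotomy b 0 with hb | hb | hb
  · simp [Real.sign_of_neg ha, Real.sign_of_neg hb, Real.sign_of_pos (mul_pos_of_neg_of_neg ha hb)]
  · simp [hb]
  · simp [Real.sign_of_neg ha, Real.sign_of_pos hb, Real.sign_of_neg (mul_neg_of_neg_of_pos ha hb)]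
  · simp [ha]
  · simp [ha]
  · simp [ha]
  · simp [Real.sign_of_pos ha, Real.sign_of_neg hb, Real.sign_of_neg (mul_neg_of_pos_of_neg ha hb)]
  · simp [hb]
  · simp [Real.sign_of_pos ha, Real.sign_of_pos hb, Real.sign_of_pos (mul_pos ha hb)]

section Charts

variable {k : ℕ} {X : Type*} [TopologicalSpace X] [ChartedSpace (Model k) X]

/-- The differential of the inverse of a chart. -/
def chartDeriv (x₀ : X) (z : Model k) : Model k →L[ℝ] Model k :=
  mfderiv (𝓡 k) (𝓡 k) (chartAt (Model k) x₀).symm z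

lemma mdifferentiableAt_chart_symm [IsManifold (𝓡 k) ∞ X] (x₀ : X) {z : Model k}
    (hz : z ∈ (chartAt (Model k) x₀).target) :
    MDifferentiableAt (𝓡 k) (𝓡 k) (chartAt (Model k) x₀).symm z :=
  ((contMDiffOn_chart_symm (I := 𝓡 k) (n := ∞) (x := x₀)).contMDiffAt
    ((chartAt (Model k) x₀).open_target.mem_nhds hz)).mdifferentiableAt (by simp)

/-- The transition map between two charts. -/
def transition (x₀ x₁ : X) : OpenPartialHomeomorph (Model k) (Model k) :=
  (chartAt (Model k) x₀).symm.trans (chartAt (Model k) x₁)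

lemma transition_source (x₀ x₁ : X) : (transition x₀ x₁).source =
    (chartAt (Model k) x₀).target ∩
      (chartAt (Model k) x₀).symm ⁻¹' (chartAt (Model k) x₁).source := by
  simp [transition]

lemma transition_target (x₀ x₁ : X) : (transition x₀ x₁).target =
    (chartAt (Model k) x₁).target ∩
      (chartAt (Model k) x₁).symm ⁻¹' (chartAt (Model k) x₀).source := by
  simp [transition]

lemma symm_transition {x₀ x₁ : X} {z : Model k} (hz : z ∈ (transition x₀ x₁).source) :
    (chartAt (Model k) x₁).symm (transition x₀ x₁ z) = (chartAt (Model k) x₀).symm z := by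
  rw [transition_source] at hz
  exact (chartAt (Model k) x₁).left_inv hz.2

variable [IsManifold (𝓡 k) ∞ X]

lemma contDiffOn_transition (x₀ x₁ : X) :
    ContDiffOn ℝ ∞ (transition (k := k) x₀ x₁) (transition x₀ x₁).source := by
  have h := (contMDiffOn_chart (I := 𝓡 k) (n := ∞) (x := x₁)).comp
    ((contMDiffOn_chart_symm (I := 𝓡 k) (n := ∞) (x := x₀)).mono
      (by rw [transition_source]; exact Set.inter_subset_left))
    (s := (transition x₀ x₁).source)
    (by rw [transition_source]; exact Set.inter_subset_right)
  exact h.contDiffOn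

lemma chartDeriv_eq_comp {x₀ x₁ : X} {z : Model k} (hz : z ∈ (transition x₀ x₁).source) :
    chartDeriv x₀ z = (chartDeriv x₁ (transition x₀ x₁ z)).comp
      (fderiv ℝ (transition x₀ x₁) z) := by
  have hev : (chartAt (Model k) x₀).symm =ᶠ[𝓝 z]
      (chartAt (Model k) x₁).symm ∘ (transition x₀ x₁) := by
    filter_upwards [(transition x₀ x₁).open_source.mem_nhds hz] with z' hz'
    exact (symm_transition hz').symm
  have ht : transition x₀ x₁ z ∈ (chartAt (Model k) x₁).target := by
    have := (transition x₀ x₁).map_source hz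
    rw [transition_target] at this
    exact this.1
  have hd : MDifferentiableAt (𝓡 k) (𝓡 k) (transition x₀ x₁) z :=
    (((contDiffOn_transition x₀ x₁).contDiffAt
      ((transition x₀ x₁).open_source.mem_nhds hz)).differentiableAt
        (by simp)).mdifferentiableAt
  unfold chartDeriv
  rw [hev.mfderiv_eq]
  rw [mfderiv_comp z (mdifferentiableAt_chart_symm x₁ ht) hd, mfderiv_eq_fderiv]
  rfl

lemma chartDeriv_surjective (x₀ : X) {z : Model k} (hz : z ∈ (chartAt (Model k) x₀).target) :
    Function.Surjective (chartDeriv x₀ z) := by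
  set φ := chartAt (Model k) x₀
  have h1 : MDifferentiableAt (𝓡 k) (𝓡 k) φ (φ.symm z) :=
    ((contMDiffOn_chart (I := 𝓡 k) (n := ∞) (x := x₀)).contMDiffAt
      (φ.open_source.mem_nhds (φ.map_target hz))).mdifferentiableAt (by simp)
  have h2 : MDifferentiableAt (𝓡 k) (𝓡 k) φ.symm (φ (φ.symm z)) := by
    rw [φ.right_inv hz]; exact mdifferentiableAt_chart_symm x₀ hz
  have hev : φ.symm ∘ φ =ᶠ[𝓝 (φ.symm z)] id := by
    filter_upwards [φ.open_source.mem_nhds (φ.map_target hz)] with x hx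
    exact φ.left_inv hx
  have h3 := mfderiv_comp (φ.symm z) h2 h1
  rw [hev.mfderiv_eq, mfderiv_id, φ.right_inv hz] at h3
  intro v
  refine ⟨(mfderiv (𝓡 k) (𝓡 k) φ (φ.symm z) : Model k →L[ℝ] Model k) v, ?_⟩
  have := congrArg (fun f : Model k →L[ℝ] Model k => f v) h3
  exact this.symm

/-- The differential of the inverse chart is surjective, so a top form vanishing on the coordinate
frame would be zero. -/
lemma orient_frame_ne_zero (o : Orient k X) (x₀ : X) {z : Model k}
    (hz : z ∈ (chartAt (Model k) x₀).target) :
    o.form ((chartAt (Model k) x₀).symm z) (coordFrame x₀ z) ≠ 0 := by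
  intro h0
  set A : (Model k) [⋀^Fin k]→ₗ[ℝ] ℝ := o.form ((chartAt (Model k) x₀).symm z)
  have h1 : A.compLinearMap (chartDeriv x₀ z).toLinearMap = 0 :=
    AlternatingMap.eq_zero_of_basis _ h0
  apply o.ne_zero ((chartAt (Model k) x₀).symm z)
  change A = 0
  ext v
  choose w hw using fun i => chartDeriv_surjective x₀ hz (v i)
  have := congrArg (fun B : (Model k) [⋀^Fin k]→ₗ[ℝ] ℝ => B w) h1
  simp only [AlternatingMap.compLinearMap_apply, AlternatingMap.zero_apply] at this
  rw [AlternatingMap.zero_apply, ← this]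
  congr 1
  funext i
  exact (hw i).symm

/-- The sign of a chart with respect to the orientation. -/
def chartSign (o : Orient k X) (x₀ : X) (z : Model k) : ℝ :=
  Real.sign (o.form ((chartAt (Model k) x₀).symm z) (coordFrame x₀ z))

/-- A continuous function without zeros keeps its sign locally. This makes the orientation sign
harmless in the integration by parts. -/
lemma eventually_chartSign_eq (o : Orient k X) (x₀ : X) {z : Model k}
    (hz : z ∈ (chartAt (Model k) x₀).target) :
    ∀ᶠ z' in 𝓝 z, chartSign o x₀ z' = chartSign o x₀ z := by
  have hc := (o.continuousOn x₀).continuousAt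
    ((chartAt (Model k) x₀).open_target.mem_nhds hz)
  unfold chartSign
  rcases lt_or_gt_of_ne (orient_frame_ne_zero o x₀ hz) with h | h
  · filter_upwards [hc.eventually (gt_mem_nhds h)] with z' hz'
    rw [Real.sign_of_neg h, Real.sign_of_neg hz']
  · filter_upwards [hc.eventually (lt_mem_nhds h)] with z' hz'
    rw [Real.sign_of_pos h, Real.sign_of_pos hz']

lemma continuousOn_chartSign (o : Orient k X) (x₀ : X) :
    ContinuousOn (chartSign o x₀) (chartAt (Model k) x₀).target := fun z hz =>
  ((continuousAt_const (y := chartSign o x₀ z)).congr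
    ((eventually_chartSign_eq o x₀ hz).mono fun _ h => h.symm)).continuousWithinAt

lemma chartSign_transition (o : Orient k X) {x₀ x₁ : X} {z : Model k}
    (hz : z ∈ (transition x₀ x₁).source) :
    chartSign o x₀ z = Real.sign (fderiv ℝ (transition x₀ x₁) z).det *
      chartSign o x₁ (transition x₀ x₁ z) := by
  have h : o.form ((chartAt (Model k) x₀).symm z) (coordFrame x₀ z) =
      (fderiv ℝ (transition x₀ x₁) z).det *
        o.form ((chartAt (Model k) x₁).symm (transition x₀ x₁ z))
          (coordFrame x₁ (transition x₀ x₁ z)) := by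
    let A : X → (Model k) [⋀^Fin k]→ₗ[ℝ] ℝ := fun x => o.form x
    change A _ (fun j => chartDeriv x₀ z (EuclideanSpace.single j (1 : ℝ))) = _ *
      A _ (fun j => chartDeriv x₁ (transition x₀ x₁ z) (EuclideanSpace.single j (1 : ℝ)))
    rw [symm_transition hz, chartDeriv_eq_comp hz]
    exact AlternatingMap.map_linear_real ((A _).compLinearMap
      (chartDeriv x₁ (transition x₀ x₁ z)).toLinearMap)
      (fderiv ℝ (transition x₀ x₁) z).toLinearMap (fun j => EuclideanSpace.single j (1 : ℝ))
  unfold chartSign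
  rw [h]
  exact Real.sign_mul_eq _ _

/-- A `k`-form that is alternating at each point. -/
def IsAltForm (α : ∀ x : X, (Fin k → TangentSpace (𝓡 k) x) → ℂ) : Prop :=
  ∀ x, ∃ A : (Model k) [⋀^Fin k]→ₗ[ℝ] ℂ, ∀ w : Fin k → Model k, α x w = A w

/-- The coefficient of a `k`-form in a chart. -/
def chartCoeff (α : ∀ x : X, (Fin k → TangentSpace (𝓡 k) x) → ℂ) (x₀ : X) (z : Model k) : ℂ :=
  α ((chartAt (Model k) x₀).symm z) (coordFrame x₀ z)

lemma chartCoeff_transition {α : ∀ x : X, (Fin k → TangentSpace (𝓡 k) x) → ℂ} (hα : IsAltForm α)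
    {x₀ x₁ : X} {z : Model k} (hz : z ∈ (transition x₀ x₁).source) :
    chartCoeff α x₀ z = ((fderiv ℝ (transition x₀ x₁) z).det : ℝ) *
      chartCoeff α x₁ (transition x₀ x₁ z) := by
  choose A hA using hα
  unfold chartCoeff
  refine (hA _ _).trans ?_
  refine Eq.trans ?_ (congrArg _ (hA _ _)).symm
  rw [symm_transition hz]
  change A _ (fun j => chartDeriv x₀ z (EuclideanSpace.single j (1 : ℝ))) = _ *
      A _ (fun j => chartDeriv x₁ (transition x₀ x₁ z) (EuclideanSpace.single j (1 : ℝ)))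
  rw [chartDeriv_eq_comp hz]
  exact AlternatingMap.map_linear_complex ((A _).compLinearMap
      (chartDeriv x₁ (transition x₀ x₁ z)).toLinearMap)
      (fderiv ℝ (transition x₀ x₁) z).toLinearMap (fun j => EuclideanSpace.single j (1 : ℝ))

/-- Change of charts in an integral. -/
lemma integral_chart_change (o : Orient k X) (x₀ x₁ : X)
    {α : ∀ x : X, (Fin k → TangentSpace (𝓡 k) x) → ℂ} (hα : IsAltForm α) (f : X → ℝ)
    (h0 : ∀ x ∉ (chartAt (Model k) x₀).source, f x = 0)
    (h1 : ∀ x ∉ (chartAt (Model k) x₁).source, ∀ w, α x w = 0) :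
    ∫ z in (chartAt (Model k) x₀).target, ((f ((chartAt (Model k) x₀).symm z) *
      chartSign o x₀ z : ℝ) : ℂ) * chartCoeff α x₀ z =
    ∫ z in (chartAt (Model k) x₁).target, ((f ((chartAt (Model k) x₁).symm z) *
      chartSign o x₁ z : ℝ) : ℂ) * chartCoeff α x₁ z := by
  set g : X → Model k → ℂ := fun x z => ((f ((chartAt (Model k) x).symm z) *
      chartSign o x z : ℝ) : ℂ) * chartCoeff α x z
  change ∫ z in (chartAt (Model k) x₀).target, g x₀ z =
    ∫ z in (chartAt (Model k) x₁).target, g x₁ z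
  -- Both integrals reduce to the overlap of the charts: outside it the form vanishes in the first
  -- chart, and the function `f` in the second.
  have e0 : ∫ z in (chartAt (Model k) x₀).target, g x₀ z =
      ∫ z in (transition x₀ x₁).source, g x₀ z := by
    refine setIntegral_eq_of_subset_of_forall_sdiff_eq_zero
      (chartAt (Model k) x₀).open_target.measurableSet ?_ ?_
    · rw [transition_source]; exact Set.inter_subset_left
    · rintro z ⟨hz, hz'⟩
      rw [transition_source] at hz'
      have : (chartAt (Model k) x₀).symm z ∉ (chartAt (Model k) x₁).source :=
        fun h => hz' ⟨hz, h⟩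
      simp [g, chartCoeff, h1 _ this]
  have e1 : ∫ z in (chartAt (Model k) x₁).target, g x₁ z =
      ∫ z in (transition x₀ x₁).target, g x₁ z := by
    refine setIntegral_eq_of_subset_of_forall_sdiff_eq_zero
      (chartAt (Model k) x₁).open_target.measurableSet ?_ ?_
    · rw [transition_target]; exact Set.inter_subset_left
    · rintro z ⟨hz, hz'⟩
      rw [transition_target] at hz'
      have : (chartAt (Model k) x₁).symm z ∉ (chartAt (Model k) x₀).source :=
        fun h => hz' ⟨hz, h⟩
      simp [g, h0 _ this]
  rw [e0, e1, ← (transition x₀ x₁).image_source_eq_target,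
    integral_image_eq_integral_abs_det_fderiv_smul volume
      (transition x₀ x₁).open_source.measurableSet
      (f' := fderiv ℝ (transition x₀ x₁)) (fun z hz =>
        ((((contDiffOn_transition x₀ x₁).contDiffAt
          ((transition x₀ x₁).open_source.mem_nhds hz)).differentiableAt
            (by simp)).hasFDerivAt).hasFDerivWithinAt) (transition x₀ x₁).injOn]
  refine setIntegral_congr_fun (transition x₀ x₁).open_source.measurableSet fun z hz => ?_
  simp only [g]
  rw [chartSign_transition o hz, chartCoeff_transition hα hz, symm_transition hz]
  set D := (fderiv ℝ (transition x₀ x₁) z).det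
  -- The form transforms by the determinant and the chart sign by the sign of the determinant;
  -- together they give the Jacobian of the change of variables.
  have : |D| = Real.sign D * D := by
    rcases lt_trichotomy D 0 with h | h | h
    · rw [Real.sign_of_neg h, abs_of_neg h]; ring
    · simp [h]
    · rw [Real.sign_of_pos h, abs_of_pos h]; ring
  rw [this, Complex.real_smul]
  push_cast
  ring

end Charts

section Integral

variable {k : ℕ} {X : Type*} [TopologicalSpace X] [ChartedSpace (Model k) X]

/-- A `k`-form whose coefficients in the charts are continuous. -/
def IsContForm (α : ∀ x : X, (Fin k → TangentSpace (𝓡 k) x) → ℂ) : Prop :=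
  ∀ x₀, ContinuousOn (chartCoeff α x₀) (chartAt (Model k) x₀).target

variable [T2Space X] [CompactSpace X] [IsManifold (𝓡 k) ∞ X]

lemma tsupport_chartPartition (x₀ : X) :
    tsupport (chartPartition k X x₀) ⊆ (chartAt (Model k) x₀).source :=
  (SmoothPartitionOfUnity.exists_isSubordinate_chartAt_source (𝓡 k) X).choose_spec x₀

/-- The support of a function of the partition of unity, in the chart. -/
def chartSupport (k : ℕ) {X : Type*} [TopologicalSpace X] [ChartedSpace (Model k) X]
    [T2Space X] [CompactSpace X] [IsManifold (𝓡 k) ∞ X] (x₀ : X) : Set (Model k) :=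
  chartAt (Model k) x₀ '' tsupport (chartPartition k X x₀)

lemma isCompact_chartSupport (x₀ : X) : IsCompact (chartSupport k x₀) :=
  (isClosed_tsupport _).isCompact.image_of_continuousOn
    ((chartAt (Model k) x₀).continuousOn.mono (tsupport_chartPartition x₀))

lemma chartSupport_subset (x₀ : X) : chartSupport k x₀ ⊆ (chartAt (Model k) x₀).target := by
  rintro _ ⟨x, hx, rfl⟩
  exact (chartAt (Model k) x₀).map_source (tsupport_chartPartition x₀ hx)

/-- The weight of the point with coordinates `z` in the integral. -/
def chartWeight (o : Orient k X) (x₀ : X) (z : Model k) : ℝ :=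
  chartPartition k X x₀ ((chartAt (Model k) x₀).symm z) * chartSign o x₀ z

lemma notMem_tsupport_of_notMem_chartSupport {x₀ : X} {z : Model k}
    (hz : z ∈ (chartAt (Model k) x₀).target) (hz' : z ∉ chartSupport k x₀) :
    (chartAt (Model k) x₀).symm z ∉ tsupport (chartPartition k X x₀) := fun h =>
  hz' ⟨_, h, (chartAt (Model k) x₀).right_inv hz⟩

lemma chartWeight_eq_zero (o : Orient k X) {x₀ : X} {z : Model k}
    (hz : z ∈ (chartAt (Model k) x₀).target) (hz' : z ∉ chartSupport k x₀) :
    chartWeight o x₀ z = 0 := by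
  unfold chartWeight
  rw [image_eq_zero_of_notMem_tsupport (notMem_tsupport_of_notMem_chartSupport hz hz'), zero_mul]

lemma continuousOn_chartWeight (o : Orient k X) (x₀ : X) :
    ContinuousOn (chartWeight o x₀) (chartAt (Model k) x₀).target :=
  ((chartPartition k X x₀).contMDiff.continuous.comp_continuousOn
    (chartAt (Model k) x₀).continuousOn_symm).mul (continuousOn_chartSign o x₀)

variable (k X) in
lemma finite_chartPartition : {x₀ : X | chartPartition k X x₀ ≠ 0}.Finite := by
  refine ((chartPartition k X).locallyFinite.finite_nonempty_of_compact).subset fun x₀ h => ?_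
  by_contra h'
  apply h
  ext x
  by_contra hx
  exact h' ⟨x, hx⟩

variable (k X) in
/-- The charts that occur in the integral. -/
def activeCharts : Finset X := (finite_chartPartition k X).toFinset

lemma sum_chartPartition (x : X) : ∑ x₀ ∈ activeCharts k X, chartPartition k X x₀ x = 1 := by
  rw [← (chartPartition k X).sum_eq_one (Set.mem_univ x)]
  symm
  refine finsum_eq_sum_of_support_subset _ fun x₀ hx => ?_
  simp only [activeCharts, Set.Finite.coe_toFinset, Set.mem_ofPred_eq]
  intro h
  simp [h] at hx

lemma integral_eq_sum_target (o : Orient k X)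
    (α : ∀ x : X, (Fin k → TangentSpace (𝓡 k) x) → ℂ) :
    integral o α = ∑ x₀ ∈ activeCharts k X, ∫ z in (chartAt (Model k) x₀).target,
      (chartWeight o x₀ z : ℂ) * chartCoeff α x₀ z := by
  refine finsum_eq_sum_of_support_subset _ fun x₀ hx => ?_
  simp only [activeCharts, Set.Finite.coe_toFinset, Set.mem_ofPred_eq]
  intro h
  simp [h] at hx

lemma integral_eq_sum (o : Orient k X) (α : ∀ x : X, (Fin k → TangentSpace (𝓡 k) x) → ℂ) :
    integral o α = ∑ x₀ ∈ activeCharts k X, ∫ z in chartSupport k x₀,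
      (chartWeight o x₀ z : ℂ) * chartCoeff α x₀ z := by
  rw [integral_eq_sum_target]
  refine Finset.sum_congr rfl fun x₀ _ => ?_
  refine setIntegral_eq_of_subset_of_forall_sdiff_eq_zero
    (chartAt (Model k) x₀).open_target.measurableSet (chartSupport_subset x₀) ?_
  rintro z ⟨hz, hz'⟩
  rw [chartWeight_eq_zero o hz hz']
  simp

lemma integrableOn_chart (o : Orient k X) {α : ∀ x : X, (Fin k → TangentSpace (𝓡 k) x) → ℂ}
    (hα : IsContForm α) (x₀ : X) : IntegrableOn
      (fun z => (chartWeight o x₀ z : ℂ) * chartCoeff α x₀ z) (chartSupport k x₀) := by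
  refine ContinuousOn.integrableOn_compact (isCompact_chartSupport x₀) ?_
  exact (Complex.continuous_ofReal.comp_continuousOn
    ((continuousOn_chartWeight o x₀).mono (chartSupport_subset x₀))).mul
    ((hα x₀).mono (chartSupport_subset x₀))

lemma integral_finset_sum' {ι : Type*} (s : Finset ι) (o : Orient k X)
    {α : ι → ∀ x : X, (Fin k → TangentSpace (𝓡 k) x) → ℂ} (hα : ∀ i, IsContForm (α i)) :
    integral o (fun x w => ∑ i ∈ s, α i x w) = ∑ i ∈ s, integral o (α i) := by
  simp only [integral_eq_sum]
  rw [Finset.sum_comm]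
  refine Finset.sum_congr rfl fun x₀ _ => ?_
  rw [← integral_finsetSum _ (fun i _ => integrableOn_chart o (hα i) x₀)]
  congr 1
  funext z
  simp [chartCoeff, Finset.mul_sum]

lemma integral_add' (o : Orient k X) {α β : ∀ x : X, (Fin k → TangentSpace (𝓡 k) x) → ℂ}
    (hα : IsContForm α) (hβ : IsContForm β) :
    integral o (fun x w => α x w + β x w) = integral o α + integral o β := by
  simp only [integral_eq_sum]
  rw [← Finset.sum_add_distrib]
  refine Finset.sum_congr rfl fun x₀ _ => ?_
  rw [← integral_add (integrableOn_chart o hα x₀) (integrableOn_chart o hβ x₀)]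
  congr 1
  funext z
  simp [chartCoeff, mul_add]

lemma integral_const_mul' (o : Orient k X) (c : ℂ)
    (α : ∀ x : X, (Fin k → TangentSpace (𝓡 k) x) → ℂ) :
    integral o (fun x w => c * α x w) = c * integral o α := by
  simp only [integral_eq_sum]
  rw [Finset.mul_sum]
  refine Finset.sum_congr rfl fun x₀ _ => ?_
  rw [← MeasureTheory.integral_const_mul]
  congr 1
  funext z
  simp [chartCoeff]
  ring

lemma integral_congr' (o : Orient k X) {α β : ∀ x : X, (Fin k → TangentSpace (𝓡 k) x) → ℂ}
    (h : ∀ x w, α x w = β x w) : integral o α = integral o β := by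
  have : α = β := by funext x w; exact h x w
  rw [this]

/-- The integral of a form that is supported in one chart. -/
lemma integral_eq_of_support (o : Orient k X) (x₁ : X) {K : Set (Model k)} (hK : IsCompact K)
    (hKV : K ⊆ (chartAt (Model k) x₁).target)
    {α : ∀ x : X, (Fin k → TangentSpace (𝓡 k) x) → ℂ} (hα : IsAltForm α) (hc : IsContForm α)
    (h1 : ∀ x ∉ (chartAt (Model k) x₁).source, ∀ w, α x w = 0)
    (h2 : ∀ z ∈ (chartAt (Model k) x₁).target, z ∉ K → chartCoeff α x₁ z = 0) :
    integral o α = ∫ z in (chartAt (Model k) x₁).target,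
      (chartSign o x₁ z : ℂ) * chartCoeff α x₁ z := by
  rw [integral_eq_sum_target]
  -- Each summand is moved into the one chart that contains the support; there the partition of
  -- unity sums to `1`.
  have e1 : ∀ x₀ ∈ activeCharts k X, ∫ z in (chartAt (Model k) x₀).target,
      (chartWeight o x₀ z : ℂ) * chartCoeff α x₀ z =
      ∫ z in (chartAt (Model k) x₁).target,
        ((chartPartition k X x₀ ((chartAt (Model k) x₁).symm z) * chartSign o x₁ z : ℝ) : ℂ) *
          chartCoeff α x₁ z := fun x₀ _ => by
    refine integral_chart_change o x₀ x₁ hα (chartPartition k X x₀) (fun x hx => ?_) h1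
    exact image_eq_zero_of_notMem_tsupport fun h => hx (tsupport_chartPartition x₀ h)
  rw [Finset.sum_congr rfl e1, ← integral_finsetSum]
  · refine setIntegral_congr_fun (chartAt (Model k) x₁).open_target.measurableSet fun z _ => ?_
    simp only [Complex.ofReal_mul]
    rw [← Finset.sum_mul, ← Finset.sum_mul, ← Complex.ofReal_sum, sum_chartPartition]
    simp
  · intro x₀ _
    refine IntegrableOn.of_forall_sdiff_eq_zero (s := K) ?_
      (chartAt (Model k) x₁).open_target.measurableSet ?_
    · refine ContinuousOn.integrableOn_compact hK ?_
      refine ContinuousOn.mul (Complex.continuous_ofReal.comp_continuousOn ?_) ((hc x₁).mono hKV)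
      exact (((chartPartition k X x₀).contMDiff.continuous.comp_continuousOn
        (chartAt (Model k) x₁).continuousOn_symm).mul (continuousOn_chartSign o x₁)).mono hKV
    · rintro z ⟨hz, hz'⟩
      rw [h2 z hz hz', mul_zero]

end Integral

/-! ### Forms on `X` that are built from maps to the Lie algebra -/

section SlotForm

variable {d k : ℕ} {G : Type*} [TopologicalSpace G] [ChartedSpace (Model d) G] [Group G]
  {X : Type*} [TopologicalSpace X] [ChartedSpace (Model k) X]

/-- Smoothness of a map to the Lie algebra. -/
def IsSmooth (y : X → LieAlg d G) : Prop :=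
  ContMDiff (M' := Model d) (𝓡 k) 𝓘(ℝ, Model d) ∞ y

/-- A map to the Lie algebra in a chart. -/
def inChart (x₀ : X) (y : X → LieAlg d G) (z : Model k) : Model d :=
  y ((chartAt (Model k) x₀).symm z)

variable {S : Type*} [Fintype S]

/-- A multilinear form on the Lie algebra, as a continuous form on the model space. -/
def modelForm (M : MultilinearMap ℝ (fun _ : S => LieAlg d G) ℂ) :
    ContinuousMultilinearMap ℝ (fun _ : S => Model d) ℂ :=
  toCMM (d := d) M

lemma modelForm_apply (M : MultilinearMap ℝ (fun _ : S => LieAlg d G) ℂ) (v : S → Model d) :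
    modelForm M v = M v := rfl

/-- The `k`-form obtained by entering maps to the Lie algebra, or their differentials, into a
multilinear form. -/
def slotForm (M : MultilinearMap ℝ (fun _ : S => LieAlg d G) ℂ) (role : S → Option (Fin k))
    (y : S → X → LieAlg d G) (x : X) (w : Fin k → TangentSpace (𝓡 k) x) : ℂ :=
  ∑ ρ : Equiv.Perm (Fin k), ((Equiv.Perm.sign ρ : ℤ) : ℂ) *
    M (fun s => (role s).elim (y s x) (fun c => diff (y s) x (w (ρ c))))

variable [IsManifold (𝓡 k) ∞ X]

lemma contDiffOn_inChart {y : X → LieAlg d G} (hy : IsSmooth (k := k) y) (x₀ : X) :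
    ContDiffOn ℝ ∞ (inChart x₀ y) (chartAt (Model k) x₀).target :=
  (ContMDiff.comp_contMDiffOn (M' := X) hy
    (contMDiffOn_chart_symm (I := 𝓡 k) (n := ∞) (x := x₀))).contDiffOn

lemma diff_coordFrame {y : X → LieAlg d G} (hy : IsSmooth (k := k) y) (x₀ : X) {z : Model k}
    (hz : z ∈ (chartAt (Model k) x₀).target) (j : Fin k) :
    (diff y ((chartAt (Model k) x₀).symm z) (coordFrame x₀ z j) : Model d) =
      fderiv ℝ (inChart x₀ y) z (EuclideanSpace.single j (1 : ℝ)) := by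
  let y' : X → Model d := y
  have hy' : MDifferentiableAt (𝓡 k) 𝓘(ℝ, Model d) y' ((chartAt (Model k) x₀).symm z) :=
    ContMDiff.mdifferentiableAt (M' := Model d) hy (by simp)
  have h1 := mfderiv_comp z hy' (mdifferentiableAt_chart_symm x₀ hz)
  have h2 : fderiv ℝ (inChart x₀ y) z = mfderiv (𝓡 k) 𝓘(ℝ, Model d)
      (y' ∘ (chartAt (Model k) x₀).symm) z := mfderiv_eq_fderiv.symm
  rw [h2]
  exact (congrArg (fun f : Model k →L[ℝ] Model d => f (EuclideanSpace.single j (1 : ℝ))) h1).symm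

lemma chartCoeff_slotForm [DecidableEq S] (M : MultilinearMap ℝ (fun _ : S => LieAlg d G) ℂ)
    (role : S → Option (Fin k)) {y : S → X → LieAlg d G} (hy : ∀ s, IsSmooth (k := k) (y s))
    (x₀ : X) {z : Model k} (hz : z ∈ (chartAt (Model k) x₀).target) :
    chartCoeff (slotForm M role y) x₀ z = ∑ ρ : Equiv.Perm (Fin k),
      ((Equiv.Perm.sign ρ : ℤ) : ℂ) * modelForm M (entries role (fun s => inChart x₀ (y s))
        (fun a => EuclideanSpace.single (ρ a) (1 : ℝ)) z) := by
  unfold chartCoeff slotForm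
  refine Finset.sum_congr rfl fun ρ _ => ?_
  rw [modelForm_apply]
  congr 2
  funext s
  unfold entries
  cases role s with
  | none => rfl
  | some c => exact diff_coordFrame (hy s) x₀ hz (ρ c)

lemma isContForm_slotForm (M : MultilinearMap ℝ (fun _ : S => LieAlg d G) ℂ)
    (role : S → Option (Fin k)) {y : S → X → LieAlg d G} (hy : ∀ s, IsSmooth (k := k) (y s)) :
    IsContForm (slotForm M role y) := by
  classical
  intro x₀
  refine ContinuousOn.congr ?_ (fun z hz => chartCoeff_slotForm M role hy x₀ hz)
  refine continuousOn_finsetSum _ fun ρ _ => continuousOn_const.mul ?_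
  refine (modelForm M).cont.comp_continuousOn (continuousOn_pi.2 fun s => ?_)
  exact (contDiffOn_entries (chartAt (Model k) x₀).open_target role
    (fun s => contDiffOn_inChart (hy s) x₀) _ s).continuousOn

lemma diff_add_vec (y : X → LieAlg d G) (x : X) (v w : TangentSpace (𝓡 k) x) :
    diff y x (v + w) = diff y x v + diff y x w :=
  let L : Model k →L[ℝ] Model d := mfderiv (M' := Model d) (𝓡 k) 𝓘(ℝ, Model d) y x
  L.map_add v w

lemma diff_smul_vec (y : X → LieAlg d G) (x : X) (c : ℝ) (v : TangentSpace (𝓡 k) x) :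
    diff y x (c • v) = c • diff y x v :=
  let L : Model k →L[ℝ] Model d := mfderiv (M' := Model d) (𝓡 k) 𝓘(ℝ, Model d) y x
  L.map_smul c v

lemma units_smul_complex (e : ℤˣ) (z : ℂ) : e • z = ((e : ℤ) : ℂ) * z := by
  rw [Units.smul_def, zsmul_eq_mul]

/-- Every direction enters exactly one slot, namely `δ c`, so the expression under the sum is
multilinear in `w` and the sum over `ρ` is its alternatization. -/
lemma isAltForm_slotForm (M : MultilinearMap ℝ (fun _ : S => LieAlg d G) ℂ)
    {role : S → Option (Fin k)} {δ : Fin k → S} (hrole : ∀ s c, role s = some c ↔ δ c = s)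
    (y : S → X → LieAlg d G) : IsAltForm (slotForm M role y) := by
  classical
  intro x
  have hupd : ∀ (w : Fin k → TangentSpace (𝓡 k) x) (c : Fin k) (v : TangentSpace (𝓡 k) x),
      (fun s => (role s).elim (y s x) (fun a => diff (y s) x (Function.update w c v a))) =
      Function.update (fun s => (role s).elim (y s x) (fun a => diff (y s) x (w a))) (δ c)
        (diff (y (δ c)) x v) := by
    intro w c v
    funext s
    by_cases hs : s = δ c
    · subst hs
      rw [(hrole (δ c) c).2 rfl]
      simp
    · rw [Function.update_of_ne hs]
      cases h : role s with
      | none => rfl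
      | some a =>
        have ha : a ≠ c := fun h' => hs (by rw [← (hrole s a).1 h, h'])
        simp [Function.update_of_ne ha]
  let m : MultilinearMap ℝ (fun _ : Fin k => TangentSpace (𝓡 k) x) ℂ :=
    { toFun := fun w => M (fun s => (role s).elim (y s x) (fun c => diff (y s) x (w c)))
      map_update_add' := fun w c v v' => by
        have := Subsingleton.elim ‹DecidableEq (Fin k)› (instDecidableEqFin k)
        subst this
        rw [hupd, hupd, hupd, diff_add_vec, M.map_update_add]
      map_update_smul' := fun w c r v => by
        have := Subsingleton.elim ‹DecidableEq (Fin k)› (instDecidableEqFin k)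
        subst this
        rw [hupd, hupd, diff_smul_vec, M.map_update_smul] }
  let A : (TangentSpace (𝓡 k) x) [⋀^Fin k]→ₗ[ℝ] ℂ := MultilinearMap.alternatization m
  refine ⟨A, fun w => ?_⟩
  refine Eq.trans ?_ (MultilinearMap.alternatization_apply m w).symm
  refine Finset.sum_congr rfl fun ρ _ => ?_
  exact (units_smul_complex _ _).symm

/-! ### Stokes' theorem -/

lemma diff_add_map {f g : X → LieAlg d G} (hf : IsSmooth (k := k) f) (hg : IsSmooth (k := k) g)
    (x : X) (w : TangentSpace (𝓡 k) x) :
    diff (fun x => f x + g x) x w = diff f x w + diff g x w := by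
  have h1 : MDifferentiableAt (M' := Model d) (𝓡 k) 𝓘(ℝ, Model d) f x :=
    ContMDiff.mdifferentiableAt (M' := Model d) hf (by simp)
  have h2 : MDifferentiableAt (M' := Model d) (𝓡 k) 𝓘(ℝ, Model d) g x :=
    ContMDiff.mdifferentiableAt (M' := Model d) hg (by simp)
  exact congrArg (fun L : Model k →L[ℝ] Model d => L w) (mfderiv_add (E' := Model d) h1 h2)

lemma isSmooth_add {f g : X → LieAlg d G} (hf : IsSmooth (k := k) f) (hg : IsSmooth (k := k) g) :
    IsSmooth (k := k) (fun x => f x + g x) := ContMDiff.add (G := Model d) hf hg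

lemma isSmooth_smul {f : X → LieAlg d G} (hf : IsSmooth (k := k) f) {χ : X → ℝ}
    (hχ : ContMDiff (𝓡 k) 𝓘(ℝ, ℝ) ∞ χ) : IsSmooth (k := k) (fun x => χ x • f x) :=
  (contDiff_smul (𝕜 := ℝ) (F := Model d)).contMDiff.comp (hχ.prodMk_space hf)

lemma isSmooth_zero : IsSmooth (k := k) (fun _ : X => (0 : LieAlg d G)) :=
  contMDiff_const (M' := Model d)

lemma diff_zero_map (x : X) (w : TangentSpace (𝓡 k) x) :
    diff (fun _ : X => (0 : LieAlg d G)) x w = 0 :=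
  congrArg (fun L : Model k →L[ℝ] Model d => L w) (mfderiv_const (M' := Model d))

lemma slotForm_update_add [DecidableEq S] (M : MultilinearMap ℝ (fun _ : S => LieAlg d G) ℂ)
    (role : S → Option (Fin k)) (y : S → X → LieAlg d G) (s : S) {f g : X → LieAlg d G}
    (hf : IsSmooth (k := k) f) (hg : IsSmooth (k := k) g) (x : X)
    (w : Fin k → TangentSpace (𝓡 k) x) :
    slotForm M role (Function.update y s (fun x => f x + g x)) x w =
      slotForm M role (Function.update y s f) x w +
      slotForm M role (Function.update y s g) x w := by
  have hu : ∀ (h : X → LieAlg d G) (ρ : Equiv.Perm (Fin k)),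
      (fun t => (role t).elim (Function.update y s h t x)
        (fun c => diff (Function.update y s h t) x (w (ρ c)))) =
      Function.update (fun t => (role t).elim (y t x) (fun c => diff (y t) x (w (ρ c)))) s
        ((role s).elim (h x) (fun c => diff h x (w (ρ c)))) := by
    intro h ρ
    funext t
    by_cases ht : t = s
    · subst ht; simp
    · simp [Function.update_of_ne ht]
  unfold slotForm
  simp only [hu]
  rw [← Finset.sum_add_distrib]
  refine Finset.sum_congr rfl fun ρ _ => ?_
  rw [← mul_add, ← M.map_update_add]
  cases role s with
  | none => rfl
  | some c => simp only [Option.elim]; rw [diff_add_map hf hg]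

lemma slotForm_eq_zero (M : MultilinearMap ℝ (fun _ : S => LieAlg d G) ℂ)
    (role : S → Option (Fin k)) (y : S → X → LieAlg d G) (s : S) {x : X}
    (h : y s =ᶠ[𝓝 x] fun _ => 0) (w : Fin k → TangentSpace (𝓡 k) x) :
    slotForm M role y x w = 0 := by
  unfold slotForm
  refine Finset.sum_eq_zero fun ρ _ => ?_
  rw [M.map_coord_zero s, mul_zero]
  cases role s with
  | none => exact h.self_of_nhds
  | some c =>
    have : mfderiv (M' := Model d) (𝓡 k) 𝓘(ℝ, Model d) (y s) x =
        mfderiv (M' := Model d) (𝓡 k) 𝓘(ℝ, Model d) (fun _ => (0 : Model d)) x :=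
      Filter.EventuallyEq.mfderiv_eq h
    exact (congrArg (fun L : Model k →L[ℝ] Model d => L (w (ρ c))) this).trans
      (diff_zero_map x (w (ρ c)))

variable [T2Space X] [CompactSpace X]

/-- Stokes' theorem for the forms obtained by entering maps to the Lie algebra, or their
differentials, into a multilinear form. -/
theorem sum_integral_slotForm_eq_zero [DecidableEq S] (o : Orient k X)
    (M : MultilinearMap ℝ (fun _ : S => LieAlg d G) ℂ)
    {role : S → Option (Fin k)} {δ : Fin k → S} (hδ : Function.Injective δ) (b : Fin k)
    (hrole : ∀ s c, role s = some c ↔ c ≠ b ∧ δ c = s)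
    {y : S → X → LieAlg d G} (hy : ∀ s, IsSmooth (k := k) (y s)) :
    ∑ s ∈ Finset.univ.filter (fun s => role s = none),
      integral o (slotForm M (Function.update role s (some b)) y) = 0 := by
  set T : Finset S := Finset.univ.filter (fun s => role s = none) with hT
  have hrb : role (δ b) = none := by
    cases h : role (δ b) with
    | none => rfl
    | some c => exact absurd (hδ ((hrole _ _).1 h).2) ((hrole _ _).1 h).1
  rw [← integral_finset_sum' T o (fun s => isContForm_slotForm M _ hy)]
  -- The sum is additive in the entry of the slot `δ b`, so it suffices to treat this entry
  -- multiplied by a single function of the partition of unity; the problem is then local to one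
  -- chart.
  set E : (X → LieAlg d G) → ∀ x : X, (Fin k → TangentSpace (𝓡 k) x) → ℂ := fun f x w =>
    ∑ s ∈ T, slotForm M (Function.update role s (some b)) (Function.update y (δ b) f) x w with hE
  have hsm : ∀ f, IsSmooth (k := k) f → ∀ s, IsSmooth (k := k) (Function.update y (δ b) f s) := by
    intro f hf s
    by_cases hs : s = δ b
    · subst hs; simpa using hf
    · simpa [Function.update_of_ne hs] using hy s
  have hcont : ∀ f, IsSmooth (k := k) f → IsContForm (E f) := by
    intro f hf x₀
    have : chartCoeff (E f) x₀ = fun z => ∑ s ∈ T, chartCoeff (slotForm M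
        (Function.update role s (some b)) (Function.update y (δ b) f)) x₀ z := rfl
    rw [this]
    exact continuousOn_finsetSum _ fun s _ => isContForm_slotForm M _ (hsm f hf) x₀
  have hadd : ∀ f g, IsSmooth (k := k) f → IsSmooth (k := k) g →
      ∀ x w, E (fun x => f x + g x) x w = E f x w + E g x w := by
    intro f g hf hg x w
    simp only [hE]
    rw [← Finset.sum_add_distrib]
    exact Finset.sum_congr rfl fun s _ => slotForm_update_add M _ y (δ b) hf hg x w
  set χ : X → X → ℝ := fun x₁ x => chartPartition k X x₁ x
  have hχ : ∀ x₁, IsSmooth (k := k) (fun x => χ x₁ x • y (δ b) x) := fun x₁ =>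
    isSmooth_smul (hy _) (chartPartition k X x₁).contMDiff
  have hzero : ∀ x₁, integral o (E (fun x => χ x₁ x • y (δ b) x)) = 0 := by
    intro x₁
    set y' := Function.update y (δ b) (fun x => χ x₁ x • y (δ b) x) with hy'
    have hy's := hsm _ (hχ x₁)
    have hvan : ∀ x ∉ tsupport (chartPartition k X x₁), y' (δ b) =ᶠ[𝓝 x] fun _ => 0 := by
      intro x hx
      filter_upwards [(isClosed_tsupport _).isOpen_compl.mem_nhds hx] with x' hx'
      rw [hy', Function.update_self]
      simp only [χ]
      rw [image_eq_zero_of_notMem_tsupport hx', zero_smul]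
    have hEz : ∀ x ∉ tsupport (chartPartition k X x₁), ∀ w,
        E (fun x => χ x₁ x • y (δ b) x) x w = 0 := fun x hx w =>
      Finset.sum_eq_zero fun s _ => slotForm_eq_zero M _ y' (δ b) (hvan x hx) w
    rw [integral_eq_of_support o x₁ (isCompact_chartSupport x₁) (chartSupport_subset x₁) ?_
      (hcont _ (hχ x₁)) (fun x hx w => hEz x (fun h => hx (tsupport_chartPartition x₁ h)) w)
      (fun z hz hz' => hEz _ (notMem_tsupport_of_notMem_chartSupport hz hz') _)]
    · have key := integral_sum_entries_eq_zero (modelForm M) (chartAt (Model k) x₁).open_target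
        (isCompact_chartSupport x₁) (chartSupport_subset x₁)
        (fun z hz => eventually_chartSign_eq o x₁ hz) hδ b hrole
        (fun s => contDiffOn_inChart (hy's s) x₁)
        (fun z hz hz' => (hvan _ (notMem_tsupport_of_notMem_chartSupport hz hz')).self_of_nhds)
        (fun j => EuclideanSpace.single j (1 : ℝ))
      rw [← key]
      refine setIntegral_congr_fun (chartAt (Model k) x₁).open_target.measurableSet fun z hz => ?_
      have : chartCoeff (E fun x => χ x₁ x • y (δ b) x) x₁ z = ∑ s ∈ T, chartCoeff (slotForm M
        (Function.update role s (some b)) y') x₁ z := rfl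
      simp only [this]
      congr 1
      exact Finset.sum_congr rfl fun s _ => chartCoeff_slotForm M _ hy's x₁ hz
    -- With the direction `b` assigned to the slot `s`, the directions again occupy distinct slots,
    -- given by `Function.update δ b s`.
    · have halt : ∀ s ∈ T, IsAltForm (slotForm M (Function.update role s (some b)) y') := by
        intro s hs
        have hs' : role s = none := by simpa [hT] using hs
        refine isAltForm_slotForm M (δ := Function.update δ b s) (fun t c => ?_) y'
        by_cases hc : c = b
        · subst hc
          by_cases ht : t = s
          · subst ht; simp
          · rw [Function.update_of_ne ht, Function.update_self]
            constructor
            · intro h; exact absurd rfl ((hrole _ _).1 h).1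
            · intro h; exact absurd h.symm ht
        · rw [Function.update_of_ne hc]
          by_cases ht : t = s
          · subst ht
            simp only [Function.update_self, Option.some.injEq]
            constructor
            · intro h; exact absurd h.symm hc
            · intro h
              rw [(hrole t c).2 ⟨hc, h⟩] at hs'
              simp at hs'
          · rw [Function.update_of_ne ht, hrole]
            simp [hc]
      intro x
      choose! A hA using fun s hs => halt s hs x
      refine ⟨∑ s ∈ T, A s, fun w => ?_⟩
      let ev : ((TangentSpace (𝓡 k) x) [⋀^Fin k]→ₗ[ℝ] ℂ) →+ ℂ :=
        { toFun := fun A => A w, map_zero' := rfl, map_add' := fun _ _ => rfl }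
      exact (Finset.sum_congr rfl fun s hs => hA s hs w).trans (map_sum ev A T).symm
  have hsum : ∀ C : Finset X, IsSmooth (k := k) (fun x => ∑ x₁ ∈ C, χ x₁ x • y (δ b) x) ∧
      integral o (E (fun x => ∑ x₁ ∈ C, χ x₁ x • y (δ b) x)) = 0 := by
    classical
    intro C
    induction C using Finset.induction_on with
    | empty =>
      simp only [Finset.sum_empty]
      refine ⟨isSmooth_zero, ?_⟩
      have : ∀ x w, E (fun _ => 0) x w = 0 * E (fun _ => 0) x w := fun x w => by
        rw [zero_mul]
        refine Finset.sum_eq_zero fun s _ => slotForm_eq_zero M _ _ (δ b) ?_ w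
        rw [Function.update_self]
      rw [integral_congr' o this, integral_const_mul', zero_mul]
    | insert x₁ C hx₁ ih =>
      simp only [Finset.sum_insert hx₁]
      refine ⟨isSmooth_add (hχ x₁) ih.1, ?_⟩
      rw [integral_congr' o (hadd _ _ (hχ x₁) ih.1), integral_add' o (hcont _ (hχ x₁))
        (hcont _ ih.1), hzero, ih.2, add_zero]
  have hfin := (hsum (activeCharts k X)).2
  have hone : (fun x => ∑ x₁ ∈ activeCharts k X, χ x₁ x • y (δ b) x) = y (δ b) := by
    funext x
    rw [← Finset.sum_smul]
    simp only [χ]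
    rw [sum_chartPartition, one_smul]
  rw [hone] at hfin
  simpa only [hE, Function.update_eq_self] using hfin

end SlotForm

/-! ### The simplex -/

lemma isClosed_simplex (q : ℕ) : IsClosed (simplex q) := by
  have : simplex q = (⋂ i, {t | 0 ≤ t i}) ∩ {t | ∑ i, t i ≤ 1} := by
    ext t; simp [simplex]
  rw [this]
  exact (isClosed_iInter fun i => isClosed_le continuous_const (continuous_apply i)).inter
    (isClosed_le (continuous_finsetSum _ fun i _ => continuous_apply i) continuous_const)

lemma le_one_of_mem_simplex {q : ℕ} {t : Fin q → ℝ} (ht : t ∈ simplex q) (i : Fin q) : t i ≤ 1 :=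
  (Finset.single_le_sum (fun j _ => ht.1 j) (Finset.mem_univ i)).trans ht.2

lemma isCompact_simplex (q : ℕ) : IsCompact (simplex q) := by
  refine IsCompact.of_isClosed_subset (isCompact_Icc (a := fun _ : Fin q => (0 : ℝ))
    (b := fun _ => 1)) (isClosed_simplex q) fun t ht => ⟨fun i => ht.1 i, fun i => ?_⟩
  exact le_one_of_mem_simplex ht i

/-! ### Chern-Weil forms -/

section ChernWeil

variable {d : ℕ} {G : Type*} [TopologicalSpace G] [ChartedSpace (Model d) G] [Group G]

lemma Ad_add (g : G) (v w : LieAlg d G) : Ad g (v + w) = Ad g v + Ad g w :=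
  let L : Model d →L[ℝ] Model d := mfderiv (𝓡 d) (𝓡 d) (fun h : G => g * h * g⁻¹) 1
  L.map_add v w

lemma Ad_smul (g : G) (c : ℝ) (v : LieAlg d G) : Ad g (c • v) = c • Ad g v :=
  let L : Model d →L[ℝ] Model d := mfderiv (𝓡 d) (𝓡 d) (fun h : G => g * h * g⁻¹) 1
  L.map_smul c v

lemma Ad_one (v : LieAlg d G) : Ad (1 : G) v = v := by
  have h : (fun h : G => (1 : G) * h * 1⁻¹) = id := by funext h; simp
  unfold Ad
  have h1 : ∀ f : G → G, f = id → (mfderiv (𝓡 d) (𝓡 d) f 1 : Model d →L[ℝ] Model d) v = v := by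
    rintro f rfl
    exact congrArg (fun L : Model d →L[ℝ] Model d => L v) mfderiv_id
  exact h1 _ h

variable {m : ℕ}

lemma connForm_add (a : Fin m → G) (j : Fin m) (v w : Fin m → LieAlg d G) :
    connForm a j (v + w) = connForm a j v + connForm a j w := by
  simp only [connForm, Pi.add_apply, Ad_add, Finset.sum_add_distrib]

lemma connForm_smul (a : Fin m → G) (j : Fin m) (c : ℝ) (v : Fin m → LieAlg d G) :
    connForm a j (c • v) = c • connForm a j v := by
  simp only [connForm, Pi.smul_apply, Ad_smul, Finset.smul_sum]

lemma connForm_zero (a : Fin m → G) (j : Fin m) :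
    connForm a j (0 : Fin m → LieAlg d G) = 0 := by
  simpa using connForm_smul a j 0 (0 : Fin m → LieAlg d G)

lemma curvature_skew [LieGroup (𝓡 d) ∞ G] (a : Fin m → G) (t : Fin m → ℝ)
    (w w' : (Fin m → LieAlg d G) × (Fin m → ℝ)) :
    curvature a t w' w = - curvature a t w w' := by
  unfold curvature
  rw [← lie_skew (∑ j, t j • connForm a j w'.1)]
  have : ∀ j, ⁅connForm a j w'.1, connForm a j w.1⁆ = -⁅connForm a j w.1, connForm a j w'.1⁆ :=
    fun j => (lie_skew _ _).symm
  simp only [this, smul_neg, Finset.sum_neg_distrib, Finset.sum_sub_distrib]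
  abel

lemma curvature_add_left [LieGroup (𝓡 d) ∞ G] (a : Fin m → G) (t : Fin m → ℝ)
    (w₁ w₂ w' : (Fin m → LieAlg d G) × (Fin m → ℝ)) :
    curvature a t (w₁ + w₂) w' = curvature a t w₁ w' + curvature a t w₂ w' := by
  unfold curvature
  simp only [Prod.fst_add, Prod.snd_add, connForm_add, Pi.add_apply, add_smul, smul_add, add_lie,
    Finset.sum_add_distrib, Finset.sum_sub_distrib]
  abel

lemma curvature_smul_left [LieGroup (𝓡 d) ∞ G] (a : Fin m → G) (t : Fin m → ℝ) (c : ℝ)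
    (w w' : (Fin m → LieAlg d G) × (Fin m → ℝ)) :
    curvature a t (c • w) w' = c • curvature a t w w' := by
  unfold curvature
  have h1 : ∀ (x : ℝ) (z : LieAlg d G), x • c • z = c • x • z := fun x z => smul_comm x c z
  simp only [Prod.smul_fst, Prod.smul_snd, connForm_smul, Pi.smul_apply, smul_assoc, smul_lie, h1,
    ← smul_sub, ← Finset.smul_sum, ← smul_add]

/-- The curvature as a bilinear map. -/
def curvatureMap [LieGroup (𝓡 d) ∞ G] (a : Fin m → G) (t : Fin m → ℝ) :
    ((Fin m → LieAlg d G) × (Fin m → ℝ)) →ₗ[ℝ] ((Fin m → LieAlg d G) × (Fin m → ℝ)) →ₗ[ℝ]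
      LieAlg d G :=
  LinearMap.mk₂ ℝ (curvature a t) (curvature_add_left a t) (curvature_smul_left a t)
    (fun w w₁ w₂ => by
      rw [curvature_skew a t (w₁ + w₂), curvature_add_left, curvature_skew a t w₁,
        curvature_skew a t w₂]
      abel)
    (fun c w w' => by
      rw [curvature_skew a t (c • w'), curvature_smul_left, curvature_skew a t w', smul_neg])

variable {p : ℕ} {W : Type*} [AddCommGroup W] [Module ℝ W]

/-- The form `P(R(w₁, w₂), …, R(w_{2p-1}, w_{2p}))`. -/
def pairForm (P : MultilinearMap ℝ (fun _ : Fin p => LieAlg d G) ℂ)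
    (R : W →ₗ[ℝ] W →ₗ[ℝ] LieAlg d G) : MultilinearMap ℝ (fun _ : Fin (2 * p) => W) ℂ :=
  -- The `j`-th vector occurs only in the factor `j / 2`, on the left if `j` is even and on the
  -- right if `j` is odd, and it enters linearly.
  have key : ∀ (w : Fin (2 * p) → W) (j : Fin (2 * p)), ∃ L : W →ₗ[ℝ] LieAlg d G, ∀ v,
      (fun i : Fin p => R (Function.update w j v ⟨2 * i, by omega⟩)
        (Function.update w j v ⟨2 * i + 1, by omega⟩)) =
      Function.update (fun i : Fin p => R (w ⟨2 * i, by omega⟩) (w ⟨2 * i + 1, by omega⟩))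
        ⟨j / 2, by omega⟩ (L v) := by
    intro w j
    rcases Nat.even_or_odd' (j : ℕ) with ⟨c, hc | hc⟩
    · refine ⟨R.flip (w ⟨2 * c + 1, by omega⟩), fun v => ?_⟩
      funext i
      by_cases hi : (i : ℕ) = c
      · have h1 : i = ⟨j / 2, by omega⟩ := Fin.ext (by simp; omega)
        have h2 : (⟨2 * i, by omega⟩ : Fin (2 * p)) = j := Fin.ext (by simp; omega)
        have h3 : (⟨2 * i + 1, by omega⟩ : Fin (2 * p)) ≠ j := fun h => by
          have := congrArg Fin.val h; simp at this; omega
        rw [h2, Function.update_self, Function.update_of_ne h3, ← h1, Function.update_self]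
        subst hi
        rfl
      · have h1 : i ≠ ⟨j / 2, by omega⟩ := fun h => hi (by
          have := congrArg Fin.val h; simp at this; omega)
        have h2 : (⟨2 * i, by omega⟩ : Fin (2 * p)) ≠ j := fun h => by
          have := congrArg Fin.val h; simp at this; omega
        have h3 : (⟨2 * i + 1, by omega⟩ : Fin (2 * p)) ≠ j := fun h => by
          have := congrArg Fin.val h; simp at this; omega
        rw [Function.update_of_ne h2, Function.update_of_ne h3, Function.update_of_ne h1]
    · refine ⟨R (w ⟨2 * c, by omega⟩), fun v => ?_⟩
      funext i
      by_cases hi : (i : ℕ) = c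
      · have h1 : i = ⟨j / 2, by omega⟩ := Fin.ext (by simp; omega)
        have h2 : (⟨2 * i + 1, by omega⟩ : Fin (2 * p)) = j := Fin.ext (by simp; omega)
        have h3 : (⟨2 * i, by omega⟩ : Fin (2 * p)) ≠ j := fun h => by
          have := congrArg Fin.val h; simp at this; omega
        rw [h2, Function.update_self, Function.update_of_ne h3, ← h1, Function.update_self]
        subst hi
        rfl
      · have h1 : i ≠ ⟨j / 2, by omega⟩ := fun h => hi (by
          have := congrArg Fin.val h; simp at this; omega)
        have h2 : (⟨2 * i, by omega⟩ : Fin (2 * p)) ≠ j := fun h => by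
          have := congrArg Fin.val h; simp at this; omega
        have h3 : (⟨2 * i + 1, by omega⟩ : Fin (2 * p)) ≠ j := fun h => by
          have := congrArg Fin.val h; simp at this; omega
        rw [Function.update_of_ne h2, Function.update_of_ne h3, Function.update_of_ne h1]
  { toFun := fun w => P (fun i => R (w ⟨2 * i, by omega⟩) (w ⟨2 * i + 1, by omega⟩))
    map_update_add' := fun {inst} w j v v' => by
      have := Subsingleton.elim inst (instDecidableEqFin (2 * p))
      subst this
      obtain ⟨L, hL⟩ := key w j
      rw [hL, hL, hL, map_add, P.map_update_add]
    map_update_smul' := fun {inst} w j c v => by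
      have := Subsingleton.elim inst (instDecidableEqFin (2 * p))
      subst this
      obtain ⟨L, hL⟩ := key w j
      rw [hL, hL, map_smul, P.map_update_smul] }

/-- The Chern-Weil form as an alternating map. -/
def chernWeilAlt (P : MultilinearMap ℝ (fun _ : Fin p => LieAlg d G) ℂ)
    (R : W →ₗ[ℝ] W →ₗ[ℝ] LieAlg d G) : W [⋀^Fin (2 * p)]→ₗ[ℝ] ℂ :=
  ((2 : ℂ) ^ p)⁻¹ • MultilinearMap.alternatization (pairForm P R)

lemma chernWeilAlt_apply (P : MultilinearMap ℝ (fun _ : Fin p => LieAlg d G) ℂ)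
    (R : W →ₗ[ℝ] W →ₗ[ℝ] LieAlg d G) (w : Fin (2 * p) → W) :
    chernWeilAlt P R w = chernWeil P (fun x y => R x y) w := by
  refine (congrArg (fun z => ((2 : ℂ) ^ p)⁻¹ * z)
    (MultilinearMap.alternatization_apply (pairForm P R) w)).trans ?_
  unfold chernWeil
  congr 1
  refine Finset.sum_congr rfl fun τ _ => ?_
  exact units_smul_complex _ _

end ChernWeil

/-! ### The group in the chart at the identity, and smoothness of the adjoint action and of the
Maurer-Cartan form -/

section GroupChart

variable {d : ℕ} {G : Type*} [TopologicalSpace G] [ChartedSpace (Model d) G] [Group G]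

/-- The chart at the identity. -/
def oneChart (d : ℕ) (G : Type*) [TopologicalSpace G] [ChartedSpace (Model d) G] [Group G] :
    OpenPartialHomeomorph G (Model d) := chartAt (Model d) (1 : G)

lemma one_mem_source : (1 : G) ∈ (oneChart d G).source := mem_chart_source _ _

/-- The tangent space at `1` is trivialised by the preferred chart at `1`, so derivatives at points
sent to `1` are ordinary derivatives in this one chart. -/
lemma mfderiv_eq_fderiv_oneChart {E : Type*} [NormedAddCommGroup E] [NormedSpace ℝ E] {f : E → G}
    {x : E} (hf : MDifferentiableAt 𝓘(ℝ, E) (𝓡 d) f x) (h : f x = 1) (w : E) :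
    (mfderiv 𝓘(ℝ, E) (𝓡 d) f x w : Model d) = fderiv ℝ (fun y => oneChart d G (f y)) x w := by
  rw [MDifferentiableAt.mfderiv hf]
  have : writtenInExtChartAt 𝓘(ℝ, E) (𝓡 d) x f = fun y => oneChart d G (f y) := by
    funext y
    simp [writtenInExtChartAt, h, oneChart, mfld_simps]; rfl
  rw [this]
  simp [fderivWithin_univ, mfld_simps]; rfl

variable [LieGroup (𝓡 d) ∞ G]

lemma contMDiffAt_oneChart {g : G} (hg : g = 1) :
    ContMDiffAt (𝓡 d) 𝓘(ℝ, Model d) ∞ (oneChart d G) g := by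
  subst hg
  exact contMDiffAt_extChartAt (I := 𝓡 d) (n := ∞) (x := (1 : G))

lemma Ad_eq (g : G) (v : LieAlg d G) : (Ad g v : Model d) =
    fderiv ℝ (fun s => oneChart d G (g * (oneChart d G).symm s * g⁻¹)) (oneChart d G 1) v := by
  have hsm : ContMDiff (𝓡 d) (𝓡 d) ∞ (fun h : G => g * h * g⁻¹) :=
    (contMDiff_const.mul contMDiff_id).mul contMDiff_const
  have h1 : g * 1 * g⁻¹ = 1 := by simp
  unfold Ad
  rw [MDifferentiableAt.mfderiv (hsm.mdifferentiableAt (by simp))]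
  have : writtenInExtChartAt (𝓡 d) (𝓡 d) (1 : G) (fun h : G => g * h * g⁻¹) =
      fun s => oneChart d G (g * (oneChart d G).symm s * g⁻¹) := by
    funext s
    simp [writtenInExtChartAt, oneChart]
  rw [this]
  simp [fderivWithin_univ, oneChart]; rfl

lemma maurerCartan_eq {E : Type*} [NormedAddCommGroup E] [NormedSpace ℝ E] {f : E → G} {x : E}
    (hf : ContMDiffAt 𝓘(ℝ, E) (𝓡 d) 1 f x) (w : E) :
    (maurerCartan 𝓘(ℝ, E) f x w : Model d) =
      fderiv ℝ (fun y => oneChart d G (f y * (f x)⁻¹)) x w :=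
  have : LieGroup (𝓡 d) 1 G := LieGroup.of_le (n := ∞) (by simp)
  mfderiv_eq_fderiv_oneChart ((hf.mul contMDiffAt_const).mdifferentiableAt (by simp))
    (mul_inv_cancel _) w

variable {E F : Type*} [NormedAddCommGroup E] [NormedSpace ℝ E]
  [NormedAddCommGroup F] [NormedSpace ℝ F]

lemma contMDiffAt_oneChart_symm : ContMDiffAt 𝓘(ℝ, Model d) (𝓡 d) ∞ (oneChart d G).symm
    (oneChart d G 1) :=
  (contMDiffOn_chart_symm (I := 𝓡 d) (n := ∞) (x := (1 : G))).contMDiffAt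
    ((oneChart d G).open_target.mem_nhds ((oneChart d G).map_source one_mem_source))

lemma ContDiffAt.oneChart_comp {f : E → G} {x : E} (hf : ContMDiffAt 𝓘(ℝ, E) (𝓡 d) ∞ f x)
    (h : f x = 1) : ContDiffAt ℝ ∞ (fun y => oneChart d G (f y)) x :=
  ((contMDiffAt_oneChart h).comp x hf).contDiffAt

/-- In the chart, the adjoint action is a partial derivative of conjugation, which is jointly smooth
in the group element and the coordinate. -/
lemma contDiffAt_Ad {g : E → G} {v : E → LieAlg d G} {e : E}
    (hg : ContMDiffAt 𝓘(ℝ, E) (𝓡 d) ∞ g e) (hv : ContDiffAt (F := Model d) ℝ ∞ v e) :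
    ContDiffAt (F := Model d) ℝ ∞ (fun e => Ad (g e) (v e)) e := by
  simp only [Ad_eq]
  refine ContDiffAt.clm_apply (F := Model d) (G := Model d) ?_ hv
  refine ContDiffAt.fderiv (n := ∞) (g := fun _ => oneChart d G 1)
    (f := fun e s => oneChart d G (g e * (oneChart d G).symm s * (g e)⁻¹)) ?_ contDiffAt_const
    (by simp)
  refine ContDiffAt.oneChart_comp (f := fun y : E × Model d =>
    g y.1 * (oneChart d G).symm y.2 * (g y.1)⁻¹) ?_ ?_
  · have h1 : ContMDiffAt 𝓘(ℝ, E × Model d) (𝓡 d) ∞ (fun y : E × Model d => g y.1)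
        (e, oneChart d G 1) := ContMDiffAt.comp (e, oneChart d G 1) hg contDiffAt_fst.contMDiffAt
    have h2 : ContMDiffAt 𝓘(ℝ, E × Model d) (𝓡 d) ∞
        (fun y : E × Model d => (oneChart d G).symm y.2) (e, oneChart d G 1) :=
      ContMDiffAt.comp (e, oneChart d G 1) contMDiffAt_oneChart_symm contDiffAt_snd.contMDiffAt
    exact (h1.mul h2).mul h1.inv
  · simp [(oneChart d G).left_inv one_mem_source]

lemma contDiffAt_maurerCartan {f : E → F → G} {g : E → F} {w : E → F} {e : E}
    (hf : ContMDiffAt 𝓘(ℝ, E × F) (𝓡 d) ∞ (fun y : E × F => f y.1 y.2) (e, g e))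
    (hg : ContDiffAt ℝ ∞ g e) (hw : ContDiffAt ℝ ∞ w e) :
    ContDiffAt (F := Model d) ℝ ∞ (fun e => maurerCartan 𝓘(ℝ, F) (f e) (g e) (w e)) e := by
  have hev : ∀ᶠ e' in 𝓝 e, ContMDiffAt 𝓘(ℝ, F) (𝓡 d) 1 (f e') (g e') := by
    have h1 := (contMDiffAt_iff_contMDiffAt_nhds (I := 𝓘(ℝ, E × F)) (n := 1) (by simp)).1
      (hf.of_le (by simp))
    have h2 : Filter.Tendsto (fun e' => (e', g e')) (𝓝 e) (𝓝 (e, g e)) :=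
      continuousAt_id.prodMk hg.continuousAt
    filter_upwards [h2.eventually h1] with e' he'
    exact ContMDiffAt.comp (I' := 𝓘(ℝ, E × F)) (g := fun y : E × F => f y.1 y.2) (g e') he'
      (contDiffAt_const.prodMk contDiffAt_id).contMDiffAt
  refine ContDiffAt.congr_of_eventuallyEq ?_ (hev.mono fun e' he' => maurerCartan_eq he' (w e'))
  refine ContDiffAt.clm_apply (F := F) (G := Model d) ?_ hw
  refine ContDiffAt.fderiv (n := ∞) (g := g)
    (f := fun e y => oneChart d G (f e y * (f e (g e))⁻¹)) ?_ hg (by simp)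
  refine ContDiffAt.oneChart_comp (f := fun y : E × F => f y.1 y.2 * (f y.1 (g y.1))⁻¹) ?_
    (mul_inv_cancel _)
  refine hf.mul ?_
  have : ContMDiffAt 𝓘(ℝ, E × F) (𝓡 d) ∞ (fun y : E × F => f y.1 (g y.1)) (e, g e) :=
    ContMDiffAt.comp (g := fun y : E × F => f y.1 y.2)
      (f := fun y : E × F => (y.1, g y.1)) (e, g e) hf
      (contDiffAt_fst.prodMk (hg.comp (e, g e) contDiffAt_fst)).contMDiffAt
  exact this.inv

end GroupChart

/-- Integrals over a compact set depend smoothly on parameters. -/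
theorem eventually_contDiffAt_integral {T Z V : Type*} [NormedAddCommGroup T] [NormedSpace ℝ T]
    [NormedAddCommGroup Z] [NormedSpace ℝ Z] [FiniteDimensional ℝ Z] [MeasurableSpace Z]
    [BorelSpace Z] (μ : Measure Z) [μ.IsAddHaarMeasure]
    [NormedAddCommGroup V] [NormedSpace ℝ V] {K : Set Z} (hK : IsCompact K) {w : Z → ℝ}
    (hw : IntegrableOn w K μ) {F : T × Z → V} {t₀ : T}
    (hF : ∀ z ∈ K, ∀ᶠ y in 𝓝 (t₀, z), ContDiffAt ℝ ∞ F y) :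
    ∀ᶠ t in 𝓝 t₀, ContDiffAt ℝ ∞ (fun t => ∫ z in K, w z • F (t, z) ∂μ) t := by
  set O : Set (T × Z) := {y | ∀ᶠ y' in 𝓝 y, ContDiffAt ℝ ∞ F y'} with hO
  have hOo : IsOpen O := isOpen_setOfPred_eventually_nhds
  obtain ⟨u, v, hu, hv, hu₀, hKv, huv⟩ := generalized_tube_lemma (s := {t₀}) isCompact_singleton hK
    hOo (by rintro ⟨t, z⟩ ⟨rfl, hz⟩; exact hF z hz)
  obtain ⟨K', hK', hKK', hK'v⟩ := exists_compact_between hK hv hKv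
  -- The cut-off is `1` exactly on `K` and is supported in a compact subset of the region where `F`
  -- is smooth.
  obtain ⟨χ, hχ, -, hχs, hχ1⟩ := exists_contMDiff_support_eq_eq_one_iff (n := ⊤) 𝓘(ℝ, Z)
    (isOpen_interior (s := K')) hK.isClosed hKK'
  have hχ0 : ∀ z ∉ K', χ z = 0 := fun z hz => by
    by_contra h
    exact hz (interior_subset (hχs ▸ (Function.mem_support.2 h)))
  have hFat : ∀ p ∈ u, ∀ z ∈ v, ContDiffAt ℝ ∞ F (p, z) := fun p hp z hz =>
    (show ∀ᶠ y' in 𝓝 (p, z), ContDiffAt ℝ ∞ F y' from huv ⟨hp, hz⟩).self_of_nhds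
  -- With the reflection in the second variable, the integral becomes the value at `0` of the
  -- convolution of `w` restricted to `K` with a compactly supported smooth kernel depending on a
  -- parameter.
  set g : T → Z → V := fun p x => χ (-x) • F (p, -x) with hg
  have hgs : ContDiffOn ℝ ((⊤ : ℕ∞) : WithTop ℕ∞) (Function.uncurry g) (u ×ˢ Set.univ) := by
    rintro ⟨p, x⟩ ⟨hp, -⟩
    refine ContDiffAt.contDiffWithinAt ?_
    by_cases hx : -x ∈ v
    · refine ContDiffAt.smul ?_ ?_
      · exact hχ.contDiff.contDiffAt.comp (p, x) contDiffAt_snd.neg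
      · exact (hFat p hp _ hx).comp (f := fun y : T × Z => (y.1, -y.2)) (p, x)
          (contDiffAt_fst.prodMk contDiffAt_snd.neg)
    · refine (contDiffAt_const (c := (0 : V))).congr_of_eventuallyEq ?_
      have : ∀ᶠ y : T × Z in 𝓝 (p, x), -y.2 ∈ K'ᶜ :=
        (continuous_snd.neg.continuousAt (x := (p, x))).eventually
          (hK'.isClosed.isOpen_compl.mem_nhds fun h => hx (hK'v h))
      filter_upwards [this] with y hy
      change χ (-y.2) • F (y.1, -y.2) = 0
      rw [hχ0 _ hy, zero_smul]
  have key := contDiffOn_convolution_right_with_param (μ := μ) (f := K.indicator w)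
    (g := g) (n := ⊤)
    (ContinuousLinearMap.lsmul ℝ ℝ : ℝ →L[ℝ] V →L[ℝ] V) hu (k := -K') hK'.neg
    (fun p x _ hx => by
      change χ (-x) • F (p, -x) = 0
      rw [hχ0 (-x) (fun h => hx (by simpa using h)), zero_smul])
    ((integrable_indicator_iff hK.measurableSet).2 hw).locallyIntegrable hgs
  filter_upwards [hu.mem_nhds (hu₀ rfl)] with t ht
  have h1 := key.contDiffAt (x := (t, 0)) ((hu.prod isOpen_univ).mem_nhds ⟨ht, trivial⟩)
  have h2 := h1.comp (f := fun t : T => (t, (0 : Z))) t (contDiffAt_id.prodMk contDiffAt_const)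
  refine h2.congr_of_eventuallyEq (Filter.Eventually.of_forall fun t => ?_)
  change ∫ z in K, w z • F (t, z) ∂μ = ∫ z, K.indicator w z • g t (0 - z) ∂μ
  rw [← integral_indicator hK.measurableSet]
  congr 1
  funext z
  by_cases hz : z ∈ K
  · simp [hz, hg, (hχ1 z).1 hz]
  · simp [hz]

/-! ### Smoothness and multilinearity of the Bott-Shulman-Stasheff forms -/

section BssForm

variable {d : ℕ} {G : Type*} [TopologicalSpace G] [ChartedSpace (Model d) G] [Group G]
  [LieGroup (𝓡 d) ∞ G] {m p n : ℕ} {E : Type*} [NormedAddCommGroup E] [NormedSpace ℝ E]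

variable (d G) in
lemma contDiff_bracket :
    ContDiff ℝ ∞ (fun y : Model d × Model d => bracketMap d G y.1 y.2) :=
  (((bracketMap d G).toContinuousBilinearMap.contDiff (n := ∞)).comp contDiff_fst).clm_apply
    contDiff_snd

lemma contDiffAt_bracket {u v : E → LieAlg d G} {e : E}
    (hu : ContDiffAt (F := Model d) ℝ ∞ u e) (hv : ContDiffAt (F := Model d) ℝ ∞ v e) :
    ContDiffAt (F := Model d) ℝ ∞ (fun e => (⁅u e, v e⁆ : LieAlg d G)) e :=
  (contDiff_bracket d G).contDiffAt.comp (f := fun e => ((u e, v e) : Model d × Model d)) e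
    (hu.prodMk hv)

lemma contMDiffAt_partialProd {a : E → Fin m → G} {e : E}
    (ha : ∀ i, ContMDiffAt 𝓘(ℝ, E) (𝓡 d) ∞ (fun e => a e i) e) (j : Fin (m + 1)) :
    ContMDiffAt 𝓘(ℝ, E) (𝓡 d) ∞ (fun e => Fin.partialProd (a e) j) e := by
  induction j using Fin.induction with
  | zero => simpa using contMDiffAt_const
  | succ j ih =>
    simp only [Fin.partialProd_succ]
    exact ih.mul (ha j)

lemma contDiffAt_connForm {a : E → Fin m → G} {v : E → Fin m → LieAlg d G} {e : E}
    (ha : ∀ i, ContMDiffAt 𝓘(ℝ, E) (𝓡 d) ∞ (fun e => a e i) e)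
    (hv : ∀ i, ContDiffAt (F := Model d) ℝ ∞ (fun e => v e i) e) (j : Fin m) :
    ContDiffAt (F := Model d) ℝ ∞ (fun e => connForm (a e) j (v e)) e :=
  ContDiffAt.sum (F := Model d) fun i _ => contDiffAt_Ad (contMDiffAt_partialProd ha _) (hv i)

lemma contDiffAt_curvature {a : E → Fin m → G} {t : E → Fin m → ℝ}
    {w w' : E → (Fin m → LieAlg d G) × (Fin m → ℝ)} {e : E}
    (ha : ∀ i, ContMDiffAt 𝓘(ℝ, E) (𝓡 d) ∞ (fun e => a e i) e) (ht : ContDiffAt ℝ ∞ t e)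
    (hw : ∀ i, ContDiffAt (F := Model d) ℝ ∞ (fun e => (w e).1 i) e)
    (hw2 : ContDiffAt ℝ ∞ (fun e => (w e).2) e)
    (hw' : ∀ i, ContDiffAt (F := Model d) ℝ ∞ (fun e => (w' e).1 i) e)
    (hw2' : ContDiffAt ℝ ∞ (fun e => (w' e).2) e) :
    ContDiffAt (F := Model d) ℝ ∞ (fun e => curvature (a e) (t e) (w e) (w' e)) e := by
  have ht' := contDiffAt_pi.1 ht
  have h2 := contDiffAt_pi.1 hw2
  have h2' := contDiffAt_pi.1 hw2'
  have c := contDiffAt_connForm ha hw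
  have c' := contDiffAt_connForm ha hw'
  unfold curvature
  refine ContDiffAt.sub (F := Model d) (ContDiffAt.add (F := Model d) ?_ ?_) ?_
  · exact ContDiffAt.sum (F := Model d) fun j _ =>
      ((h2 j).smul (F := Model d) (c' j)).sub ((h2' j).smul (F := Model d) (c j))
  · exact ContDiffAt.sum (F := Model d) fun j _ => (ht' j).smul (F := Model d)
      (contDiffAt_bracket (c j) (c' j))
  · exact contDiffAt_bracket
      (ContDiffAt.sum (F := Model d) fun j _ => (ht' j).smul (F := Model d) (c j))
      (ContDiffAt.sum (F := Model d) fun j _ => (ht' j).smul (F := Model d) (c' j))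

/-- The tangent vectors of `G^m × Δ_m` in the definition of `bssForm`. -/
def bssVec (h : n + m = 2 * p) (v : Fin n → Fin m → LieAlg d G) (i : Fin (2 * p)) :
    (Fin m → LieAlg d G) × (Fin m → ℝ) :=
  Fin.append (fun l => ((v l, 0) : (Fin m → LieAlg d G) × (Fin m → ℝ)))
    (fun j => (0, Pi.single j 1)) (Fin.cast h.symm i)

lemma bssForm_eq (P : MultilinearMap ℝ (fun _ : Fin p => LieAlg d G) ℂ) (h : n + m = 2 * p)
    (a : Fin m → G) (v : Fin n → Fin m → LieAlg d G) :
    bssForm P h a v = ∫ t in simplex m, chernWeil P (curvature a t) (bssVec h v) := rfl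

lemma contDiffAt_chernWeil (P : MultilinearMap ℝ (fun _ : Fin p => LieAlg d G) ℂ)
    (h : n + m = 2 * p) {a : E → Fin m → G} {t : E → Fin m → ℝ}
    {v : E → Fin n → Fin m → LieAlg d G} {e : E}
    (ha : ∀ i, ContMDiffAt 𝓘(ℝ, E) (𝓡 d) ∞ (fun e => a e i) e) (ht : ContDiffAt ℝ ∞ t e)
    (hv : ∀ l i, ContDiffAt (F := Model d) ℝ ∞ (fun e => v e l i) e) :
    ContDiffAt ℝ ∞ (fun e => chernWeil P (curvature (a e) (t e)) (bssVec h (v e))) e := by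
  have h1 : ∀ (l : Fin (2 * p)) i,
      ContDiffAt (F := Model d) ℝ ∞ (fun e => (bssVec h (v e) l).1 i) e := by
    intro l
    obtain ⟨l', rfl⟩ : ∃ l', Fin.cast h l' = l := ⟨Fin.cast h.symm l, by simp⟩
    intro i
    simp only [bssVec, Fin.cast_cast, Fin.cast_eq_self]
    induction l' using Fin.addCases with
    | left l' => simpa using hv l' i
    | right l' => simpa using contDiffAt_const (F := Model d)
  have h2 : ∀ (l : Fin (2 * p)), ContDiffAt ℝ ∞ (fun e => (bssVec h (v e) l).2) e := by
    intro l
    obtain ⟨l', rfl⟩ : ∃ l', Fin.cast h l' = l := ⟨Fin.cast h.symm l, by simp⟩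
    simp only [bssVec, Fin.cast_cast, Fin.cast_eq_self]
    induction l' using Fin.addCases with
    | left l' => simpa using contDiffAt_const
    | right l' => simpa using contDiffAt_const
  unfold chernWeil
  refine contDiffAt_const.mul (ContDiffAt.sum fun τ _ => contDiffAt_const.mul ?_)
  have h3 : ContDiffAt (F := Fin p → Model d) ℝ ∞ (fun e (i : Fin p) =>
      curvature (a e) (t e) (bssVec h (v e) (τ ⟨2 * i, by omega⟩))
        (bssVec h (v e) (τ ⟨2 * i + 1, by omega⟩))) e :=
    (contDiffAt_pi (F' := fun _ : Fin p => Model d)).2 fun i =>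
      contDiffAt_curvature ha ht (h1 _) (h2 _) (h1 _) (h2 _)
  exact ContDiffAt.comp (F := Fin p → Model d) e ((modelForm P).contDiff (n := ∞)).contDiffAt h3

lemma integrableOn_chernWeil (P : MultilinearMap ℝ (fun _ : Fin p => LieAlg d G) ℂ)
    (h : n + m = 2 * p) (a : Fin m → G) (v : Fin n → Fin m → LieAlg d G) :
    IntegrableOn (fun t => chernWeil P (curvature a t) (bssVec h v)) (simplex m) := by
  refine ContinuousOn.integrableOn_compact (isCompact_simplex m) fun t _ => ?_
  exact (contDiffAt_chernWeil P h (a := fun _ => a) (t := id) (v := fun _ => v) (n := n) (e := t)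
    (fun i => contMDiffAt_const) contDiffAt_id
    (fun l i => contDiffAt_const (F := Model d))).continuousAt.continuousWithinAt

lemma eventually_contDiffAt_bssForm (P : MultilinearMap ℝ (fun _ : Fin p => LieAlg d G) ℂ)
    (h : n + m = 2 * p) {a : E → Fin m → G} {v : E → Fin n → Fin m → LieAlg d G} {e₀ : E}
    (ha : ∀ᶠ e in 𝓝 e₀, ∀ i, ContMDiffAt 𝓘(ℝ, E) (𝓡 d) ∞ (fun e => a e i) e)
    (hv : ∀ᶠ e in 𝓝 e₀, ∀ l i, ContDiffAt (F := Model d) ℝ ∞ (fun e => v e l i) e) :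
    ∀ᶠ e in 𝓝 e₀, ContDiffAt ℝ ∞ (fun e => bssForm P h (a e) (v e)) e := by
  have := eventually_contDiffAt_integral (T := E) (volume : Measure (Fin m → ℝ))
    (isCompact_simplex m) (w := fun _ => 1) (t₀ := e₀) (V := ℂ)
    (F := fun y => chernWeil P (curvature (a y.1) y.2) (bssVec h (v y.1)))
    (continuousOn_const.integrableOn_compact (isCompact_simplex m))
    (fun z _ => by
      have hf : Filter.Tendsto (Prod.fst : E × (Fin m → ℝ) → E) (𝓝 (e₀, z)) (𝓝 e₀) :=
        continuousAt_fst
      filter_upwards [hf.eventually ha, hf.eventually hv] with y hya hyv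
      exact contDiffAt_chernWeil P h (a := fun y : E × (Fin m → ℝ) => a y.1)
        (v := fun y : E × (Fin m → ℝ) => v y.1)
        (fun i => ContMDiffAt.comp (I' := 𝓘(ℝ, E)) (g := fun e => a e i) y (hya i)
          contDiffAt_fst.contMDiffAt) contDiffAt_snd
        (fun l i => ContDiffAt.comp (F := E) (G := Model d) (g := fun e => v e l i) y (hyv l i)
          contDiffAt_fst))
  simp only [one_smul] at this
  exact this

/-- The Bott-Shulman-Stasheff form as an alternating map. -/
def bssAlt (P : MultilinearMap ℝ (fun _ : Fin p => LieAlg d G) ℂ) (h : n + m = 2 * p)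
    (a : Fin m → G) : (Fin m → LieAlg d G) [⋀^Fin n]→ₗ[ℝ] ℂ :=
  have key : ∀ (v : Fin n → Fin m → LieAlg d G) (l : Fin n) (u : Fin m → LieAlg d G),
      bssVec h (Function.update v l u) =
        Function.update (bssVec h v) (Fin.cast h (Fin.castAdd m l)) (u, 0) := by
    intro v l u
    funext i
    obtain ⟨i, rfl⟩ : ∃ l', Fin.cast h l' = i := ⟨Fin.cast h.symm i, by simp⟩
    simp only [bssVec, Fin.cast_cast, Fin.cast_eq_self]
    induction i using Fin.addCases with
    | left i =>
      by_cases hi : i = l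
      · subst hi; simp
      · have : Fin.cast h (Fin.castAdd m i) ≠ Fin.cast h (Fin.castAdd m l) := fun h' => hi (by
          simpa using h')
        rw [Function.update_of_ne this]
        simp [bssVec, Function.update_of_ne hi]
    | right i =>
      have : Fin.cast h (Fin.natAdd n i) ≠ Fin.cast h (Fin.castAdd m l) := fun h' => by
        have := congrArg Fin.val h'
        simp at this
        omega
      rw [Function.update_of_ne this]
      simp [bssVec]
  have cw : ∀ (t : Fin m → ℝ) (w : Fin (2 * p) → (Fin m → LieAlg d G) × (Fin m → ℝ)),
      chernWeil P (curvature a t) w = chernWeilAlt P (curvatureMap a t) w := fun t w =>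
    (chernWeilAlt_apply P (curvatureMap a t) w).symm
  { toFun := fun v => bssForm P h a v
    map_update_add' := fun {inst} v l u u' => by
      have := Subsingleton.elim inst (instDecidableEqFin n)
      subst this
      simp only [bssForm_eq]
      rw [← integral_add (integrableOn_chernWeil P h a _) (integrableOn_chernWeil P h a _)]
      congr 1
      funext t
      simp only [key, cw]
      rw [← AlternatingMap.map_update_add]
      simp
    map_update_smul' := fun {inst} v l c u => by
      have := Subsingleton.elim inst (instDecidableEqFin n)
      subst this
      simp only [bssForm_eq]
      rw [← integral_smul]
      congr 1
      funext t
      simp only [key, cw]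
      rw [← AlternatingMap.map_update_smul]
      simp
    map_eq_zero_of_eq' := fun v i j hij hne => by
      simp only [bssForm_eq, cw]
      have : ∀ t, chernWeilAlt P (curvatureMap a t) (bssVec h v) = 0 := fun t => by
        refine (chernWeilAlt P (curvatureMap a t)).map_eq_zero_of_eq _
          (i := Fin.cast h (Fin.castAdd m i)) (j := Fin.cast h (Fin.castAdd m j)) ?_ ?_
        · simp [bssVec, hij]
        · intro h'; exact hne (by simpa using h')
      simp [this] }

lemma bssAlt_apply (P : MultilinearMap ℝ (fun _ : Fin p => LieAlg d G) ℂ) (h : n + m = 2 * p)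
    (a : Fin m → G) (v : Fin n → Fin m → LieAlg d G) : bssAlt P h a v = bssForm P h a v := rfl

end BssForm

/-- If `f j < j`, then `f (f j) = f j` by induction, against injectivity. This forces the pairing of
the simplex directions with the first `k` copies. -/
lemma Function.Injective.eq_id_of_le {k : ℕ} {f : Fin k → Fin k} (hf : Function.Injective f)
    (h : ∀ j, f j ≤ j) (j : Fin k) : f j = j := by
  induction j using WellFoundedLT.induction with
  | ind j ih =>
    rcases (h j).lt_or_eq with hj | hj
    · exact hf (ih _ hj)
    · exact hj

/-! ### Pairings of simplex and base vectors in the terms of the Chern-Weil form -/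

section Terms

variable {d : ℕ} {G : Type*} [TopologicalSpace G] [ChartedSpace (Model d) G] [Group G]
  [LieGroup (𝓡 d) ∞ G] {m p n : ℕ}

/-- The label of the `j`-th vector of the simplex. -/
abbrev simplexLabel (h : n + m = 2 * p) (j : Fin m) : Fin (2 * p) := Fin.cast h (Fin.natAdd n j)

/-- The label of the `l`-th vector of the base. -/
abbrev baseLabel (h : n + m = 2 * p) (l : Fin n) : Fin (2 * p) := Fin.cast h (Fin.castAdd m l)

lemma label_cases (h : n + m = 2 * p) (x : Fin (2 * p)) :
    (∃ l, x = baseLabel h l) ∨ ∃ j, x = simplexLabel h j := by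
  obtain ⟨l', rfl⟩ : ∃ l', Fin.cast h l' = x := ⟨Fin.cast h.symm x, by simp⟩
  induction l' using Fin.addCases with
  | left l' => exact Or.inl ⟨l', rfl⟩
  | right l' => exact Or.inr ⟨l', rfl⟩

lemma bssVec_base (h : n + m = 2 * p) (v : Fin n → Fin m → LieAlg d G) (l : Fin n) :
    bssVec h v (baseLabel h l) = (v l, 0) := by simp [bssVec]

lemma bssVec_simplex (h : n + m = 2 * p) (v : Fin n → Fin m → LieAlg d G) (j : Fin m) :
    bssVec h v (simplexLabel h j) = (0, Pi.single j 1) := by simp [bssVec]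

/-- The summand dt_j ∧ ρ_j of the curvature is the only one with a simplex direction. -/
lemma curvature_simplex_base (a : Fin m → G) (t : Fin m → ℝ) (j : Fin m)
    (v : Fin m → LieAlg d G) :
    curvature a t (0, Pi.single j 1) (v, 0) = connForm a j v := by
  unfold curvature
  simp only [connForm_zero, smul_zero, zero_lie, Pi.zero_apply, sub_zero,
    Finset.sum_const_zero, add_zero]
  rw [Finset.sum_eq_single j]
  · simp
  · intro b _ hb; simp [Pi.single_eq_of_ne hb]
  · simp

lemma curvature_simplex_simplex (a : Fin m → G) (t : Fin m → ℝ) (c c' : Fin m → ℝ) :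
    curvature (d := d) a t (0, c) (0, c') = 0 := by
  unfold curvature
  simp [connForm_zero]

/-- The factors of a term of the Chern-Weil form. -/
def factor (h : n + m = 2 * p) (a : Fin m → G) (t : Fin m → ℝ) (v : Fin n → Fin m → LieAlg d G)
    (τ : Equiv.Perm (Fin (2 * p))) (i : Fin p) : LieAlg d G :=
  curvature a t (bssVec h v (τ ⟨2 * i, by omega⟩)) (bssVec h v (τ ⟨2 * i + 1, by omega⟩))

lemma chernWeil_bssVec (P : MultilinearMap ℝ (fun _ : Fin p => LieAlg d G) ℂ)
    (h : n + m = 2 * p) (a : Fin m → G) (t : Fin m → ℝ) (v : Fin n → Fin m → LieAlg d G) :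
    chernWeil P (curvature a t) (bssVec h v) = ((2 : ℂ) ^ p)⁻¹ * ∑ τ : Equiv.Perm (Fin (2 * p)),
      ((Equiv.Perm.sign τ : ℤ) : ℂ) * P (factor h a t v τ) := rfl

/-- In the pairing of the labels given by `τ`, the `j`-th vector of the simplex and the `l`-th
vector of the base are paired in the slot `s`. -/
def Paired (h : n + m = 2 * p) (τ : Equiv.Perm (Fin (2 * p))) (s : Fin p) (j : Fin m)
    (l : Fin n) : Prop :=
  (τ ⟨2 * s, by omega⟩ = simplexLabel h j ∧ τ ⟨2 * s + 1, by omega⟩ = baseLabel h l) ∨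
  (τ ⟨2 * s, by omega⟩ = baseLabel h l ∧ τ ⟨2 * s + 1, by omega⟩ = simplexLabel h j)

/-- The sign records which of the two vectors comes first. It depends on the permutation only, hence
is uniform in the point and the vectors. -/
lemma factor_of_paired {h : n + m = 2 * p} {τ : Equiv.Perm (Fin (2 * p))} {s : Fin p} {j : Fin m}
    {l : Fin n} (hs : Paired h τ s j l) : ∃ ε : ℝ, ∀ (a : Fin m → G) (t : Fin m → ℝ)
      (v : Fin n → Fin m → LieAlg d G), factor h a t v τ s = ε • connForm a j (v l) := by
  rcases hs with ⟨h1, h2⟩ | ⟨h1, h2⟩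
  · refine ⟨1, fun a t v => ?_⟩
    rw [factor, h1, h2, bssVec_base, bssVec_simplex, curvature_simplex_base, one_smul]
  · refine ⟨-1, fun a t v => ?_⟩
    rw [factor, h1, h2, bssVec_base, bssVec_simplex, curvature_skew, curvature_simplex_base,
      neg_one_smul]

/-- The position of a label. -/
lemma exists_slot (τ : Equiv.Perm (Fin (2 * p))) (x : Fin (2 * p)) : ∃ s : Fin p,
    τ ⟨2 * s, by omega⟩ = x ∨ τ ⟨2 * s + 1, by omega⟩ = x := by
  refine ⟨⟨(τ.symm x : ℕ) / 2, by omega⟩, ?_⟩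
  rcases Nat.even_or_odd' (τ.symm x : ℕ) with ⟨c, hc | hc⟩
  · left
    rw [← τ.apply_symm_apply x]
    congr 1
    ext
    simp
    omega
  · right
    rw [← τ.apply_symm_apply x]
    congr 1
    ext
    simp
    omega

/-- The curvature has no dt ∧ dt component, so a simplex vector in a nonvanishing term must have a
base vector as partner. -/
lemma exists_paired {h : n + m = 2 * p} {a : Fin m → G} {t : Fin m → ℝ}
    {v : Fin n → Fin m → LieAlg d G} {τ : Equiv.Perm (Fin (2 * p))}
    (hf : ∀ i, factor h a t v τ i ≠ 0) (j : Fin m) :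
    ∃ s l, Paired h τ s j l ∧ connForm a j (v l) ≠ 0 := by
  have key : ∃ s l, Paired h τ s j l := by
    obtain ⟨s, hs | hs⟩ := exists_slot τ (simplexLabel h j)
    · rcases label_cases h (τ ⟨2 * s + 1, by omega⟩) with ⟨l, hl⟩ | ⟨j', hj'⟩
      · exact ⟨s, l, Or.inl ⟨hs, hl⟩⟩
      · refine absurd ?_ (hf s)
        rw [factor, hs, hj', bssVec_simplex, bssVec_simplex, curvature_simplex_simplex]
    · rcases label_cases h (τ ⟨2 * s, by omega⟩) with ⟨l, hl⟩ | ⟨j', hj'⟩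
      · exact ⟨s, l, Or.inr ⟨hl, hs⟩⟩
      · refine absurd ?_ (hf s)
        rw [factor, hs, hj', bssVec_simplex, bssVec_simplex, curvature_simplex_simplex]
  obtain ⟨s, l, hsl⟩ := key
  refine ⟨s, l, hsl, fun h0 => hf s ?_⟩
  obtain ⟨ε, hε⟩ := factor_of_paired (d := d) (G := G) hsl
  rw [hε, h0, smul_zero]

lemma simplexLabel_ne_baseLabel (h : n + m = 2 * p) (j : Fin m) (l : Fin n) :
    simplexLabel h j ≠ baseLabel h l := fun h' => by
  have := congrArg Fin.val h'
  simp at this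
  omega

lemma simplexLabel_injective (h : n + m = 2 * p) : Function.Injective (simplexLabel h) :=
  fun j j' h' => by simpa using h'

lemma even_inj {τ : Equiv.Perm (Fin (2 * p))} {s s' : Fin p} {x : Fin (2 * p)}
    (h : τ ⟨2 * s, by omega⟩ = x) (h' : τ ⟨2 * s', by omega⟩ = x) : s = s' := by
  have := congrArg Fin.val (τ.injective (h.trans h'.symm))
  exact Fin.ext (by simp at this; omega)

lemma odd_inj {τ : Equiv.Perm (Fin (2 * p))} {s s' : Fin p} {x : Fin (2 * p)}
    (h : τ ⟨2 * s + 1, by omega⟩ = x) (h' : τ ⟨2 * s' + 1, by omega⟩ = x) : s = s' := by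
  have := congrArg Fin.val (τ.injective (h.trans h'.symm))
  exact Fin.ext (by simp at this; omega)

lemma even_ne_odd {τ : Equiv.Perm (Fin (2 * p))} {s s' : Fin p} {x : Fin (2 * p)}
    (h : τ ⟨2 * s, by omega⟩ = x) (h' : τ ⟨2 * s' + 1, by omega⟩ = x) : False := by
  have := congrArg Fin.val (τ.injective (h.trans h'.symm))
  simp at this
  omega

lemma Paired.eq_of_slot {h : n + m = 2 * p} {τ : Equiv.Perm (Fin (2 * p))} {s : Fin p}
    {j j' : Fin m} {l l' : Fin n} (h1 : Paired h τ s j l) (h2 : Paired h τ s j' l') : j = j' := by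
  rcases h1 with ⟨h1, h1'⟩ | ⟨h1, h1'⟩ <;> rcases h2 with ⟨h2, h2'⟩ | ⟨h2, h2'⟩
  · exact simplexLabel_injective h (h1.symm.trans h2)
  · exact absurd (h1.symm.trans h2) (simplexLabel_ne_baseLabel h _ _)
  · exact absurd (h2.symm.trans h1) (simplexLabel_ne_baseLabel h _ _)
  · exact simplexLabel_injective h (h1'.symm.trans h2')

lemma Paired.slot_eq_of_base {h : n + m = 2 * p} {τ : Equiv.Perm (Fin (2 * p))} {s s' : Fin p}
    {j j' : Fin m} {l : Fin n} (h1 : Paired h τ s j l) (h2 : Paired h τ s' j' l) : s = s' := by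
  rcases h1 with ⟨h1, h1'⟩ | ⟨h1, h1'⟩ <;> rcases h2 with ⟨h2, h2'⟩ | ⟨h2, h2'⟩
  · exact odd_inj h1' h2'
  · exact (even_ne_odd h2 h1').elim
  · exact (even_ne_odd h1 h2').elim
  · exact even_inj h1 h2

lemma Paired.base_injective {h : n + m = 2 * p} {τ : Equiv.Perm (Fin (2 * p))} {s : Fin m → Fin p}
    {l : Fin m → Fin n} (hsl : ∀ j, Paired h τ (s j) j (l j)) : Function.Injective l := by
  intro j j' hj
  have h1 := hsl j
  have h2 := hsl j'
  rw [← hj] at h2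
  have h3 := h1.slot_eq_of_base h2
  rw [← h3] at h2
  exact h1.eq_of_slot h2

/-- Before the last index, ρ_j does not involve the last factor. -/
lemma connForm_eq_zero_of_top {m : ℕ} (a : Fin (m + 1) → G) (j : Fin m)
    {v : Fin (m + 1) → LieAlg d G} (hv : ∀ i : Fin m, v i.castSucc = 0) :
    connForm a j.castSucc v = 0 := by
  refine Finset.sum_eq_zero fun i hi => ?_
  induction i using Fin.lastCases with
  | last =>
    have := (Finset.mem_filter.1 hi).2
    exact absurd this (by simp [Fin.le_def])
  | cast i =>
    rw [hv]
    simpa using Ad_smul (Fin.partialProd a i.castSucc.castSucc) 0 (0 : LieAlg d G)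

/-- The Bott-Shulman-Stasheff form vanishes if too many vectors are tangent to the last factor. -/
lemma bssForm_eq_zero_of_top (P : MultilinearMap ℝ (fun _ : Fin p => LieAlg d G) ℂ) {m : ℕ}
    (h : n + (m + 1) = 2 * p) (a : Fin (m + 1) → G) (v : Fin n → Fin (m + 1) → LieAlg d G)
    (T : Finset (Fin n)) (hT : T.card < m)
    (hv : ∀ l ∉ T, ∀ i : Fin m, v l i.castSucc = 0) : bssForm P h a v = 0 := by
  rw [bssForm_eq]
  refine (integral_congr_ae (Filter.Eventually.of_forall fun t => ?_)).trans (integral_zero _ _)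
  change chernWeil P (curvature a t) (bssVec h v) = 0
  rw [chernWeil_bssVec, Finset.sum_eq_zero, mul_zero]
  intro τ _
  by_cases hf : ∀ i, factor h a t v τ i ≠ 0
  · exfalso
    -- The partners of the first `m` simplex vectors are distinct, and each must have a component
    -- outside the last factor. They would all lie in `T`, which is too small.
    choose s l hsl using fun j => exists_paired hf j
    have hinj := Paired.base_injective (fun j => (hsl j).1)
    have hmem : ∀ j : Fin m, l j.castSucc ∈ T := fun j => by
      by_contra hj
      exact (hsl j.castSucc).2 (connForm_eq_zero_of_top a j (hv _ hj))
    have := Finset.card_le_card_of_injOn (s := Finset.univ) (fun j : Fin m => l j.castSucc)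
      (fun j _ => hmem j) (fun j _ j' _ hj => Fin.castSucc_injective _ (hinj hj))
    simp at this
    omega
  · push Not at hf
    obtain ⟨i, hi⟩ := hf
    rw [P.map_coord_zero i hi, mul_zero]

end Terms

/-! ### The Bott-Shulman-Stasheff form at the identity -/

section AtOne

variable {d : ℕ} {G : Type*} [TopologicalSpace G] [ChartedSpace (Model d) G] [Group G]
  [LieGroup (𝓡 d) ∞ G] {p q r k : ℕ}

lemma connForm_one {m : ℕ} (j : Fin m) (v : Fin m → LieAlg d G) :
    connForm (fun _ => (1 : G)) j v = ∑ i ∈ Finset.univ.filter (fun i => i ≤ j), v i := by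
  unfold connForm
  refine Finset.sum_congr rfl fun i _ => ?_
  have : ∀ j : Fin (m + 1), Fin.partialProd (fun _ : Fin m => (1 : G)) j = 1 := by
    intro j
    induction j using Fin.induction with
    | zero => simp
    | succ j ih => rw [Fin.partialProd_succ, ih, one_mul]
  rw [this, Ad_one]

lemma connForm_one_single {m : ℕ} (j i : Fin m) (z : LieAlg d G) :
    connForm (fun _ => (1 : G)) j (Pi.single i z) = if i ≤ j then z else 0 := by
  rw [connForm_one, Finset.sum_pi_single']
  simp

/-- The tangent vectors of `G^{k+1}` at the identity of which the first `q` are tangent to the last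
factor and the others to one of the other factors each. -/
def unitVec (ξ : Fin q → LieAlg d G) (ζ : Fin k → LieAlg d G) :
    Fin (q + k) → Fin (k + 1) → LieAlg d G :=
  Fin.append (fun i => Pi.single (Fin.last k) (ξ i)) (fun j => Pi.single j.castSucc (ζ j))

lemma unitVec_left (ξ : Fin q → LieAlg d G) (ζ : Fin k → LieAlg d G) (i : Fin q) :
    unitVec ξ ζ (Fin.castAdd k i) = Pi.single (Fin.last k) (ξ i) := by simp [unitVec]

lemma unitVec_right (ξ : Fin q → LieAlg d G) (ζ : Fin k → LieAlg d G) (j : Fin k) :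
    unitVec ξ ζ (Fin.natAdd q j) = Pi.single j.castSucc (ζ j) := by simp [unitVec]

/-- On vectors of the last copy only the last connection form is nonzero. Flatness contributes t[x,
y] and the quadratic term of the curvature contributes -t²[x, y]. -/
lemma curvature_last_last (t : Fin (k + 1) → ℝ) (x y : LieAlg d G) :
    curvature (fun _ => (1 : G)) t (Pi.single (Fin.last k) x, 0) (Pi.single (Fin.last k) y, 0) =
      (t (Fin.last k) * (1 - t (Fin.last k))) • ⁅x, y⁆ := by
  unfold curvature
  have h1 : ∀ (z : LieAlg d G) (j : Fin k), connForm (fun _ => (1 : G)) j.castSucc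
      (Pi.single (Fin.last k) z) = 0 := fun z j => by
    rw [connForm_one_single, if_neg (by simp [Fin.le_def])]
  have h2 : ∀ (z : LieAlg d G), connForm (fun _ => (1 : G)) (Fin.last k)
      (Pi.single (Fin.last k) z) = z := fun z => by
    rw [connForm_one_single, if_pos le_rfl]
  simp only [Fin.sum_univ_castSucc, h1, h2, Pi.zero_apply, zero_smul, smul_zero, sub_zero,
    Finset.sum_const_zero, zero_add, zero_lie, smul_lie, lie_smul, smul_smul]
  rw [← sub_smul]
  ring_nf

/-- The arguments of the form `P(x, [x, x], …, [x, x], ζ, …, ζ)`. -/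
def unitArg (σ : Unit ⊕ (Fin r ⊕ Fin r) → Fin q) (ξ : Fin q → LieAlg d G)
    (ζ : Fin k → LieAlg d G) : Arg r k → LieAlg d G :=
  Sum.elim (fun _ => ξ (σ (Sum.inl ())))
    (Sum.elim (fun i => ξ (σ (Sum.inr i))) ζ)

/-- An invariant polynomial with the arguments indexed by the slots. -/
def slotPoly (P : MultilinearMap ℝ (fun _ : Fin p => LieAlg d G) ℂ) (e : Slot r k ≃ Fin p) :
    MultilinearMap ℝ (fun _ : Slot r k => LieAlg d G) ℂ := P.domDomCongr e.symm

lemma slotPoly_apply (P : MultilinearMap ℝ (fun _ : Fin p => LieAlg d G) ℂ) (e : Slot r k ≃ Fin p)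
    (v : Fin p → LieAlg d G) : slotPoly P e (fun s => v (e s)) = P v := by
  simp [slotPoly]

/-- By symmetry the numbering of the slots is immaterial, so one fixed numbering serves for all
terms. -/
lemma slotPoly_congr {P : MultilinearMap ℝ (fun _ : Fin p => LieAlg d G) ℂ}
    (hP : ∀ (τ : Equiv.Perm (Fin p)) (v : Fin p → LieAlg d G), P (fun i => v (τ i)) = P v)
    (e e' : Slot r k ≃ Fin p) : slotPoly P e = slotPoly P e' := by
  ext v
  simp only [slotPoly, MultilinearMap.domDomCongr_apply]
  rw [← hP (e'.symm.trans e)]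
  exact congrArg P (funext fun i => congrArg v (e.symm_apply_apply _))

/-- The structure of the nonvanishing terms of the Bott-Shulman-Stasheff form at the identity. -/
lemma exists_structure (h : q + k + (k + 1) = 2 * p) (hq : q = 2 * r + 1)
    {t : Fin (k + 1) → ℝ} {ξ : Fin q → LieAlg d G} {ζ : Fin k → LieAlg d G}
    {τ : Equiv.Perm (Fin (2 * p))}
    (hf : ∀ i, factor h (fun _ => (1 : G)) t (unitVec ξ ζ) τ i ≠ 0) :
    ∃ (e : Slot r k ≃ Fin p) (σ : Unit ⊕ (Fin r ⊕ Fin r) ≃ Fin q),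
      (∀ j, Paired h τ (e (sD j)) j.castSucc (Fin.natAdd q j)) ∧
      Paired h τ (e sU) (Fin.last k) (Fin.castAdd k (σ (Sum.inl ()))) ∧
      ∀ i, τ ⟨2 * (e (sB i) : ℕ), by omega⟩ =
          baseLabel h (Fin.castAdd k (σ (Sum.inr (Sum.inl i)))) ∧
        τ ⟨2 * (e (sB i) : ℕ) + 1, by omega⟩ =
          baseLabel h (Fin.castAdd k (σ (Sum.inr (Sum.inr i)))) := by
  choose s l hsl hne using fun j => exists_paired hf j
  have hl := Paired.base_injective hsl
  have hs : Function.Injective s := fun j j' hj =>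
    (hsl j).eq_of_slot (by have := hsl j'; rwa [← hj] at this)
  -- For `j < k` the form ρ_j kills the last copy and all copies after `j`; the partner is thus one
  -- of the `k` special vectors, with index at most `j`. Injectivity then forces equality.
  have hD : ∀ j : Fin k, ∃ b : Fin k, l j.castSucc = Fin.natAdd q b ∧ b ≤ j := by
    intro j
    have h0 := hne j.castSucc
    generalize l j.castSucc = x at h0
    induction x using Fin.addCases with
    | left i =>
      rw [unitVec_left, connForm_one_single, if_neg (by simp [Fin.le_def])] at h0
      exact absurd rfl h0
    | right b =>
      refine ⟨b, rfl, ?_⟩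
      rw [unitVec_right, connForm_one_single] at h0
      by_contra hb
      exact h0 (if_neg (by simpa using hb))
  choose b hb hbj using hD
  have hbinj : Function.Injective b := fun j j' hj =>
    Fin.castSucc_injective _ (hl (by rw [hb, hb, hj]))
  have hbid := Function.Injective.eq_id_of_le hbinj hbj
  have hlD : ∀ j : Fin k, l j.castSucc = Fin.natAdd q j := fun j => by rw [hb, hbid]
  -- The special vectors are used up by the first `k` simplex directions, so the last direction is
  -- paired with a vector of the last copy.
  obtain ⟨u, hu⟩ : ∃ u, l (Fin.last k) = Fin.castAdd k u := by
    generalize hx : l (Fin.last k) = x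
    induction x using Fin.addCases with
    | left i => exact ⟨i, rfl⟩
    | right b =>
      rw [← hlD b] at hx
      exact absurd (hl hx) (by simp [Fin.ext_iff]; omega)
  have hcard : Fintype.card {x // x ∉ Set.range s} = r := by
    classical
    rw [Fintype.card_subtype_compl (fun x => x ∈ Set.range s)]
    have : Fintype.card {x // x ∈ Set.range s} = k + 1 := by
      rw [← Fintype.card_congr (Equiv.ofInjective s hs)]
      simp
    rw [this]
    simp
    omega
  let g : Fin r ≃ {x // x ∉ Set.range s} := (Fintype.equivFinOfCardEq hcard).symm
  let e' : Slot r k → Fin p := Sum.elim (fun _ => s (Fin.last k))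
    (Sum.elim (fun i => g i) (fun j => s j.castSucc))
  have he' : Function.Injective e' := by
    have hg : ∀ i j, (g i : Fin p) ≠ s j := fun i j hij => (g i).2 ⟨j, hij.symm⟩
    have hlc : ∀ j : Fin k, Fin.last k ≠ j.castSucc := fun j h' => by
      simp [Fin.ext_iff] at h'; omega
    rintro (x | x | x) (y | y | y) hxy
    · rfl
    · exact absurd hxy.symm (hg _ _)
    · exact absurd (hs hxy) (hlc y)
    · exact absurd hxy (hg _ _)
    · rw [g.injective (Subtype.ext hxy)]
    · exact absurd hxy (hg _ _)
    · exact absurd (hs hxy).symm (hlc x)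
    · exact absurd hxy.symm (hg _ _)
    · rw [Fin.castSucc_injective _ (hs hxy)]
  have hcard2 : Fintype.card (Slot r k) = Fintype.card (Fin p) := by simp; omega
  let e : Slot r k ≃ Fin p :=
    Equiv.ofBijective e' ((Fintype.bijective_iff_injective_and_card e').2 ⟨he', hcard2⟩)
  have heD : ∀ j, e (sD j) = s j.castSucc := fun j => rfl
  have heU : e sU = s (Fin.last k) := rfl
  -- The other `r` slots contain no simplex vector and no special vector, hence only vectors of the
  -- last copy; they are the bracket slots.
  have hB : ∀ (i : Fin r) (x : Fin (2 * p)),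
      (x = ⟨2 * (e (sB i) : ℕ), by omega⟩ ∨ x = ⟨2 * (e (sB i) : ℕ) + 1, by omega⟩) →
      ∃ u, τ x = baseLabel h (Fin.castAdd k u) := by
    intro i x hx
    have hnot : ∀ j, s j ≠ e (sB i) := fun j hj => (g i).2 ⟨j, hj⟩
    have hpos : ∀ j, x ≠ ⟨2 * (s j : ℕ), by omega⟩ ∧ x ≠ ⟨2 * (s j : ℕ) + 1, by omega⟩ := by
      intro j
      have := hnot j
      rw [Ne, Fin.ext_iff] at this
      rcases hx with rfl | rfl <;> constructor <;> intro h' <;>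
        have h'' := congrArg Fin.val h' <;> simp at h'' <;> omega
    have hlab : ∀ j, τ x ≠ simplexLabel h j ∧ τ x ≠ baseLabel h (l j) := by
      intro j
      rcases hsl j with ⟨h1, h2⟩ | ⟨h1, h2⟩ <;> rw [← h1, ← h2] <;> constructor <;> intro h' <;>
        have h'' := τ.injective h'
      · exact (hpos j).1 h''
      · exact (hpos j).2 h''
      · exact (hpos j).2 h''
      · exact (hpos j).1 h''
    rcases label_cases h (τ x) with ⟨y, hy⟩ | ⟨j, hj⟩
    · induction y using Fin.addCases with
      | left y => exact ⟨y, hy⟩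
      | right y => exact absurd hy (by rw [← hlD]; exact (hlab _).2)
    · exact absurd hj (hlab j).1
  choose xL hxL using fun i => hB i _ (Or.inl rfl)
  choose xR hxR using fun i => hB i _ (Or.inr rfl)
  have hcast : Function.Injective (fun u : Fin q => baseLabel h (Fin.castAdd k u)) :=
    fun a b hab => by simpa using hab
  have hU : ∀ x, (x = e sU → False) →
      τ ⟨2 * (x : ℕ), by omega⟩ ≠ baseLabel h (Fin.castAdd k u) ∧
      τ ⟨2 * (x : ℕ) + 1, by omega⟩ ≠ baseLabel h (Fin.castAdd k u) := by
    intro x hx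
    have h0 := hsl (Fin.last k)
    rw [hu, ← heU] at h0
    rcases h0 with ⟨h1, h2⟩ | ⟨h1, h2⟩ <;> constructor <;> intro h'
    · exact even_ne_odd h' h2
    · exact hx (odd_inj h' h2)
    · exact hx (even_inj h' h1)
    · exact even_ne_odd h1 h'
  let σ' : Unit ⊕ (Fin r ⊕ Fin r) → Fin q := Sum.elim (fun _ => u) (Sum.elim xL xR)
  have heB : ∀ i, e (sB i) = e sU → False := fun i h' => by
    have := e.injective h'; simp at this
  have hσ' : Function.Injective σ' := by
    rintro (x | x | x) (y | y | y) hxy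
    · rfl
    · exact absurd (by rw [hxL, show xL y = u from hxy.symm]) (hU _ (heB y)).1
    · exact absurd (by rw [hxR, show xR y = u from hxy.symm]) (hU _ (heB y)).2
    · exact absurd (by rw [hxL, show xL x = u from hxy]) (hU _ (heB x)).1
    · have h1 := hxL x
      rw [show xL x = xL y from hxy] at h1
      have := e.injective (even_inj h1 (hxL y))
      simpa using this
    · have h1 := hxL x
      rw [show xL x = xR y from hxy] at h1
      exact (even_ne_odd h1 (hxR y)).elim
    · exact absurd (by rw [hxR, show xR x = u from hxy]) (hU _ (heB x)).2
    · have h1 := hxR x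
      rw [show xR x = xL y from hxy] at h1
      exact (even_ne_odd (hxL y) h1).elim
    · have h1 := hxR x
      rw [show xR x = xR y from hxy] at h1
      have := e.injective (odd_inj h1 (hxR y))
      simpa using this
  have hcard3 : Fintype.card (Unit ⊕ (Fin r ⊕ Fin r)) = Fintype.card (Fin q) := by simp; omega
  let σ : Unit ⊕ (Fin r ⊕ Fin r) ≃ Fin q :=
    Equiv.ofBijective σ' ((Fintype.bijective_iff_injective_and_card σ').2 ⟨hσ', hcard3⟩)
  refine ⟨e, σ, fun j => ?_, ?_, fun i => ⟨hxL i, hxR i⟩⟩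
  · rw [heD, ← hlD]; exact hsl _
  · have := hsl (Fin.last k)
    rw [hu] at this
    exact this

/-- The terms of the Bott-Shulman-Stasheff form at the identity. -/
lemma exists_term {P : MultilinearMap ℝ (fun _ : Fin p => LieAlg d G) ℂ}
    (hP : ∀ (τ : Equiv.Perm (Fin p)) (v : Fin p → LieAlg d G), P (fun i => v (τ i)) = P v)
    (h : q + k + (k + 1) = 2 * p) (hq : q = 2 * r + 1) (e₀ : Slot r k ≃ Fin p)
    (σ₀ : Unit ⊕ (Fin r ⊕ Fin r) ≃ Fin q) (τ : Equiv.Perm (Fin (2 * p))) :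
    ∃ (ε : ℝ) (σ : Unit ⊕ (Fin r ⊕ Fin r) ≃ Fin q), ∀ (t : Fin (k + 1) → ℝ)
      (ξ : Fin q → LieAlg d G) (ζ : Fin k → LieAlg d G),
      P (factor h (fun _ => (1 : G)) t (unitVec ξ ζ) τ) =
        ((ε * (t (Fin.last k) * (1 - t (Fin.last k))) ^ r : ℝ) : ℂ) *
          slotPoly P e₀ (slots id (fun _ => id) (unitArg σ ξ ζ)) := by
  -- A term that vanishes identically gets the coefficient `0`. Otherwise a single nonvanishing
  -- instance determines the pairing, which belongs to `τ` and does not depend on the vectors or on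
  -- `t`.
  by_cases hz : ∀ (t : Fin (k + 1) → ℝ) (ξ : Fin q → LieAlg d G) (ζ : Fin k → LieAlg d G),
      P (factor h (fun _ => (1 : G)) t (unitVec ξ ζ) τ) = 0
  · exact ⟨0, σ₀, fun t ξ ζ => by rw [hz]; simp⟩
  push Not at hz
  obtain ⟨t₁, ξ₁, ζ₁, h1⟩ := hz
  obtain ⟨e, σ, hD, hU, hB⟩ := exists_structure h hq (t := t₁) (ξ := ξ₁) (ζ := ζ₁) (τ := τ)
    (fun i hi => h1 (P.map_coord_zero i hi))
  choose εD hεD using fun j => factor_of_paired (d := d) (G := G) (hD j)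
  obtain ⟨εU, hεU⟩ := factor_of_paired (d := d) (G := G) hU
  refine ⟨εU * ∏ j, εD j, σ, fun t ξ ζ => ?_⟩
  rw [slotPoly_congr hP e₀ e, ← slotPoly_apply P e]
  set c : Slot r k → ℝ := Sum.elim (fun _ => εU)
    (Sum.elim (fun _ => t (Fin.last k) * (1 - t (Fin.last k))) εD) with hc
  have hfac : (fun s => factor h (fun _ => (1 : G)) t (unitVec ξ ζ) τ (e s)) =
      fun s => c s • slots id (fun _ => id) (unitArg σ ξ ζ) s := by
    funext s
    rcases s with s | i | j
    · refine (hεU _ t _).trans ?_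
      rw [unitVec_left, connForm_one_single, if_pos le_rfl]
      rfl
    · rw [factor, (hB i).1, (hB i).2, bssVec_base, bssVec_base, unitVec_left, unitVec_left,
        curvature_last_last]
      rfl
    · refine (hεD j _ t _).trans ?_
      rw [unitVec_right, connForm_one_single, if_pos le_rfl]
      rfl
  rw [hfac, MultilinearMap.map_smul_univ, Complex.real_smul]
  congr 2
  simp [hc, Fintype.prod_sum_type]
  ring

/-- The Bott-Shulman-Stasheff form at the identity. -/
theorem exists_bssForm_eq {P : MultilinearMap ℝ (fun _ : Fin p => LieAlg d G) ℂ}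
    (hP : ∀ (τ : Equiv.Perm (Fin p)) (v : Fin p → LieAlg d G), P (fun i => v (τ i)) = P v)
    (h : q + k + (k + 1) = 2 * p) (hq : q = 2 * r + 1) (e₀ : Slot r k ≃ Fin p)
    (σ₀ : Unit ⊕ (Fin r ⊕ Fin r) ≃ Fin q) :
    ∃ C : ℂ, ∀ (ξ : Fin q → LieAlg d G) (ζ : Fin k → LieAlg d G),
      bssForm P h (fun _ => (1 : G)) (unitVec ξ ζ) =
        C * altSum (fun x : Fin q → LieAlg d G =>
          slotPoly P e₀ (slots id (fun _ => id) (unitArg σ₀ x ζ))) ξ := by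
  choose ε σ hεσ using exists_term hP h hq e₀ σ₀
  have hsum : ∃ c : Equiv.Perm (Fin (2 * p)) → ℂ, ∀ (ξ : Fin q → LieAlg d G)
      (ζ : Fin k → LieAlg d G), bssForm P h (fun _ => (1 : G)) (unitVec ξ ζ) =
      ∑ τ, c τ * slotPoly P e₀ (slots id (fun _ => id) (unitArg (σ τ) ξ ζ)) := by
    -- The point of the simplex enters only through the scalar weight, so each term integrates to a
    -- constant times its polynomial.
    refine ⟨fun τ => ((2 : ℂ) ^ p)⁻¹ * (((Equiv.Perm.sign τ : ℤ) : ℂ) *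
      ∫ t in simplex (k + 1),
        ((ε τ * (t (Fin.last k) * (1 - t (Fin.last k))) ^ r : ℝ) : ℂ)), fun ξ ζ => ?_⟩
    rw [bssForm_eq]
    simp only [chernWeil_bssVec, hεσ]
    rw [MeasureTheory.integral_const_mul, integral_finsetSum]
    · rw [Finset.mul_sum]
      refine Finset.sum_congr rfl fun τ _ => ?_
      rw [MeasureTheory.integral_const_mul, MeasureTheory.integral_mul_const]
      ring
    · intro τ _
      refine ContinuousOn.integrableOn_compact (isCompact_simplex (k + 1))
        (Continuous.continuousOn ?_)
      fun_prop
  obtain ⟨c, hc⟩ := hsum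
  -- The form is alternating in `ξ`, hence `1 / q!` times its skew-symmetrisation; the numbering of
  -- each term differs from `σ₀` by a permutation, which contributes its sign.
  refine ⟨((Nat.factorial q : ℂ))⁻¹ * ∑ τ, c τ *
    ((Equiv.Perm.sign (σ₀.symm.trans (σ τ)) : ℤ) : ℂ), fun ξ ζ => ?_⟩
  have hfac : (Nat.factorial q : ℂ) ≠ 0 := by exact_mod_cast Nat.factorial_ne_zero q
  have halt : altSum (fun x : Fin q → LieAlg d G =>
      bssForm P h (fun _ => (1 : G)) (unitVec x ζ)) ξ =
      (Nat.factorial q : ℂ) * bssForm P h (fun _ => (1 : G)) (unitVec ξ ζ) := by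
    have h1 : ∀ ρ : Equiv.Perm (Fin q), bssForm P h (fun _ => (1 : G))
        (unitVec (fun j => ξ (ρ j)) ζ) = ((Equiv.Perm.sign ρ : ℤ) : ℂ) *
          bssForm P h (fun _ => (1 : G)) (unitVec ξ ζ) := by
      intro ρ
      set ρ' : Equiv.Perm (Fin (q + k)) :=
        finSumFinEquiv.permCongr (Equiv.sumCongr ρ (Equiv.refl (Fin k))) with hρ'
      have h2 : unitVec (fun j => ξ (ρ j)) ζ = fun l => unitVec ξ ζ (ρ' l) := by
        funext l
        induction l using Fin.addCases with
        | left i =>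
          have : ρ' (Fin.castAdd k i) = Fin.castAdd k (ρ i) := by simp [hρ', Equiv.permCongr_apply]
          rw [this, unitVec_left, unitVec_left]
        | right j =>
          have : ρ' (Fin.natAdd q j) = Fin.natAdd q j := by simp [hρ', Equiv.permCongr_apply]
          rw [this, unitVec_right, unitVec_right]
      have h3 : Equiv.Perm.sign ρ' = Equiv.Perm.sign ρ := by
        rw [hρ', Equiv.Perm.sign_permCongr, Equiv.Perm.sign_sumCongr]
        simp
      have h4 := (bssAlt P h (fun _ => (1 : G))).map_perm (unitVec ξ ζ) ρ'
      rw [h3, units_smul_complex] at h4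
      rw [h2]
      exact h4
    simpa using altSum_of_alternating (fun x : Fin q → LieAlg d G =>
      bssForm P h (fun _ => (1 : G)) (unitVec x ζ)) ξ h1
  have hperm : ∀ τ, altSum (fun x : Fin q → LieAlg d G =>
      slotPoly P e₀ (slots id (fun _ => id) (unitArg (σ τ) x ζ))) ξ =
      ((Equiv.Perm.sign (σ₀.symm.trans (σ τ)) : ℤ) : ℂ) * altSum (fun x : Fin q → LieAlg d G =>
        slotPoly P e₀ (slots id (fun _ => id) (unitArg σ₀ x ζ))) ξ := by
    intro τ
    rw [← altSum_comp]
    congr 1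
    funext x
    congr 2
    funext a
    rcases a with a | a | a <;> simp [unitArg]
  have hA : altSum (fun x : Fin q → LieAlg d G =>
      bssForm P h (fun _ => (1 : G)) (unitVec x ζ)) ξ = ∑ τ, c τ *
        altSum (fun x : Fin q → LieAlg d G =>
          slotPoly P e₀ (slots id (fun _ => id) (unitArg (σ τ) x ζ))) ξ := by
    simp only [hc]
    rw [altSum_sum]
    exact Finset.sum_congr rfl fun τ _ => altSum_const_mul _ _ _
  rw [halt] at hA
  simp only [hperm, ← mul_assoc, ← Finset.sum_mul] at hA
  rw [mul_assoc, ← hA, ← mul_assoc, inv_mul_cancel₀ hfac, one_mul]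

end AtOne

/-! ### The Chern-Weil form of a quadratic polynomial -/

section LowDegree

variable {d : ℕ} {G : Type*} [TopologicalSpace G] [ChartedSpace (Model d) G] [Group G]
  [LieGroup (𝓡 d) ∞ G]

/-- The 24 permutations are listed once, with signs, so that the sum over them can be evaluated term
by term. -/
lemma map_perm_four : (Finset.univ : Finset (Equiv.Perm (Fin 4))).val.map
    (fun τ => ((Equiv.Perm.sign τ : ℤ), τ 0, τ 1, τ 2, τ 3)) = {
      (1, 0, 1, 2, 3), (-1, 0, 1, 3, 2), (-1, 0, 2, 1, 3), (1, 0, 2, 3, 1),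
      (1, 0, 3, 1, 2), (-1, 0, 3, 2, 1), (-1, 1, 0, 2, 3), (1, 1, 0, 3, 2),
      (1, 1, 2, 0, 3), (-1, 1, 2, 3, 0), (-1, 1, 3, 0, 2), (1, 1, 3, 2, 0),
      (1, 2, 0, 1, 3), (-1, 2, 0, 3, 1), (-1, 2, 1, 0, 3), (1, 2, 1, 3, 0),
      (1, 2, 3, 0, 1), (-1, 2, 3, 1, 0), (-1, 3, 0, 1, 2), (1, 3, 0, 2, 1),
      (1, 3, 1, 0, 2), (-1, 3, 1, 2, 0), (-1, 3, 2, 0, 1), (1, 3, 2, 1, 0)} := by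
  decide

lemma sum_perm_four (f : ℤ × Fin 4 × Fin 4 × Fin 4 × Fin 4 → ℂ) :
    ∑ τ : Equiv.Perm (Fin 4), f ((Equiv.Perm.sign τ : ℤ), τ 0, τ 1, τ 2, τ 3) =
      (Multiset.map f {
      (1, 0, 1, 2, 3), (-1, 0, 1, 3, 2), (-1, 0, 2, 1, 3), (1, 0, 2, 3, 1),
      (1, 0, 3, 1, 2), (-1, 0, 3, 2, 1), (-1, 1, 0, 2, 3), (1, 1, 0, 3, 2),
      (1, 1, 2, 0, 3), (-1, 1, 2, 3, 0), (-1, 1, 3, 0, 2), (1, 1, 3, 2, 0),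
      (1, 2, 0, 1, 3), (-1, 2, 0, 3, 1), (-1, 2, 1, 0, 3), (1, 2, 1, 3, 0),
      (1, 2, 3, 0, 1), (-1, 2, 3, 1, 0), (-1, 3, 0, 1, 2), (1, 3, 0, 2, 1),
      (1, 3, 1, 0, 2), (-1, 3, 1, 2, 0), (-1, 3, 2, 0, 1), (1, 3, 2, 1, 0)}).sum := by
  rw [← map_perm_four, Multiset.map_map]
  rfl

/-- Of the three pairings of four vectors the two hypotheses kill {0,2},{1,3} and {0,1},{2,3}. The
remaining one comes from 8 permutations with equal contributions, and 8/4 = 2. -/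
lemma chernWeil_two (P : MultilinearMap ℝ (fun _ : Fin 2 => LieAlg d G) ℂ)
    (hP : ∀ (τ : Equiv.Perm (Fin 2)) (v : Fin 2 → LieAlg d G), P (fun i => v (τ i)) = P v)
    {W : Type*} (R : W → W → LieAlg d G) (hR : ∀ x y, R y x = - R x y) (w : Fin 4 → W)
    (h02 : R (w 0) (w 2) = 0) (h23 : R (w 2) (w 3) = 0) :
    chernWeil P R w = 2 * P ![R (w 0) (w 3), R (w 1) (w 2)] := by
  have h20 : R (w 2) (w 0) = 0 := by rw [hR, h02, neg_zero]
  have h32 : R (w 3) (w 2) = 0 := by rw [hR, h23, neg_zero]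
  have e : ∀ τ : Equiv.Perm (Fin (2 * 2)),
      (fun i : Fin 2 => R (w (τ ⟨2 * i, by omega⟩)) (w (τ ⟨2 * i + 1, by omega⟩))) =
      ![R (w (τ 0)) (w (τ 1)), R (w (τ 2)) (w (τ 3))] := by
    intro τ
    funext i
    fin_cases i <;> rfl
  have hs : ∀ x y, P ![y, x] = P ![x, y] := by
    intro x y
    rw [← hP (Equiv.swap 0 1) ![x, y]]
    congr 1
    funext i
    fin_cases i <;> rfl
  have hz1 : ∀ x, P ![0, x] = 0 := fun x => P.map_coord_zero 0 rfl
  have hz2 : ∀ x, P ![x, 0] = 0 := fun x => P.map_coord_zero 1 rfl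
  have hn1 : ∀ x y, P ![-x, y] = - P ![x, y] := fun x y => by
    have h1 : ∀ z, ![z, y] = Function.update ![x, y] 0 z := fun z => by
      funext i; fin_cases i <;> rfl
    rw [h1 (-x), P.map_update_neg, ← h1]
  have hn2 : ∀ x y, P ![x, -y] = - P ![x, y] := fun x y => by
    have h1 : ∀ z, ![x, z] = Function.update ![x, y] 1 z := fun z => by
      funext i; fin_cases i <;> rfl
    rw [h1 (-y), P.map_update_neg, ← h1]
  unfold chernWeil
  simp only [e]
  refine (congrArg _ (sum_perm_four fun x => (x.1 : ℂ) *
    P ![R (w x.2.1) (w x.2.2.1), R (w x.2.2.2.1) (w x.2.2.2.2)])).trans ?_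
  simp only [Multiset.insert_eq_cons, Multiset.map_cons, Multiset.map_singleton,
    Multiset.sum_cons, Multiset.sum_singleton]
  simp only [hR (w 0) (w 1), hR (w 0) (w 3), hR (w 1) (w 2), hR (w 1) (w 3), h02, h20, h23, h32,
    hz1, hz2, hn1, hn2, hs (R (w 0) (w 3)) (R (w 1) (w 2))]
  push_cast
  ring

end LowDegree

/-! ### Stokes' theorem on the simplex -/

section Simplex

lemma insertNth_mem_simplex {q : ℕ} (b : Fin (q + 1)) (x : ℝ) (s : Fin q → ℝ) :
    b.insertNth (α := fun _ => ℝ) x s ∈ simplex (q + 1) ↔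
      s ∈ simplex q ∧ 0 ≤ x ∧ x ≤ 1 - ∑ i, s i := by
  simp only [simplex, Set.mem_ofPred_eq, Fin.forall_iff_succAbove b, Fin.insertNth_apply_same,
    Fin.insertNth_apply_succAbove, Fin.sum_univ_succAbove _ b]
  constructor
  · rintro ⟨⟨h1, h2⟩, h3⟩
    exact ⟨⟨h2, by linarith⟩, h1, by linarith⟩
  · rintro ⟨⟨h1, h2⟩, h3, h4⟩
    exact ⟨⟨h3, h1⟩, by linarith⟩

lemma continuous_insertNth {q : ℕ} (b : Fin (q + 1)) :
    Continuous (fun y : ℝ × (Fin q → ℝ) => b.insertNth (α := fun _ => ℝ) y.1 y.2) := by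
  refine continuous_pi fun i => ?_
  rcases Fin.eq_self_or_eq_succAbove b i with rfl | ⟨j, rfl⟩
  · simpa using continuous_fst
  · simp only [Fin.insertNth_apply_succAbove]
    exact (continuous_apply j).comp continuous_snd

/-- Fubini's theorem on the simplex. -/
lemma integral_simplex_succ {q : ℕ} (b : Fin (q + 1)) {f : (Fin (q + 1) → ℝ) → ℂ}
    (hf : ContinuousOn f (simplex (q + 1))) :
    ∫ t in simplex (q + 1), f t =
      ∫ s in simplex q, ∫ x in (0 : ℝ)..(1 - ∑ i, s i), f (b.insertNth (α := fun _ => ℝ) x s) := by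
  have hms := (isClosed_simplex (q + 1)).measurableSet
  have mp := (volume_preserving_piFinSuccAbove (fun _ : Fin (q + 1) => ℝ) b).symm
  rw [← integral_indicator hms, ← mp.integral_comp']
  have hint : Integrable (fun y : ℝ × (Fin q → ℝ) => (simplex (q + 1)).indicator f
      ((MeasurableEquiv.piFinSuccAbove (fun _ => ℝ) b).symm y)) (volume.prod volume) :=
    mp.integrable_comp_of_integrable ((integrable_indicator_iff hms).2
      (hf.integrableOn_compact (isCompact_simplex _)))
  rw [Measure.volume_eq_prod, integral_prod_symm _ hint,
    ← integral_indicator (isClosed_simplex q).measurableSet]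
  congr 1
  funext s
  have he : ∀ x : ℝ, (MeasurableEquiv.piFinSuccAbove (fun _ => ℝ) b).symm (x, s) =
      b.insertNth (α := fun _ => ℝ) x s := fun x => rfl
  by_cases hs : s ∈ simplex q
  · have h1 : (0 : ℝ) ≤ 1 - ∑ i, s i := by linarith [hs.2]
    rw [Set.indicator_of_mem hs, intervalIntegral.integral_of_le h1, ← integral_Icc_eq_integral_Ioc,
      ← integral_indicator measurableSet_Icc]
    congr 1
    funext x
    rw [he]
    by_cases hx : x ∈ Set.Icc 0 (1 - ∑ i, s i)
    · rw [Set.indicator_of_mem hx,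
        Set.indicator_of_mem ((insertNth_mem_simplex b x s).2 ⟨hs, hx.1, hx.2⟩)]
    · rw [Set.indicator_of_notMem hx,
        Set.indicator_of_notMem fun h => hx ((insertNth_mem_simplex b x s).1 h).2]
  · rw [Set.indicator_of_notMem hs]
    have : ∀ x : ℝ, (simplex (q + 1)).indicator f
        ((MeasurableEquiv.piFinSuccAbove (fun _ => ℝ) b).symm (x, s)) = 0 := fun x => by
      rw [he, Set.indicator_of_notMem fun h => hs ((insertNth_mem_simplex b x s).1 h).1]
    exact (integral_congr_ae (Filter.Eventually.of_forall this)).trans (integral_zero _ _)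

lemma hasDerivAt_insertNth {q : ℕ} (b : Fin (q + 1)) (x : ℝ) (s : Fin q → ℝ) :
    HasDerivAt (fun x : ℝ => b.insertNth (α := fun _ => ℝ) x s) (Pi.single b 1) x := by
  rw [hasDerivAt_pi]
  intro i
  rcases Fin.eq_self_or_eq_succAbove b i with rfl | ⟨j, rfl⟩
  · simpa using hasDerivAt_id' x
  · simpa [Fin.succAbove_ne] using hasDerivAt_const x (s j)

/-- The fundamental theorem of calculus on the segments in the direction `b`, which run from the
face `t_b = 0` to the slanted face. -/
lemma integral_simplex_partial {q : ℕ} (b : Fin (q + 1)) {f : (Fin (q + 1) → ℝ) → ℂ}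
    (hf : ∀ t ∈ simplex (q + 1), ContDiffAt ℝ ∞ f t) :
    ∫ t in simplex (q + 1), fderiv ℝ f t (Pi.single b 1) =
      (∫ s in simplex q, f (b.insertNth (α := fun _ => ℝ) (1 - ∑ i, s i) s)) -
        ∫ s in simplex q, f (b.insertNth (α := fun _ => ℝ) 0 s) := by
  have hf' : ContinuousOn (fun t => fderiv ℝ f t (Pi.single b 1)) (simplex (q + 1)) := fun t ht =>
    (((hf t ht).fderiv_right (m := 0) (by simp)).continuousAt.clm_apply
      continuousAt_const).continuousWithinAt
  have hfc : ContinuousOn f (simplex (q + 1)) := fun t ht =>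
    (hf t ht).continuousAt.continuousWithinAt
  rw [integral_simplex_succ b hf', ← integral_sub]
  · refine setIntegral_congr_fun (isClosed_simplex q).measurableSet fun s hs => ?_
    have h1 : (0 : ℝ) ≤ 1 - ∑ i, s i := by linarith [hs.2]
    have hmem : ∀ x ∈ Set.uIcc 0 (1 - ∑ i, s i),
        b.insertNth (α := fun _ => ℝ) x s ∈ simplex (q + 1) := fun x hx => by
      rw [Set.uIcc_of_le h1] at hx
      exact (insertNth_mem_simplex b x s).2 ⟨hs, hx.1, hx.2⟩
    refine intervalIntegral.integral_eq_sub_of_hasDerivAt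
      (f := fun x => f (b.insertNth (α := fun _ => ℝ) x s)) (fun x hx => ?_) ?_
    · exact ((hf _ (hmem x hx)).differentiableAt (by simp)).hasFDerivAt.comp_hasDerivAt x
        (hasDerivAt_insertNth b x s)
    · refine ContinuousOn.intervalIntegrable (hf'.comp ?_ hmem)
      exact ((continuous_insertNth b).comp (continuous_id.prodMk continuous_const)).continuousOn
  · refine ContinuousOn.integrableOn_compact (isCompact_simplex q) (hfc.comp ?_ fun s hs => ?_)
    · exact ((continuous_insertNth b).comp ((continuous_const.sub
        (continuous_finsetSum _ fun i _ => continuous_apply i)).prodMk continuous_id)).continuousOn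
    · exact (insertNth_mem_simplex b _ s).2 ⟨hs, by linarith [hs.2], le_rfl⟩
  · refine ContinuousOn.integrableOn_compact (isCompact_simplex q) (hfc.comp ?_ fun s hs => ?_)
    · exact ((continuous_insertNth b).comp (continuous_const.prodMk continuous_id)).continuousOn
    · exact (insertNth_mem_simplex b _ s).2 ⟨hs, le_rfl, by linarith [hs.2]⟩

/-- The reflections of the simplex preserve integrals. -/
lemma integral_simplex_reflect {q : ℕ} (b : Fin q) {f : (Fin q → ℝ) → ℂ}
    (hf : ContinuousOn f (simplex q)) :
    ∫ s in simplex q, f (Function.update s b (1 - ∑ i, s i)) = ∫ s in simplex q, f s := by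
  obtain ⟨q, rfl⟩ : ∃ q', q = q' + 1 := ⟨q - 1, by have := b.2; omega⟩
  -- On each segment in the direction `b` the map is the reflection of the interval, so the claim
  -- reduces to one variable.
  have hupd : ∀ (x : ℝ) (s : Fin q → ℝ),
      Function.update (b.insertNth (α := fun _ => ℝ) x s) b
        (1 - ∑ i, b.insertNth (α := fun _ => ℝ) x s i) =
      b.insertNth (α := fun _ => ℝ) (1 - ∑ i, s i - x) s := fun x s => by
    rw [Fin.update_insertNth, Fin.sum_univ_succAbove _ b]
    simp only [Fin.insertNth_apply_same, Fin.insertNth_apply_succAbove]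
    congr 1
    ring
  have hmaps : Set.MapsTo (fun s : Fin (q + 1) → ℝ => Function.update s b (1 - ∑ i, s i))
      (simplex (q + 1)) (simplex (q + 1)) := by
    intro s hs
    obtain ⟨⟨x, s'⟩, rfl⟩ := (Fin.insertNthEquiv (fun _ : Fin (q + 1) => ℝ) b).surjective s
    change b.insertNth (α := fun _ => ℝ) x s' ∈ _ at hs
    rw [insertNth_mem_simplex] at hs
    change Function.update (b.insertNth (α := fun _ => ℝ) x s') b _ ∈ _
    refine Eq.mpr (congrArg (· ∈ simplex (q + 1)) (hupd x s')) ?_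
    exact (insertNth_mem_simplex _ _ _).2 ⟨hs.1, by linarith [hs.2.2], by linarith [hs.2.1]⟩
  rw [integral_simplex_succ b hf]
  refine (integral_simplex_succ b (f := fun s => f (Function.update s b (1 - ∑ i, s i)))
    (hf.comp ?_ hmaps)).trans ?_
  rotate_left
  · refine setIntegral_congr_fun (isClosed_simplex q).measurableSet fun s hs => ?_
    simp only [hupd]
    rw [intervalIntegral.integral_comp_sub_left
      (fun x => f (b.insertNth (α := fun _ => ℝ) x s)) (1 - ∑ i, s i)]
    simp
  · exact (continuous_id.update b (continuous_const.sub
      (continuous_finsetSum _ fun i _ => continuous_apply i))).continuousOn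

/-- The slanted face may be parametrised by omitting any coordinate. Consecutive choices differ by a
reflection of the lower simplex, so all give the same integral. -/
lemma integral_simplex_slant {q : ℕ} (b : Fin (q + 1)) {f : (Fin (q + 1) → ℝ) → ℂ}
    (hf : ContinuousOn f (simplex (q + 1))) :
    ∫ s in simplex q, f (b.insertNth (α := fun _ => ℝ) (1 - ∑ i, s i) s) =
      ∫ s in simplex q, f (Fin.cons (1 - ∑ i, s i) s) := by
  induction b using Fin.induction with
  | zero => simp
  | succ b ih =>
    rw [← ih]
    have hc : ContinuousOn (fun s : Fin q → ℝ =>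
        f (b.castSucc.insertNth (α := fun _ => ℝ) (1 - ∑ i, s i) s)) (simplex q) := by
      refine hf.comp ?_ fun s hs => ?_
      · exact ((continuous_insertNth b.castSucc).comp ((continuous_const.sub
          (continuous_finsetSum _ fun i _ => continuous_apply i)).prodMk
            continuous_id)).continuousOn
      · exact (insertNth_mem_simplex _ _ s).2 ⟨hs, by linarith [hs.2], le_rfl⟩
    rw [← integral_simplex_reflect b hc]
    refine setIntegral_congr_fun (isClosed_simplex q).measurableSet fun s hs => ?_
    have hsum : ∑ i, Function.update s b (1 - ∑ i, s i) i = 1 - s b := by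
      rw [Finset.sum_update_of_mem (Finset.mem_univ b), ← Finset.add_sum_erase _ s
        (Finset.mem_univ b), Finset.sdiff_singleton_eq_erase]
      ring
    simp only [hsum]
    congr 1
    funext i
    rcases Fin.eq_self_or_eq_succAbove b.succ i with rfl | ⟨j, rfl⟩
    · have : b.succ = b.castSucc.succAbove b := by simp
      rw [Fin.insertNth_apply_same, this, Fin.insertNth_apply_succAbove, Function.update_self]
    · rw [Fin.insertNth_apply_succAbove]
      by_cases hj : j = b
      · subst hj
        have : j.succ.succAbove j = j.castSucc := by simp
        rw [this, Fin.insertNth_apply_same]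
        ring
      · have : b.succ.succAbove j = b.castSucc.succAbove j := by
          have : (j : ℕ) ≠ b := fun h => hj (Fin.ext h)
          ext
          simp only [Fin.succAbove, Fin.lt_def, Fin.val_castSucc, Fin.val_succ]
          split_ifs <;> simp <;> omega
        rw [this, Fin.insertNth_apply_succAbove, Function.update_of_ne hj]

/-- The divergence theorem on the simplex. -/
theorem integral_simplex_divergence {q : ℕ} {F : Fin (q + 1) → (Fin (q + 1) → ℝ) → ℂ}
    (hF : ∀ b, ∀ t ∈ simplex (q + 1), ContDiffAt ℝ ∞ (F b) t) :
    ∫ t in simplex (q + 1), ∑ b, fderiv ℝ (F b) t (Pi.single b 1) =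
      (∫ s in simplex q, ∑ b, F b (Fin.cons (1 - ∑ i, s i) s)) -
        ∑ b, ∫ s in simplex q, F b (b.insertNth (α := fun _ => ℝ) 0 s) := by
  have hc : ∀ b, ContinuousOn (F b) (simplex (q + 1)) := fun b t ht =>
    (hF b t ht).continuousAt.continuousWithinAt
  rw [integral_finsetSum, integral_finsetSum, ← Finset.sum_sub_distrib]
  · refine Finset.sum_congr rfl fun b _ => ?_
    rw [integral_simplex_partial b (hF b), integral_simplex_slant b (hc b)]
  · intro b _
    refine ContinuousOn.integrableOn_compact (isCompact_simplex q)
      ((hc b).comp ?_ fun s hs => ?_)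
    · have := ((continuous_insertNth (0 : Fin (q + 1))).comp ((continuous_const (y := (1 : ℝ)).sub
          (continuous_finsetSum Finset.univ fun (i : Fin q) _ => continuous_apply i)).prodMk
            continuous_id)).continuousOn (s := simplex q)
      simpa [Function.comp_def] using this
    · have := (insertNth_mem_simplex 0 (1 - ∑ i, s i) s).2 ⟨hs, by linarith [hs.2], le_rfl⟩
      simpa using this
  · intro b _
    refine ContinuousOn.integrableOn_compact (isCompact_simplex _) fun t ht => ?_
    exact (((hF b t ht).fderiv_right (m := 0) (by simp)).continuousAt.clm_apply
      continuousAt_const).continuousWithinAt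

end Simplex

/-! ### Algebra of alternating forms: column operations and wedge products -/

section AlternatingAlgebra

variable {E : Type*} [AddCommGroup E] [Module ℝ E] {n : ℕ}

/-- Column operations: each subtraction adds a term with a repeated entry. -/
lemma AlternatingMap.map_sub_const {ι : Type*} [DecidableEq ι] (Ω : E [⋀^ι]→ₗ[ℝ] ℂ) (v : ι → E)
    (i₀ : ι) (s : Finset ι) (hs : i₀ ∉ s) :
    Ω (fun c => if c ∈ s then v c - v i₀ else v c) = Ω v := by
  induction s using Finset.induction_on with
  | empty => simp
  | insert c s hc ih =>
    have hci : i₀ ≠ c := fun h => hs (by simp [h])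
    have hi : i₀ ∉ s := fun h => hs (by simp [h])
    have h1 : (fun a => if a ∈ insert c s then v a - v i₀ else v a) =
        Function.update (fun a => if a ∈ s then v a - v i₀ else v a) c (v c - v i₀) := by
      funext a
      by_cases ha : a = c
      · subst ha; simp
      · simp [ha]
    have h2 : Function.update (fun a => if a ∈ s then v a - v i₀ else v a) c (v c) =
        fun a => if a ∈ s then v a - v i₀ else v a := by
      funext a
      by_cases ha : a = c
      · subst ha; simp [hc]
      · simp [ha]
    rw [h1, Ω.map_update_sub, h2, ih hi, sub_eq_self]
    refine Ω.map_eq_zero_of_eq _ (i := c) (j := i₀) ?_ hci.symm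
    simp [Function.update_of_ne hci, hi]

/-- The sum over the faces of a simplex through a slanted face. -/
lemma AlternatingMap.sum_update_eq (Ω : E [⋀^Fin (n + 1)]→ₗ[ℝ] ℂ) (D : Fin (n + 1) → E) (x : E) :
    ∑ b, Ω (Function.update D b x) = Ω (Fin.cons x (fun c : Fin n => D c.succ - D 0)) := by
  -- The differences are introduced one at a time. Each one adds the term with `D 0` in the place
  -- `c.succ`, which after exchanging two entries has `x` in that place.
  have key : ∀ s : Finset (Fin n), Ω (Fin.cons x (fun c : Fin n =>
      if c ∈ s then D c.succ - D 0 else D c.succ)) =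
      Ω (Function.update D 0 x) + ∑ c ∈ s, Ω (Function.update D c.succ x) := by
    intro s
    induction s using Finset.induction_on with
    | empty =>
      simp only [Finset.notMem_empty, if_false, Finset.sum_empty, add_zero]
      congr 1
      funext i
      refine Fin.cases ?_ (fun i => ?_) i <;> simp
    | insert c s hc ih =>
      set u : Fin (n + 1) → E := Fin.cons x (fun c : Fin n =>
        if c ∈ s then D c.succ - D 0 else D c.succ) with hu
      have h1 : (Fin.cons x (fun a : Fin n =>
          if a ∈ insert c s then D a.succ - D 0 else D a.succ) : Fin (n + 1) → E) =
          Function.update u c.succ (D c.succ - D 0) := by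
        funext i
        refine Fin.cases ?_ (fun i => ?_) i
        · simp [hu, Function.update_of_ne (Fin.succ_ne_zero c).symm]
        · by_cases hi : i = c
          · subst hi; simp
          · simp [hu, hi]
      have h2 : Function.update u c.succ (D c.succ) = u := by
        rw [Function.update_eq_self_iff]
        simp [hu, hc]
      set v : Fin (n + 1) → E := Function.update (Function.update D 0 x) c.succ (D 0) with hv
      have h3 : Function.update u c.succ (D 0) =
          fun a => if a ∈ s.map (Fin.succEmb n) then v a - v c.succ else v a := by
        funext i
        refine Fin.cases ?_ (fun i => ?_) i
        · simp [hu, hv, Function.update_of_ne (Fin.succ_ne_zero c).symm]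
        · by_cases hi : i = c
          · subst hi; simp [hv, hc]
          · simp [hu, hv, hi]
      have h4 : v = (Function.update D c.succ x) ∘ Equiv.swap 0 c.succ := by
        funext i
        have h0 := Fin.succ_ne_zero c
        simp only [hv, Function.comp]
        rcases eq_or_ne i 0 with rfl | hi
        · simp [h0.symm]
        · rcases eq_or_ne i c.succ with rfl | hic
          · simp [h0.symm]
          · simp [Equiv.swap_apply_of_ne_of_ne hi hic, hi, hic]
      rw [h1, Ω.map_update_sub, h2, ih, h3, AlternatingMap.map_sub_const Ω v c.succ _ (by simpa),
        h4, Ω.map_swap _ (Fin.succ_ne_zero c).symm, Finset.sum_insert hc]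
      ring
  have := key Finset.univ
  simp only [Finset.mem_univ, if_true] at this
  rw [this, Fin.sum_univ_succ]

/-- The skew product of families of vectors in an alternating form. -/
def wedgeForm (η : E [⋀^Fin n]→ₗ[ℝ] ℂ) : (Fin n → E) [⋀^Fin n]→ₗ[ℝ] ℂ :=
  { ∑ π : Equiv.Perm (Fin n), η.toMultilinearMap.compLinearMap
      (fun c => LinearMap.proj (π c) : Fin n → (Fin n → E) →ₗ[ℝ] E) with
    map_eq_zero_of_eq' := fun u i j hij hne => by
      change (∑ π : Equiv.Perm (Fin n), η.toMultilinearMap.compLinearMap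
        (fun c => LinearMap.proj (π c) : Fin n → (Fin n → E) →ₗ[ℝ] E)) u = 0
      rw [sum_apply]
      set T : Equiv.Perm (Fin n) → ℂ := fun π => η (fun c => u c (π c)) with hT
      change ∑ π, T π = 0
      have h1 : ∀ π, T (π * Equiv.swap i j) = - T π := fun π => by
        have : (fun c => u c ((π * Equiv.swap i j) c)) =
            (fun c => u c (π c)) ∘ Equiv.swap i j := by
          funext c
          simp only [Equiv.Perm.mul_apply, Function.comp]
          rcases eq_or_ne c i with rfl | hi
          · rw [Equiv.swap_apply_left, hij]
          · rcases eq_or_ne c j with rfl | hj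
            · rw [Equiv.swap_apply_right, hij]
            · rw [Equiv.swap_apply_of_ne_of_ne hi hj]
        simp only [hT, this]
        exact η.map_swap _ hne
      have h2 : ∑ π, T (π * Equiv.swap i j) = ∑ π, T π :=
        Fintype.sum_equiv (Equiv.mulRight (Equiv.swap i j)) _ _ fun _ => rfl
      simp only [h1, Finset.sum_neg_distrib] at h2
      linear_combination (-1 / 2 : ℂ) * h2 }

lemma wedgeForm_apply (η : E [⋀^Fin n]→ₗ[ℝ] ℂ) (u : Fin n → Fin n → E) :
    wedgeForm η u = ∑ π : Equiv.Perm (Fin n), η (fun c => u c (π c)) := by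
  change (∑ π : Equiv.Perm (Fin n), η.toMultilinearMap.compLinearMap
    (fun c => LinearMap.proj (π c) : Fin n → (Fin n → E) →ₗ[ℝ] E)) u = _
  rw [sum_apply]
  rfl

end AlternatingAlgebra

/-! ### A primitive for the wedge product of differentials on the simplex -/

section Flux

variable {d n : ℕ}

/-- The flux whose divergence is a multiple of the wedge product of differentials. -/
def flux (η : (Model d) [⋀^Fin n]→ₗ[ℝ] ℂ) (a : Fin n → (Fin n → ℝ) → Model d) (b : Fin n)
    (t : Fin n → ℝ) : ℂ :=
  wedgeForm η (Function.update (fun c i => fderiv ℝ (a i) t (Pi.single c 1)) b (fun i => a i t))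

lemma flux_eq (η : (Model d) [⋀^Fin n]→ₗ[ℝ] ℂ) (a : Fin n → (Fin n → ℝ) → Model d) (b : Fin n)
    (t : Fin n → ℝ) : flux η a b t = ∑ π : Equiv.Perm (Fin n), toCMM η.toMultilinearMap
      (fun c => if c = b then a (π c) t else fderiv ℝ (a (π c)) t (Pi.single c 1)) := by
  unfold flux
  rw [wedgeForm_apply]
  refine Finset.sum_congr rfl fun π _ => ?_
  change η _ = η _
  congr 1
  funext c
  by_cases hc : c = b
  · subst hc; simp
  · simp [hc]

variable {η : (Model d) [⋀^Fin n]→ₗ[ℝ] ℂ} {a : Fin n → (Fin n → ℝ) → Model d} {t : Fin n → ℝ}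

lemma contDiffAt_flux_entry (ha : ∀ i, ContDiffAt ℝ ∞ (a i) t) (b c i : Fin n) :
    ContDiffAt ℝ ∞ (fun t => if c = b then a i t else fderiv ℝ (a i) t (Pi.single c 1)) t := by
  by_cases hc : c = b
  · simpa [hc] using ha i
  · simpa [hc] using ((ha i).fderiv_right (m := ∞) (by simp)).clm_apply contDiffAt_const

lemma contDiffAt_flux (ha : ∀ i, ContDiffAt ℝ ∞ (a i) t) (b : Fin n) :
    ContDiffAt ℝ ∞ (flux η a b) t := by
  have : flux η a b = fun t => ∑ π : Equiv.Perm (Fin n), toCMM η.toMultilinearMap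
      (fun c => if c = b then a (π c) t else fderiv ℝ (a (π c)) t (Pi.single c 1)) :=
    funext fun t => flux_eq η a b t
  rw [this]
  refine ContDiffAt.sum fun π _ => ?_
  exact ((toCMM η.toMultilinearMap).contDiff (n := ∞)).contDiffAt.comp t
    (contDiffAt_pi.2 fun c => contDiffAt_flux_entry ha b c (π c))

/-- Differentiating the one undifferentiated row of the `b`-th flux restores the full wedge product,
once for each `b`. The other terms contain mixed second derivatives and cancel in pairs. -/
lemma sum_fderiv_flux (ha : ∀ i, ContDiffAt ℝ ∞ (a i) t) :
    ∑ b, fderiv ℝ (flux η a b) t (Pi.single b 1) =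
      n * wedgeForm η (fun c i => fderiv ℝ (a i) t (Pi.single c 1)) := by
  set D : Fin n → Fin n → Model d := fun c i => fderiv ℝ (a i) t (Pi.single c 1) with hD
  set H : Fin n → Fin n → Fin n → Model d := fun s b i =>
    fderiv ℝ (fderiv ℝ (a i)) t (Pi.single b 1) (Pi.single s 1) with hH
  have hHs : ∀ s b i, H s b i = H b s i := by
    intro s b i
    have hsy : IsSymmSndFDerivAt ℝ (a i) t := (ha i).isSymmSndFDerivAt (by
      rw [minSmoothness_of_isRCLikeNormedField]
      exact WithTop.coe_le_coe.2 (le_top : (2 : ℕ∞) ≤ ⊤))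
    exact hsy _ _
  have h1 : ∀ b, fderiv ℝ (flux η a b) t (Pi.single b 1) = wedgeForm η D +
      ∑ s ∈ Finset.univ.filter (fun s => s ≠ b),
        wedgeForm η (Function.update (Function.update D b (fun i => a i t)) s (H s b)) := by
    intro b
    have hfl : flux η a b = fun t => ∑ π : Equiv.Perm (Fin n), toCMM η.toMultilinearMap
      (fun c => if c = b then a (π c) t else fderiv ℝ (a (π c)) t (Pi.single c 1)) :=
      funext fun t => flux_eq η a b t
    have hder := HasFDerivAt.fun_sum (u := Finset.univ)
      (fun (π : Equiv.Perm (Fin n)) _ => HasFDerivAt.multilinear_comp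
        (f := toCMM η.toMultilinearMap)
        (g := fun c t => if c = b then a (π c) t else fderiv ℝ (a (π c)) t (Pi.single c 1))
        (fun c => ((contDiffAt_flux_entry ha b c (π c)).differentiableAt (by simp)).hasFDerivAt))
    rw [← hfl] at hder
    rw [hder.fderiv]
    have hval : ∀ (π : Equiv.Perm (Fin n)) (s : Fin n),
        fderiv ℝ (fun t => if s = b then a (π s) t else
          fderiv ℝ (a (π s)) t (Pi.single s 1)) t (Pi.single b 1) =
        if s = b then D b (π b) else H s b (π s) := by
      intro π s
      by_cases hs : s = b
      · subst hs; simp [hD]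
      · simp only [hs, if_false]
        rw [fderiv_clm_apply (((ha (π s)).fderiv_right (m := ∞) (by simp)).differentiableAt
          (by simp)) (by fun_prop)]
        simp [hH]
    rw [sum_apply]
    have hπ : ∀ π : Equiv.Perm (Fin n),
        ∑ s, toCMM η.toMultilinearMap (Function.update
          (fun c => if c = b then a (π c) t else fderiv ℝ (a (π c)) t (Pi.single c 1)) s
          (if s = b then D b (π b) else H s b (π s))) = η (fun c => D c (π c)) +
        ∑ s ∈ Finset.univ.filter (fun s => s ≠ b), η (fun c =>
          Function.update (Function.update D b (fun i => a i t)) s (H s b) c (π c)) := by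
      intro π
      rw [← Finset.add_sum_erase _ _ (Finset.mem_univ b), Finset.filter_ne']
      congr 1
      · change η _ = η _
        congr 1
        funext c
        by_cases hc : c = b
        · subst hc; simp
        · simp [hc, hD]
      · refine Finset.sum_congr rfl fun s hs => ?_
        have hsb : s ≠ b := Finset.ne_of_mem_erase hs
        change η _ = η _
        congr 1
        funext c
        by_cases hc : c = s
        · subst hc; simp [hsb]
        · by_cases hcb : c = b
          · subst hcb; simp [hc]
          · simp [hc, hcb, hD]
    simp only [wedgeForm_apply]
    rw [Finset.sum_comm, ← Finset.sum_add_distrib]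
    refine Finset.sum_congr rfl fun π _ => ?_
    rw [← hπ]
    simp only [← hval]
    simp [ContinuousMultilinearMap.toContinuousLinearMap]
  -- The two expressions differ by an exchange of the rows `b` and `s`, because mixed partial
  -- derivatives commute.
  have h2 : ∀ b s, s ≠ b →
      wedgeForm η (Function.update (Function.update D b (fun i => a i t)) s (H s b)) =
      - wedgeForm η (Function.update (Function.update D s (fun i => a i t)) b (H b s)) := by
    intro b s hsb
    rw [← (wedgeForm η).map_swap _ hsb]
    congr 1
    funext c
    rcases eq_or_ne c s with rfl | hcs
    · simp [funext (hHs c b)]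
    · rcases eq_or_ne c b with rfl | hcb
      · simp [hsb, hsb.symm]
      · simp [Equiv.swap_apply_of_ne_of_ne hcs hcb, hcs, hcb]
  have h3 : ∑ b, ∑ s ∈ Finset.univ.filter (fun s => s ≠ b),
      wedgeForm η (Function.update (Function.update D b (fun i => a i t)) s (H s b)) = 0 := by
    set S := ∑ b, ∑ s ∈ Finset.univ.filter (fun s => s ≠ b),
      wedgeForm η (Function.update (Function.update D b (fun i => a i t)) s (H s b)) with hS
    have : S = - S := by
      conv_lhs => rw [hS, Finset.sum_comm' (t' := Finset.univ)
        (s' := fun s => Finset.univ.filter (fun b => b ≠ s)) (by simp [ne_comm])]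
      rw [hS, ← Finset.sum_neg_distrib]
      refine Finset.sum_congr rfl fun s _ => ?_
      rw [← Finset.sum_neg_distrib]
      refine Finset.sum_congr rfl fun b hb => ?_
      exact h2 b s (by simpa [ne_comm] using hb)
    linear_combination (1 / 2 : ℂ) * this
  simp only [h1, Finset.sum_add_distrib, h3, add_zero]
  simp

end Flux

/-! ### Integrals over the interior of the simplex -/

section SimplexInterior

lemma convex_simplex (q : ℕ) : Convex ℝ (simplex q) := by
  intro s hs t ht a b ha hb hab
  refine ⟨fun i => ?_, ?_⟩
  · have := mul_nonneg ha (hs.1 i)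
    have := mul_nonneg hb (ht.1 i)
    simp only [Pi.add_apply, Pi.smul_apply, smul_eq_mul]
    linarith
  · simp only [Pi.add_apply, Pi.smul_apply, smul_eq_mul, Finset.sum_add_distrib, ← Finset.mul_sum]
    have := mul_le_mul_of_nonneg_left hs.2 ha
    have := mul_le_mul_of_nonneg_left ht.2 hb
    linarith

lemma setIntegral_interior_simplex {q : ℕ} (f : (Fin q → ℝ) → ℂ) :
    ∫ t in interior (simplex q), f t = ∫ t in simplex q, f t :=
  setIntegral_congr_set (interior_ae_eq_of_null_frontier
    ((convex_simplex q).addHaar_frontier volume))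

/-- Identities that hold only on a simplex can be differentiated only at interior points. This
suffices under an integral, since the boundary of a convex set is null. -/
lemma setIntegral_simplex_congr {q : ℕ} {f g : (Fin q → ℝ) → ℂ}
    (h : ∀ t ∈ interior (simplex q), f t = g t) :
    ∫ t in simplex q, f t = ∫ t in simplex q, g t := by
  rw [← setIntegral_interior_simplex f, ← setIntegral_interior_simplex g]
  exact setIntegral_congr_fun isOpen_interior.measurableSet h

end SimplexInterior

/-! ### Stokes' theorem for infinitesimal families of simplices -/

section SimplexFamily

variable {d : ℕ}

/-- The compatibility with the faces of the differentials at `(1, …, 1)` of a family of local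
simplices. -/
structure IsSimplexFamily (A : ∀ q : ℕ, Fin q → (Fin q → ℝ) → (Model d →L[ℝ] Model d)) : Prop where
  smooth : ∀ q i, ∀ t ∈ simplex q, ContDiffAt ℝ ∞ (A q i) t
  face_zero_zero : ∀ q, ∀ t ∈ simplex q,
    A (q + 1) 0 (Fin.cons (1 - ∑ i, t i) t) = ContinuousLinearMap.id ℝ (Model d)
  face_zero_succ : ∀ q, ∀ t ∈ simplex q, ∀ i : Fin q,
    A (q + 1) i.succ (Fin.cons (1 - ∑ i, t i) t) = A q i t
  face_last : ∀ q, ∀ t ∈ simplex q,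
    A (q + 1) (Fin.last q) ((Fin.last q).insertNth (α := fun _ => ℝ) 0 t) = 0
  face_castSucc : ∀ q, ∀ t ∈ simplex q, ∀ j : Fin q,
    A (q + 1) j.castSucc (j.castSucc.insertNth (α := fun _ => ℝ) 0 t) =
      A (q + 1) j.succ (j.castSucc.insertNth (α := fun _ => ℝ) 0 t)

lemma fderiv_comp_insertNth {q : ℕ} {E : Type*} [NormedAddCommGroup E] [NormedSpace ℝ E]
    {f : (Fin (q + 1) → ℝ) → E} (b : Fin (q + 1)) {s : Fin q → ℝ}
    (hf : DifferentiableAt ℝ f (b.insertNth (α := fun _ => ℝ) 0 s)) (c : Fin q) :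
    fderiv ℝ (fun s : Fin q → ℝ => f (b.insertNth (α := fun _ => ℝ) 0 s)) s (Pi.single c 1) =
      fderiv ℝ f (b.insertNth (α := fun _ => ℝ) 0 s) (Pi.single (b.succAbove c) 1) := by
  have hL : HasFDerivAt (fun s : Fin q → ℝ => b.insertNth (α := fun _ => ℝ) 0 s)
      (ContinuousLinearMap.pi fun i => b.insertNth (α := fun _ => (Fin q → ℝ) →L[ℝ] ℝ) 0
        (fun c => ContinuousLinearMap.proj c) i) s := by
    rw [hasFDerivAt_pi]
    intro i
    rcases Fin.eq_self_or_eq_succAbove b i with rfl | ⟨j, rfl⟩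
    · simpa using hasFDerivAt_const (0 : ℝ) s
    · simpa using hasFDerivAt_apply j s
  refine (congrArg (fun L : (Fin q → ℝ) →L[ℝ] E => L (Pi.single c 1))
    (HasFDerivAt.comp (g := f) s hf.hasFDerivAt hL).fderiv).trans ?_
  simp only [ContinuousLinearMap.comp_apply]
  congr 1
  funext i
  rcases Fin.eq_self_or_eq_succAbove b i with rfl | ⟨j, rfl⟩
  · simp [Fin.ne_succAbove]
  · simp [Pi.single_apply]

lemma fderiv_comp_slant {q : ℕ} {E : Type*} [NormedAddCommGroup E] [NormedSpace ℝ E]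
    {f : (Fin (q + 1) → ℝ) → E} {s : Fin q → ℝ}
    (hf : DifferentiableAt ℝ f (Fin.cons (1 - ∑ i, s i) s)) (c : Fin q) :
    fderiv ℝ (fun s : Fin q → ℝ => f (Fin.cons (1 - ∑ i, s i) s)) s (Pi.single c 1) =
      fderiv ℝ f (Fin.cons (1 - ∑ i, s i) s) (Pi.single c.succ 1) -
        fderiv ℝ f (Fin.cons (1 - ∑ i, s i) s) (Pi.single 0 1) := by
  have hL : HasFDerivAt (fun s : Fin q → ℝ => (Fin.cons (1 - ∑ i, s i) s : Fin (q + 1) → ℝ))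
      (ContinuousLinearMap.pi (Fin.cons (- ∑ i, ContinuousLinearMap.proj i)
        (fun c => ContinuousLinearMap.proj c) : Fin (q + 1) → (Fin q → ℝ) →L[ℝ] ℝ)) s := by
    rw [hasFDerivAt_pi]
    intro i
    refine Fin.cases ?_ (fun i => ?_) i
    · simpa using (HasFDerivAt.fun_sum (u := Finset.univ)
        (fun (i : Fin q) _ => hasFDerivAt_apply (𝕜 := ℝ) i s)).const_sub 1
    · simpa using hasFDerivAt_apply i s
  rw [← map_sub]
  refine (congrArg (fun L : (Fin q → ℝ) →L[ℝ] E => L (Pi.single c 1)) (HasFDerivAt.comp (g := f)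
    (f := fun s : Fin q → ℝ => (Fin.cons (1 - ∑ i, s i) s : Fin (q + 1) → ℝ)) s
      hf.hasFDerivAt hL).fderiv).trans ?_
  simp only [ContinuousLinearMap.comp_apply]
  congr 1
  funext i
  refine Fin.cases ?_ (fun i => ?_) i
  · simp
  · simp [Pi.single_apply]

variable {A : ∀ q : ℕ, Fin q → (Fin q → ℝ) → (Model d →L[ℝ] Model d)}

/-- The integral over the simplex of the wedge product of the differentials of `A ξ`. -/
def wedgeIntegral (A : ∀ q : ℕ, Fin q → (Fin q → ℝ) → (Model d →L[ℝ] Model d)) {q : ℕ}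
    (η : (Model d) [⋀^Fin q]→ₗ[ℝ] ℂ) (ξ : Fin q → Model d) : ℂ :=
  ∫ t in simplex q, wedgeForm η (fun c i => fderiv ℝ (fun t => A q i t (ξ i)) t (Pi.single c 1))

lemma altSum_eq_zero_of_swap {L ι : Type*} [Fintype ι] [DecidableEq ι] {F : (ι → L) → ℂ} {i j : ι}
    (hij : i ≠ j) (h : ∀ x, F (fun a => x (Equiv.swap i j a)) = F x) (ξ : ι → L) :
    altSum F ξ = 0 := by
  have := altSum_smul_swap (F := F) (F' := F) hij (fun x => (h x).symm) ξ
  linear_combination (1 / 2 : ℂ) * this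

lemma IsSimplexFamily.contDiffAt (hA : IsSimplexFamily A) {q : ℕ} (ξ : Fin q → Model d)
    (i : Fin q) {t : Fin q → ℝ} (ht : t ∈ simplex q) :
    ContDiffAt ℝ ∞ (fun t => A q i t (ξ i)) t :=
  (hA.smooth q i t ht).clm_apply contDiffAt_const

lemma insertNth_zero_mem_simplex {q : ℕ} (b : Fin (q + 1)) {s : Fin q → ℝ} (hs : s ∈ simplex q) :
    b.insertNth (α := fun _ => ℝ) 0 s ∈ simplex (q + 1) :=
  (insertNth_mem_simplex b 0 s).2 ⟨hs, le_rfl, by linarith [hs.2]⟩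

lemma cons_mem_simplex {q : ℕ} {s : Fin q → ℝ} (hs : s ∈ simplex q) :
    (Fin.cons (1 - ∑ i, s i) s : Fin (q + 1) → ℝ) ∈ simplex (q + 1) := by
  have := (insertNth_mem_simplex 0 (1 - ∑ i, s i) s).2 ⟨hs, by linarith [hs.2], le_rfl⟩
  simpa using this

lemma fderiv_tangential_eq {q : ℕ} {E : Type*} [NormedAddCommGroup E] [NormedSpace ℝ E]
    {f g : (Fin (q + 1) → ℝ) → E} (b : Fin (q + 1)) {s : Fin q → ℝ}
    (hs : s ∈ interior (simplex q))
    (hf : DifferentiableAt ℝ f (b.insertNth (α := fun _ => ℝ) 0 s))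
    (hg : DifferentiableAt ℝ g (b.insertNth (α := fun _ => ℝ) 0 s))
    (h : ∀ s ∈ simplex q, f (b.insertNth (α := fun _ => ℝ) 0 s) =
      g (b.insertNth (α := fun _ => ℝ) 0 s)) (c : Fin q) :
    fderiv ℝ f (b.insertNth (α := fun _ => ℝ) 0 s) (Pi.single (b.succAbove c) 1) =
      fderiv ℝ g (b.insertNth (α := fun _ => ℝ) 0 s) (Pi.single (b.succAbove c) 1) := by
  rw [← fderiv_comp_insertNth b hf, ← fderiv_comp_insertNth b hg]
  congr 1
  refine Filter.EventuallyEq.fderiv_eq ?_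
  filter_upwards [isOpen_interior.mem_nhds hs] with s' hs'
  exact h s' (interior_subset hs')

/-- On this face the last operator is zero, and so are its tangential derivatives; the flux through
the face involves no normal derivative. -/
lemma IsSimplexFamily.flux_last (hA : IsSimplexFamily A) {q : ℕ}
    (η : (Model d) [⋀^Fin (q + 1)]→ₗ[ℝ] ℂ) (ξ : Fin (q + 1) → Model d) {s : Fin q → ℝ}
    (hs : s ∈ interior (simplex q)) :
    flux η (fun i t => A (q + 1) i t (ξ i)) (Fin.last q)
      ((Fin.last q).insertNth (α := fun _ => ℝ) 0 s) = 0 := by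
  have hs' := interior_subset hs
  unfold flux
  rw [wedgeForm_apply]
  refine Finset.sum_eq_zero fun π _ => η.map_coord_zero (π.symm (Fin.last q)) ?_
  rw [Equiv.apply_symm_apply]
  rcases Fin.eq_self_or_eq_succAbove (Fin.last q) (π.symm (Fin.last q)) with h | ⟨c, hc⟩
  · rw [h, Function.update_self]
    change A (q + 1) (Fin.last q) ((Fin.last q).insertNth (α := fun _ => ℝ) 0 s) _ = 0
    rw [hA.face_last q s hs']
    simp
  · rw [hc, Function.update_of_ne (Fin.succAbove_ne _ _)]
    rw [fderiv_tangential_eq (g := fun _ => 0) (Fin.last q) hs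
      ((hA.contDiffAt ξ _ (insertNth_zero_mem_simplex _ hs')).differentiableAt (by simp))
      (by fun_prop) (fun s hs => by rw [hA.face_last q s hs]; simp)]
    simp

/-- On this face two neighbouring arguments enter through the same operator, as does the tangential
derivative. The flux is therefore symmetric in them, and skew-symmetrisation will kill it. -/
lemma IsSimplexFamily.flux_castSucc (hA : IsSimplexFamily A) {q : ℕ}
    (η : (Model d) [⋀^Fin (q + 1)]→ₗ[ℝ] ℂ) (ξ : Fin (q + 1) → Model d) {s : Fin q → ℝ}
    (hs : s ∈ interior (simplex q)) (j : Fin q) :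
    flux η (fun i t => A (q + 1) i t (ξ (Equiv.swap j.castSucc j.succ i))) j.castSucc
      (j.castSucc.insertNth (α := fun _ => ℝ) 0 s) =
    flux η (fun i t => A (q + 1) i t (ξ i)) j.castSucc
      (j.castSucc.insertNth (α := fun _ => ℝ) 0 s) := by
  have hs' := interior_subset hs
  set sw := Equiv.swap j.castSucc j.succ
  have hsw : ∀ i, ∀ s ∈ simplex q, A (q + 1) i (j.castSucc.insertNth (α := fun _ => ℝ) 0 s) =
      A (q + 1) (sw i) (j.castSucc.insertNth (α := fun _ => ℝ) 0 s) := by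
    intro i s hs
    rcases eq_or_ne i j.castSucc with rfl | h1
    · simp only [sw, Equiv.swap_apply_left]
      exact hA.face_castSucc q s hs j
    · rcases eq_or_ne i j.succ with rfl | h2
      · simp only [sw, Equiv.swap_apply_right]
        exact (hA.face_castSucc q s hs j).symm
      · simp only [sw, Equiv.swap_apply_of_ne_of_ne h1 h2]
  unfold flux
  rw [wedgeForm_apply, wedgeForm_apply]
  refine Fintype.sum_equiv (Equiv.mulLeft sw) _ _ fun π => ?_
  congr 1
  funext c
  simp only [Equiv.coe_mulLeft, Equiv.Perm.mul_apply]
  rcases Fin.eq_self_or_eq_succAbove j.castSucc c with rfl | ⟨c, rfl⟩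
  · rw [Function.update_self, Function.update_self, hsw _ s hs']
  · rw [Function.update_of_ne (Fin.succAbove_ne _ _), Function.update_of_ne (Fin.succAbove_ne _ _)]
    refine fderiv_tangential_eq j.castSucc hs ?_ ?_ (fun s hs => by rw [hsw _ s hs]) c
    · exact ((hA.contDiffAt (fun i => ξ (sw i)) _
        (insertNth_zero_mem_simplex _ hs')).differentiableAt (by simp))
    · exact ((hA.contDiffAt ξ _ (insertNth_zero_mem_simplex _ hs')).differentiableAt (by simp))

/-- On the slanted face the first operator is the identity and the others form the family one
dimension lower. The first argument is thus undifferentiated, and the others give the lower wedge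
product. -/
lemma IsSimplexFamily.sum_flux_slant (hA : IsSimplexFamily A) {q : ℕ}
    (η : (Model d) [⋀^Fin (q + 1)]→ₗ[ℝ] ℂ) (ξ : Fin (q + 1) → Model d) {s : Fin q → ℝ}
    (hs : s ∈ interior (simplex q)) :
    ∑ b, flux η (fun i t => A (q + 1) i t (ξ i)) b (Fin.cons (1 - ∑ i, s i) s) =
      wedgeForm (η.curryLeft (ξ 0)) (fun c i =>
        fderiv ℝ (fun t => A q i t (Fin.tail ξ i)) s (Pi.single c 1)) := by
  have hs' := interior_subset hs
  have hev : ∀ᶠ s in 𝓝 s, s ∈ simplex q := by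
    filter_upwards [isOpen_interior.mem_nhds hs] with s' hs' using interior_subset hs'
  have hT : ∀ (c : Fin q) (i : Fin (q + 1)),
      fderiv ℝ (fun t => A (q + 1) i t (ξ i)) (Fin.cons (1 - ∑ i, s i) s) (Pi.single c.succ 1) -
      fderiv ℝ (fun t => A (q + 1) i t (ξ i)) (Fin.cons (1 - ∑ i, s i) s) (Pi.single 0 1) =
      (Fin.cons 0 (fun i => fderiv ℝ (fun t => A q i t (Fin.tail ξ i)) s (Pi.single c 1)) :
        Fin (q + 1) → Model d) i := by
    intro c i
    rw [← fderiv_comp_slant ((hA.contDiffAt ξ i (cons_mem_simplex hs')).differentiableAt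
      (by simp)) c]
    refine Fin.cases ?_ (fun i => ?_) i
    · have : (fun s : Fin q → ℝ => A (q + 1) 0 (Fin.cons (1 - ∑ i, s i) s) (ξ 0)) =ᶠ[𝓝 s]
          fun _ => ξ 0 := by
        filter_upwards [hev] with s hs
        rw [hA.face_zero_zero q s hs]; rfl
      rw [this.fderiv_eq]
      simp
    · have : (fun s : Fin q → ℝ => A (q + 1) i.succ (Fin.cons (1 - ∑ i, s i) s) (ξ i.succ)) =ᶠ[𝓝 s]
          fun s => A q i s (Fin.tail ξ i) := by
        filter_upwards [hev] with s hs
        rw [hA.face_zero_succ q s hs]; rfl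
      rw [this.fderiv_eq]
      simp
  unfold flux
  rw [AlternatingMap.sum_update_eq, wedgeForm_apply, wedgeForm_apply,
    ← Equiv.Perm.decomposeFin.symm.sum_comp, Fintype.sum_prod_type, Fin.sum_univ_succ]
  rw [add_eq_left.2]
  · refine Finset.sum_congr rfl fun e _ => ?_
    rw [AlternatingMap.curryLeft_apply_apply]
    congr 1
    funext c
    refine Fin.cases ?_ (fun c => ?_) c
    · simp only [Fin.cons_zero, Equiv.Perm.decomposeFin_symm_apply_zero, Matrix.cons_val_zero]
      rw [hA.face_zero_zero q s hs']; rfl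
    · have := hT c (e c).succ
      simp only [Fin.cons_succ] at this
      simp only [Fin.cons_succ, Equiv.Perm.decomposeFin_symm_apply_succ, Equiv.swap_self,
        Equiv.refl_apply, Pi.sub_apply, Matrix.cons_val_succ]
      exact this
  -- When `π 0 ≠ 0`, the first argument is differentiated along the face, where its operator is
  -- constant.
  · refine Finset.sum_eq_zero fun p _ => Finset.sum_eq_zero fun e _ => ?_
    set π := Equiv.Perm.decomposeFin.symm (p.succ, e) with hπ
    refine η.map_coord_zero (π.symm 0) ?_
    rw [Equiv.apply_symm_apply]
    have h0 : π.symm 0 ≠ 0 := fun h => by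
      have h1 : π 0 = 0 := by rw [← h, Equiv.apply_symm_apply, h]
      rw [hπ, Equiv.Perm.decomposeFin_symm_apply_zero] at h1
      exact Fin.succ_ne_zero p h1
    obtain ⟨c, hc⟩ := Fin.exists_succ_eq.2 h0
    rw [← hc]
    have := hT c 0
    simp only [Fin.cons_zero] at this
    simpa using this

/-- Stokes' theorem for the differentials of a family of local simplices. -/
theorem IsSimplexFamily.altSum_wedgeIntegral (hA : IsSimplexFamily A) {q : ℕ}
    (η : (Model d) [⋀^Fin q]→ₗ[ℝ] ℂ) (ξ : Fin q → Model d) :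
    altSum (wedgeIntegral A η) ξ = η ξ := by
  induction q with
  | zero =>
    have : simplex 0 = Set.univ := by ext t; simp [simplex]
    simp only [altSum, wedgeIntegral, wedgeForm_apply, this]
    simp [Measure.volume_pi_eq_dirac (fun i : Fin 0 => i.elim0)]
    exact congrArg η (Subsingleton.elim _ _)
  | succ q ih =>
    -- Divergence theorem for the flux: the slanted face gives the integral in dimension `q` with
    -- the first argument contracted, and the coordinate faces remain as corrections.
    have hfl : ∀ x : Fin (q + 1) → Model d, ((q : ℂ) + 1) * wedgeIntegral A η x =
        wedgeIntegral A (η.curryLeft (x 0)) (Fin.tail x) - ∑ b : Fin (q + 1),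
          ∫ s in simplex q, flux η (fun i t => A (q + 1) i t (x i)) b
            (b.insertNth (α := fun _ => ℝ) 0 s) := by
      intro x
      have h1 := integral_simplex_divergence (F := flux η (fun i t => A (q + 1) i t (x i)))
        (fun b t ht => contDiffAt_flux (fun i => hA.contDiffAt x i ht) b)
      rw [setIntegral_simplex_congr (fun s hs => hA.sum_flux_slant η x hs)] at h1
      rw [setIntegral_congr_fun (isClosed_simplex _).measurableSet
        (fun t ht => sum_fderiv_flux (η := η) (fun i => hA.contDiffAt x i ht)),
        MeasureTheory.integral_const_mul] at h1
      push_cast at h1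
      exact h1
    have hface : ∀ b : Fin (q + 1), altSum (fun x : Fin (q + 1) → Model d =>
        ∫ s in simplex q, flux η (fun i t => A (q + 1) i t (x i)) b
            (b.insertNth (α := fun _ => ℝ) 0 s)) ξ = 0 := by
      intro b
      induction b using Fin.lastCases with
      | last =>
        have : ∀ x : Fin (q + 1) → Model d, ∫ s in simplex q,
            flux η (fun i t => A (q + 1) i t (x i)) (Fin.last q)
            ((Fin.last q).insertNth (α := fun _ => ℝ) 0 s) = 0 := fun x => by
          rw [setIntegral_simplex_congr (fun s hs => hA.flux_last η x hs)]
          simp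
        exact (congrArg (fun F => altSum F ξ) (funext this)).trans (by simp [altSum])
      | cast j =>
        refine altSum_eq_zero_of_swap (i := j.castSucc) (j := j.succ)
          (by simp [Fin.ext_iff]) (fun x => ?_) ξ
        exact setIntegral_simplex_congr (fun s hs => hA.flux_castSucc η x hs j)
    -- By induction, skew-symmetrising over the permutations that fix `0` already gives `η`. The
    -- full skew-symmetrisation therefore counts each contribution `q!` times, against the factor
    -- `(q + 1)!` for the alternating form `η`.
    have hK : (Nat.factorial q : ℂ) * altSum (fun x : Fin (q + 1) → Model d =>
        wedgeIntegral A (η.curryLeft (x 0)) (Fin.tail x)) ξ =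
        (Nat.factorial (q + 1) : ℂ) * η ξ := by
      set K := fun x : Fin (q + 1) → Model d => wedgeIntegral A (η.curryLeft (x 0)) (Fin.tail x)
        with hKdef
      have h1 : ∀ x, ∑ e : Equiv.Perm (Fin q), ((Equiv.Perm.sign e : ℤ) : ℂ) *
          K (fun i => x (Equiv.Perm.decomposeFin.symm (0, e) i)) = η x := by
        intro x
        have := ih (η.curryLeft (x 0)) (Fin.tail x)
        rw [AlternatingMap.curryLeft_apply_apply] at this
        have hc : (Matrix.vecCons (x 0) (Fin.tail x) : Fin (q + 1) → Model d) = x :=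
          Fin.cons_self_tail x
        rw [hc] at this
        rw [← this]
        refine Finset.sum_congr rfl fun e _ => ?_
        congr 1
      have h2 : altSum (fun x => η x) ξ = (Nat.factorial (q + 1) : ℂ) * η ξ := by
        simpa using altSum_of_alternating (fun x => η x) ξ (fun τ => by
          have := η.map_perm ξ τ
          rw [units_smul_complex] at this
          exact this)
      rw [← h2]
      simp only [← h1]
      rw [altSum_sum]
      have h3 : ∀ e : Equiv.Perm (Fin q), altSum (fun x => ((Equiv.Perm.sign e : ℤ) : ℂ) *
          K (fun i => x (Equiv.Perm.decomposeFin.symm (0, e) i))) ξ = altSum K ξ := by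
        intro e
        rw [altSum_const_mul, altSum_comp, Equiv.Perm.decomposeFin.symm_sign, ← mul_assoc]
        simp [sign_mul_self]
      simp only [h3]
      simp [Fintype.card_perm]
    have hq : ((q : ℂ) + 1) ≠ 0 := by exact_mod_cast Nat.succ_ne_zero q
    have hqf : (Nat.factorial q : ℂ) ≠ 0 := by exact_mod_cast Nat.factorial_ne_zero q
    have h4 : ((q : ℂ) + 1) * altSum (wedgeIntegral A η) ξ = altSum (fun x : Fin (q + 1) → Model d =>
        wedgeIntegral A (η.curryLeft (x 0)) (Fin.tail x)) ξ := by
      rw [← altSum_const_mul]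
      simp only [hfl, sub_eq_add_neg]
      rw [altSum_add, altSum_neg, altSum_sum, Finset.sum_eq_zero fun b _ => hface b]
      simp
    rw [Nat.factorial_succ] at hK
    push_cast at hK
    rw [← h4] at hK
    have : (Nat.factorial q : ℂ) * ((q : ℂ) + 1) ≠ 0 := mul_ne_zero hqf hq
    apply mul_left_cancel₀ this
    linear_combination hK

end SimplexFamily

/-! ### The adjoint representation of the Lie algebra -/

section Adjoint

/-- The derivative of conjugation in terms of the second derivative of the multiplication. -/
lemma fderiv_fderiv_conj {V : Type*} [NormedAddCommGroup V] [NormedSpace ℝ V]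
    {m c : V × V → V} {e : V} (hm : ContDiffAt ℝ ∞ m (e, e)) (hc : ContDiffAt ℝ ∞ c (e, e))
    (hce : ∀ᶠ y in 𝓝 e, c (y, e) = e) (hme : ∀ᶠ x in 𝓝 e, m (x, e) = x)
    (hem : (fun x => m (e, x)) =ᶠ[𝓝 e] fun x => x)
    (hmc : ∀ᶠ z in 𝓝 (e, e), m (c z, z.1) = m z) (v w : V) :
    fderiv ℝ (fun y => fderiv ℝ (fun x => c (y, x)) e v) e w =
      fderiv ℝ (fun y => fderiv ℝ (fun x => m (y, x)) e v) e w -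
        fderiv ℝ (fun y => fderiv ℝ (fun x => m (y, x)) e w) e v := by
  have hpair : ContinuousAt (fun y : V => (y, e)) e := by fun_prop
  have hpair' : ContinuousAt (fun y : V => (e, y)) e := by fun_prop
  have hmd : ∀ᶠ z in 𝓝 (e, e), DifferentiableAt ℝ m z :=
    ((hm.of_le (m := 1) (by simp)).eventually (by simp)).mono
      fun z hz => hz.differentiableAt (by simp)
  have hcd : ∀ᶠ z in 𝓝 (e, e), DifferentiableAt ℝ c z :=
    ((hc.of_le (m := 1) (by simp)).eventually (by simp)).mono
      fun z hz => hz.differentiableAt (by simp)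
  have hpart : ∀ (f : V × V → V) (y : V), DifferentiableAt ℝ f (y, e) → ∀ v,
      fderiv ℝ (fun x => f (y, x)) e v = fderiv ℝ f (y, e) (0, v) := by
    intro f y hf v
    have h := HasFDerivAt.comp (g := f) (f := fun x : V => (y, x)) e hf.hasFDerivAt
      ((hasFDerivAt_const y e).prodMk (hasFDerivAt_id e))
    exact congrArg (fun L : V →L[ℝ] V => L v) h.fderiv
  have hA : ContDiffAt ℝ ∞ (fun y => fderiv ℝ (fun x => c (y, x)) e v) e :=
    ContDiffAt.clm_apply (ContDiffAt.fderiv (n := ∞) (g := fun _ => e)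
      (f := fun y x => c (y, x)) hc contDiffAt_const (by simp)) contDiffAt_const
  have hDm : DifferentiableAt ℝ (fderiv ℝ m) (e, e) :=
    (hm.fderiv_right (m := ∞) (by simp)).differentiableAt (by simp)
  have hid : ∀ u, fderiv ℝ m (e, e) (u, 0) = u := by
    intro u
    have h := HasFDerivAt.comp (g := m) (f := fun x : V => (x, e)) e
      (hm.differentiableAt (by simp)).hasFDerivAt ((hasFDerivAt_id e).prodMk (hasFDerivAt_const e e))
    have h2 : HasFDerivAt (fun x => m (x, e)) (ContinuousLinearMap.id ℝ V) e :=
      (hasFDerivAt_id e).congr_of_eventuallyEq hme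
    exact congrArg (fun L : V →L[ℝ] V => L u) (h.unique h2)
  have hsec : ∀ u w, fderiv ℝ (fun y => fderiv ℝ (fun x => m (y, x)) e u) e w =
      fderiv ℝ (fderiv ℝ m) (e, e) (w, 0) (0, u) := by
    intro u w
    have h1 : (fun y => fderiv ℝ (fun x => m (y, x)) e u) =ᶠ[𝓝 e]
        fun y => fderiv ℝ m (y, e) (0, u) := by
      filter_upwards [hpair.eventually hmd] with y hy using hpart m y hy u
    rw [h1.fderiv_eq]
    have h2 := (HasFDerivAt.comp (g := fderiv ℝ m) (f := fun x : V => (x, e)) e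
      hDm.hasFDerivAt ((hasFDerivAt_id e).prodMk (hasFDerivAt_const e e))).clm_apply
      (hasFDerivAt_const ((0 : V), u) e)
    exact (congrArg (fun L : V →L[ℝ] V => L w) h2.fderiv).trans (by simp)
  -- The relation c(y, x) · y = y · x is differentiated in x at e; differentiating the result in y
  -- expresses the derivative of conjugation by two mixed second derivatives of the product.
  have key : (fun y => fderiv ℝ m (e, y) (fderiv ℝ (fun x => c (y, x)) e v, 0)) =ᶠ[𝓝 e]
      fun y => fderiv ℝ (fun x => m (y, x)) e v := by
    filter_upwards [hpair.eventually hcd, hpair'.eventually hmd, hce,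
      hpair.eventually hmc.eventually_nhds] with y h1 h2 h3 h4
    have h5 : (fun x => m (c (y, x), y)) =ᶠ[𝓝 e] fun x => m (y, x) := by
      have : ContinuousAt (fun x : V => (y, x)) e := by fun_prop
      exact this.eventually h4
    rw [← h5.fderiv_eq]
    have h6 : DifferentiableAt ℝ (fun x => c (y, x)) e :=
      DifferentiableAt.comp (g := c) e h1 (by fun_prop)
    have h7 := HasFDerivAt.comp (g := m) (f := fun x : V => (c (y, x), y)) e
      (by simp only [h3]; exact h2.hasFDerivAt) (h6.hasFDerivAt.prodMk (hasFDerivAt_const y e))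
    exact ((congrArg (fun L : V →L[ℝ] V => L v) h7.fderiv).trans (by simp)).symm
  have h8 := congrArg (fun L : V →L[ℝ] V => L w) key.fderiv_eq
  have h9 := (HasFDerivAt.comp (g := fderiv ℝ m) (f := fun x : V => (e, x)) e
      hDm.hasFDerivAt ((hasFDerivAt_const e e).prodMk (hasFDerivAt_id e))).clm_apply
      ((hA.differentiableAt (by simp)).hasFDerivAt.prodMk (hasFDerivAt_const (0 : V) e))
  have h10 := congrArg (fun L : V →L[ℝ] V => L w) h9.fderiv
  have hAe : fderiv ℝ (fun x => c (e, x)) e v = v := by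
    have h11 := key.self_of_nhds
    simp only at h11
    rw [hid, hem.fderiv_eq] at h11
    simpa using h11
  have hsymm : IsSymmSndFDerivAt ℝ m (e, e) := hm.isSymmSndFDerivAt
    (by rw [minSmoothness_of_isRCLikeNormedField]; exact WithTop.coe_le_coe.2 (le_top : (2 : ℕ∞) ≤ ⊤))
  rw [hsec, hsec]
  have h12 : fderiv ℝ (fderiv ℝ m) (e, e) (0, w) (v, 0) +
      fderiv ℝ (fun y => fderiv ℝ (fun x => c (y, x)) e v) e w =
      fderiv ℝ (fderiv ℝ m) (e, e) (w, 0) (0, v) := by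
    rw [← hsec, ← h8]
    refine Eq.trans ?_ h10.symm
    simp [hAe, hid, add_comm]
  rw [← h12, hsymm.eq (v, 0) (0, w), add_sub_cancel_left]

variable {d : ℕ} {G : Type*} [TopologicalSpace G] [ChartedSpace (Model d) G] [Group G]
  [LieGroup (𝓡 d) ∞ G]

/-- The multiplication of `G` in the chart at the identity. -/
def chartMul (d : ℕ) (G : Type*) [TopologicalSpace G] [ChartedSpace (Model d) G] [Group G]
    (z : Model d × Model d) : Model d :=
  oneChart d G ((oneChart d G).symm z.1 * (oneChart d G).symm z.2)

lemma oneChart_symm_one : (oneChart d G).symm (oneChart d G 1) = 1 :=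
  (oneChart d G).left_inv one_mem_source

lemma contDiffAt_chartMul : ContDiffAt ℝ ∞ (chartMul d G) (oneChart d G 1, oneChart d G 1) := by
  have h1 : ContMDiffAt 𝓘(ℝ, Model d × Model d) (𝓡 d) ∞
      (fun y : Model d × Model d => (oneChart d G).symm y.1) (oneChart d G 1, oneChart d G 1) :=
    ContMDiffAt.comp (oneChart d G 1, oneChart d G 1) contMDiffAt_oneChart_symm
      contDiffAt_fst.contMDiffAt
  have h2 : ContMDiffAt 𝓘(ℝ, Model d × Model d) (𝓡 d) ∞
      (fun y : Model d × Model d => (oneChart d G).symm y.2) (oneChart d G 1, oneChart d G 1) :=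
    ContMDiffAt.comp (oneChart d G 1, oneChart d G 1) contMDiffAt_oneChart_symm
      contDiffAt_snd.contMDiffAt
  exact ContDiffAt.oneChart_comp (h1.mul h2) (by simp [oneChart_symm_one])

lemma eventually_oneChart_symm_mem {Y : Type*} [TopologicalSpace Y] {f : Y → G} {y : Y}
    (hf : ContinuousAt f y) (h : f y = 1) : ∀ᶠ y in 𝓝 y, f y ∈ (oneChart d G).source :=
  hf.eventually_mem (h ▸ (oneChart d G).open_source.mem_nhds one_mem_source)

lemma eventually_mem_target : ∀ᶠ x in 𝓝 (oneChart d G 1), x ∈ (oneChart d G).target :=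
  (oneChart d G).open_target.mem_nhds ((oneChart d G).map_source one_mem_source)

/-- A left-invariant field is the differential of left translation applied to a fixed vector, and
the chart at `1` acts as the identity on the tangent space at `1`. -/
lemma mpullbackWithin_mulInvariantVectorField (v : LieAlg d G) {y : Model d}
    (hy : y ∈ (oneChart d G).target) :
    (VectorField.mpullbackWithin 𝓘(ℝ, Model d) (𝓡 d) (extChartAt (𝓡 d) (1 : G)).symm
      (mulInvariantVectorField v) (Set.range (𝓡 d)) y : Model d) =
      fderiv ℝ (fun x => chartMul d G (y, x)) (oneChart d G 1) v := by
  have hyt : y ∈ (extChartAt (𝓡 d) (1 : G)).target := by simpa [oneChart, extChartAt] using hy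
  have hysrc : (oneChart d G).symm y ∈ (oneChart d G).source := (oneChart d G).map_target hy
  rw [VectorField.mpullbackWithin_apply,
    ContinuousLinearMap.inverse_eq (mfderivWithin_extChartAt_symm_comp_mfderiv_extChartAt hyt)
      (mfderiv_extChartAt_comp_mfderivWithin_extChartAt_symm hyt)]
  set g : G := (oneChart d G).symm y
  let D1 : Model d →L[ℝ] Model d :=
    mfderiv 𝓘(ℝ, Model d) (𝓡 d) (oneChart d G).symm (oneChart d G 1)
  let D2 : Model d →L[ℝ] Model d := mfderiv (𝓡 d) (𝓡 d) (fun h : G => g * h) 1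
  let D3 : Model d →L[ℝ] Model d := mfderiv (𝓡 d) 𝓘(ℝ, Model d) (extChartAt (𝓡 d) (1 : G)) g
  have hmd : MDifferentiableAt 𝓘(ℝ, Model d) (𝓡 d) (oneChart d G).symm (oneChart d G 1) :=
    contMDiffAt_oneChart_symm.mdifferentiableAt (by simp)
  have h1 : HasMFDerivAt 𝓘(ℝ, Model d) (𝓡 d) (oneChart d G).symm (oneChart d G 1) D1 :=
    hmd.hasMFDerivAt
  have h2 : ∀ x : G, x = 1 → HasMFDerivAt (𝓡 d) (𝓡 d) (fun h : G => g * h) x D2 := by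
    rintro _ rfl
    exact ((contMDiff_mul_left (I := 𝓡 d) (n := ∞)).mdifferentiableAt (by simp)).hasMFDerivAt
  have h3 : ∀ x : G, x = g →
      HasMFDerivAt (𝓡 d) 𝓘(ℝ, Model d) (extChartAt (𝓡 d) (1 : G)) x D3 := by
    rintro _ rfl
    exact (mdifferentiableAt_extChartAt hysrc).hasMFDerivAt
  have h4 := (h3 _ ((congrArg (g * ·) oneChart_symm_one).trans (mul_one g))).comp (oneChart d G 1)
    ((h2 _ oneChart_symm_one).comp (oneChart d G 1) h1)
  have h5 : HasFDerivAt (fun x => chartMul d G (y, x)) (D3.comp (D2.comp D1)) (oneChart d G 1) :=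
    h4.hasFDerivAt
  have h6 : D1 v = v := by
    have h7 : (fun x => oneChart d G ((oneChart d G).symm x)) =ᶠ[𝓝 (oneChart d G 1)] fun x => x := by
      filter_upwards [eventually_mem_target] with x hx using (oneChart d G).right_inv hx
    refine (mfderiv_eq_fderiv_oneChart hmd oneChart_symm_one v).trans ?_
    rw [h7.fderiv_eq]
    simp; rfl
  rw [h5.fderiv]
  change D3 (D2 v) = D3 (D2 (D1 v))
  rw [h6]

lemma bracket_eq (v w : LieAlg d G) : (⁅v, w⁆ : LieAlg d G) =
    fderiv ℝ (fun y => fderiv ℝ (fun x => chartMul d G (y, x)) (oneChart d G 1) w)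
      (oneChart d G 1) v -
    fderiv ℝ (fun y => fderiv ℝ (fun x => chartMul d G (y, x)) (oneChart d G 1) v)
      (oneChart d G 1) w := by
  have hV : ∀ v : LieAlg d G, (fun y => (VectorField.mpullbackWithin 𝓘(ℝ, Model d) (𝓡 d)
      (extChartAt (𝓡 d) (1 : G)).symm (mulInvariantVectorField v) (Set.range (𝓡 d)) y : Model d))
      =ᶠ[𝓝 (oneChart d G 1)] fun y => fderiv ℝ (fun x => chartMul d G (y, x)) (oneChart d G 1) v := by
    intro v
    filter_upwards [eventually_mem_target] with y h1
    exact mpullbackWithin_mulInvariantVectorField v h1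
  have h1 : ∀ v : LieAlg d G, fderiv ℝ (fun x => chartMul d G (oneChart d G 1, x)) (oneChart d G 1) v
      = v := by
    intro v
    have : (fun x => chartMul d G (oneChart d G 1, x)) =ᶠ[𝓝 (oneChart d G 1)] fun x => x := by
      filter_upwards [eventually_mem_target] with x hx
      simp [chartMul, oneChart_symm_one, (oneChart d G).right_inv hx]
    rw [this.fderiv_eq]
    simp; rfl
  rw [GroupLieAlgebra.bracket_def, VectorField.mlieBracket, VectorField.mlieBracketWithin_apply,
    mfderiv_extChartAt_self]
  refine (congrArg (fun L : Model d →L[ℝ] Model d => L _) ContinuousLinearMap.inverse_id).trans ?_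
  have h2 : (extChartAt (𝓡 d) (1 : G)).symm ⁻¹' Set.univ ∩ Set.range (𝓡 d) = Set.univ := by simp
  have h3 : extChartAt (𝓡 d) (1 : G) (1 : G) = oneChart d G 1 := by simp [oneChart, extChartAt]
  rw [h2, h3]
  refine ((hV v).lieBracketWithin_vectorField_eq_nhds (hV w)).trans ?_
  rw [VectorField.lieBracketWithin_univ, VectorField.lieBracket_eq]
  simp only [h1]

/-- Conjugation of `G` in the chart at the identity. -/
def chartConj (d : ℕ) (G : Type*) [TopologicalSpace G] [ChartedSpace (Model d) G] [Group G]
    (z : Model d × Model d) : Model d :=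
  oneChart d G ((oneChart d G).symm z.1 * (oneChart d G).symm z.2 * ((oneChart d G).symm z.1)⁻¹)

/-- Both sides are the antisymmetrised mixed second derivative of the multiplication: the left one
by differentiating conjugation, the right one as the bracket of left-invariant fields. -/
lemma fderiv_Ad (v w : LieAlg d G) :
    fderiv ℝ (fun y => (Ad ((oneChart d G).symm y) v : Model d)) (oneChart d G 1) w =
      (⁅w, v⁆ : LieAlg d G) := by
  have h1 : ContMDiffAt 𝓘(ℝ, Model d × Model d) (𝓡 d) ∞
      (fun y : Model d × Model d => (oneChart d G).symm y.1) (oneChart d G 1, oneChart d G 1) :=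
    ContMDiffAt.comp (oneChart d G 1, oneChart d G 1) contMDiffAt_oneChart_symm
      contDiffAt_fst.contMDiffAt
  have h2 : ContMDiffAt 𝓘(ℝ, Model d × Model d) (𝓡 d) ∞
      (fun y : Model d × Model d => (oneChart d G).symm y.2) (oneChart d G 1, oneChart d G 1) :=
    ContMDiffAt.comp (oneChart d G 1, oneChart d G 1) contMDiffAt_oneChart_symm
      contDiffAt_snd.contMDiffAt
  have h3 : ContMDiffAt 𝓘(ℝ, Model d × Model d) (𝓡 d) ∞ (fun z : Model d × Model d =>
      (oneChart d G).symm z.1 * (oneChart d G).symm z.2 * ((oneChart d G).symm z.1)⁻¹)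
      (oneChart d G 1, oneChart d G 1) := (h1.mul h2).mul h1.inv
  have hone : (oneChart d G).symm (oneChart d G 1) * (oneChart d G).symm (oneChart d G 1) *
      ((oneChart d G).symm (oneChart d G 1))⁻¹ = 1 := by simp [oneChart_symm_one]
  simp only [Ad_eq]
  rw [bracket_eq]
  refine fderiv_fderiv_conj (c := chartConj d G) contDiffAt_chartMul
    (ContDiffAt.oneChart_comp h3 hone) ?_ ?_ ?_ ?_ v w
  · refine Filter.Eventually.of_forall fun y => ?_
    simp [chartConj, oneChart_symm_one]
  · filter_upwards [eventually_mem_target] with x hx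
    simp [chartMul, oneChart_symm_one, (oneChart d G).right_inv hx]
  · filter_upwards [eventually_mem_target] with x hx
    simp [chartMul, oneChart_symm_one, (oneChart d G).right_inv hx]
  · filter_upwards [eventually_oneChart_symm_mem (d := d) h3.continuousAt hone] with z hz
    simp [chartMul, chartConj, (oneChart d G).left_inv hz]

/-- The infinitesimal form of the invariance of a polynomial. -/
lemma IsInvariantPolynomial.sum_update_bracket {p : ℕ}
    {P : MultilinearMap ℝ (fun _ : Fin p => LieAlg d G) ℂ} (hP : IsInvariantPolynomial P)
    (u : Fin p → LieAlg d G) (z : LieAlg d G) : ∑ s, P (Function.update u s ⁅u s, z⁆) = 0 := by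
  let g : Fin p → Model d → Model d := fun s y => (Ad ((oneChart d G).symm y) (u s) : Model d)
  have hsm : ∀ s, DifferentiableAt ℝ (g s) (oneChart d G 1) := fun s =>
    (contDiffAt_Ad (v := fun _ => u s) contMDiffAt_oneChart_symm
      (contDiffAt_const (F := Model d))).differentiableAt (by simp)
  have h1 := HasFDerivAt.multilinear_comp (f := toCMM P) (g := g) fun s => (hsm s).hasFDerivAt
  have h2 : HasFDerivAt (fun y : Model d => toCMM P (fun s => g s y))
      (0 : Model d →L[ℝ] ℂ) (oneChart d G 1) :=
    (hasFDerivAt_const (P u) _).congr_of_eventuallyEq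
      (Filter.Eventually.of_forall fun y => hP.2 _ u)
  have h4 : (fun s => g s (oneChart d G 1)) = u := funext fun s => by
    simp only [g, oneChart_symm_one]
    exact Ad_one (u s)
  have h5 : ∀ s, fderiv ℝ (g s) (oneChart d G 1) z = (⁅z, u s⁆ : LieAlg d G) := fun s =>
    fderiv_Ad (u s) z
  have h3 : ∑ s, P (Function.update u s ⁅z, u s⁆) = 0 := by
    refine Eq.trans ?_ (congrArg (fun L : Model d →L[ℝ] ℂ => L (z : Model d)) (h1.unique h2))
    refine Eq.trans ?_ (_root_.sum_apply _ _ _).symm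
    refine Finset.sum_congr rfl fun s _ => ?_
    change _ = P (Function.update (fun s => g s (oneChart d G 1)) s
      (fderiv ℝ (g s) (oneChart d G 1) z))
    rw [h4, h5]
  have h6 : ∀ s, P (Function.update u s ⁅u s, z⁆) = - P (Function.update u s ⁅z, u s⁆) := fun s => by
    rw [← lie_skew, P.map_update_neg]
  simp only [h6, Finset.sum_neg_distrib, neg_eq_zero]
  exact h3

end Adjoint

/-! ### The constant in the case of loop groups -/

section KacMoody

lemma integral_simplex_zero (f : (Fin 0 → ℝ) → ℂ) : ∫ s in simplex 0, f s = f default := by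
  have h : simplex 0 = Set.univ := by ext t; simp [simplex]
  rw [h, Measure.restrict_univ, Measure.volume_pi_eq_dirac (fun i : Fin 0 => i.elim0),
    integral_dirac]
  exact congrArg f (Subsingleton.elim _ _)

lemma integral_simplex_two_const (c : ℂ) : ∫ _ in simplex 2, c = 1 / 2 * c := by
  rw [integral_simplex_succ 0 continuousOn_const]
  simp only [intervalIntegral.integral_const, sub_zero]
  rw [integral_simplex_succ 0 (by fun_prop), integral_simplex_zero]
  simp only [Fin.sum_univ_succ, Finset.univ_eq_empty, Finset.sum_empty, Fin.insertNth_zero,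
    Fin.cons_zero, add_zero, sub_zero]
  rw [intervalIntegral.integral_smul_const, intervalIntegral.integral_sub (by simp) (by simp)]
  norm_num

variable {d : ℕ} {G : Type*} [TopologicalSpace G] [ChartedSpace (Model d) G] [Group G]
  [LieGroup (𝓡 d) ∞ G]

lemma curvature_one_mixed {m : ℕ} (t : Fin m → ℝ) (v : Fin m → LieAlg d G) (j : Fin m) :
    curvature (fun _ => (1 : G)) t (v, 0) (0, Pi.single j 1) = - connForm (fun _ => (1 : G)) j v := by
  unfold curvature
  simp [connForm_zero, Pi.single_apply]

lemma curvature_one_simplex {m : ℕ} (t : Fin m → ℝ) (s s' : Fin m → ℝ) :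
    curvature (d := d) (fun _ => (1 : G)) t (0, s) (0, s') = 0 := by
  unfold curvature
  simp [connForm_zero]

/-- The first connection form vanishes on the last copy, so one pairing survives. Its factor `2` is
cancelled by the area `1/2` of the triangle, and the two signs from the order in each pair cancel
each other. -/
lemma bssForm_two (P : MultilinearMap ℝ (fun _ : Fin 2 => LieAlg d G) ℂ)
    (hP : ∀ (τ : Equiv.Perm (Fin 2)) (v : Fin 2 → LieAlg d G), P (fun i => v (τ i)) = P v)
    (h : 1 + 1 + (1 + 1) = 2 * 2) (ξ ζ : Fin 1 → LieAlg d G) :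
    bssForm P h (fun _ => (1 : G)) (unitVec ξ ζ) = P ![ξ 0, ζ 0] := by
  have h0 : bssVec h (unitVec ξ ζ) 0 = (Pi.single (Fin.last 1) (ξ 0), 0) := by
    refine (Fin.append_left _ _ (0 : Fin 2)).trans ?_
    rw [← unitVec_left ξ ζ]; rfl
  have h1 : bssVec h (unitVec ξ ζ) 1 = (Pi.single (Fin.castSucc 0) (ζ 0), 0) := by
    refine (Fin.append_left _ _ (1 : Fin 2)).trans ?_
    rw [← unitVec_right ξ ζ]; rfl
  have h2 : bssVec h (unitVec ξ ζ) 2 = (0, Pi.single 0 1) := Fin.append_right _ _ (0 : Fin 2)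
  have h3 : bssVec h (unitVec ξ ζ) 3 = (0, Pi.single 1 1) := Fin.append_right _ _ (1 : Fin 2)
  have key : ∀ t : Fin 2 → ℝ, chernWeil P (curvature (fun _ => (1 : G)) t) (bssVec h (unitVec ξ ζ)) =
      2 * P ![ξ 0, ζ 0] := by
    intro t
    rw [chernWeil_two P hP _ (fun x y => curvature_skew _ _ _ _), h0, h1, h2, h3]
    · rw [curvature_one_mixed, curvature_one_mixed, connForm_one_single, connForm_one_single]
      have : (![-ξ 0, -ζ 0] : Fin 2 → LieAlg d G) = fun i => (-1 : ℝ) • ![ξ 0, ζ 0] i := by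
        funext i
        fin_cases i <;> simp
      rw [if_pos (by decide), if_pos (by decide), this, P.map_smul_univ]
      simp
    · rw [h0, h2, curvature_one_mixed, connForm_one_single]
      simp
    · rw [h2, h3, curvature_one_simplex]
  rw [bssForm_eq]
  simp only [key]
  rw [integral_simplex_two_const]
  ring

end KacMoody

/-! ### The cocycle -/

section SlotsLinear

variable {r k : ℕ} {𝔤 L : Type*} [LieRing 𝔤] [LieAlgebra ℝ 𝔤] [AddCommGroup L] [Module ℝ L]

/-- Each argument enters exactly one slot, and linearly; hence the integral form is multilinear. -/
lemma slots_update (ev : L →ₗ[ℝ] 𝔤) (D : Fin k → L →ₗ[ℝ] 𝔤) (y : Arg r k → L) (a : Arg r k) :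
    ∃ (s : Slot r k) (T : L →ₗ[ℝ] 𝔤), ∀ z,
      slots ev (fun b => D b) (Function.update y a z) =
        Function.update (slots ev (fun b => D b) y) s (T z) := by
  rcases a with a | (i | i) | b
  · refine ⟨sU, ev, fun z => ?_⟩
    funext s; rcases s with s | s | s <;> simp [slots_unit, slots_bracket, slots_deriv]
  · refine ⟨sB i, (LieModule.toEnd ℝ 𝔤 𝔤).flip (ev (y (aR i))) ∘ₗ ev, fun z => ?_⟩
    funext s; rcases s with s | s | s <;>
      simp [slots_unit, slots_bracket, slots_deriv, Function.update_apply]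
    split_ifs with h <;> simp [h]
  · refine ⟨sB i, LieModule.toEnd ℝ 𝔤 𝔤 (ev (y (aL i))) ∘ₗ ev, fun z => ?_⟩
    funext s; rcases s with s | s | s <;>
      simp [slots_unit, slots_bracket, slots_deriv, Function.update_apply]
    split_ifs with h <;> simp [h]
  · refine ⟨sD b, D b, fun z => ?_⟩
    funext s; rcases s with s | s | s <;>
      simp [slots_unit, slots_bracket, slots_deriv, Function.update_apply]
    split_ifs with h <;> simp [h]

end SlotsLinear

section Cocycle

variable {d k r : ℕ} {G : Type*} [TopologicalSpace G] [ChartedSpace (Model d) G] [Group G]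
  [LieGroup (𝓡 d) ∞ G] {X : Type*} [TopologicalSpace X] [ChartedSpace (Model k) X]
  [IsManifold (𝓡 k) ∞ X]

/-- The value of a gauge algebra element at a point. -/
def evAt (x : X) : gaugeLieAlgebra d k G X →ₗ[ℝ] LieAlg d G where
  toFun ξ := (ξ : X → LieAlg d G) x
  map_add' _ _ := rfl
  map_smul' _ _ := rfl

lemma isSmooth_coe (ξ : gaugeLieAlgebra d k G X) : IsSmooth (k := k) (ξ : X → LieAlg d G) := ξ.2

/-- The differential of a gauge algebra element. -/
def diffAt (x : X) (v : TangentSpace (𝓡 k) x) : gaugeLieAlgebra d k G X →ₗ[ℝ] LieAlg d G where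
  toFun ξ := diff (ξ : X → LieAlg d G) x v
  map_add' ξ ζ := diff_add_map (isSmooth_coe ξ) (isSmooth_coe ζ) x v
  map_smul' c ξ := by
    have h : MDifferentiableAt (M' := Model d) (𝓡 k) 𝓘(ℝ, Model d) (ξ : X → LieAlg d G) x :=
      ContMDiff.mdifferentiableAt (M' := Model d) ξ.2 (by simp)
    exact congrArg (fun L : Model k →L[ℝ] Model d => L v) (const_smul_mfderiv (E' := Model d) h c)

lemma evAt_lie (x : X) (ξ ζ : gaugeLieAlgebra d k G X) : evAt x ⁅ξ, ζ⁆ = ⁅evAt x ξ, evAt x ζ⁆ := rfl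

lemma diffAt_lie (x : X) (v : TangentSpace (𝓡 k) x) (ξ ζ : gaugeLieAlgebra d k G X) :
    diffAt x v ⁅ξ, ζ⁆ = ⁅diffAt x v ξ, evAt x ζ⁆ + ⁅evAt x ξ, diffAt x v ζ⁆ := by
  let B := (bracketMap d G).toContinuousBilinearMap
  let ξ' : X → Model d := (ξ : X → LieAlg d G)
  let ζ' : X → Model d := (ζ : X → LieAlg d G)
  have h1 : HasMFDerivAt (𝓡 k) 𝓘(ℝ, Model d) ξ' x (mfderiv (𝓡 k) 𝓘(ℝ, Model d) ξ' x) :=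
    (ContMDiff.mdifferentiableAt (M' := Model d) ξ.2 (by simp)).hasMFDerivAt
  have h2 : HasMFDerivAt (𝓡 k) 𝓘(ℝ, Model d) ζ' x (mfderiv (𝓡 k) 𝓘(ℝ, Model d) ζ' x) :=
    (ContMDiff.mdifferentiableAt (M' := Model d) ζ.2 (by simp)).hasMFDerivAt
  have h3 := B.isBoundedBilinearMap.hasFDerivAt (ξ' x, ζ' x)
  have h4 := HasMFDerivAt.comp (I' := 𝓘(ℝ, Model d × Model d))
    (f := fun x => (ξ' x, ζ' x)) x h3.hasMFDerivAt
    ⟨h1.1.prodMk h2.1, h1.2.prodMk h2.2⟩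
  refine (congrArg (fun L : Model k →L[ℝ] Model d => L v) h4.mfderiv).trans ?_
  exact add_comm _ _

/-- The gauge algebra elements in the slots of the cocycle. -/
def gaugeArgs (y : Arg r k → gaugeLieAlgebra d k G X) : Slot r k → gaugeLieAlgebra d k G X :=
  slots id (fun _ => id) y

/-- The slots of the cocycle that hold a differential. -/
def baseRole (r k : ℕ) : Slot r k → Option (Fin k) :=
  Sum.elim (fun _ => none) (Sum.elim (fun _ => none) some)

variable (M : MultilinearMap ℝ (fun _ : Slot r k => LieAlg d G) ℂ)

/-- The form `M(x, [x, x], …, [x, x], dx, …, dx)`. -/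
def baseForm (y : Arg r k → gaugeLieAlgebra d k G X) (x : X) (w : Fin k → TangentSpace (𝓡 k) x) : ℂ :=
  slotForm M (baseRole r k) (fun s => (gaugeArgs y s : X → LieAlg d G)) x w

lemma baseForm_eq (y : Arg r k → gaugeLieAlgebra d k G X) (x : X)
    (w : Fin k → TangentSpace (𝓡 k) x) :
    baseForm M y x w = ∑ ρ : Equiv.Perm (Fin k), ((Equiv.Perm.sign ρ : ℤ) : ℂ) *
      M (slots (evAt x) (fun c => diffAt x (w (ρ c))) y) := by
  unfold baseForm slotForm
  refine Finset.sum_congr rfl fun ρ _ => ?_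
  congr 2
  funext s
  rcases s with s | s | s <;> rfl

/-- The form that arises from the derivative in one of the slots with a differential. -/
def baseFormZ (b : Fin k) (y : Option (Arg r k) → gaugeLieAlgebra d k G X) (x : X)
    (w : Fin k → TangentSpace (𝓡 k) x) : ℂ :=
  ∑ s ∈ Finset.univ.filter (fun s => Function.update (baseRole r k) (sD b) none s = none),
    slotForm M (Function.update (Function.update (baseRole r k) (sD b) none) s (some b))
      (fun s => (Function.update (gaugeArgs fun a => y (some a)) (sD b) ⁅y (some (aD b)), y none⁆ s :
        X → LieAlg d G)) x w

/-- The Leibniz rule for the pointwise bracket turns the derivative of each bracket slot into two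
terms, so the exact form is pointwise the algebraic expression whose skew-symmetrisation is known.
-/
lemma baseFormZ_eq (b : Fin k) (y : Option (Arg r k) → gaugeLieAlgebra d k G X) (x : X)
    (w : Fin k → TangentSpace (𝓡 k) x) :
    baseFormZ M b y x w = ∑ ρ : Equiv.Perm (Fin k), ((Equiv.Perm.sign ρ : ℤ) : ℂ) *
      slotsZ (evAt x) (fun c => diffAt x (w (ρ c))) M b y := by
  unfold baseFormZ slotForm
  rw [Finset.sum_comm]
  refine Finset.sum_congr rfl fun ρ _ => ?_
  rw [← Finset.mul_sum]
  congr 1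
  set role := Function.update (baseRole r k) (sD b) none with hrole
  set u := slotsB (evAt x) (fun c => diffAt x (w (ρ c))) b y with hu
  have key : ∀ s, role s = none → (fun t => (Function.update role s (some b) t).elim
      ((Function.update (gaugeArgs fun a => y (some a)) (sD b) ⁅y (some (aD b)), y none⁆ t :
        X → LieAlg d G) x)
      (fun c => diff (Function.update (gaugeArgs fun a => y (some a)) (sD b)
        ⁅y (some (aD b)), y none⁆ t : X → LieAlg d G) x (w (ρ c)))) =
      Function.update u s (diffAt x (w (ρ b)) (Function.update (gaugeArgs fun a => y (some a)) (sD b)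
        ⁅y (some (aD b)), y none⁆ s)) := by
    intro s hs
    funext t
    by_cases ht : t = s
    · subst ht
      simp only [Function.update_self, Option.elim]
      rfl
    · rw [Function.update_of_ne ht, Function.update_of_ne ht, hu, slotsB, hrole]
      by_cases htb : t = sD b
      · subst htb
        simp only [Function.update_self, Option.elim]
        rfl
      · simp only [Function.update_of_ne htb]
        rcases t with t | t | t <;> rfl
  rw [Finset.sum_congr rfl fun s hs => congrArg M (key s (by simpa using hs)), Finset.sum_filter,
    Fintype.sum_sum_type, Fintype.sum_sum_type]
  have h1 : ∀ i, role (sB i) = none := fun i => by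
    rw [hrole, Function.update_of_ne (by simp)]; rfl
  have h2 : role sU = none := by
    rw [hrole, Function.update_of_ne (by simp)]; rfl
  have h3 : ∀ c, role (sD c) = none ↔ c = b := fun c => by
    by_cases hc : c = b
    · subst hc; rw [hrole, Function.update_self]; simp
    · rw [hrole, Function.update_of_ne (by simpa using hc)]; simp [baseRole, hc]
  simp only [Finset.univ_unique, Finset.sum_singleton, PUnit.default_eq_unit, h1, h2, h3, if_true,
    Finset.sum_ite_eq', Finset.mem_univ]
  unfold slotsZ
  rw [add_assoc]
  congr 2
  · refine Finset.sum_congr rfl fun i _ => ?_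
    rw [Function.update_of_ne (by simp)]
    congr 2
    exact diffAt_lie x _ _ _
  · rw [Function.update_self, diffAt_lie]

lemma isContForm_baseForm (y : Arg r k → gaugeLieAlgebra d k G X) : IsContForm (baseForm M y) :=
  isContForm_slotForm M _ fun _ => isSmooth_coe _

lemma isContForm_sum {ι : Type*} (s : Finset ι) {α : ι → ∀ x : X, (Fin k → TangentSpace (𝓡 k) x) → ℂ}
    (hα : ∀ i, IsContForm (α i)) : IsContForm (fun x w => ∑ i ∈ s, α i x w) := fun x₀ =>
  continuousOn_finsetSum _ fun i _ => hα i x₀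

lemma isContForm_const_mul (c : ℂ) {α : ∀ x : X, (Fin k → TangentSpace (𝓡 k) x) → ℂ}
    (hα : IsContForm α) : IsContForm (fun x w => c * α x w) := fun x₀ =>
  continuousOn_const.mul (hα x₀)

lemma isContForm_baseFormZ (b : Fin k) (y : Option (Arg r k) → gaugeLieAlgebra d k G X) :
    IsContForm (baseFormZ M b y) :=
  isContForm_sum _ fun _ => isContForm_slotForm M _ fun _ => isSmooth_coe _

variable [T2Space X] [CompactSpace X] (o : Orient k X)

lemma update_baseRole_eq_some_iff (b : Fin k) (s : Slot r k) (c : Fin k) :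
    Function.update (baseRole r k) (sD b) none s = some c ↔ c ≠ b ∧ sD c = s := by
  by_cases hs : s = sD b
  · subst hs
    rw [Function.update_self]
    constructor
    · intro h; simp at h
    · rintro ⟨h1, h2⟩; exact absurd (by simpa using h2) h1
  · rw [Function.update_of_ne hs]
    rcases s with s | s | s
    · simp [baseRole]
    · simp [baseRole]
    · have : s ≠ b := by simpa using hs
      simp only [baseRole, Sum.elim_inr, Option.some.injEq, Sum.inr.injEq]
      constructor
      · rintro rfl; exact ⟨this, rfl⟩
      · rintro ⟨_, h⟩; exact h.symm

/-- Stokes' theorem: releasing the slot `b` from its differential and distributing the derivative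
over all undifferentiated slots produces an exact form. -/
lemma integral_baseFormZ (b : Fin k) (y : Option (Arg r k) → gaugeLieAlgebra d k G X) :
    integral o (baseFormZ M b y) = 0 := by
  unfold baseFormZ
  rw [integral_finset_sum' _ o fun _ => isContForm_slotForm M _ fun _ => isSmooth_coe _]
  exact sum_integral_slotForm_eq_zero o M (δ := fun c => sD c)
    (fun c c' h => by simpa using h) b (update_baseRole_eq_some_iff b) (fun _ => isSmooth_coe _)

lemma baseForm_update (y : Arg r k → gaugeLieAlgebra d k G X) (a : Arg r k) (x : X)
    (w : Fin k → TangentSpace (𝓡 k) x) : ∃ T : gaugeLieAlgebra d k G X →ₗ[ℝ] ℂ,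
      ∀ z, baseForm M (Function.update y a z) x w = T z := by
  choose s T hT using fun ρ : Equiv.Perm (Fin k) =>
    slots_update (evAt x) (fun c => diffAt x (w (ρ c))) y a
  refine ⟨∑ ρ : Equiv.Perm (Fin k), ((Equiv.Perm.sign ρ : ℤ) : ℂ) •
    (M.toLinearMap (slots (evAt x) (fun c => diffAt x (w (ρ c))) y) (s ρ) ∘ₗ T ρ), fun z => ?_⟩
  rw [baseForm_eq]
  simp [hT]

/-- The integral of `M(x, [x, x], …, [x, x], dx, …, dx)`. -/
def baseIntegral : MultilinearMap ℝ (fun _ : Arg r k => gaugeLieAlgebra d k G X) ℂ :=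
  MultilinearMap.mk' (fun y => integral o (baseForm M y))
    (fun y a z z' => by
      rw [← integral_add' o (isContForm_baseForm M _) (isContForm_baseForm M _)]
      refine integral_congr' o fun x w => ?_
      obtain ⟨T, hT⟩ := baseForm_update M y a x w
      simp only [hT, map_add])
    (fun y a c z => by
      rw [Complex.real_smul, ← integral_const_mul' o]
      refine integral_congr' o fun x w => ?_
      obtain ⟨T, hT⟩ := baseForm_update M y a x w
      simp only [hT, map_smul, Complex.real_smul])

lemma altSum_integral {ι L : Type*} [Fintype ι] [DecidableEq ι]
    {α : (ι → L) → ∀ x : X, (Fin k → TangentSpace (𝓡 k) x) → ℂ} (hα : ∀ y, IsContForm (α y))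
    (ξ : ι → L) : altSum (fun y => integral o (α y)) ξ =
      integral o (fun x w => altSum (fun y => α y x w) ξ) := by
  unfold altSum
  rw [integral_finset_sum' _ o fun τ => isContForm_const_mul _ (hα _)]
  exact Finset.sum_congr rfl fun τ _ => (integral_const_mul' o _ _).symm

variable {M}

/-- After multiplication by the nonzero number k + 2r + 2, the integrand of the Chevalley-Eilenberg
differential is a sum of exact forms, by the pointwise identity `altSum_slotsZ`. -/
theorem altSum_baseIntegral_ce
    (hsymm : ∀ (τ : Equiv.Perm (Slot r k)) (u : Slot r k → LieAlg d G), M (fun s => u (τ s)) = M u)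
    (hinv : ∀ u z, ∑ s, M (Function.update u s ⁅u s, z⁆) = 0)
    (ξ : Option (Arg r k) → gaugeLieAlgebra d k G X) :
    altSum (fun y : Option (Arg r k) → gaugeLieAlgebra d k G X => ∑ a : Arg r k,
      baseIntegral M o (Function.update (fun a => y (some a)) a ⁅y (some a), y none⁆)) ξ = 0 := by
  have h1 : ∀ y : Option (Arg r k) → gaugeLieAlgebra d k G X, ∑ a : Arg r k,
      baseIntegral M o (Function.update (fun a => y (some a)) a ⁅y (some a), y none⁆) =
      integral o (fun x w => ∑ a : Arg r k,
        baseForm M (Function.update (fun a => y (some a)) a ⁅y (some a), y none⁆) x w) := fun y =>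
    (integral_finset_sum' _ o fun a => isContForm_baseForm M _).symm
  simp only [h1]
  rw [altSum_integral o fun y => isContForm_sum _ fun a => isContForm_baseForm M _]
  have hc : ((k : ℂ) + 2 * r + 2) ≠ 0 := by
    have : ((k + 2 * r + 2 : ℕ) : ℂ) ≠ 0 := Nat.cast_ne_zero.2 (by omega)
    push_cast at this
    exact this
  apply mul_left_cancel₀ hc
  rw [← integral_const_mul' o, mul_zero]
  have h2 : ∀ (x : X) (w : Fin k → TangentSpace (𝓡 k) x), ((k : ℂ) + 2 * r + 2) *
      altSum (fun y : Option (Arg r k) → gaugeLieAlgebra d k G X => ∑ a : Arg r k,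
        baseForm M (Function.update (fun a => y (some a)) a ⁅y (some a), y none⁆) x w) ξ =
      ∑ b, altSum (fun y => baseFormZ M b y x w) ξ := by
    intro x w
    have h3 : ∀ y : Option (Arg r k) → gaugeLieAlgebra d k G X, ∑ a : Arg r k,
        baseForm M (Function.update (fun a => y (some a)) a ⁅y (some a), y none⁆) x w =
        ∑ ρ : Equiv.Perm (Fin k), ((Equiv.Perm.sign ρ : ℤ) : ℂ) *
          ∑ b, slotsW (evAt x) (fun c => diffAt x (w (ρ c))) M b y := by
      intro y
      simp only [baseForm_eq]
      rw [Finset.sum_comm]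
      refine Finset.sum_congr rfl fun ρ _ => ?_
      rw [← Finset.mul_sum, altSum_slots_ce (evAt_lie x) (fun c => diffAt_lie x (w (ρ c))) hinv]
    simp only [h3, baseFormZ_eq]
    simp only [altSum_sum, altSum_const_mul]
    rw [Finset.sum_comm, Finset.mul_sum]
    refine Finset.sum_congr rfl fun ρ _ => ?_
    rw [← Finset.mul_sum, altSum_slotsZ hsymm hinv]
    ring
  rw [integral_congr' o h2]
  have h4 : ∀ b, IsContForm (fun (x : X) w => altSum (fun y => baseFormZ M b y x w) ξ) := fun b =>
    isContForm_sum _ fun τ => isContForm_const_mul _ (isContForm_baseFormZ M b _)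
  rw [integral_finset_sum' _ o h4]
  refine Finset.sum_eq_zero fun b _ => ?_
  rw [← altSum_integral o fun y => isContForm_baseFormZ M b y]
  simp [integral_baseFormZ, altSum]

/-- The alternating form of the cocycle. -/
def gaugeForm (M : MultilinearMap ℝ (fun _ : Slot r k => LieAlg d G) ℂ) {n : ℕ} (ε : Arg r k ≃ Fin n)
    (C : ℂ) : (gaugeLieAlgebra d k G X) [⋀^Fin n]→ₗ[ℝ] ℂ :=
  MultilinearMap.alternatization (C • (baseIntegral M o).domDomCongr ε)

lemma gaugeForm_apply {n : ℕ} (ε : Arg r k ≃ Fin n) (C : ℂ) (ξ : Fin n → gaugeLieAlgebra d k G X) :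
    gaugeForm o M ε C ξ = altSum (fun y : Fin n → gaugeLieAlgebra d k G X =>
      C * baseIntegral M o (fun a => y (ε a))) ξ := by
  unfold gaugeForm
  rw [MultilinearMap.alternatization_apply]
  exact Finset.sum_congr rfl fun τ _ => units_smul_complex _ _

theorem isLieCocycle_gaugeForm
    (hsymm : ∀ (τ : Equiv.Perm (Slot r k)) (u : Slot r k → LieAlg d G), M (fun s => u (τ s)) = M u)
    (hinv : ∀ u z, ∑ s, M (Function.update u s ⁅u s, z⁆) = 0) {n : ℕ} (ε : Arg r k ≃ Fin n)
    (C : ℂ) : IsLieCocycle (gaugeForm (X := X) o M ε C) := by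
  intro ξ
  have h := altSum_ce (fun y : Fin n → gaugeLieAlgebra d k G X =>
      C * baseIntegral M o (fun a => y (ε a)))
    (fun x a z => by
      rw [← gaugeForm_apply, ← gaugeForm_apply, AlternatingMap.map_update_neg]) ξ
  simp only [← gaugeForm_apply] at h
  -- The additional argument `none` gets the number `0`, the position that `altSum_ce` singles out.
  let ε' : Option (Arg r k) ≃ Fin (n + 1) := (Equiv.optionCongr ε).trans (finSuccEquiv n).symm
  let K : (Option (Arg r k) → gaugeLieAlgebra d k G X) → ℂ := fun y => C * ∑ a : Arg r k,
    baseIntegral M o (Function.update (fun a => y (some a)) a ⁅y (some a), y none⁆)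
  have h1 : (fun x : Fin (n + 1) → gaugeLieAlgebra d k G X => ∑ a : Fin n, C * baseIntegral M o
      (fun b => Function.update (Fin.tail x) a ⁅x a.succ, x 0⁆ (ε b))) =
      fun x => K (fun a => x (ε' a)) := by
    funext x
    simp only [K]
    rw [← Finset.mul_sum]
    congr 1
    refine (Fintype.sum_equiv ε _ _ fun a => ?_).symm
    congr 1
    funext b
    by_cases hb : b = a
    · subst hb; simp [ε']
    · rw [Function.update_of_ne hb, Function.update_of_ne (fun h => hb (ε.injective h))]
      simp [ε', Fin.tail]
  rw [h1, altSum_equiv ε' K, altSum_const_mul, altSum_baseIntegral_ce o hsymm hinv, mul_zero] at h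
  have h2 : (2 : ℂ) ≠ 0 := two_ne_zero
  exact (mul_eq_zero.1 h.symm).resolve_left h2

end Cocycle

/-! ### Symmetry and invariance after renumbering the slots -/

section SlotPoly

variable {d k r p : ℕ} {G : Type*} [TopologicalSpace G] [ChartedSpace (Model d) G] [Group G]
  [LieGroup (𝓡 d) ∞ G]

lemma slotPoly_symm {P : MultilinearMap ℝ (fun _ : Fin p => LieAlg d G) ℂ}
    (hP : ∀ (τ : Equiv.Perm (Fin p)) (v : Fin p → LieAlg d G), P (fun i => v (τ i)) = P v)
    (e : Slot r k ≃ Fin p) (τ : Equiv.Perm (Slot r k)) (u : Slot r k → LieAlg d G) :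
    slotPoly P e (fun s => u (τ s)) = slotPoly P e u := by
  simp only [slotPoly, MultilinearMap.domDomCongr_apply]
  refine Eq.trans ?_ (hP (e.permCongr τ) _)
  simp [Equiv.permCongr_apply]

lemma IsInvariantPolynomial.sum_slotPoly_bracket
    {P : MultilinearMap ℝ (fun _ : Fin p => LieAlg d G) ℂ} (hP : IsInvariantPolynomial P)
    (e : Slot r k ≃ Fin p) (u : Slot r k → LieAlg d G) (z : LieAlg d G) :
    ∑ s, slotPoly P e (Function.update u s ⁅u s, z⁆) = 0 := by
  rw [← hP.sum_update_bracket (fun i => u (e.symm i)) z]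
  refine Fintype.sum_equiv e _ _ fun s => ?_
  simp only [slotPoly, MultilinearMap.domDomCongr_apply, Equiv.symm_apply_apply]
  congr 1
  funext i
  by_cases hi : i = e s
  · subst hi; simp
  · rw [Function.update_of_ne hi, Function.update_of_ne (fun h => hi (by rw [← h]; simp))]

end SlotPoly

/-! ### The cocycle as the skew-symmetrisation of α -/

section Alpha

variable {d k r p q N : ℕ} {G : Type*} [TopologicalSpace G] [ChartedSpace (Model d) G] [Group G]
  [LieGroup (𝓡 d) ∞ G] {X : Type*} [TopologicalSpace X] [ChartedSpace (Model k) X]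
  [IsManifold (𝓡 k) ∞ X]

/-- The form `[ω_{k+1}]₁(ξ₁, …, ξ_q, dξ_{q+1} ∧ ⋯ ∧ dξ_N)`. -/
def unitForm (P : MultilinearMap ℝ (fun _ : Fin p => LieAlg d G) ℂ) (h : q + k + (k + 1) = 2 * p)
    (hN : q + k = N) (ξ : Fin N → X → LieAlg d G) (x : X) (w : Fin k → TangentSpace (𝓡 k) x) : ℂ :=
  ∑ τ : Equiv.Perm (Fin k), ((Equiv.Perm.sign τ : ℤ) : ℂ) *
    bssForm P h (fun _ => (1 : G)) (unitVec (fun i => ξ (Fin.cast hN (Fin.castAdd k i)) x)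
      (fun j => diff (ξ (Fin.cast hN (Fin.natAdd q j))) x (w (τ j))))

lemma alphaForm_eq (hk : k < p) (P : MultilinearMap ℝ (fun _ : Fin p => LieAlg d G) ℂ)
    (ξ : Fin (2 * p - k - 1) → X → LieAlg d G) (x : X) (w : Fin k → TangentSpace (𝓡 k) x) :
    alphaForm hk P ξ x w = ((Nat.factorial (2 * p - 2 * k - 1) : ℂ))⁻¹ *
      unitForm P (q := 2 * p - 2 * k - 1) (by omega) (by omega) ξ x w := rfl

/-- The numbering of the arguments. -/
def argEquiv (hN : q + k = N) (σ₀ : Unit ⊕ (Fin r ⊕ Fin r) ≃ Fin q) : Arg r k ≃ Fin N :=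
  ((Equiv.sumAssoc Unit (Fin r ⊕ Fin r) (Fin k)).symm.trans
    (Equiv.sumCongr σ₀ (Equiv.refl (Fin k)))).trans (finSumFinEquiv.trans (finCongr hN))

/-- The extension of a permutation of the first indices. -/
def extendPerm (hN : q + k = N) (π : Equiv.Perm (Fin q)) : Equiv.Perm (Fin N) :=
  (finSumFinEquiv.trans (finCongr hN)).permCongr (Equiv.Perm.sumCongr π 1)

lemma sign_extendPerm (hN : q + k = N) (π : Equiv.Perm (Fin q)) :
    Equiv.Perm.sign (extendPerm hN π) = Equiv.Perm.sign π := by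
  simp [extendPerm]

lemma extendPerm_left (hN : q + k = N) (π : Equiv.Perm (Fin q)) (i : Fin q) :
    extendPerm hN π (Fin.cast hN (Fin.castAdd k i)) = Fin.cast hN (Fin.castAdd k (π i)) := by
  subst hN
  simp [extendPerm, Equiv.permCongr_apply]

lemma extendPerm_right (hN : q + k = N) (π : Equiv.Perm (Fin q)) (j : Fin k) :
    extendPerm hN π (Fin.cast hN (Fin.natAdd q j)) = Fin.cast hN (Fin.natAdd q j) := by
  subst hN
  simp [extendPerm, Equiv.permCongr_apply]

lemma unitForm_eq {P : MultilinearMap ℝ (fun _ : Fin p => LieAlg d G) ℂ}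
    {h : q + k + (k + 1) = 2 * p} {e₀ : Slot r k ≃ Fin p} {σ₀ : Unit ⊕ (Fin r ⊕ Fin r) ≃ Fin q}
    {C : ℂ} (hC : ∀ (ξ : Fin q → LieAlg d G) (ζ : Fin k → LieAlg d G),
      bssForm P h (fun _ => (1 : G)) (unitVec ξ ζ) = C * altSum (fun x : Fin q → LieAlg d G =>
          slotPoly P e₀ (slots id (fun _ => id) (unitArg σ₀ x ζ))) ξ)
    (hN : q + k = N) (ξ : Fin N → gaugeLieAlgebra d k G X) (x : X)
    (w : Fin k → TangentSpace (𝓡 k) x) :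
    unitForm P h hN (fun i => (ξ i : X → LieAlg d G)) x w =
      C * ∑ π : Equiv.Perm (Fin q), ((Equiv.Perm.sign π : ℤ) : ℂ) *
        baseForm (slotPoly P e₀) (fun a => ξ (extendPerm hN π (argEquiv hN σ₀ a))) x w := by
  unfold unitForm
  simp only [hC, baseForm_eq, altSum, Finset.mul_sum]
  rw [Finset.sum_comm]
  refine Finset.sum_congr rfl fun π _ => Finset.sum_congr rfl fun τ _ => ?_
  have : slots id (fun _ => id) (unitArg σ₀ (fun i => (ξ (Fin.cast hN (Fin.castAdd k (π i))) :
      X → LieAlg d G) x) (fun j => diff (ξ (Fin.cast hN (Fin.natAdd q j)) : X → LieAlg d G) x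
        (w (τ j)))) = slots (evAt x) (fun c => diffAt x (w (τ c)))
        (fun a => ξ (extendPerm hN π (argEquiv hN σ₀ a))) := by
    have hl : ∀ s, extendPerm hN π (Fin.cast hN (Fin.castAdd k (σ₀ s))) =
      Fin.cast hN (Fin.castAdd k (π (σ₀ s))) := fun s => extendPerm_left hN π _
    have hr : ∀ j, extendPerm hN π (Fin.cast hN (Fin.natAdd q j)) = Fin.cast hN (Fin.natAdd q j) :=
      fun s => extendPerm_right hN π _
    funext s
    rcases s with s | s | s
    · refine (congrArg (fun i => (ξ i : X → LieAlg d G) x) (hl (Sum.inl ()))).symm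
    · exact congrArg₂ (fun a b : LieAlg d G => ⁅a, b⁆)
        (congrArg (fun i => (ξ i : X → LieAlg d G) x) (hl (Sum.inr (Sum.inl s)))).symm
        (congrArg (fun i => (ξ i : X → LieAlg d G) x) (hl (Sum.inr (Sum.inr s)))).symm
    · exact (congrArg (fun i => diff (ξ i : X → LieAlg d G) x (w (τ s))) (hr s)).symm
  rw [this]
  ring

variable [T2Space X] [CompactSpace X] (o : Orient k X)

/-- The form ω_{k+1} at the identity already contains a skew-symmetrisation over the first
arguments. Its `(2p - 2k - 1)!` summands contribute equally to the full skew-symmetrisation, which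
cancels the factorial in the definition of α. -/
theorem gaugeForm_eq_alphaForm (hk : k < p) {P : MultilinearMap ℝ (fun _ : Fin p => LieAlg d G) ℂ}
    {e₀ : Slot r k ≃ Fin p} {σ₀ : Unit ⊕ (Fin r ⊕ Fin r) ≃ Fin (2 * p - 2 * k - 1)}
    {C : ℂ} (hC : ∀ (ξ : Fin (2 * p - 2 * k - 1) → LieAlg d G) (ζ : Fin k → LieAlg d G),
      bssForm P (by omega) (fun _ => (1 : G)) (unitVec ξ ζ) =
        C * altSum (fun x : Fin (2 * p - 2 * k - 1) → LieAlg d G =>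
          slotPoly P e₀ (slots id (fun _ => id) (unitArg σ₀ x ζ))) ξ)
    (ξ : Fin (2 * p - k - 1) → gaugeLieAlgebra d k G X) :
    gaugeForm o (slotPoly P e₀) (argEquiv (by omega) σ₀) C ξ =
      ∑ τ : Equiv.Perm (Fin (2 * p - k - 1)), ((Equiv.Perm.sign τ : ℤ) : ℂ) *
        integral o (alphaForm hk P (fun i => (ξ (τ i) : X → LieAlg d G))) := by
  have hN : 2 * p - 2 * k - 1 + k = 2 * p - k - 1 := by omega
  have h1 : ∀ ξ : Fin (2 * p - k - 1) → gaugeLieAlgebra d k G X,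
      integral o (alphaForm hk P (fun i => (ξ i : X → LieAlg d G))) =
      (((Nat.factorial (2 * p - 2 * k - 1) : ℂ))⁻¹ * C) * ∑ π : Equiv.Perm (Fin (2 * p - 2 * k - 1)),
        ((Equiv.Perm.sign π : ℤ) : ℂ) * baseIntegral (slotPoly P e₀) o
          (fun a => ξ (extendPerm hN π (argEquiv hN σ₀ a))) := by
    intro ξ
    rw [integral_congr' o fun x w => (alphaForm_eq hk P _ x w).trans
      (congrArg (_ * ·) (unitForm_eq hC hN ξ x w))]
    rw [integral_const_mul', integral_const_mul',
      integral_finset_sum' _ o fun π => isContForm_const_mul _ (isContForm_baseForm _ _)]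
    simp only [integral_const_mul', ← mul_assoc]
    rfl
  rw [gaugeForm_apply]
  change _ = altSum (fun y : Fin (2 * p - k - 1) → gaugeLieAlgebra d k G X =>
    integral o (alphaForm hk P (fun i => (y i : X → LieAlg d G)))) ξ
  simp only [h1, altSum_const_mul, altSum_sum]
  have h2 : ∀ π : Equiv.Perm (Fin (2 * p - 2 * k - 1)),
      ((Equiv.Perm.sign π : ℤ) : ℂ) * altSum (fun y : Fin (2 * p - k - 1) → gaugeLieAlgebra d k G X =>
        baseIntegral (slotPoly P e₀) o (fun a => y (extendPerm hN π (argEquiv hN σ₀ a)))) ξ =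
      altSum (fun y : Fin (2 * p - k - 1) → gaugeLieAlgebra d k G X =>
        baseIntegral (slotPoly P e₀) o (fun a => y (argEquiv hN σ₀ a))) ξ := by
    intro π
    rw [altSum_comp (fun y : Fin (2 * p - k - 1) → gaugeLieAlgebra d k G X =>
      baseIntegral (slotPoly P e₀) o (fun a => y (argEquiv hN σ₀ a))) ξ (extendPerm hN π),
      sign_extendPerm, ← mul_assoc, sign_mul_self, one_mul]
  simp only [h2, Finset.sum_const, Finset.card_univ, Fintype.card_perm, Fintype.card_fin,
    nsmul_eq_mul]
  have hf : (Nat.factorial (2 * p - 2 * k - 1) : ℂ) ≠ 0 := by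
    exact_mod_cast Nat.factorial_ne_zero _
  field_simp

end Alpha

/-! ### The case k = p - 1: Feigin's cocycle and the Kac-Moody cocycle -/

section TopDimension

variable {d k p q N : ℕ} {G : Type*} [TopologicalSpace G] [ChartedSpace (Model d) G] [Group G]
  [LieGroup (𝓡 d) ∞ G] {X : Type*} [TopologicalSpace X] [ChartedSpace (Model k) X]
  [IsManifold (𝓡 k) ∞ X]

/-- The transpositions through one fixed element generate: every other one is a product of three of
them. The case of interest is the undifferentiated slot. -/
lemma comp_perm_of_swap {ι L : Type*} [Fintype ι] [DecidableEq ι] {F : (ι → L) → ℂ} (i₀ : ι)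
    (h : ∀ j, j ≠ i₀ → ∀ y, F (fun i => y (Equiv.swap i₀ j i)) = - F y) (τ : Equiv.Perm ι)
    (y : ι → L) : F (fun i => y (τ i)) = ((Equiv.Perm.sign τ : ℤ) : ℂ) * F y := by
  have hswap : ∀ a b, a ≠ b → ∀ y, F (fun i => y (Equiv.swap a b i)) = - F y := by
    intro a b hab y
    by_cases ha : a = i₀
    · subst ha; exact h b (Ne.symm hab) y
    · by_cases hb : b = i₀
      · subst hb; rw [Equiv.swap_comm]; exact h a ha y
      · have h1 : Equiv.swap a b = Equiv.swap i₀ a * Equiv.swap i₀ b * Equiv.swap i₀ a := by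
          rw [Equiv.swap_comm i₀ b, Equiv.swap_mul_swap_mul_swap hb (Ne.symm hab)]
        rw [h1]
        refine (h a ha (fun i => y (Equiv.swap i₀ a (Equiv.swap i₀ b i)))).trans ?_
        rw [h b hb (fun i => y (Equiv.swap i₀ a i)), h a ha y, neg_neg]
  induction τ using Equiv.Perm.swap_induction_on generalizing y with
  | one => simp
  | swap_mul f a b hab ih =>
    refine (ih fun i => y (Equiv.swap a b i)).trans ?_
    rw [hswap a b hab, Equiv.Perm.sign_mul, Equiv.Perm.sign_swap hab]
    simp

variable [T2Space X] [CompactSpace X] (o : Orient k X)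

/-- Integration by parts moves the derivative from the slot `b` to the undifferentiated slot, the
only other term without bracket slots, and the symmetry of `M` then exchanges the two slots. -/
lemma baseIntegral_swap {M : MultilinearMap ℝ (fun _ : Slot 0 k => LieAlg d G) ℂ}
    (hsymm : ∀ (τ : Equiv.Perm (Slot 0 k)) (u : Slot 0 k → LieAlg d G), M (fun s => u (τ s)) = M u)
    (b : Fin k) (y : Arg 0 k → gaugeLieAlgebra d k G X) :
    baseIntegral M o (fun a => y (Equiv.swap aU (aD b) a)) = - baseIntegral M o y := by
  have h := sum_integral_slotForm_eq_zero o M (δ := fun c => sD c)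
    (fun c c' h => by simpa using h) b (update_baseRole_eq_some_iff b)
    (y := fun s => (gaugeArgs y s : X → LieAlg d G)) (fun _ => isSmooth_coe _)
  set role := Function.update (baseRole 0 k) (sD b) none with hrole
  have h2 : role sU = none := by
    rw [hrole, Function.update_of_ne (by simp)]; rfl
  have h3 : ∀ c, role (sD c) = none ↔ c = b := fun c => by
    by_cases hc : c = b
    · subst hc; rw [hrole, Function.update_self]; simp
    · rw [hrole, Function.update_of_ne (by simpa using hc)]; simp [baseRole, hc]
  rw [Finset.sum_filter, Fintype.sum_sum_type, Fintype.sum_sum_type] at h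
  simp only [Finset.univ_unique, Finset.sum_singleton, PUnit.default_eq_unit, h2, h3, if_true,
    Finset.sum_ite_eq', Finset.mem_univ, Finset.univ_eq_empty, Finset.sum_empty, zero_add] at h
  have hb : Function.update role (sD b) (some b) = baseRole 0 k := by
    rw [hrole, Function.update_idem]
    exact Function.update_eq_self_iff.2 rfl
  rw [hb] at h
  rw [eq_neg_iff_add_eq_zero, ← h]
  congr 1
  refine integral_congr' o fun x w => Finset.sum_congr rfl fun ρ _ => ?_
  congr 1
  rw [← hsymm (Equiv.swap sU (sD b))]
  congr 1
  funext s
  rcases s with s | s | s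
  · have : Equiv.swap (sU : Slot 0 k) (sD b) (Sum.inl s) = sD b := Equiv.swap_apply_left _ _
    obtain rfl := Subsingleton.elim s PUnit.unit
    rw [this, Function.update_self]
    simp [baseRole, gaugeArgs, slots]
  · exact s.elim0
  · by_cases hs : s = b
    · subst hs
      have : Equiv.swap (sU : Slot 0 k) (sD s) (Sum.inr (Sum.inr s)) = sU :=
        Equiv.swap_apply_right _ _
      rw [this, Function.update_of_ne (by simp), hrole, Function.update_self]
      simp [baseRole, gaugeArgs, slots]
    · have h4 : Equiv.swap (sU : Slot 0 k) (sD b) (Sum.inr (Sum.inr s)) = sD s :=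
        Equiv.swap_apply_of_ne_of_ne (by simp) (by simpa using hs)
      have h5 : Equiv.swap (aU : Arg 0 k) (aD b) (aD s) = aD s :=
        Equiv.swap_apply_of_ne_of_ne (by simp) (by simpa using hs)
      rw [h4, Function.update_of_ne (by simp), hrole, Function.update_of_ne (by simpa using hs)]
      simp [baseRole, gaugeArgs, slots, h5]

lemma altSum_baseIntegral {M : MultilinearMap ℝ (fun _ : Slot 0 k => LieAlg d G) ℂ}
    (hsymm : ∀ (τ : Equiv.Perm (Slot 0 k)) (u : Slot 0 k → LieAlg d G), M (fun s => u (τ s)) = M u)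
    (y : Arg 0 k → gaugeLieAlgebra d k G X) :
    altSum (baseIntegral M o) y = (Nat.factorial (k + 1) : ℂ) * baseIntegral M o y := by
  rw [altSum_of_alternating _ _ fun τ => comp_perm_of_swap aU (fun j hj y => ?_) τ y]
  · simp [add_comm]
  · rcases j with j | (j | j) | j
    · exact absurd rfl hj
    · exact j.elim0
    · exact j.elim0
    · exact baseIntegral_swap o hsymm j y

lemma gaugeForm_eq_unitForm {P : MultilinearMap ℝ (fun _ : Fin p => LieAlg d G) ℂ}
    (hP : ∀ (τ : Equiv.Perm (Fin p)) (v : Fin p → LieAlg d G), P (fun i => v (τ i)) = P v)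
    (hq : q = 1) {h : q + k + (k + 1) = 2 * p} {e₀ : Slot 0 k ≃ Fin p}
    {σ₀ : Unit ⊕ (Fin 0 ⊕ Fin 0) ≃ Fin q}
    {C : ℂ} (hC : ∀ (ξ : Fin q → LieAlg d G) (ζ : Fin k → LieAlg d G),
      bssForm P h (fun _ => (1 : G)) (unitVec ξ ζ) = C * altSum (fun x : Fin q → LieAlg d G =>
          slotPoly P e₀ (slots id (fun _ => id) (unitArg σ₀ x ζ))) ξ)
    (hN : q + k = N) (ξ : Fin N → gaugeLieAlgebra d k G X) :
    gaugeForm o (slotPoly P e₀) (argEquiv hN σ₀) C ξ =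
      (Nat.factorial (k + 1) : ℂ) *
        integral o (unitForm P h hN (fun i => (ξ i : X → LieAlg d G))) := by
  subst hq
  have hsymm : ∀ (τ : Equiv.Perm (Slot 0 k)) (u : Slot 0 k → LieAlg d G),
      slotPoly P e₀ (fun s => u (τ s)) = slotPoly P e₀ u :=
    slotPoly_symm hP e₀
  rw [gaugeForm_apply, altSum_const_mul, altSum_equiv (argEquiv hN σ₀) (baseIntegral (slotPoly P e₀) o),
    altSum_baseIntegral o hsymm, integral_congr' o (unitForm_eq hC hN ξ), integral_const_mul']
  have : ∀ a, extendPerm hN 1 a = a := fun a => by simp [extendPerm]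
  simp only [Fintype.sum_unique, Equiv.Perm.default_eq, Equiv.Perm.sign_one, Units.val_one,
    Int.cast_one, one_mul, this]
  change _ = _ * (C * baseIntegral (slotPoly P e₀) o _)
  ring

lemma bssForm_cast {m n n' : ℕ} (P : MultilinearMap ℝ (fun _ : Fin p => LieAlg d G) ℂ) (e : n = n')
    (h : n + m = 2 * p) (h' : n' + m = 2 * p) (a : Fin m → G) (v : Fin n' → Fin m → LieAlg d G) :
    bssForm P h a (fun i => v (Fin.cast e i)) = bssForm P h' a v := by
  subst e
  rfl

/-- The numbering of the slots that begins with the derivatives. -/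
def slotEquivLast (k : ℕ) : Slot 0 k ≃ Fin (k + 1) :=
  (Equiv.sumCongr (Equiv.refl Unit) (Equiv.emptySum (Fin 0) (Fin k))).trans
    ((Equiv.sumComm _ _).trans ((Equiv.optionEquivSumPUnit (Fin k)).symm.trans
      finSuccEquivLast.symm))

/-- The numbering of the slots that ends with the derivatives. -/
def slotEquivFirst (k : ℕ) : Slot 0 k ≃ Fin (k + 1) :=
  (Equiv.sumCongr (Equiv.refl Unit) (Equiv.emptySum (Fin 0) (Fin k))).trans
    ((Equiv.sumComm _ _).trans ((Equiv.optionEquivSumPUnit (Fin k)).symm.trans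
      (finSuccEquiv k).symm))

/-- Without brackets, the value at the identity is a constant times the symmetric polynomial, so it
does not matter which of the vectors sits in which copy. -/
lemma bssForm_unitVec_rotate {P : MultilinearMap ℝ (fun _ : Fin (k + 1) => LieAlg d G) ℂ}
    (hP : ∀ (τ : Equiv.Perm (Fin (k + 1))) (v : Fin (k + 1) → LieAlg d G), P (fun i => v (τ i)) = P v)
    (h : 1 + k + (k + 1) = 2 * (k + 1)) (V : Fin (k + 1) → LieAlg d G) :
    bssForm P h (fun _ => (1 : G)) (unitVec (fun _ => V (Fin.last k)) (fun j => V j.castSucc)) =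
      bssForm P h (fun _ => (1 : G)) (unitVec (fun _ => V 0) (fun j => V j.succ)) := by
  obtain ⟨C, hC⟩ := exists_bssForm_eq (r := 0) hP h rfl (slotEquivLast k)
    (Fintype.equivOfCardEq (by simp))
  rw [hC, hC]
  congr 1
  simp only [altSum, Fintype.sum_unique, Equiv.Perm.default_eq, Equiv.Perm.sign_one, Units.val_one,
    Int.cast_one, one_mul]
  have h1 := slotPoly_apply P (slotEquivLast k) V
  have h2 := slotPoly_apply P (slotEquivFirst k) V
  rw [slotPoly_congr hP _ (slotEquivLast k), ← h1] at h2
  refine Eq.trans (congrArg _ ?_) (h2.symm.trans (congrArg _ ?_))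
  · funext s
    rcases s with s | s | s
    · simp [slots, unitArg, slotEquivLast]
    · exact s.elim0
    · simp [slots, unitArg, slotEquivLast]
  · funext s
    rcases s with s | s | s
    · simp [slots, unitArg, slotEquivFirst]
    · exact s.elim0
    · simp [slots, unitArg, slotEquivFirst]

/-- The vector in the last copy is listed first on one side and last on the other; the cyclic
permutation of `k + 1` elements has the sign `(-1)^k`. -/
lemma bssForm_diagonal {P : MultilinearMap ℝ (fun _ : Fin (k + 1) => LieAlg d G) ℂ}
    (hP : ∀ (τ : Equiv.Perm (Fin (k + 1))) (v : Fin (k + 1) → LieAlg d G), P (fun i => v (τ i)) = P v)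
    (h : 1 + k + (k + 1) = 2 * (k + 1)) (h' : k + 1 + (k + 1) = 2 * (k + 1))
    (V : Fin (k + 1) → LieAlg d G) :
    bssForm P h (fun _ => (1 : G)) (unitVec (fun _ => V 0) (fun j => V j.succ)) =
      (-1) ^ k * bssForm P h' (fun _ => (1 : G)) (fun i => Pi.single i (V i)) := by
  rw [← bssForm_unitVec_rotate hP, ← bssForm_cast P (add_comm k 1) h']
  have h1 := (bssAlt P h' (fun _ => (1 : G))).map_perm (fun i => Pi.single i (V i))
    (finRotate (k + 1))⁻¹
  rw [Equiv.Perm.sign_inv, sign_finRotate, units_smul_complex, bssAlt_apply, bssAlt_apply] at h1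
  rw [show ((((-1 : ℤˣ) ^ (k + 1 - 1) : ℤˣ) : ℤ) : ℂ) = (-1) ^ k by simp] at h1
  rw [← h1]
  congr 1
  funext i
  refine Fin.cases ?_ (fun j => ?_) i
  · have h2 : (finRotate (k + 1))⁻¹ 0 = Fin.last k := by
      rw [Equiv.Perm.inv_eq_iff_eq, finRotate_last]
    simp only [Function.comp_apply, h2]
    exact unitVec_left _ _ 0
  · have h2 : (finRotate (k + 1))⁻¹ j.succ = j.castSucc := by
      rw [Equiv.Perm.inv_eq_iff_eq, Fin.ext_iff, coe_finRotate_of_ne_last (Fin.castSucc_ne_last j)]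
      simp
    have h3 : Fin.cast (add_comm k 1) j.succ = Fin.natAdd 1 j := by ext; simp [add_comm]
    simp only [Function.comp_apply, h2]
    rw [h3, unitVec_right]

lemma feiginForm_eq (hp : k + 1 = p) {P : MultilinearMap ℝ (fun _ : Fin p => LieAlg d G) ℂ}
    (hP : ∀ (τ : Equiv.Perm (Fin p)) (v : Fin p → LieAlg d G), P (fun i => v (τ i)) = P v)
    (h : q + k + (k + 1) = 2 * p) (hN : q + k = 2 * p - k - 1)
    (ξ : Fin (2 * p - k - 1) → X → LieAlg d G) (x : X) (w : Fin k → TangentSpace (𝓡 k) x) :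
    unitForm P h hN ξ x w = (-1) ^ k * feiginForm hp P ξ x w := by
  subst hp
  obtain rfl : q = 1 := by omega
  unfold unitForm feiginForm
  rw [Finset.mul_sum]
  refine Finset.sum_congr rfl fun τ _ => ?_
  rw [mul_left_comm]
  congr 1
  rw [← bssForm_diagonal hP h (by omega)]
  congr 2
  · funext i
    obtain rfl := Subsingleton.elim i 0
    rfl
  · funext j
    simp only [Fin.cons_succ]
    congr 2
    ext
    simp [add_comm]

lemma kacMoodyForm_eq (hp : p = 2) (hk : k = 1)
    {P : MultilinearMap ℝ (fun _ : Fin p => LieAlg d G) ℂ}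
    (hP : ∀ (τ : Equiv.Perm (Fin p)) (v : Fin p → LieAlg d G), P (fun i => v (τ i)) = P v)
    (h : q + k + (k + 1) = 2 * p) (hN : q + k = 2 * p - k - 1)
    (ξ : Fin (2 * p - k - 1) → X → LieAlg d G) (x : X) (w : Fin k → TangentSpace (𝓡 k) x) :
    unitForm P h hN ξ x w = kacMoodyForm hp hk P ξ x w := by
  subst hp hk
  obtain rfl : q = 1 := by omega
  unfold unitForm kacMoodyForm
  simp only [Fintype.sum_unique, Equiv.Perm.default_eq, Equiv.Perm.sign_one, Units.val_one,
    Int.cast_one, one_mul]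
  rw [bssForm_two P hP]
  congr 1
  funext i
  fin_cases i <;> rfl

end TopDimension

/-! ### Hadamard's lemma and leading terms of functions of the parameters -/

section Leading

variable {N n : ℕ} {Y V : Type*} [NormedAddCommGroup Y] [NormedSpace ℝ Y]
  [NormedAddCommGroup V] [NormedSpace ℝ V]

/-- The coefficients in Hadamard's lemma for the variable in `ℝᴺ`. -/
def hadamard (v : (Fin N → ℝ) × Y → V) (i : Fin N) (x : (Fin N → ℝ) × Y) : V :=
  ∫ u in Set.Icc (0 : ℝ) 1, fderiv ℝ v (u • x.1, x.2) (Pi.single i 1, 0)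

lemma tendsto_scale (y₀ : Y) (u : ℝ) :
    Filter.Tendsto (fun z : ((Fin N → ℝ) × Y) × ℝ => (z.2 • z.1.1, z.1.2)) (𝓝 ((0, y₀), u))
      (𝓝 (0, y₀)) := by
  have : Continuous (fun z : ((Fin N → ℝ) × Y) × ℝ => (z.2 • z.1.1, z.1.2)) := by fun_prop
  simpa using this.tendsto ((0, y₀), u)

lemma eventually_contDiffAt_hadamard {v : (Fin N → ℝ) × Y → V} {y₀ : Y}
    (hv : ∀ᶠ x in 𝓝 (0, y₀), ContDiffAt ℝ ∞ v x) (i : Fin N) :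
    ∀ᶠ x in 𝓝 (0, y₀), ContDiffAt ℝ ∞ (hadamard v i) x := by
  have := eventually_contDiffAt_integral (volume : Measure ℝ) (isCompact_Icc (a := (0 : ℝ)) (b := 1))
    (w := fun _ => 1) (t₀ := ((0 : Fin N → ℝ), y₀))
    (F := fun z : ((Fin N → ℝ) × Y) × ℝ => fderiv ℝ v (z.2 • z.1.1, z.1.2) (Pi.single i 1, 0))
    (continuousOn_const.integrableOn_compact isCompact_Icc) (fun u _ => by
      filter_upwards [(tendsto_scale y₀ u).eventually hv] with z hz
      refine ContDiffAt.clm_apply ?_ contDiffAt_const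
      have h1 : ContDiffAt ℝ ∞ (fderiv ℝ v) (z.2 • z.1.1, z.1.2) := hz.fderiv_right (m := ∞) (by simp)
      exact h1.comp (f := fun z : ((Fin N → ℝ) × Y) × ℝ => (z.2 • z.1.1, z.1.2)) z
        (by fun_prop))
  simp only [one_smul] at this
  exact this

lemma hadamard_zero [CompleteSpace V] (v : (Fin N → ℝ) × Y → V) (i : Fin N) (y : Y) :
    hadamard v i (0, y) = fderiv ℝ v (0, y) (Pi.single i 1, 0) := by
  simp [hadamard]

/-- The fundamental theorem of calculus along the segment from `(0, y)` to `(x, y)`, which stays in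
the region of smoothness by compactness of the unit interval. -/
lemma eventually_eq_add_hadamard [CompleteSpace V] {v : (Fin N → ℝ) × Y → V} {y₀ : Y}
    (hv : ∀ᶠ x in 𝓝 (0, y₀), ContDiffAt ℝ ∞ v x) :
    ∀ᶠ x in 𝓝 (0, y₀), v x = v (0, x.2) + ∑ i, x.1 i • hadamard v i x := by
  have h : ∀ᶠ x : (Fin N → ℝ) × Y in 𝓝 (0, y₀), ∀ u ∈ Set.Icc (0 : ℝ) 1,
      ContDiffAt ℝ ∞ v (u • x.1, x.2) :=
    isCompact_Icc.eventually_forall_of_forall_eventually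
      (P := fun (x : (Fin N → ℝ) × Y) u => ContDiffAt ℝ ∞ v (u • x.1, x.2))
      fun u _ => (tendsto_scale y₀ u).eventually hv
  filter_upwards [h] with x hx
  have hc : ∀ w : (Fin N → ℝ) × Y,
      ContinuousOn (fun u : ℝ => fderiv ℝ v (u • x.1, x.2) w) (Set.Icc 0 1) := fun w u hu => by
    have h1 : ContDiffAt ℝ ∞ (fderiv ℝ v) (u • x.1, x.2) :=
      (hx u hu).fderiv_right (m := ∞) (by simp)
    exact ((h1.continuousAt.comp (f := fun u : ℝ => (u • x.1, x.2))
      (by fun_prop : Continuous fun u : ℝ => (u • x.1, x.2)).continuousAt).clm_apply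
        continuousAt_const).continuousWithinAt
  have h1 : ∫ u in (0 : ℝ)..1, fderiv ℝ v (u • x.1, x.2) (x.1, 0) =
      v ((1 : ℝ) • x.1, x.2) - v ((0 : ℝ) • x.1, x.2) := by
    refine intervalIntegral.integral_eq_sub_of_hasDerivAt
      (f := fun u : ℝ => v (u • x.1, x.2)) (fun u hu => ?_) ?_
    · rw [Set.uIcc_of_le zero_le_one] at hu
      have h2 : HasDerivAt (fun u : ℝ => (u • x.1, x.2)) (x.1, (0 : Y)) u :=
        (by simpa using (hasDerivAt_id u).smul_const x.1 :
          HasDerivAt (fun u : ℝ => u • x.1) x.1 u).prodMk (hasDerivAt_const u x.2)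
      exact (((hx u hu).differentiableAt (by simp)).hasFDerivAt).comp_hasDerivAt u h2
    · exact ContinuousOn.intervalIntegrable (by rw [Set.uIcc_of_le zero_le_one]; exact hc _)
  rw [intervalIntegral.integral_of_le zero_le_one, ← integral_Icc_eq_integral_Ioc] at h1
  have h3 : ∀ u : ℝ, fderiv ℝ v (u • x.1, x.2) (x.1, 0) =
      ∑ i, x.1 i • fderiv ℝ v (u • x.1, x.2) (Pi.single i 1, 0) := fun u => by
    conv_lhs => rw [show ((x.1, 0) : (Fin N → ℝ) × Y) =
      ∑ i, x.1 i • ((Pi.single i 1, 0) : (Fin N → ℝ) × Y) from by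
        refine Prod.ext ?_ ?_
        · simp only [Prod.fst_sum, Prod.smul_fst]
          exact pi_eq_sum_univ' x.1
        · simp [Prod.snd_sum], map_sum]
    simp only [map_smul]
  simp only [h3] at h1
  have hi : ∀ i ∈ (Finset.univ : Finset (Fin N)), Integrable (fun u : ℝ =>
      x.1 i • fderiv ℝ v (u • x.1, x.2) (Pi.single i 1, 0)) (volume.restrict (Set.Icc 0 1)) :=
    fun i _ => ((hc (Pi.single i 1, 0)).const_smul (x.1 i)).integrableOn_compact isCompact_Icc
  rw [integral_finsetSum _ hi] at h1
  simp only [integral_smul] at h1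
  rw [one_smul, zero_smul] at h1
  unfold hadamard
  rw [h1]
  simp

/-- `f` is near `0` a combination of the monomials `t ↦ ∏ₗ t_{φ l}` of degree `n`, with smooth
coefficients that have the values `g φ` at `0`. -/
def HasLeadingTerms (f : (Fin N → ℝ) → ℂ) (g : (Fin n → Fin N) → ℂ) : Prop :=
  ∃ A : (Fin n → Fin N) → (Fin N → ℝ) → ℂ, (∀ φ, ∀ᶠ t in 𝓝 0, ContDiffAt ℝ ∞ (A φ) t) ∧
    (∀ φ, A φ 0 = g φ) ∧ f =ᶠ[𝓝 0] fun t => ∑ φ, (∏ l, t (φ l)) • A φ t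

lemma contDiffAt_prod_smul {ι : Type*} {W : Type*} [NormedAddCommGroup W] [NormedSpace ℝ W]
    (φ : ι → Fin N) (s : Finset ι) {A : (Fin N → ℝ) → W} {t : Fin N → ℝ}
    (hA : ContDiffAt ℝ ∞ A t) : ContDiffAt ℝ ∞ (fun t => (∏ l ∈ s, t (φ l)) • A t) t :=
  (contDiffAt_prod fun l _ => by fun_prop).smul hA

/-- Induction by the product rule: a derivative removes one coordinate factor or falls on `A`, and
in either case the order of vanishing drops by at most one. The target `W` varies because
derivatives take values in spaces of linear maps. -/
lemma iteratedFDeriv_prod_smul_eq_zero {ι : Type} [DecidableEq ι] (φ : ι → Fin N) (j : ℕ) :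
    ∀ {W : Type} [NormedAddCommGroup W] [NormedSpace ℝ W] (s : Finset ι) {A : (Fin N → ℝ) → W},
      (∀ᶠ t in 𝓝 0, ContDiffAt ℝ ∞ A t) → (j < s.card ∨ (j = s.card ∧ A 0 = 0)) →
      iteratedFDeriv ℝ j (fun t => (∏ l ∈ s, t (φ l)) • A t) 0 = 0 := by
  induction j with
  | zero =>
    intro W _ _ s A hA h
    ext v
    simp only [iteratedFDeriv_zero_apply, _root_.zero_apply]
    rcases h with h | h
    · obtain ⟨l, hl⟩ := Finset.card_pos.1 h
      rw [Finset.prod_eq_zero hl (by simp), zero_smul]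
    · rw [h.2, smul_zero]
  | succ j ih =>
    intro W _ _ s A hA h
    have hd : (fderiv ℝ fun t : Fin N → ℝ => (∏ l ∈ s, t (φ l)) • A t) =ᶠ[𝓝 0] fun t =>
        ∑ l ∈ s, ((∏ l' ∈ s.erase l, t (φ l')) •
          (ContinuousLinearMap.proj (R := ℝ) (φ := fun _ : Fin N => ℝ) (φ l)).smulRight (A t)) +
        (∏ l ∈ s, t (φ l)) • fderiv ℝ A t := by
      filter_upwards [hA] with t ht
      have h1 := HasFDerivAt.finsetProd (u := s) (x := t)
        (g := fun l (t : Fin N → ℝ) => t (φ l)) fun l _ =>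
        (ContinuousLinearMap.proj (R := ℝ) (φ := fun _ : Fin N => ℝ) (φ l)).hasFDerivAt
      refine (h1.smul (ht.differentiableAt (by simp)).hasFDerivAt).fderiv.trans ?_
      ext v
      simp [Finset.sum_smul, mul_smul, add_comm]
    have h0 : iteratedFDeriv ℝ j (fderiv ℝ fun t : Fin N → ℝ => (∏ l ∈ s, t (φ l)) • A t) 0 = 0 := by
      have hr : ∀ l, ∀ᶠ t in 𝓝 0, ContDiffAt ℝ ∞ (fun t =>
          (ContinuousLinearMap.proj (R := ℝ) (φ := fun _ : Fin N => ℝ) (φ l)).smulRight (A t)) t :=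
        fun l => hA.mono fun t ht => contDiffAt_const.smulRight ht
      have hf : ∀ᶠ t in 𝓝 0, ContDiffAt ℝ ∞ (fderiv ℝ A) t :=
        hA.mono fun t ht => ht.fderiv_right (m := ∞) (by simp)
      rw [(hd.iteratedFDeriv ℝ j).eq_of_nhds, fun_iteratedFDeriv_add_apply
        (ContDiffAt.sum fun l _ => (contDiffAt_prod_smul φ _ (hr l).self_of_nhds).of_le
          (by exact_mod_cast le_top))
        ((contDiffAt_prod_smul φ _ hf.self_of_nhds).of_le (by exact_mod_cast le_top)),
        iteratedFDeriv_fun_sum_apply fun l _ =>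
          (contDiffAt_prod_smul φ _ (hr l).self_of_nhds).of_le (by exact_mod_cast le_top),
        ih s hf (by omega), add_zero]
      refine Finset.sum_eq_zero fun l hl => ih (s.erase l) (hr l) ?_
      rw [Finset.card_erase_of_mem hl]
      refine h.imp (fun h => by omega) fun h => ⟨by omega, by ext; simp [h.2]⟩
    ext v
    rw [iteratedFDeriv_succ_apply_right, h0]
    simp

/-- The mixed derivative selects the monomials in which every variable occurs exactly once; a
product of coordinates is the diagonal of a multilinear map, whose polarisation is a sum over
permutations. -/
lemma iteratedFDeriv_prod (φ : Fin N → Fin N) :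
    iteratedFDeriv ℝ N (fun t : Fin N → ℝ => ∏ l, t (φ l)) 0 (fun i => Pi.single i 1) =
      ∑ π : Equiv.Perm (Fin N), if φ = π then 1 else 0 := by
  have := ((ContinuousMultilinearMap.mkPiAlgebra ℝ (Fin N) ℝ).compContinuousLinearMap
    (fun l => ContinuousLinearMap.proj (R := ℝ) (φ := fun _ : Fin N => ℝ) (φ l))).iteratedFDeriv_comp_diagonal
      0 (fun i => Pi.single i 1)
  simp only [ContinuousMultilinearMap.compContinuousLinearMap_apply,
    ContinuousMultilinearMap.mkPiAlgebra_apply, ContinuousLinearMap.proj_apply] at this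
  rw [this]
  refine Finset.sum_congr rfl fun π _ => ?_
  split_ifs with h
  · exact Finset.prod_eq_one fun l _ => by simp [h]
  · obtain ⟨l, hl⟩ := Function.ne_iff.1 h
    exact Finset.prod_eq_zero (Finset.mem_univ l) (by simp [hl])

namespace HasLeadingTerms

variable {f : (Fin N → ℝ) → ℂ} {g : (Fin n → Fin N) → ℂ}

lemma eventually_contDiffAt (hf : HasLeadingTerms f g) : ∀ᶠ t in 𝓝 0, ContDiffAt ℝ ∞ f t := by
  obtain ⟨A, hA, -, he⟩ := hf
  filter_upwards [he.eventuallyEq_nhds, Filter.eventually_all.2 hA] with t h1 h2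
  exact (ContDiffAt.sum fun φ _ => contDiffAt_prod_smul φ _ (h2 φ)).congr_of_eventuallyEq h1

lemma iteratedFDeriv_eq_sum (hf : HasLeadingTerms f g) (j : ℕ) :
    ∃ A : (Fin n → Fin N) → (Fin N → ℝ) → ℂ, (∀ φ, ∀ᶠ t in 𝓝 0, ContDiffAt ℝ ∞ (A φ) t) ∧
      (∀ φ, A φ 0 = g φ) ∧ iteratedFDeriv ℝ j f 0 =
        ∑ φ, iteratedFDeriv ℝ j (fun t => (∏ l, t (φ l)) • A φ t) 0 := by
  obtain ⟨A, hA, h0, he⟩ := hf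
  refine ⟨A, hA, h0, ?_⟩
  rw [(he.iteratedFDeriv ℝ j).eq_of_nhds, iteratedFDeriv_fun_sum_apply fun φ _ =>
    (contDiffAt_prod_smul φ _ (hA φ).self_of_nhds).of_le (by exact_mod_cast le_top)]

lemma iteratedFDeriv_eq_zero (hf : HasLeadingTerms f g) {j : ℕ} (hj : j < n) :
    iteratedFDeriv ℝ j f 0 = 0 := by
  obtain ⟨A, hA, -, h⟩ := hf.iteratedFDeriv_eq_sum j
  rw [h]
  exact Finset.sum_eq_zero fun φ _ =>
    iteratedFDeriv_prod_smul_eq_zero φ j Finset.univ (hA φ) (Or.inl (by simpa using hj))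

lemma iteratedFDeriv_apply {g : (Fin N → Fin N) → ℂ} (hf : HasLeadingTerms f g) :
    iteratedFDeriv ℝ N f 0 (fun i => Pi.single i 1) = ∑ π : Equiv.Perm (Fin N), g π := by
  obtain ⟨A, hA, h0, h⟩ := hf.iteratedFDeriv_eq_sum N
  have key : ∀ φ : Fin N → Fin N,
      iteratedFDeriv ℝ N (fun t => (∏ l, t (φ l)) • A φ t) 0 (fun i => Pi.single i 1) =
        ∑ π : Equiv.Perm (Fin N), if φ = π then g φ else 0 := fun φ => by
    -- The coefficient is split into its value at `0` and a part vanishing at `0`, which raises the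
    -- order of vanishing beyond `N`.
    have h1 : (fun t : Fin N → ℝ => (∏ l, t (φ l)) • A φ t) =
        fun t => (∏ l, t (φ l)) • (A φ t - A φ 0) +
          ((ContinuousLinearMap.toSpanSingleton ℝ (g φ)) ∘ fun t : Fin N → ℝ => ∏ l, t (φ l)) t := by
      funext t
      simp [h0, smul_sub]
    have h2 : ∀ᶠ t in 𝓝 0, ContDiffAt ℝ ∞ (fun t => A φ t - A φ 0) t :=
      (hA φ).mono fun t ht => ht.sub contDiffAt_const
    have h3 : ContDiff ℝ ∞ (fun t : Fin N → ℝ => ∏ l, t (φ l)) :=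
      contDiff_prod fun l _ => by fun_prop
    rw [h1, fun_iteratedFDeriv_add_apply
      ((contDiffAt_prod_smul φ _ h2.self_of_nhds).of_le (by exact_mod_cast le_top))
      (((ContinuousLinearMap.contDiff _).comp h3).contDiffAt.of_le (by exact_mod_cast le_top)),
      iteratedFDeriv_prod_smul_eq_zero φ N Finset.univ h2 (Or.inr (by simp)), zero_add,
      ContinuousLinearMap.iteratedFDeriv_comp_left _ h3.contDiffAt (by exact_mod_cast le_top)]
    simp only [ContinuousLinearMap.compContinuousMultilinearMap_coe, Function.comp_apply,
      iteratedFDeriv_prod]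
    simp only [map_sum]
    exact Finset.sum_congr rfl fun π _ => by split_ifs <;> simp
  rw [h, _root_.sum_apply, Finset.sum_congr rfl fun φ _ => key φ, Finset.sum_comm]
  exact Finset.sum_congr rfl fun π _ => by simp

lemma comp_perm (hf : HasLeadingTerms f g) (τ : Equiv.Perm (Fin N)) :
    HasLeadingTerms (fun t => f (fun i => t (τ i))) (fun φ : Fin n → Fin N => g (fun l => τ⁻¹ (φ l))) := by
  obtain ⟨A, hA, h0, he⟩ := hf
  have hc : Filter.Tendsto (fun (t : Fin N → ℝ) i => t (τ i)) (𝓝 0) (𝓝 0) :=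
    (by fun_prop : Continuous fun (t : Fin N → ℝ) i => t (τ i)).tendsto 0
  refine ⟨fun φ t => A (fun l => τ⁻¹ (φ l)) (fun i => t (τ i)), fun φ => ?_, fun φ => h0 _, ?_⟩
  · filter_upwards [hc.eventually (hA (fun l => τ⁻¹ (φ l)))] with t ht
    exact ht.comp (f := fun (t : Fin N → ℝ) i => t (τ i)) t (by fun_prop)
  · filter_upwards [hc.eventually he] with t ht
    rw [ht]
    refine Fintype.sum_equiv (Equiv.arrowCongr (Equiv.refl _) τ) _ _ fun φ => ?_
    simp [Equiv.arrowCongr]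

end HasLeadingTerms

lemma HasLeadingTerms.sum {ι : Type*} (s : Finset ι) {f : ι → (Fin N → ℝ) → ℂ}
    {g : ι → (Fin n → Fin N) → ℂ} (h : ∀ i ∈ s, HasLeadingTerms (f i) (g i)) :
    HasLeadingTerms (fun t => ∑ i ∈ s, f i t) (fun φ => ∑ i ∈ s, g i φ) := by
  choose! A hA h0 he using h
  refine ⟨fun φ t => ∑ i ∈ s, A i φ t, fun φ => ?_, fun φ => Finset.sum_congr rfl fun i hi => h0 i hi φ,
    ?_⟩
  · filter_upwards [(Filter.eventually_all_finset s).2 fun i hi => hA i hi φ] with t ht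
    exact ContDiffAt.sum ht
  · filter_upwards [(Filter.eventually_all_finset s).2 fun i hi => he i hi] with t ht
    rw [Finset.sum_congr rfl ht, Finset.sum_comm]
    simp only [Finset.smul_sum]

end Leading

/-! ### Leading terms of integrals of the Bott-Shulman-Stasheff forms -/

section Nested

variable {d k p q m n N : ℕ} {G : Type*} [TopologicalSpace G] [ChartedSpace (Model d) G] [Group G]
  [LieGroup (𝓡 d) ∞ G] {E : Type*} [NormedAddCommGroup E] [NormedSpace ℝ E]

/-- The integral over `K × Δ_q` of the Bott-Shulman-Stasheff form at the point `a`, on the vectors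
`v`, with weight `w`. -/
def nestedIntegral (K : Set (Model k)) (w : Model k → ℝ)
    (P : MultilinearMap ℝ (fun _ : Fin p => LieAlg d G) ℂ) (h : n + m = 2 * p)
    (a : Model k × (Fin q → ℝ) → Fin m → G) (v : Model k × (Fin q → ℝ) → Fin n → Fin m → LieAlg d G) :
    ℂ :=
  ∫ z in K, w z • ∫ s in simplex q, bssForm P h (a (z, s)) (v (z, s))

lemma eventually_contDiffAt_simplexIntegral (P : MultilinearMap ℝ (fun _ : Fin p => LieAlg d G) ℂ)
    (h : n + m = 2 * p) {a : E × (Fin q → ℝ) → Fin m → G}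
    {v : E × (Fin q → ℝ) → Fin n → Fin m → LieAlg d G} {e₀ : E}
    (ha : ∀ s ∈ simplex q, ∀ᶠ y in 𝓝 (e₀, s), ∀ i,
      ContMDiffAt 𝓘(ℝ, E × (Fin q → ℝ)) (𝓡 d) ∞ (fun y => a y i) y)
    (hv : ∀ s ∈ simplex q, ∀ᶠ y in 𝓝 (e₀, s), ∀ l i,
      ContDiffAt (F := Model d) ℝ ∞ (fun y => v y l i) y) :
    ∀ᶠ e in 𝓝 e₀, ContDiffAt ℝ ∞ (fun e => ∫ s in simplex q, bssForm P h (a (e, s)) (v (e, s))) e := by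
  have := eventually_contDiffAt_integral (volume : Measure (Fin q → ℝ)) (isCompact_simplex q)
    (w := fun _ => 1) (t₀ := e₀) (V := ℂ) (F := fun y => bssForm P h (a y) (v y))
    (continuousOn_const.integrableOn_compact (isCompact_simplex q))
    (fun s hs => eventually_contDiffAt_bssForm P h (ha s hs) (hv s hs))
  simp only [one_smul] at this
  exact this

/-- All `n` tangent vectors vanish at `t = 0`. Hadamard's lemma writes each as a combination of the
coordinates of `t`, and multilinearity expands the form into monomials of degree `n`. The
coefficients are integrals over compact sets and so depend smoothly on `t`. -/
theorem hasLeadingTerms_nestedIntegral {K : Set (Model k)} (hK : IsCompact K) {w : Model k → ℝ}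
    (hw : ContinuousOn w K) (P : MultilinearMap ℝ (fun _ : Fin p => LieAlg d G) ℂ)
    (h : n + m = 2 * p) {F : (Fin N → ℝ) × (Model k × (Fin q → ℝ)) → Fin m → G}
    {v : (Fin N → ℝ) × (Model k × (Fin q → ℝ)) → Fin n → Fin m → LieAlg d G}
    (hF : ∀ z ∈ K, ∀ s ∈ simplex q, ∀ᶠ x in 𝓝 (0, (z, s)), ∀ i,
      ContMDiffAt 𝓘(ℝ, (Fin N → ℝ) × (Model k × (Fin q → ℝ))) (𝓡 d) ∞ (fun x => F x i) x)
    (hv : ∀ z ∈ K, ∀ s ∈ simplex q, ∀ᶠ x in 𝓝 (0, (z, s)), ∀ l i,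
      ContDiffAt (F := Model d) ℝ ∞ (fun x => v x l i) x)
    (hF0 : ∀ z ∈ K, ∀ s ∈ simplex q, F (0, (z, s)) = fun _ => 1)
    (hv0 : ∀ z ∈ K, ∀ s ∈ simplex q, v (0, (z, s)) = 0) :
    HasLeadingTerms (fun t => nestedIntegral K w P h (fun y => F (t, y)) (fun y => v (t, y)))
      (fun φ : Fin n → Fin N => nestedIntegral K w P h (fun (_ : Model k × (Fin q → ℝ)) _ => 1)
        (fun y l j => fderiv (F := Model d) ℝ (fun x => v x l j) (0, y) (Pi.single (φ l) 1, 0))) := by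
  let V : (Fin n → Fin N) → (Fin N → ℝ) × (Model k × (Fin q → ℝ)) → Fin n → Fin m → LieAlg d G :=
    fun φ x l j => hadamard (V := Model d) (fun x => v x l j) (φ l) x
  have hV : ∀ φ, ∀ z ∈ K, ∀ s ∈ simplex q, ∀ᶠ x in 𝓝 (0, (z, s)), ∀ l i,
      ContDiffAt (F := Model d) ℝ ∞ (fun x => V φ x l i) x := fun φ z hz s hs =>
    Filter.eventually_all.2 fun l => Filter.eventually_all.2 fun i =>
      eventually_contDiffAt_hadamard (V := Model d) ((hv z hz s hs).mono fun x hx => hx l i) (φ l)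
  have hB : ∀ φ, ∀ y ∈ K ×ˢ simplex q, ∀ᶠ x in 𝓝 (0, y),
      ContDiffAt ℝ ∞ (fun x => bssForm P h (F x) (V φ x)) x := fun φ y hy =>
    eventually_contDiffAt_bssForm P h (hF y.1 hy.1 y.2 hy.2) (hV φ y.1 hy.1 y.2 hy.2)
  have hassoc : ContDiff ℝ ∞ (fun y : ((Fin N → ℝ) × Model k) × (Fin q → ℝ) =>
      (y.1.1, (y.1.2, y.2))) := by fun_prop
  have hI : ∀ φ, ∀ z ∈ K, ∀ᶠ e : (Fin N → ℝ) × Model k in 𝓝 (0, z), ContDiffAt ℝ ∞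
      (fun e : (Fin N → ℝ) × Model k => ∫ s in simplex q,
        bssForm P h (F (e.1, (e.2, s))) (V φ (e.1, (e.2, s)))) e := fun φ z hz => by
    refine eventually_contDiffAt_simplexIntegral P h
      (a := fun y : ((Fin N → ℝ) × Model k) × (Fin q → ℝ) => F (y.1.1, (y.1.2, y.2)))
      (v := fun y => V φ (y.1.1, (y.1.2, y.2))) (fun s hs => ?_) (fun s hs => ?_)
    · filter_upwards [(hassoc.continuous.tendsto ((0, z), s)).eventually (hF z hz s hs)] with y hy i
      exact ContMDiffAt.comp (I' := 𝓘(ℝ, (Fin N → ℝ) × (Model k × (Fin q → ℝ))))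
        (g := fun x => F x i) y (hy i) hassoc.contDiffAt.contMDiffAt
    · filter_upwards [(hassoc.continuous.tendsto ((0, z), s)).eventually (hV φ z hz s hs)] with y hy l i
      exact ContDiffAt.comp (G := Model d) (g := fun x => V φ x l i) y (hy l i) hassoc.contDiffAt
  refine ⟨fun φ t => nestedIntegral K w P h (fun y => F (t, y)) (fun y => V φ (t, y)), fun φ => ?_,
    fun φ => ?_, ?_⟩
  · exact eventually_contDiffAt_integral (volume : Measure (Model k)) hK
      (hw.integrableOn_compact hK) (t₀ := (0 : Fin N → ℝ))
      (F := fun e : (Fin N → ℝ) × Model k => ∫ s in simplex q,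
        bssForm P h (F (e.1, (e.2, s))) (V φ (e.1, (e.2, s)))) (hI φ)
  · refine setIntegral_congr_fun hK.measurableSet fun z hz => ?_
    congr 1
    refine setIntegral_congr_fun (isCompact_simplex q).measurableSet fun s hs => ?_
    change bssForm P h (F (0, (z, s))) _ = _
    rw [hF0 z hz s hs]
    congr 1
    funext l j
    exact hadamard_zero (V := Model d) _ _ _
  -- Compactness of the domain of integration makes the local statements uniform: they hold at all
  -- of its points for every small `t`.
  · have e1 : ∀ᶠ t in 𝓝 (0 : Fin N → ℝ), ∀ y ∈ K ×ˢ simplex q, ∀ l j,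
        v (t, y) l j = v (0, y) l j + ∑ i, t i • V (fun _ => i) (t, y) l j :=
      (hK.prod (isCompact_simplex q)).eventually_forall_of_forall_eventually
        (P := fun t y => ∀ l j, v (t, y) l j = v (0, y) l j + ∑ i, t i • V (fun _ => i) (t, y) l j)
        fun y hy => Filter.eventually_all.2 fun l => Filter.eventually_all.2 fun j =>
          eventually_eq_add_hadamard (V := Model d)
            ((hv y.1 hy.1 y.2 hy.2).mono fun x hx => hx l j)
    have e2 : ∀ᶠ t in 𝓝 (0 : Fin N → ℝ), ∀ z ∈ K, ∀ φ, ContDiffAt ℝ ∞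
        (fun e : (Fin N → ℝ) × Model k => ∫ s in simplex q,
          bssForm P h (F (e.1, (e.2, s))) (V φ (e.1, (e.2, s)))) (t, z) :=
      hK.eventually_forall_of_forall_eventually (P := fun t z => ∀ φ, ContDiffAt ℝ ∞
        (fun e : (Fin N → ℝ) × Model k => ∫ s in simplex q,
          bssForm P h (F (e.1, (e.2, s))) (V φ (e.1, (e.2, s)))) (t, z))
        fun z hz => Filter.eventually_all.2 fun φ => hI φ z hz
    have e3 : ∀ᶠ t in 𝓝 (0 : Fin N → ℝ), ∀ y ∈ K ×ˢ simplex q, ∀ φ,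
        ContDiffAt ℝ ∞ (fun x => bssForm P h (F x) (V φ x)) (t, y) :=
      (hK.prod (isCompact_simplex q)).eventually_forall_of_forall_eventually
        (P := fun t y => ∀ φ, ContDiffAt ℝ ∞ (fun x => bssForm P h (F x) (V φ x)) (t, y))
        fun y hy => Filter.eventually_all.2 fun φ => hB φ y hy
    filter_upwards [e1, e2, e3] with t h1 h2 h3
    have key : ∀ z ∈ K, ∀ s ∈ simplex q, bssForm P h (F (t, (z, s))) (v (t, (z, s))) =
        ∑ φ : Fin n → Fin N, (∏ l, t (φ l)) • bssForm P h (F (t, (z, s))) (V φ (t, (z, s))) := by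
      intro z hz s hs
      have hvs : v (t, (z, s)) = fun l => ∑ i, t i • V (fun _ => i) (t, (z, s)) l := by
        funext l j
        rw [h1 (z, s) ⟨hz, hs⟩, hv0 z hz s hs, Finset.sum_apply]
        exact zero_add _
      rw [hvs, ← bssAlt_apply, ← AlternatingMap.coe_multilinearMap, MultilinearMap.map_sum]
      exact Finset.sum_congr rfl fun φ _ => (MultilinearMap.map_smul_univ _ _ _)
    have key' : ∀ z ∈ K, w z • ∫ s in simplex q, bssForm P h (F (t, (z, s))) (v (t, (z, s))) =
        ∑ φ : Fin n → Fin N, (∏ l, t (φ l)) • (w z • ∫ s in simplex q,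
          bssForm P h (F (t, (z, s))) (V φ (t, (z, s)))) := by
      intro z hz
      rw [setIntegral_congr_fun (isCompact_simplex q).measurableSet fun s hs => key z hz s hs,
        integral_finsetSum, Finset.smul_sum]
      · simp only [integral_smul, smul_comm (w z)]
      · intro φ _
        have hc : ContinuousOn (fun s => bssForm P h (F (t, (z, s))) (V φ (t, (z, s)))) (simplex q) :=
          fun s hs => ((h3 (z, s) ⟨hz, hs⟩ φ).continuousAt.comp (f := fun s => (t, (z, s)))
            (by fun_prop)).continuousWithinAt
        exact (hc.const_smul (∏ l, t (φ l))).integrableOn_compact (isCompact_simplex q)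
    unfold nestedIntegral
    rw [setIntegral_congr_fun hK.measurableSet key', integral_finsetSum]
    · simp only [integral_smul]
    · intro φ _
      have hc : ContinuousOn (fun z => ∫ s in simplex q,
          bssForm P h (F (t, (z, s))) (V φ (t, (z, s)))) K :=
        fun z hz => ((h2 z hz φ).continuousAt.comp (f := fun z => (t, z))
          (by fun_prop)).continuousWithinAt
      exact ((hw.smul hc).const_smul (∏ l, t (φ l))).integrableOn_compact hK

end Nested

/-! ### First-order variation of the Maurer-Cartan form -/

section Translation

variable {d : ℕ} {G : Type*} [TopologicalSpace G] [ChartedSpace (Model d) G] [Group G]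
  [LieGroup (𝓡 d) ∞ G]

/-- The map `(a, b) ↦ a b⁻¹` of `G` in the chart at the identity. -/
def chartDiv (d : ℕ) (G : Type*) [TopologicalSpace G] [ChartedSpace (Model d) G] [Group G]
    (z : Model d × Model d) : Model d :=
  oneChart d G ((oneChart d G).symm z.1 * ((oneChart d G).symm z.2)⁻¹)

lemma contDiffAt_chartDiv : ContDiffAt ℝ ∞ (chartDiv d G) (oneChart d G 1, oneChart d G 1) := by
  have h1 : ContMDiffAt 𝓘(ℝ, Model d × Model d) (𝓡 d) ∞
      (fun y : Model d × Model d => (oneChart d G).symm y.1) (oneChart d G 1, oneChart d G 1) :=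
    ContMDiffAt.comp (oneChart d G 1, oneChart d G 1) contMDiffAt_oneChart_symm
      contDiffAt_fst.contMDiffAt
  have h2 : ContMDiffAt 𝓘(ℝ, Model d × Model d) (𝓡 d) ∞
      (fun y : Model d × Model d => (oneChart d G).symm y.2) (oneChart d G 1, oneChart d G 1) :=
    ContMDiffAt.comp (oneChart d G 1, oneChart d G 1) contMDiffAt_oneChart_symm
      contDiffAt_snd.contMDiffAt
  exact ContDiffAt.oneChart_comp (h1.mul h2.inv) (by simp [oneChart_symm_one])

/-- The differential at the point with coordinates `a` of the right translation that takes this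
point to the identity. -/
def rightTranslation (d : ℕ) (G : Type*) [TopologicalSpace G] [ChartedSpace (Model d) G] [Group G]
    (a : Model d) : Model d →L[ℝ] Model d :=
  fderiv ℝ (fun b => chartDiv d G (b, a)) a

lemma contDiffAt_rightTranslation :
    ContDiffAt ℝ ∞ (rightTranslation d G) (oneChart d G 1) := by
  refine ContDiffAt.fderiv (n := ∞) (f := fun a b => chartDiv d G (b, a)) (g := fun a => a) ?_
    contDiffAt_id (by simp)
  exact contDiffAt_chartDiv.comp (f := fun z : Model d × Model d => (z.2, z.1))
    (oneChart d G 1, oneChart d G 1) (contDiffAt_snd.prodMk contDiffAt_fst)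

lemma rightTranslation_one :
    rightTranslation d G (oneChart d G 1) = ContinuousLinearMap.id ℝ (Model d) := by
  have : (fun b => chartDiv d G (b, oneChart d G 1)) =ᶠ[𝓝 (oneChart d G 1)] id := by
    filter_upwards [eventually_mem_target] with b hb
    simp [chartDiv, oneChart_symm_one, (oneChart d G).right_inv hb]
  rw [rightTranslation, this.fderiv_eq, fderiv_id]

variable {T Y : Type*} [NormedAddCommGroup T] [NormedSpace ℝ T] [NormedAddCommGroup Y]
  [NormedSpace ℝ Y] {F : T × Y → G} {t₀ : T} {y₀ : Y}

/-- The Maurer-Cartan form of a family of maps, on a constant vector. -/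
def partialMC (d : ℕ) {G : Type*} [TopologicalSpace G] [ChartedSpace (Model d) G] [Group G]
    {T Y : Type*} [NormedAddCommGroup T] [NormedSpace ℝ T] [NormedAddCommGroup Y]
    [NormedSpace ℝ Y] (F : T × Y → G) (u : Y) (x : T × Y) : LieAlg d G :=
  maurerCartan 𝓘(ℝ, Y) (fun y => F (x.1, y)) x.2 u

lemma contDiffAt_partialMC {x : T × Y} (hF : ContMDiffAt 𝓘(ℝ, T × Y) (𝓡 d) ∞ F x) (u : Y) :
    ContDiffAt (F := Model d) ℝ ∞ (partialMC d F u) x := by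
  refine contDiffAt_maurerCartan (f := fun (x : T × Y) y => F (x.1, y)) (g := fun x => x.2)
    (w := fun _ => u) ?_ contDiffAt_snd contDiffAt_const
  exact ContMDiffAt.comp (I' := 𝓘(ℝ, T × Y)) (g := F)
    (f := fun z : (T × Y) × Y => (z.1.1, z.2)) (x, x.2) hF
    ((contDiffAt_fst.fst).prodMk contDiffAt_snd).contMDiffAt

/-- The chain rule separates the translation to the identity, which depends on the value of the map
only, from the ordinary derivative in the chart. -/
lemma partialMC_eq_rightTranslation {x : T × Y} (hF : ContMDiffAt 𝓘(ℝ, T × Y) (𝓡 d) ∞ F x)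
    (hs : F x ∈ (oneChart d G).source)
    (hd : DifferentiableAt ℝ (chartDiv d G) (oneChart d G (F x), oneChart d G (F x)))
    (hf : DifferentiableAt ℝ (fun x => oneChart d G (F x)) x) (u : Y) :
    (partialMC d F u x : Model d) = rightTranslation d G (oneChart d G (F x))
      (fderiv ℝ (fun x => oneChart d G (F x)) x (0, u)) := by
  have hi : HasFDerivAt (fun y : Y => (x.1, y)) (ContinuousLinearMap.inr ℝ T Y) x.2 :=
    hasFDerivAt_prodMk_right x.1 x.2
  have hFx : ContMDiffAt 𝓘(ℝ, Y) (𝓡 d) ∞ (fun y => F (x.1, y)) x.2 :=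
    ContMDiffAt.comp (I' := 𝓘(ℝ, T × Y)) (g := F) x.2 hF
      (contDiffAt_const.prodMk contDiffAt_id).contMDiffAt
  refine (maurerCartan_eq (hFx.of_le (by simp)) u).trans ?_
  have h1 : (fun y => oneChart d G (F (x.1, y) * (F (x.1, x.2))⁻¹)) =ᶠ[𝓝 x.2] fun y =>
      chartDiv d G (oneChart d G (F (x.1, y)), oneChart d G (F x)) := by
    filter_upwards [hFx.continuousAt.eventually_mem ((oneChart d G).open_source.mem_nhds hs)] with y hy
    simp only [chartDiv]
    rw [(oneChart d G).left_inv hy, (oneChart d G).left_inv hs]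
  rw [h1.fderiv_eq]
  have h2 : HasFDerivAt (fun b => chartDiv d G (b, oneChart d G (F x)))
      (rightTranslation d G (oneChart d G (F x))) (oneChart d G (F x)) :=
    (hd.comp (f := fun b : Model d => (b, oneChart d G (F x))) (oneChart d G (F x))
      (by fun_prop)).hasFDerivAt
  have h3 : HasFDerivAt (fun y => oneChart d G (F (x.1, y)))
      ((fderiv ℝ (fun x => oneChart d G (F x)) x).comp (ContinuousLinearMap.inr ℝ T Y)) x.2 :=
    HasFDerivAt.comp (g := fun x => oneChart d G (F x)) x.2 hf.hasFDerivAt hi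
  have h4 := HasFDerivAt.comp (g := fun b => chartDiv d G (b, oneChart d G (F x)))
    (f := fun y => oneChart d G (F (x.1, y))) x.2 h2 h3
  refine (congrArg (fun L : Y →L[ℝ] Model d => L u) h4.fderiv).trans ?_
  simp

/-- The derivative of the Maurer-Cartan form of a family of maps with parameter `t`, at a parameter
where the map is constant. -/
lemma fderiv_partialMC (hF : ∀ᶠ x in 𝓝 (t₀, y₀), ContMDiffAt 𝓘(ℝ, T × Y) (𝓡 d) ∞ F x)
    (h1 : ∀ᶠ y in 𝓝 y₀, F (t₀, y) = 1) (u : Y) (e : T) :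
    fderiv (F := Model d) ℝ (partialMC d F u) (t₀, y₀) (e, 0) =
      fderiv ℝ (fun y => fderiv ℝ (fun x => oneChart d G (F x)) (t₀, y) (e, 0)) y₀ u := by
  set f : T × Y → Model d := fun x => oneChart d G (F x) with hf
  have hF1 : F (t₀, y₀) = 1 := h1.self_of_nhds
  have hf0 : ContDiffAt ℝ ∞ f (t₀, y₀) := ContDiffAt.oneChart_comp hF.self_of_nhds hF1
  have hf0' : ContDiffAt ℝ 1 f (t₀, y₀) := hf0.of_le (by simp)
  have hfe : f (t₀, y₀) = oneChart d G 1 := by rw [hf]; simp only [hF1]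
  have hmem : ∀ᶠ x in 𝓝 (t₀, y₀), F x ∈ (oneChart d G).source :=
    eventually_oneChart_symm_mem hF.self_of_nhds.continuousAt hF1
  have hdiv : ∀ᶠ x in 𝓝 (t₀, y₀), DifferentiableAt ℝ (chartDiv d G) (f x, f x) := by
    have h2 : ∀ᶠ z in 𝓝 (f (t₀, y₀), f (t₀, y₀)), DifferentiableAt ℝ (chartDiv d G) z := by
      rw [hfe]
      have := (contDiffAt_chartDiv (d := d) (G := G)).of_le (m := 1) (by simp)
      exact (this.eventually (by simp)).mono fun z hz => hz.differentiableAt (by simp)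
    exact (hf0.continuousAt.prodMk hf0.continuousAt).eventually h2
  have hfd : ∀ᶠ x in 𝓝 (t₀, y₀), DifferentiableAt ℝ f x :=
    (hf0'.eventually (by simp)).mono fun z hz => hz.differentiableAt (by simp)
  have hv : partialMC d F u =ᶠ[𝓝 (t₀, y₀)] fun x => rightTranslation d G (f x) (fderiv ℝ f x (0, u)) := by
    filter_upwards [hF, hmem, hdiv, hfd] with x a b c e
    exact partialMC_eq_rightTranslation a b c e u
  have hv' : fderiv (F := Model d) ℝ (partialMC d F u) (t₀, y₀) =
      fderiv ℝ (fun x => rightTranslation d G (f x) (fderiv ℝ f x (0, u))) (t₀, y₀) :=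
    Filter.EventuallyEq.fderiv_eq (F := Model d) hv
  rw [hv']
  have hD : HasFDerivAt (fderiv ℝ f) (fderiv ℝ (fderiv ℝ f) (t₀, y₀)) (t₀, y₀) :=
    ((hf0.fderiv_right (m := ∞) (by simp)).differentiableAt (by simp)).hasFDerivAt
  have hR : DifferentiableAt ℝ (fun x => rightTranslation d G (f x)) (t₀, y₀) := by
    have h2 : DifferentiableAt ℝ (rightTranslation d G) (f (t₀, y₀)) := by
      rw [hfe]
      exact contDiffAt_rightTranslation.differentiableAt (by simp)
    exact h2.comp (t₀, y₀) (hf0.differentiableAt (by simp))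
  have hi : HasFDerivAt (fun y : Y => (t₀, y)) (ContinuousLinearMap.inr ℝ T Y) y₀ :=
    hasFDerivAt_prodMk_right t₀ y₀
  -- Since the map is constant at the parameter `t₀`, the variation of the translation drops out,
  -- and only the mixed second derivative of the map in the chart is left.
  have h0 : fderiv ℝ f (t₀, y₀) (0, u) = 0 := by
    have h2 : HasFDerivAt (fun y => f (t₀, y))
        ((fderiv ℝ f (t₀, y₀)).comp (ContinuousLinearMap.inr ℝ T Y)) y₀ :=
      HasFDerivAt.comp (g := f) y₀ hfd.self_of_nhds.hasFDerivAt hi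
    have h3 : (fun y => f (t₀, y)) =ᶠ[𝓝 y₀] fun _ => oneChart d G 1 :=
      h1.mono fun y hy => by simp only [hf, hy]
    have h4 := h2.fderiv
    rw [h3.fderiv_eq, fderiv_fun_const] at h4
    exact (congrArg (fun L : Y →L[ℝ] Model d => L u) h4).symm
  have h5 := hR.hasFDerivAt.clm_apply (hD.clm_apply (hasFDerivAt_const ((0 : T), u) (t₀, y₀)))
  rw [h5.fderiv]
  have h6 : HasFDerivAt (fun y => fderiv ℝ f (t₀, y))
      ((fderiv ℝ (fderiv ℝ f) (t₀, y₀)).comp (ContinuousLinearMap.inr ℝ T Y)) y₀ :=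
    HasFDerivAt.comp (g := fderiv ℝ f) y₀ hD hi
  rw [(h6.clm_apply (hasFDerivAt_const (e, (0 : Y)) y₀)).fderiv]
  have hsymm : IsSymmSndFDerivAt ℝ f (t₀, y₀) :=
    hf0.isSymmSndFDerivAt (by simp; exact WithTop.coe_le_coe.2 (le_top : (2:ℕ∞) ≤ ⊤))
  simp [h0, hfe, rightTranslation_one, hsymm.eq (e, 0) (0, u)]

lemma partialMC_eq_zero {t : T} {y : Y} (h1 : ∀ᶠ y' in 𝓝 y, F (t, y') = F (t, y)) (u : Y) :
    partialMC d F u (t, y) = 0 := by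
  have hF : ContMDiffAt 𝓘(ℝ, Y) (𝓡 d) 1 (fun y' => F (t, y')) y :=
    contMDiffAt_const.congr_of_eventuallyEq h1
  refine (maurerCartan_eq hF u).trans ?_
  have h2 : (fun y' => oneChart d G (F (t, y') * (F (t, y))⁻¹)) =ᶠ[𝓝 y] fun _ => oneChart d G 1 :=
    h1.mono fun y' hy' => by simp only [hy', mul_inv_cancel]
  rw [h2.fderiv_eq, fderiv_fun_const]
  rfl

end Translation

/-! ### The differentials of the local simplices at the identity -/

section SimplexDerivative

variable {d : ℕ} {G : Type*} [TopologicalSpace G] [ChartedSpace (Model d) G] [Group G]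

/-- The differential at `1` of the local simplex `σ_q` in the `c`-th group element, with the other
group elements equal to `1`. -/
def simplexDeriv (d : ℕ) {G : Type*} [TopologicalSpace G] [ChartedSpace (Model d) G] [Group G]
    (σ : ∀ l : ℕ, (Fin l → G) → (Fin l → ℝ) → G) (q : ℕ) (c : Fin q) (s : Fin q → ℝ) :
    Model d →L[ℝ] Model d :=
  fderiv ℝ (fun x => oneChart d G (σ q (Function.update (fun _ => 1) c ((oneChart d G).symm x)) s))
    (oneChart d G 1)

variable [LieGroup (𝓡 d) ∞ G] {σ : ∀ l : ℕ, (Fin l → G) → (Fin l → ℝ) → G}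

lemma eventually_contDiffAt_oneChart_comp {E : Type*} [NormedAddCommGroup E] [NormedSpace ℝ E]
    {F : E → G} {x : E} (hF : ∀ᶠ y in 𝓝 x, ContMDiffAt 𝓘(ℝ, E) (𝓡 d) ∞ F y) (h : F x = 1) :
    ∀ᶠ y in 𝓝 x, ContDiffAt ℝ ∞ (fun y => oneChart d G (F y)) y := by
  filter_upwards [hF, eventually_oneChart_symm_mem (d := d) hF.self_of_nhds.continuousAt h]
    with y hy hy'
  have h1 : ContMDiffAt (𝓡 d) 𝓘(ℝ, Model d) ∞ (oneChart d G) (F y) :=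
    (contMDiffOn_chart (I := 𝓡 d) (n := ∞) (x := (1 : G))).contMDiffAt
      ((oneChart d G).open_source.mem_nhds hy')
  exact (h1.comp y hy).contDiffAt

namespace IsLocalSimplexFamily

lemma eventually_contMDiffAt (hσ : IsLocalSimplexFamily (d := d) σ) {q : ℕ} {s : Fin q → ℝ}
    (hs : s ∈ simplex q) : ∀ᶠ x in 𝓝 ((fun _ => oneChart d G 1 : Fin q → Model d), s),
      ContMDiffAt 𝓘(ℝ, (Fin q → Model d) × (Fin q → ℝ)) (𝓡 d) ∞
        (fun x : (Fin q → Model d) × (Fin q → ℝ) =>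
          σ q (fun i => (oneChart d G).symm (x.1 i)) x.2) x := by
  obtain ⟨W, hW, V, hV, hVs, h⟩ := hσ.smooth q
  have : (W ×ˢ V) ∈ 𝓝 ((fun _ => oneChart d G 1 : Fin q → Model d), s) :=
    prod_mem_nhds hW (hV.mem_nhds (hVs hs))
  filter_upwards [eventually_mem_nhds_iff.2 this] with x hx
  exact h.contMDiffAt hx

lemma comp_chart_symm_one (hσ : IsLocalSimplexFamily (d := d) σ) {q : ℕ} {s : Fin q → ℝ}
    (hs : s ∈ simplex q) : σ q (fun _ => (oneChart d G).symm (oneChart d G 1)) s = 1 := by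
  simp only [oneChart_symm_one]
  exact hσ.one q s hs

lemma update_eq {q : ℕ} (c : Fin q) (x : Model d) :
    (fun i => (oneChart d G).symm (Function.update (fun _ => oneChart d G 1) c x i)) =
      Function.update (fun _ => (1 : G)) c ((oneChart d G).symm x) := by
  funext i
  by_cases hi : i = c
  · subst hi; simp
  · simp [hi, oneChart_symm_one]

lemma eventually_contDiffAt_chart (hσ : IsLocalSimplexFamily (d := d) σ) {q : ℕ} {s : Fin q → ℝ}
    (hs : s ∈ simplex q) (c : Fin q) : ∀ᶠ y in 𝓝 (s, oneChart d G 1),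
      ContDiffAt ℝ ∞ (fun y : (Fin q → ℝ) × Model d =>
        oneChart d G (σ q (Function.update (fun _ => 1) c ((oneChart d G).symm y.2)) y.1)) y := by
  have hc : ContDiff ℝ ∞ (fun y : (Fin q → ℝ) × Model d =>
      (Function.update (fun _ => oneChart d G 1 : Fin q → Model d) c y.2, y.1)) := by
    refine ContDiff.prodMk (contDiff_pi.2 fun i => ?_) contDiff_fst
    by_cases hi : i = c
    · subst hi; simpa using contDiff_snd
    · simpa [hi] using contDiff_const
  have ht : Filter.Tendsto (fun y : (Fin q → ℝ) × Model d =>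
      (Function.update (fun _ => oneChart d G 1 : Fin q → Model d) c y.2, y.1))
      (𝓝 (s, oneChart d G 1)) (𝓝 ((fun _ => oneChart d G 1), s)) := by
    have := hc.continuous.tendsto (s, oneChart d G 1)
    simpa using this
  filter_upwards [ht.eventually (eventually_contDiffAt_oneChart_comp (hσ.eventually_contMDiffAt hs)
    (hσ.comp_chart_symm_one hs))] with y hy
  have := hy.comp y hc.contDiffAt
  refine this.congr_of_eventuallyEq (Filter.Eventually.of_forall fun z => ?_)
  simp only [Function.comp_apply, update_eq]

lemma eventually_contDiffAt_simplexDeriv (hσ : IsLocalSimplexFamily (d := d) σ) {q : ℕ}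
    {s : Fin q → ℝ} (hs : s ∈ simplex q) (c : Fin q) :
    ∀ᶠ s' in 𝓝 s, ContDiffAt ℝ ∞ (simplexDeriv d σ q c) s' := by
  have ht : Filter.Tendsto (fun s' : Fin q → ℝ => (s', oneChart d G 1)) (𝓝 s)
      (𝓝 (s, oneChart d G 1)) := (by fun_prop : Continuous fun s' : Fin q → ℝ =>
        (s', oneChart d G 1)).tendsto s
  filter_upwards [ht.eventually (hσ.eventually_contDiffAt_chart hs c)] with s' hs'
  exact ContDiffAt.fderiv (n := ∞) (f := fun s x =>
    oneChart d G (σ q (Function.update (fun _ => 1) c ((oneChart d G).symm x)) s))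
    (g := fun _ => oneChart d G 1) hs' contDiffAt_const (by simp)

lemma tendsto_update (q : ℕ) (c : Fin q) : Filter.Tendsto
    (fun x => Function.update (fun _ : Fin q => (1 : G)) c ((oneChart d G).symm x))
    (𝓝 (oneChart d G 1)) (𝓝 (fun _ => 1)) := by
  have h : Filter.Tendsto (oneChart d G).symm (𝓝 (oneChart d G 1)) (𝓝 1) := by
    have := (contMDiffAt_oneChart_symm (d := d) (G := G)).continuousAt.tendsto
    rwa [oneChart_symm_one] at this
  refine tendsto_pi_nhds.2 fun i => ?_
  by_cases hi : i = c
  · subst hi; simpa using h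
  · simpa [hi] using tendsto_const_nhds

/-- The face relations are differentiated with a single group element different from `1`. Then the
left translation in the slanted face acts only through the first element, the last face forgets the
last element, and a face with the product g_j g_{j+1} cannot tell which of its two factors is the
nontrivial one. -/
theorem isSimplexFamily (hσ : IsLocalSimplexFamily (d := d) σ) :
    IsSimplexFamily (simplexDeriv d σ) where
  smooth q c s hs := (hσ.eventually_contDiffAt_simplexDeriv hs c).self_of_nhds
  face_zero_zero q s hs := by
    rw [← fderiv_id (𝕜 := ℝ) (x := oneChart d G 1)]
    refine Filter.EventuallyEq.fderiv_eq ?_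
    filter_upwards [(tendsto_update (q + 1) 0).eventually (hσ.face_zero q), eventually_mem_target]
      with x hx hx'
    rw [hx s hs]
    have : Fin.tail (Function.update (fun _ : Fin (q + 1) => (1 : G)) 0 ((oneChart d G).symm x)) =
        fun _ => 1 := by
      funext i
      simp [Fin.tail]
    rw [this, hσ.one q s hs]
    simp [(oneChart d G).right_inv hx']
  face_zero_succ q s hs i := by
    refine Filter.EventuallyEq.fderiv_eq ?_
    filter_upwards [(tendsto_update (q + 1) i.succ).eventually (hσ.face_zero q)] with x hx
    rw [hx s hs]
    have : Fin.tail (Function.update (fun _ : Fin (q + 1) => (1 : G)) i.succ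
        ((oneChart d G).symm x)) = Function.update (fun _ => 1) i ((oneChart d G).symm x) := by
      rw [Fin.tail_update_succ]; rfl
    rw [this]
    simp [Function.update_of_ne (Fin.succ_ne_zero i).symm]
  face_last q s hs := by
    rw [← fderiv_const_apply (𝕜 := ℝ) (x := oneChart d G 1) (oneChart d G 1)]
    refine Filter.EventuallyEq.fderiv_eq ?_
    filter_upwards [(tendsto_update (q + 1) (Fin.last q)).eventually (hσ.face_succ q)] with x hx
    rw [hx s hs (Fin.last q)]
    have : Fin.contractNth (Fin.last q) (· * ·) (Function.update (fun _ : Fin (q + 1) => (1 : G))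
        (Fin.last q) ((oneChart d G).symm x)) = fun _ => 1 := by
      funext i
      rw [Fin.contractNth_apply_of_lt _ _ _ _ (by simp)]
      simp [(Fin.castSucc_lt_last i).ne]
    rw [this, hσ.one q s hs]
  face_castSucc q s hs j := by
    refine Filter.EventuallyEq.fderiv_eq ?_
    filter_upwards [(tendsto_update (q + 1) j.castSucc).eventually (hσ.face_succ q),
      (tendsto_update (q + 1) j.succ).eventually (hσ.face_succ q)] with x hx hx'
    rw [hx s hs j.castSucc, hx' s hs j.castSucc]
    congr 2
    funext i
    rcases lt_trichotomy i j with h | h | h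
    · rw [Fin.contractNth_apply_of_lt _ _ _ _ (by simpa using h),
        Fin.contractNth_apply_of_lt _ _ _ _ (by simpa using h)]
      have h1 : i.castSucc ≠ j.castSucc := fun h' => h.ne (Fin.castSucc_injective _ h')
      have h2 : i.castSucc ≠ j.succ := (Fin.castSucc_lt_succ_iff.2 h.le).ne
      simp [h1, h2]
    · subst h
      rw [Fin.contractNth_apply_of_eq _ _ _ _ (by simp), Fin.contractNth_apply_of_eq _ _ _ _ (by simp)]
      have h1 : i.castSucc ≠ i.succ := Fin.castSucc_lt_succ.ne
      simp [h1, h1.symm]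
    · rw [Fin.contractNth_apply_of_gt _ _ _ _ (by simpa using h),
        Fin.contractNth_apply_of_gt _ _ _ _ (by simpa using h)]
      have h1 : i.succ ≠ j.castSucc := (Fin.castSucc_lt_succ_iff.2 h.le).ne'
      have h2 : i.succ ≠ j.succ := fun h' => h.ne' (Fin.succ_injective _ h')
      simp [h1, h2]

end IsLocalSimplexFamily

end SimplexDerivative

/-! ### The maps f_{m,q} along curves in the gauge group -/

section GaugeMap

variable {d k N m q : ℕ} {G : Type*} [TopologicalSpace G] [ChartedSpace (Model d) G] [Group G]
  {X : Type*} [TopologicalSpace X] [ChartedSpace (Model k) X]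

/-- The curve `γ` in the gauge group, in a chart of `X`. -/
def gaugeCurve (γ : ℝ → X → G) (x₀ : X) (r : ℝ) (z : Model k) : G :=
  γ r ((chartAt (Model k) x₀).symm z)

/-- The map `f_{m,q}` at the group elements `γ_i(t_i)(x)`, with `x` in a chart of `X`. -/
def gaugeMap (σ : ∀ l : ℕ, (Fin l → G) → (Fin l → ℝ) → G) (h : m + q = N) (γ : Fin N → ℝ → X → G)
    (x₀ : X) (j : Fin (m + 1)) (x : (Fin N → ℝ) × (Model k × (Fin q → ℝ))) : G :=
  faceMap σ h (fun i => gaugeCurve (γ i) x₀ (x.1 i) x.2.1) x.2.2 j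

lemma gaugeMap_castSucc (σ : ∀ l : ℕ, (Fin l → G) → (Fin l → ℝ) → G) (h : m + q = N)
    (γ : Fin N → ℝ → X → G) (x₀ : X) (j : Fin m) (x : (Fin N → ℝ) × (Model k × (Fin q → ℝ))) :
    gaugeMap σ h γ x₀ j.castSucc x = gaugeCurve (γ (Fin.cast h (Fin.castAdd q j))) x₀
      (x.1 (Fin.cast h (Fin.castAdd q j))) x.2.1 := by
  simp [gaugeMap, faceMap]

lemma gaugeMap_last (σ : ∀ l : ℕ, (Fin l → G) → (Fin l → ℝ) → G) (h : m + q = N)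
    (γ : Fin N → ℝ → X → G) (x₀ : X) (x : (Fin N → ℝ) × (Model k × (Fin q → ℝ))) :
    gaugeMap σ h γ x₀ (Fin.last m) x = σ q (fun c => gaugeCurve (γ (Fin.cast h (Fin.natAdd m c))) x₀
      (x.1 (Fin.cast h (Fin.natAdd m c))) x.2.1) x.2.2 := by
  simp [gaugeMap, faceMap]

variable [LieGroup (𝓡 d) ∞ G] [IsManifold (𝓡 k) ∞ X]
  {σ : ∀ l : ℕ, (Fin l → G) → (Fin l → ℝ) → G}
  {γ : Fin N → ℝ → X → G} {ξ : Fin N → X → LieAlg d G} {x₀ : X}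

namespace IsGaugeCurve

variable {γ : ℝ → X → G} {ξ : X → LieAlg d G}

lemma contMDiffAt_gaugeCurve (hγ : IsGaugeCurve (d := d) (k := k) γ ξ) (x₀ : X) {z : Model k}
    (hz : z ∈ (chartAt (Model k) x₀).target) (r : ℝ) :
    ContMDiffAt 𝓘(ℝ, ℝ × Model k) (𝓡 d) ∞ (fun y : ℝ × Model k => gaugeCurve γ x₀ y.1 y.2) (r, z) := by
  have h1 : ContMDiffAt 𝓘(ℝ, ℝ × Model k) (𝓡 k) ∞
      (fun y : ℝ × Model k => (chartAt (Model k) x₀).symm y.2) (r, z) :=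
    ContMDiffAt.comp (I' := 𝓡 k) (r, z)
      ((contMDiffOn_chart_symm (I := 𝓡 k) (n := ∞) (x := x₀)).contMDiffAt
        ((chartAt (Model k) x₀).open_target.mem_nhds hz)) contDiffAt_snd.contMDiffAt
  have h2 : ContMDiffAt 𝓘(ℝ, ℝ × Model k) 𝓘(ℝ, ℝ) ∞ (fun y : ℝ × Model k => y.1) (r, z) :=
    contDiffAt_fst.contMDiffAt
  exact ContMDiffAt.comp (I' := (𝓘(ℝ, ℝ).prod (𝓡 k))) (g := fun y : ℝ × X => γ y.1 y.2)
    (f := fun y : ℝ × Model k => (y.1, (chartAt (Model k) x₀).symm y.2)) (r, z)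
    hγ.1.contMDiffAt (h2.prodMk h1)

lemma gaugeCurve_zero (hγ : IsGaugeCurve (d := d) (k := k) γ ξ) (x₀ : X) (z : Model k) :
    gaugeCurve γ x₀ 0 z = 1 := hγ.2.1 _

lemma hasDerivAt_gaugeCurve (hγ : IsGaugeCurve (d := d) (k := k) γ ξ) (x₀ : X) {z : Model k}
    (hz : z ∈ (chartAt (Model k) x₀).target) :
    HasDerivAt (fun r => oneChart d G (gaugeCurve γ x₀ r z)) (inChart x₀ ξ z) 0 := by
  have hs : ContMDiffAt 𝓘(ℝ, ℝ) (𝓡 d) ∞ (fun r => gaugeCurve γ x₀ r z) 0 :=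
    ContMDiffAt.comp (I' := 𝓘(ℝ, ℝ × Model k)) (g := fun y : ℝ × Model k => gaugeCurve γ x₀ y.1 y.2)
      (f := fun r : ℝ => (r, z)) 0 (hγ.contMDiffAt_gaugeCurve x₀ hz 0)
      (contDiffAt_id.prodMk contDiffAt_const).contMDiffAt
  have h1 := hγ.2.2 ((chartAt (Model k) x₀).symm z)
  have h2 := (maurerCartan_eq (hs.of_le (by simp)) (1 : ℝ)).symm.trans h1
  simp only [hγ.gaugeCurve_zero x₀ z, inv_one, mul_one] at h2
  have h3 := ((ContDiffAt.oneChart_comp hs (hγ.gaugeCurve_zero x₀ z)).differentiableAt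
    (by simp)).hasFDerivAt.hasDerivAt
  rwa [h2] at h3

end IsGaugeCurve

lemma contMDiffAt_gaugeCurve_apply (hγ : ∀ i, IsGaugeCurve (d := d) (k := k) (γ i) (ξ i)) (i : Fin N)
    {x : (Fin N → ℝ) × (Model k × (Fin q → ℝ))} (hx : x.2.1 ∈ (chartAt (Model k) x₀).target) :
    ContMDiffAt 𝓘(ℝ, (Fin N → ℝ) × (Model k × (Fin q → ℝ))) (𝓡 d) ∞
      (fun x : (Fin N → ℝ) × (Model k × (Fin q → ℝ)) => gaugeCurve (γ i) x₀ (x.1 i) x.2.1) x :=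
  ContMDiffAt.comp (I' := 𝓘(ℝ, ℝ × Model k))
    (g := fun y : ℝ × Model k => gaugeCurve (γ i) x₀ y.1 y.2)
    (f := fun x : (Fin N → ℝ) × (Model k × (Fin q → ℝ)) => (x.1 i, x.2.1)) x
    ((hγ i).contMDiffAt_gaugeCurve x₀ hx _) (by fun_prop : ContDiff ℝ ∞
      fun x : (Fin N → ℝ) × (Model k × (Fin q → ℝ)) => (x.1 i, x.2.1)).contDiffAt.contMDiffAt

lemma gaugeMap_zero (hσ : IsLocalSimplexFamily (d := d) σ)
    (hγ : ∀ i, IsGaugeCurve (d := d) (k := k) (γ i) (ξ i)) (h : m + q = N) (x₀ : X) (z : Model k)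
    {s : Fin q → ℝ} (hs : s ∈ simplex q) (j : Fin (m + 1)) :
    gaugeMap σ h γ x₀ j (0, (z, s)) = 1 := by
  induction j using Fin.lastCases with
  | last =>
    rw [gaugeMap_last]
    simp only [Pi.zero_apply, (hγ _).gaugeCurve_zero]
    exact hσ.one q s hs
  | cast j =>
    rw [gaugeMap_castSucc]
    exact (hγ _).gaugeCurve_zero _ _

lemma eventually_contMDiffAt_gaugeMap (hσ : IsLocalSimplexFamily (d := d) σ)
    (hγ : ∀ i, IsGaugeCurve (d := d) (k := k) (γ i) (ξ i)) (h : m + q = N) {z : Model k}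
    (hz : z ∈ (chartAt (Model k) x₀).target) {s : Fin q → ℝ} (hs : s ∈ simplex q) :
    ∀ᶠ x in 𝓝 (0, (z, s)), ∀ j, ContMDiffAt 𝓘(ℝ, (Fin N → ℝ) × (Model k × (Fin q → ℝ))) (𝓡 d) ∞
      (gaugeMap σ h γ x₀ j) x := by
  have hc2 : Continuous fun x : (Fin N → ℝ) × (Model k × (Fin q → ℝ)) => x.2.1 := by fun_prop
  have hT : ∀ᶠ x : (Fin N → ℝ) × (Model k × (Fin q → ℝ)) in 𝓝 (0, (z, s)),
      x.2.1 ∈ (chartAt (Model k) x₀).target :=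
    hc2.continuousAt.eventually_mem ((chartAt (Model k) x₀).open_target.mem_nhds hz)
  have h1 : ∀ i, gaugeCurve (γ i) x₀ ((0 : Fin N → ℝ) i) z = 1 := fun i =>
    (hγ i).gaugeCurve_zero _ _
  have hS : ∀ᶠ x : (Fin N → ℝ) × (Model k × (Fin q → ℝ)) in 𝓝 (0, (z, s)), ∀ i,
      gaugeCurve (γ i) x₀ (x.1 i) x.2.1 ∈ (oneChart d G).source :=
    Filter.eventually_all.2 fun i => eventually_oneChart_symm_mem (d := d)
      (contMDiffAt_gaugeCurve_apply (q := q) hγ i (x := (0, (z, s))) hz).continuousAt (h1 i)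
  have hL : ∀ᶠ x : (Fin N → ℝ) × (Model k × (Fin q → ℝ)) in 𝓝 (0, (z, s)), ∀ i,
      ContDiffAt ℝ ∞ (fun x : (Fin N → ℝ) × (Model k × (Fin q → ℝ)) =>
        oneChart d G (gaugeCurve (γ i) x₀ (x.1 i) x.2.1)) x :=
    Filter.eventually_all.2 fun i => eventually_contDiffAt_oneChart_comp
      (hT.mono fun x hx => contMDiffAt_gaugeCurve_apply hγ i hx) (h1 i)
  let L : (Fin N → ℝ) × (Model k × (Fin q → ℝ)) → (Fin q → Model d) × (Fin q → ℝ) := fun x =>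
    (fun c => oneChart d G (gaugeCurve (γ (Fin.cast h (Fin.natAdd m c))) x₀
      (x.1 (Fin.cast h (Fin.natAdd m c))) x.2.1), x.2.2)
  have hLd : ∀ᶠ x in 𝓝 (0, (z, s)), ContDiffAt ℝ ∞ L x := hL.mono fun x hx =>
    (contDiffAt_pi.2 fun c => hx _).prodMk (by fun_prop)
  have hLt : Filter.Tendsto L (𝓝 (0, (z, s))) (𝓝 ((fun _ => oneChart d G 1), s)) := by
    have := hLd.self_of_nhds.continuousAt.tendsto
    simpa only [L, h1] using this
  filter_upwards [hT, hS.eventually_nhds, hLd, hLt.eventually (hσ.eventually_contMDiffAt hs)]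
    with x hx1 hx2 hx3 hx4 j
  induction j using Fin.lastCases with
  | last =>
    refine (ContMDiffAt.comp (I' := 𝓘(ℝ, (Fin q → Model d) × (Fin q → ℝ))) x hx4
      hx3.contMDiffAt).congr_of_eventuallyEq ?_
    filter_upwards [hx2] with y hy
    rw [gaugeMap_last]
    simp only [Function.comp_apply, L, (oneChart d G).left_inv (hy _)]
  | cast j =>
    refine (contMDiffAt_gaugeCurve_apply hγ (Fin.cast h (Fin.castAdd q j)) hx1).congr_of_eventuallyEq
      (Filter.Eventually.of_forall fun y => gaugeMap_castSucc σ h γ x₀ j y)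

/-- The derivative of the map `f_{m,q}` at `1` in the `i`-th group element. -/
def gaugeMapDeriv (σ : ∀ l : ℕ, (Fin l → G) → (Fin l → ℝ) → G) (ξ : Fin (m + q) → X → LieAlg d G)
    (x₀ : X) (i : Fin (m + q)) (y : Model k × (Fin q → ℝ)) : Fin (m + 1) → Model d :=
  Fin.addCases (motive := fun _ => Fin (m + 1) → Model d)
    (fun b => Pi.single b.castSucc (inChart x₀ (ξ (Fin.castAdd q b)) y.1))
    (fun c => Pi.single (Fin.last m) (simplexDeriv d σ q c y.2 (inChart x₀ (ξ (Fin.natAdd m c)) y.1))) i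

/-- On a coordinate line of the parameters a single group element varies. It is either one of the
first `m` components, with velocity `ξ`, or a single argument of the local simplex. -/
lemma fderiv_gaugeMap (hσ : IsLocalSimplexFamily (d := d) σ) {γ : Fin (m + q) → ℝ → X → G}
    {ξ : Fin (m + q) → X → LieAlg d G}
    (hγ : ∀ i, IsGaugeCurve (d := d) (k := k) (γ i) (ξ i)) {z : Model k}
    (hz : z ∈ (chartAt (Model k) x₀).target) {s : Fin q → ℝ} (hs : s ∈ simplex q)
    (i : Fin (m + q)) (j : Fin (m + 1)) :
    fderiv ℝ (fun x => oneChart d G (gaugeMap σ rfl γ x₀ j x)) (0, (z, s)) (Pi.single i 1, 0) =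
      gaugeMapDeriv σ ξ x₀ i (z, s) j := by
  have hd : DifferentiableAt ℝ (fun x => oneChart d G (gaugeMap σ rfl γ x₀ j x)) (0, (z, s)) :=
    (ContDiffAt.oneChart_comp ((eventually_contMDiffAt_gaugeMap hσ hγ rfl hz hs).self_of_nhds j)
      (gaugeMap_zero hσ hγ rfl x₀ z hs j)).differentiableAt (by simp)
  have hline : HasDerivAt (fun r : ℝ => ((Pi.single i r, (z, s)) :
      (Fin (m + q) → ℝ) × (Model k × (Fin q → ℝ)))) (Pi.single i 1, 0) 0 := by
    refine HasDerivAt.prodMk ?_ (hasDerivAt_const _ _)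
    exact hasDerivAt_pi.2 fun i' => by
      by_cases hi : i' = i
      · subst hi; simpa using hasDerivAt_id' (0 : ℝ)
      · simpa [hi] using hasDerivAt_const (0 : ℝ) (0 : ℝ)
  have h0 : ((Pi.single i (0 : ℝ), (z, s)) : (Fin (m + q) → ℝ) × (Model k × (Fin q → ℝ))) =
      (0, (z, s)) := by simp
  have hcomp := HasFDerivAt.comp_hasDerivAt (x := (0 : ℝ))
    (f := fun r : ℝ => ((Pi.single i r, (z, s)) : (Fin (m + q) → ℝ) × (Model k × (Fin q → ℝ))))
    (by rw [h0]; exact hd.hasFDerivAt) hline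
  refine hcomp.unique ?_
  have hone : ∀ i' r, i' ≠ i → gaugeCurve (γ i') x₀ ((Pi.single i r : Fin (m + q) → ℝ) i') z = 1 :=
    fun i' r hi => by rw [Pi.single_eq_of_ne hi]; exact (hγ i').gaugeCurve_zero _ _
  induction j using Fin.lastCases with
  | last =>
    induction i using Fin.addCases with
    | left b =>
      have : ((fun x => oneChart d G (gaugeMap σ rfl γ x₀ (Fin.last m) x)) ∘ fun r : ℝ =>
          ((Pi.single (Fin.castAdd q b) r, (z, s)) : (Fin (m + q) → ℝ) × (Model k × (Fin q → ℝ)))) =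
          fun _ => oneChart d G 1 := by
        funext r
        simp only [Function.comp_apply, gaugeMap_last, Fin.cast_eq_self]
        congr 1
        refine Eq.trans ?_ (hσ.one q s hs)
        congr 1
        funext c
        exact hone _ r fun h => by simp [Fin.ext_iff] at h; omega
      rw [this]
      simpa [gaugeMapDeriv] using hasDerivAt_const (0 : ℝ) (oneChart d G 1)
    | right c =>
      have hcurve := (hγ (Fin.natAdd m c)).hasDerivAt_gaugeCurve x₀ hz
      have hc1 := (hγ (Fin.natAdd m c)).gaugeCurve_zero x₀ z
      have hl : HasFDerivAt (fun x => oneChart d G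
          (σ q (Function.update (fun _ => 1) c ((oneChart d G).symm x)) s)) (simplexDeriv d σ q c s)
          (oneChart d G (gaugeCurve (γ (Fin.natAdd m c)) x₀ 0 z)) := by
        rw [hc1]
        exact (((hσ.eventually_contDiffAt_chart hs c).self_of_nhds.comp
          (f := fun x : Model d => (s, x)) (oneChart d G 1)
          (contDiffAt_const.prodMk contDiffAt_id)).differentiableAt (by simp)).hasFDerivAt
      have hcont : ContinuousAt (fun r => gaugeCurve (γ (Fin.natAdd m c)) x₀ r z) 0 :=
        ContinuousAt.comp (g := fun y : ℝ × Model k => gaugeCurve (γ (Fin.natAdd m c)) x₀ y.1 y.2)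
          (f := fun r : ℝ => (r, z)) ((hγ (Fin.natAdd m c)).contMDiffAt_gaugeCurve x₀ hz 0).continuousAt
          (by fun_prop)
      have hcomp' := hl.comp_hasDerivAt (0 : ℝ) hcurve
      have hval : gaugeMapDeriv σ ξ x₀ (Fin.natAdd m c) (z, s) (Fin.last m) =
          simplexDeriv d σ q c s (inChart x₀ (ξ (Fin.natAdd m c)) z) := by
        simp [gaugeMapDeriv]
      rw [hval]
      refine hcomp'.congr_of_eventuallyEq ?_
      filter_upwards [eventually_oneChart_symm_mem (d := d) hcont hc1] with r hr
      simp only [Function.comp_apply, gaugeMap_last, Fin.cast_eq_self, (oneChart d G).left_inv hr]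
      congr 2
      funext c'
      by_cases hc : c' = c
      · subst hc; simp
      · rw [Function.update_of_ne hc]
        exact hone _ r fun h => hc (by simpa using h)
  | cast j =>
    have hf : ∀ r : ℝ, ((fun x => oneChart d G (gaugeMap σ rfl γ x₀ j.castSucc x)) ∘ fun r : ℝ =>
        ((Pi.single i r, (z, s)) : (Fin (m + q) → ℝ) × (Model k × (Fin q → ℝ)))) r =
        oneChart d G (gaugeCurve (γ (Fin.castAdd q j)) x₀
          ((Pi.single i r : Fin (m + q) → ℝ) (Fin.castAdd q j)) z) := fun r => by
      simp only [Function.comp_apply, gaugeMap_castSucc, Fin.cast_eq_self]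
    rw [funext hf]
    by_cases hi : Fin.castAdd q j = i
    · subst hi
      simpa [gaugeMapDeriv] using (hγ (Fin.castAdd q j)).hasDerivAt_gaugeCurve x₀ hz
    · have hval : gaugeMapDeriv σ ξ x₀ i (z, s) j.castSucc = 0 := by
        induction i using Fin.addCases with
        | left b =>
          have : j.castSucc ≠ b.castSucc := fun h => hi (by rw [Fin.castSucc_injective _ h])
          simp [gaugeMapDeriv, this]
        | right c => simp [gaugeMapDeriv, (Fin.castSucc_lt_last j).ne]
      rw [hval]
      simp only [hone _ _ hi]
      exact hasDerivAt_const _ _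

end GaugeMap

/-! ### Density of the interior of the simplex -/

section SimplexClosure

lemma nonempty_interior_simplex (q : ℕ) : (interior (simplex q)).Nonempty := by
  have ho : IsOpen {t : Fin q → ℝ | (∀ i, 0 < t i) ∧ ∑ i, t i < 1} := by
    have h1 : IsOpen {t : Fin q → ℝ | ∑ i, t i < 1} :=
      isOpen_lt (continuous_finsetSum _ fun i _ => continuous_apply i) continuous_const
    have h2 : IsOpen (⋂ i, {t : Fin q → ℝ | 0 < t i}) :=
      isOpen_iInter_of_finite fun i => isOpen_lt continuous_const (continuous_apply i)
    convert h2.inter h1 using 1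
    ext t
    simp
  have hsub : {t : Fin q → ℝ | (∀ i, 0 < t i) ∧ ∑ i, t i < 1} ⊆ simplex q :=
    fun t ht => ⟨fun i => (ht.1 i).le, ht.2.le⟩
  suffices hmem : (fun _ : Fin q => 1 / ((q : ℝ) + 1)) ∈
      {t : Fin q → ℝ | (∀ i, 0 < t i) ∧ ∑ i, t i < 1} from ⟨_, interior_maximal hsub ho hmem⟩
  refine ⟨fun i => by positivity, ?_⟩
  simp only [Finset.sum_const, Finset.card_univ, Fintype.card_fin, nsmul_eq_mul]
  rw [mul_one_div, div_lt_one (by positivity)]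
  linarith

/-- A convex set with interior points lies in the closure of its interior. Derivatives of relations
on the simplex thus extend to the boundary by continuity. -/
lemma eq_zero_of_interior_simplex {q : ℕ} {V : Type*} [NormedAddCommGroup V] {f : (Fin q → ℝ) → V}
    (h : ∀ s ∈ interior (simplex q), f s = 0) {s : Fin q → ℝ} (hs : s ∈ simplex q)
    (hf : ContinuousAt f s) : f s = 0 := by
  have hs' : s ∈ closure (interior (simplex q)) := by
    rw [(convex_simplex q).closure_interior_eq_closure_of_nonempty_interior
      (nonempty_interior_simplex q)]
    exact subset_closure hs
  have := mem_closure_iff_nhdsWithin_neBot.1 hs'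
  refine tendsto_nhds_unique (l := 𝓝[interior (simplex q)] s)
    (hf.tendsto.mono_left nhdsWithin_le_nhds) (tendsto_const_nhds.congr' ?_)
  filter_upwards [self_mem_nhdsWithin] with s' hs'
  exact (h s' hs').symm

end SimplexClosure

/-! ### Tangent vectors of the maps f_{m,q} and their variation -/

section GaugeVec

variable {d k N m q : ℕ} {G : Type*} [TopologicalSpace G] [ChartedSpace (Model d) G] [Group G]
  {X : Type*} [TopologicalSpace X] [ChartedSpace (Model k) X]

/-- The standard frame of `ℝᵏ × ℝ^q`. -/
def productFrame (k q : ℕ) (l : Fin (k + q)) : Model k × (Fin q → ℝ) :=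
  Fin.append (fun b => ((EuclideanSpace.single b (1 : ℝ) : Model k), (0 : Fin q → ℝ)))
    (fun b => (0, Pi.single b 1)) l

/-- The tangent vectors of the map `f_{m,q}` in a chart, in the directions of `X` and `Δ_q`. -/
def gaugeVec (σ : ∀ l : ℕ, (Fin l → G) → (Fin l → ℝ) → G) (h : m + q = N) (γ : Fin N → ℝ → X → G)
    (x₀ : X) (x : (Fin N → ℝ) × (Model k × (Fin q → ℝ))) (l : Fin (k + q)) (j : Fin (m + 1)) :
    LieAlg d G :=
  partialMC d (gaugeMap σ h γ x₀ j) (productFrame k q l) x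

variable [LieGroup (𝓡 d) ∞ G] [IsManifold (𝓡 k) ∞ X]
  {σ : ∀ l : ℕ, (Fin l → G) → (Fin l → ℝ) → G}
  {γ : Fin N → ℝ → X → G} {ξ : Fin N → X → LieAlg d G} {x₀ : X}

lemma eventually_contDiffAt_gaugeVec (hσ : IsLocalSimplexFamily (d := d) σ)
    (hγ : ∀ i, IsGaugeCurve (d := d) (k := k) (γ i) (ξ i)) (h : m + q = N) {z : Model k}
    (hz : z ∈ (chartAt (Model k) x₀).target) {s : Fin q → ℝ} (hs : s ∈ simplex q) :
    ∀ᶠ x in 𝓝 (0, (z, s)), ∀ l j, ContDiffAt (F := Model d) ℝ ∞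
      (fun x => gaugeVec (d := d) σ h γ x₀ x l j) x := by
  filter_upwards [eventually_contMDiffAt_gaugeMap hσ hγ h hz hs] with x hx l j
  exact contDiffAt_partialMC (hx j) _

/-- At the parameter `0` the map is constantly `1` over the interior of the simplex, so its
differential vanishes there, and by continuity on the boundary. -/
lemma gaugeVec_zero (hσ : IsLocalSimplexFamily (d := d) σ)
    (hγ : ∀ i, IsGaugeCurve (d := d) (k := k) (γ i) (ξ i)) (h : m + q = N) {z : Model k}
    (hz : z ∈ (chartAt (Model k) x₀).target) {s : Fin q → ℝ} (hs : s ∈ simplex q) :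
    gaugeVec (d := d) σ h γ x₀ (0, (z, s)) = 0 := by
  funext l j
  refine eq_zero_of_interior_simplex (V := Model d)
    (f := fun s => gaugeVec (d := d) σ h γ x₀ (0, (z, s)) l j) (fun s hs => ?_) hs ?_
  · refine partialMC_eq_zero ?_ _
    have hs' : ∀ᶠ y : Model k × (Fin q → ℝ) in 𝓝 (z, s), y.2 ∈ interior (simplex q) :=
      continuous_snd.continuousAt.eventually_mem (isOpen_interior.mem_nhds hs)
    filter_upwards [hs'] with y hy
    rw [gaugeMap_zero hσ hγ h x₀ z (interior_subset hs) j]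
    exact gaugeMap_zero hσ hγ h x₀ y.1 (interior_subset hy) j
  · exact ((eventually_contDiffAt_gaugeVec hσ hγ h hz hs).self_of_nhds l j).continuousAt.comp
      (f := fun s => ((0 : Fin N → ℝ), (z, s))) (by fun_prop)

/-- Mixed derivatives commute: the variation of a tangent vector is the derivative, along X or the
simplex, of the variation of the map. -/
lemma fderiv_gaugeVec (hσ : IsLocalSimplexFamily (d := d) σ) {γ : Fin (m + q) → ℝ → X → G}
    {ξ : Fin (m + q) → X → LieAlg d G}
    (hγ : ∀ i, IsGaugeCurve (d := d) (k := k) (γ i) (ξ i)) {z : Model k}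
    (hz : z ∈ (chartAt (Model k) x₀).target) {s : Fin q → ℝ} (hs : s ∈ interior (simplex q))
    (i : Fin (m + q)) (l : Fin (k + q)) (j : Fin (m + 1)) :
    fderiv (F := Model d) ℝ (fun x => gaugeVec σ rfl γ x₀ x l j) (0, (z, s)) (Pi.single i 1, 0) =
      fderiv ℝ (fun y => gaugeMapDeriv σ ξ x₀ i y j) (z, s) (productFrame k q l) := by
  have hs' : ∀ᶠ y : Model k × (Fin q → ℝ) in 𝓝 (z, s), y.2 ∈ interior (simplex q) :=
    continuous_snd.continuousAt.eventually_mem (isOpen_interior.mem_nhds hs)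
  have hz' : ∀ᶠ y : Model k × (Fin q → ℝ) in 𝓝 (z, s), y.1 ∈ (chartAt (Model k) x₀).target :=
    continuous_fst.continuousAt.eventually_mem ((chartAt (Model k) x₀).open_target.mem_nhds hz)
  refine (fderiv_partialMC ((eventually_contMDiffAt_gaugeMap hσ hγ rfl hz
    (interior_subset hs)).mono fun x hx => hx j) ?_ _ _).trans ?_
  · filter_upwards [hs'] with y hy
    exact gaugeMap_zero hσ hγ rfl x₀ y.1 (interior_subset hy) j
  · congr 1
    refine Filter.EventuallyEq.fderiv_eq ?_
    filter_upwards [hs', hz'] with y hy hy'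
    exact fderiv_gaugeMap hσ hγ hy' (interior_subset hy) i j

lemma fderiv_gaugeMapDeriv_left_left {ξ : Fin (m + q) → X → LieAlg d G}
    (hξ : ∀ i, IsSmooth (k := k) (ξ i)) {z : Model k}
    (hz : z ∈ (chartAt (Model k) x₀).target) (s : Fin q → ℝ) (b : Fin k) (b' : Fin m) :
    (fun j => fderiv ℝ (fun y => gaugeMapDeriv σ ξ x₀ (Fin.castAdd q b') y j) (z, s)
      (productFrame k q (Fin.castAdd q b))) =
      Pi.single b'.castSucc (fderiv ℝ (inChart x₀ (ξ (Fin.castAdd q b'))) z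
        (EuclideanSpace.single b (1 : ℝ))) := by
  have h1 : HasFDerivAt (fun y : Model k × (Fin q → ℝ) => inChart x₀ (ξ (Fin.castAdd q b')) y.1)
      ((fderiv ℝ (inChart x₀ (ξ (Fin.castAdd q b'))) z).comp (ContinuousLinearMap.fst ℝ _ _)) (z, s) :=
    HasFDerivAt.comp (g := inChart x₀ (ξ (Fin.castAdd q b'))) (z, s)
      ((((contDiffOn_inChart (hξ _) x₀).contDiffAt
        ((chartAt (Model k) x₀).open_target.mem_nhds hz)).differentiableAt (by simp)).hasFDerivAt)
      hasFDerivAt_fst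
  funext j
  by_cases hj : j = b'.castSucc
  · subst hj
    simp [gaugeMapDeriv, productFrame, h1.fderiv]
  · simp [gaugeMapDeriv, hj]

/-- The first `m` group elements do not depend on the point of the simplex. -/
lemma fderiv_gaugeMapDeriv_right_left {ξ : Fin (m + q) → X → LieAlg d G}
    (hξ : ∀ i, IsSmooth (k := k) (ξ i)) {z : Model k}
    (hz : z ∈ (chartAt (Model k) x₀).target) (s : Fin q → ℝ) (c : Fin q) (b : Fin m) :
    (fun j => fderiv ℝ (fun y => gaugeMapDeriv σ ξ x₀ (Fin.castAdd q b) y j) (z, s)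
      (productFrame k q (Fin.natAdd k c))) = 0 := by
  have h1 : HasFDerivAt (fun y : Model k × (Fin q → ℝ) => inChart x₀ (ξ (Fin.castAdd q b)) y.1)
      ((fderiv ℝ (inChart x₀ (ξ (Fin.castAdd q b))) z).comp (ContinuousLinearMap.fst ℝ _ _)) (z, s) :=
    HasFDerivAt.comp (g := inChart x₀ (ξ (Fin.castAdd q b))) (z, s)
      ((((contDiffOn_inChart (hξ _) x₀).contDiffAt
        ((chartAt (Model k) x₀).open_target.mem_nhds hz)).differentiableAt (by simp)).hasFDerivAt)
      hasFDerivAt_fst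
  funext j
  by_cases hj : j = b.castSucc
  · subst hj
    simp [gaugeMapDeriv, productFrame, h1.fderiv]
  · simp [gaugeMapDeriv, hj]

lemma fderiv_gaugeMapDeriv_right_right (hσ : IsLocalSimplexFamily (d := d) σ)
    {ξ : Fin (m + q) → X → LieAlg d G}
    (hξ : ∀ i, IsSmooth (k := k) (ξ i)) {z : Model k}
    (hz : z ∈ (chartAt (Model k) x₀).target) {s : Fin q → ℝ} (hs : s ∈ simplex q) (c c' : Fin q) :
    (fun j => fderiv ℝ (fun y => gaugeMapDeriv σ ξ x₀ (Fin.natAdd m c') y j) (z, s)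
      (productFrame k q (Fin.natAdd k c))) =
      Pi.single (Fin.last m) (fderiv ℝ (fun s => simplexDeriv d σ q c' s
        (inChart x₀ (ξ (Fin.natAdd m c')) z)) s (Pi.single c 1)) := by
  have h1 : DifferentiableAt ℝ (fun y : Model k × (Fin q → ℝ) =>
      simplexDeriv d σ q c' y.2 (inChart x₀ (ξ (Fin.natAdd m c')) y.1)) (z, s) :=
    DifferentiableAt.clm_apply (DifferentiableAt.comp (g := simplexDeriv d σ q c') (z, s)
      ((hσ.eventually_contDiffAt_simplexDeriv hs c').self_of_nhds.differentiableAt (by simp))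
      differentiableAt_snd) (DifferentiableAt.comp (g := inChart x₀ (ξ (Fin.natAdd m c'))) (z, s)
      (((contDiffOn_inChart (hξ _) x₀).contDiffAt
        ((chartAt (Model k) x₀).open_target.mem_nhds hz)).differentiableAt (by simp))
      differentiableAt_fst)
  have h2 : HasFDerivAt (fun s => simplexDeriv d σ q c' s (inChart x₀ (ξ (Fin.natAdd m c')) z)) _ s :=
    HasFDerivAt.comp (g := fun y : Model k × (Fin q → ℝ) =>
      simplexDeriv d σ q c' y.2 (inChart x₀ (ξ (Fin.natAdd m c')) y.1)) s h1.hasFDerivAt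
      (hasFDerivAt_prodMk_right z s)
  funext j
  by_cases hj : j = Fin.last m
  · subst hj
    simp [gaugeMapDeriv, productFrame, h2.fderiv]
  · simp [gaugeMapDeriv, hj]

/-- The simplex directions are tangent to the last factor, for all small parameters and not just to
first order; the summands with too many factors therefore vanish near the identity. -/
lemma gaugeVec_castSucc_right (σ : ∀ l : ℕ, (Fin l → G) → (Fin l → ℝ) → G) (h : m + q = N)
    (γ : Fin N → ℝ → X → G) (x₀ : X) {x : (Fin N → ℝ) × (Model k × (Fin q → ℝ))} (c : Fin q) (j : Fin m)
    (hx : ContMDiffAt 𝓘(ℝ, (Fin N → ℝ) × (Model k × (Fin q → ℝ))) (𝓡 d) ∞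
      (gaugeMap σ h γ x₀ j.castSucc) x) :
    gaugeVec (d := d) σ h γ x₀ x (Fin.natAdd k c) j.castSucc = 0 := by
  obtain ⟨t, z, s⟩ := x
  have hF : ContMDiffAt 𝓘(ℝ, Model k × (Fin q → ℝ)) (𝓡 d) ∞
      (fun y => gaugeMap σ h γ x₀ j.castSucc (t, y)) (z, s) :=
    ContMDiffAt.comp (I' := 𝓘(ℝ, (Fin N → ℝ) × (Model k × (Fin q → ℝ)))) (z, s) hx
      (contDiffAt_const.prodMk contDiffAt_id).contMDiffAt
  refine (maurerCartan_eq (hF.of_le (by simp)) _).trans ?_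
  have hd := ((ContDiffAt.oneChart_comp (hF.mul contMDiffAt_const)
    (mul_inv_cancel (gaugeMap σ h γ x₀ j.castSucc (t, (z, s))))).differentiableAt
      (by simp)).hasFDerivAt
  have hl : HasDerivAt (fun r : ℝ => ((z, s + r • Pi.single c 1) : Model k × (Fin q → ℝ)))
      (productFrame k q (Fin.natAdd k c)) 0 := by
    simp only [productFrame, Fin.append_right]
    refine (hasDerivAt_const _ _).prodMk ?_
    simpa using ((hasDerivAt_id (0 : ℝ)).smul_const (Pi.single c (1 : ℝ) : Fin q → ℝ)).const_add s
  have h0 : ((z, s + (0 : ℝ) • Pi.single c 1) : Model k × (Fin q → ℝ)) = (z, s) := by simp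
  have h1 := HasFDerivAt.comp_hasDerivAt (x := (0 : ℝ))
    (f := fun r : ℝ => ((z, s + r • Pi.single c 1) : Model k × (Fin q → ℝ)))
    (by rw [h0]; exact hd) hl
  have h2 : ∀ r : ℝ, gaugeMap σ h γ x₀ j.castSucc (t, (z, s + r • Pi.single c 1)) =
      gaugeMap σ h γ x₀ j.castSucc (t, (z, s)) := fun r => by
    simp only [gaugeMap_castSucc]
  have h3 : HasDerivAt (fun r : ℝ => oneChart d G (gaugeMap σ h γ x₀ j.castSucc
      (t, (z, s + r • Pi.single c 1)) * (gaugeMap σ h γ x₀ j.castSucc (t, (z, s)))⁻¹)) _ 0 := h1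
  simp only [h2] at h3
  exact h3.unique (hasDerivAt_const _ _)

/-- The tangent vectors of `f_{m,q}` in a chart of `X`. -/
lemma maurerCartan_faceMap (h : m + q = N) {t : Fin N → ℝ} {z : Model k} {s : Fin q → ℝ}
    (hz : z ∈ (chartAt (Model k) x₀).target) (l : Fin (k + q)) (j : Fin (m + 1))
    (hx : ContMDiffAt 𝓘(ℝ, (Fin N → ℝ) × (Model k × (Fin q → ℝ))) (𝓡 d) ∞
      (gaugeMap σ h γ x₀ j) (t, (z, s))) :
    maurerCartan ((𝓡 k).prod 𝓘(ℝ, Fin q → ℝ))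
        (fun y : X × (Fin q → ℝ) => faceMap σ h (fun i => γ i (t i) y.1) y.2 j)
        ((chartAt (Model k) x₀).symm z, s)
        (Fin.append (fun b => ((coordFrame x₀ z b, 0) :
          TangentSpace (𝓡 k) ((chartAt (Model k) x₀).symm z) × (Fin q → ℝ)))
          (fun b => (0, Pi.single b 1)) l) = gaugeVec (d := d) σ h γ x₀ (t, (z, s)) l j := by
  set e := chartAt (Model k) x₀ with he
  set φ : X × (Fin q → ℝ) → G := fun y => faceMap σ h (fun i => γ i (t i) y.1) y.2 j with hφ
  set H : Model k × (Fin q → ℝ) → X × (Fin q → ℝ) := fun y => (e.symm y.1, y.2) with hH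
  have hF : ContMDiffAt 𝓘(ℝ, Model k × (Fin q → ℝ)) (𝓡 d) ∞ (fun y => gaugeMap σ h γ x₀ j (t, y))
      (z, s) :=
    ContMDiffAt.comp (I' := 𝓘(ℝ, (Fin N → ℝ) × (Model k × (Fin q → ℝ)))) (z, s) hx
      (contDiffAt_const.prodMk contDiffAt_id).contMDiffAt
  have hφs : ContMDiffAt ((𝓡 k).prod 𝓘(ℝ, Fin q → ℝ)) (𝓡 d) ∞ φ (e.symm z, s) := by
    have hx' : e.symm z ∈ e.source := e.map_target hz
    have h1 : ContMDiffAt ((𝓡 k).prod 𝓘(ℝ, Fin q → ℝ)) 𝓘(ℝ, Model k × (Fin q → ℝ)) ∞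
        (fun y : X × (Fin q → ℝ) => (e y.1, y.2)) (e.symm z, s) := by
      refine ContMDiffAt.prodMk_space ?_ contMDiffAt_snd
      exact ContMDiffAt.comp (I' := 𝓡 k) (e.symm z, s) ((contMDiffOn_chart (I := 𝓡 k) (n := ∞)
        (x := x₀)).contMDiffAt (e.open_source.mem_nhds hx')) contMDiffAt_fst
    have h2 : ContMDiffAt 𝓘(ℝ, Model k × (Fin q → ℝ)) (𝓡 d) ∞
        (fun y => gaugeMap σ h γ x₀ j (t, y)) (e (e.symm z), s) := by
      rw [e.right_inv hz]
      exact hF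
    refine (ContMDiffAt.comp (I' := 𝓘(ℝ, Model k × (Fin q → ℝ)))
      (f := fun y : X × (Fin q → ℝ) => (e y.1, y.2)) (e.symm z, s) h2 h1).congr_of_eventuallyEq ?_
    filter_upwards [continuous_fst.continuousAt.eventually_mem (e.open_source.mem_nhds hx')] with y hy
    simp only [hφ, Function.comp_apply, gaugeMap, gaugeCurve, ← he, e.left_inv hy]
  have hφ' : MDifferentiableAt ((𝓡 k).prod 𝓘(ℝ, Fin q → ℝ)) (𝓡 d)
      (fun y => φ y * (φ (e.symm z, s))⁻¹) (H (z, s)) :=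
    (hφs.mul contMDiffAt_const).mdifferentiableAt (by simp)
  have hHd : HasMFDerivAt 𝓘(ℝ, Model k × (Fin q → ℝ)) ((𝓡 k).prod 𝓘(ℝ, Fin q → ℝ)) H (z, s)
      (((chartDeriv x₀ z).comp (ContinuousLinearMap.fst ℝ (Model k) (Fin q → ℝ))).prod
        (ContinuousLinearMap.snd ℝ (Model k) (Fin q → ℝ))) := by
    refine HasMFDerivAt.prodMk ?_ hasFDerivAt_snd.hasMFDerivAt
    exact HasMFDerivAt.comp (z, s) (mdifferentiableAt_chart_symm x₀ hz).hasMFDerivAt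
      hasFDerivAt_fst.hasMFDerivAt
  have hcomp := (hφ'.hasMFDerivAt.comp (z, s) hHd).mfderiv
  change mfderiv _ _ (fun y => φ y * (φ (e.symm z, s))⁻¹) (e.symm z, s) _ =
    mfderiv 𝓘(ℝ, Model k × (Fin q → ℝ)) (𝓡 d) ((fun y => φ y * (φ (e.symm z, s))⁻¹) ∘ H) (z, s)
      (productFrame k q l)
  rw [hcomp]
  refine congrArg (mfderiv ((𝓡 k).prod 𝓘(ℝ, Fin q → ℝ)) (𝓡 d)
    (fun y => φ y * (φ (e.symm z, s))⁻¹) (e.symm z, s)) ?_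
  induction l using Fin.addCases with
  | left b =>
    simp only [productFrame, Fin.append_left]
    exact (Fin.append_left _ _ b).trans rfl
  | right b =>
    simp only [productFrame, Fin.append_right]
    refine (Fin.append_right _ _ b).trans (Prod.ext ?_ rfl)
    exact (map_zero (chartDeriv x₀ z)).symm

end GaugeVec

/-! ### Order of vanishing of the summands of the local cochain -/

section LocalCochain

variable {d k p N m q : ℕ} {G : Type*} [TopologicalSpace G] [ChartedSpace (Model d) G] [Group G]
  [LieGroup (𝓡 d) ∞ G] {X : Type*} [TopologicalSpace X] [T2Space X] [CompactSpace X]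
  [ChartedSpace (Model k) X] [IsManifold (𝓡 k) ∞ X]
  {σ : ∀ l : ℕ, (Fin l → G) → (Fin l → ℝ) → G}
  {γ : Fin N → ℝ → X → G} {ξ : Fin N → X → LieAlg d G}

lemma HasLeadingTerms.congr {n : ℕ} {f f' : (Fin N → ℝ) → ℂ} {g : (Fin n → Fin N) → ℂ}
    (hf : HasLeadingTerms f g) (h : f' =ᶠ[𝓝 0] f) : HasLeadingTerms f' g := by
  obtain ⟨A, hA, h0, he⟩ := hf
  exact ⟨A, hA, h0, h.trans he⟩

lemma eventually_forall_contMDiffAt_gaugeMap (hσ : IsLocalSimplexFamily (d := d) σ)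
    (hγ : ∀ i, IsGaugeCurve (d := d) (k := k) (γ i) (ξ i)) (h : m + q = N) :
    ∀ᶠ t in 𝓝 (0 : Fin N → ℝ), ∀ x₀ ∈ activeCharts k X, ∀ y ∈ chartSupport k x₀ ×ˢ simplex q, ∀ j,
      ContMDiffAt 𝓘(ℝ, (Fin N → ℝ) × (Model k × (Fin q → ℝ))) (𝓡 d) ∞ (gaugeMap σ h γ x₀ j) (t, y) :=
  (Filter.eventually_all_finset _).2 fun x₀ _ =>
    ((isCompact_chartSupport x₀).prod (isCompact_simplex q)).eventually_forall_of_forall_eventually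
      (P := fun t y => ∀ j, ContMDiffAt 𝓘(ℝ, (Fin N → ℝ) × (Model k × (Fin q → ℝ))) (𝓡 d) ∞
        (gaugeMap σ h γ x₀ j) (t, y)) fun _ hy =>
          eventually_contMDiffAt_gaugeMap hσ hγ h (chartSupport_subset x₀ hy.1) hy.2

/-- The summand `c_{m,q}` of the local cochain, in the charts of `X`. -/
lemma integral_betaForm_eq (o : Orient k X) (P : MultilinearMap ℝ (fun _ : Fin p => LieAlg d G) ℂ)
    (h : m + q = N) (h' : k + q + (m + 1) = 2 * p) {t : Fin N → ℝ}
    (ht : ∀ x₀ ∈ activeCharts k X, ∀ y ∈ chartSupport k x₀ ×ˢ simplex q, ∀ j,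
      ContMDiffAt 𝓘(ℝ, (Fin N → ℝ) × (Model k × (Fin q → ℝ))) (𝓡 d) ∞ (gaugeMap σ h γ x₀ j) (t, y)) :
    integral o (betaForm P σ h h' (fun i => γ i (t i))) =
      ∑ x₀ ∈ activeCharts k X, nestedIntegral (chartSupport k x₀) (chartWeight o x₀) P h'
        (fun y j => gaugeMap σ h γ x₀ j (t, y)) (fun y => gaugeVec (d := d) σ h γ x₀ (t, y)) := by
  rw [integral_eq_sum]
  refine Finset.sum_congr rfl fun x₀ hx₀ => ?_
  refine setIntegral_congr_fun (isCompact_chartSupport x₀).measurableSet fun z hz => ?_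
  simp only [Complex.real_smul]
  congr 1
  refine setIntegral_congr_fun (isCompact_simplex q).measurableSet fun s hs => ?_
  refine congrArg (bssForm P h' (fun j => gaugeMap σ h γ x₀ j (t, (z, s)))) ?_
  funext l j
  exact maurerCartan_faceMap h (chartSupport_subset x₀ hz) l j (ht x₀ hx₀ (z, s) ⟨hz, hs⟩ j)

/-- The summand `c_{m,q}` of the local cochain vanishes to the order `k + q` at the identity. -/
theorem hasLeadingTerms_betaForm (hσ : IsLocalSimplexFamily (d := d) σ)
    (hγ : ∀ i, IsGaugeCurve (d := d) (k := k) (γ i) (ξ i)) (o : Orient k X)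
    (P : MultilinearMap ℝ (fun _ : Fin p => LieAlg d G) ℂ)
    (h : m + q = N) (h' : k + q + (m + 1) = 2 * p) :
    HasLeadingTerms (fun t => integral o (betaForm P σ h h' (fun i => γ i (t i))))
      (fun φ : Fin (k + q) → Fin N => ∑ x₀ ∈ activeCharts k X,
        nestedIntegral (chartSupport k x₀) (chartWeight o x₀) P h' (fun _ _ => 1)
          (fun y l j => fderiv (F := Model d) ℝ (fun x => gaugeVec σ h γ x₀ x l j) (0, y)
            (Pi.single (φ l) 1, 0))) := by
  refine HasLeadingTerms.congr (HasLeadingTerms.sum (activeCharts k X) fun x₀ _ =>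
    hasLeadingTerms_nestedIntegral (isCompact_chartSupport x₀)
      ((continuousOn_chartWeight o x₀).mono (chartSupport_subset x₀)) P h'
      (F := fun x j => gaugeMap σ h γ x₀ j x) (v := fun x => gaugeVec (d := d) σ h γ x₀ x)
      (fun z hz s hs => eventually_contMDiffAt_gaugeMap hσ hγ h (chartSupport_subset x₀ hz) hs)
      (fun z hz s hs => eventually_contDiffAt_gaugeVec hσ hγ h (chartSupport_subset x₀ hz) hs)
      (fun z hz s hs => funext fun j => gaugeMap_zero hσ hγ h x₀ z hs j)
      (fun z hz s hs => gaugeVec_zero hσ hγ h (chartSupport_subset x₀ hz) hs)) ?_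
  filter_upwards [eventually_forall_contMDiffAt_gaugeMap hσ hγ h] with t ht
  exact integral_betaForm_eq o P h h' ht

theorem contDiffAt_localCochain (hk : k < p) (o : Orient k X)
    (P : MultilinearMap ℝ (fun _ : Fin p => LieAlg d G) ℂ)
    {σ : ∀ l : ℕ, (Fin l → G) → (Fin l → ℝ) → G} (hσ : IsLocalSimplexFamily (d := d) σ)
    {ξ : Fin (2 * p - k - 1) → X → LieAlg d G}
    {γ : Fin (2 * p - k - 1) → ℝ → X → G} (hγ : ∀ i, IsGaugeCurve (d := d) (k := k) (γ i) (ξ i)) :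
    ∀ᶠ t in 𝓝 (0 : Fin (2 * p - k - 1) → ℝ), ContDiffAt ℝ ∞ (fun t : Fin (2 * p - k - 1) → ℝ =>
          localCochain hk P σ o (fun i => γ i (t i))) t := by
  filter_upwards [Filter.eventually_all.2 fun m : Fin p => (hasLeadingTerms_betaForm hσ hγ o P
    (m := m) (q := 2 * p - k - 1 - m) (by omega) (by omega)).eventually_contDiffAt] with t ht
  exact ContDiffAt.sum fun m _ => ht m

/-- Only the `k` directions of X can leave the last factor, while the form on `G^(m+1)` needs at
least `m` such vectors. -/
lemma integral_betaForm_eventually_zero (hσ : IsLocalSimplexFamily (d := d) σ)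
    (hγ : ∀ i, IsGaugeCurve (d := d) (k := k) (γ i) (ξ i)) (o : Orient k X)
    (P : MultilinearMap ℝ (fun _ : Fin p => LieAlg d G) ℂ)
    (h : m + q = N) (h' : k + q + (m + 1) = 2 * p) (hkm : k < m) :
    ∀ᶠ t in 𝓝 (0 : Fin N → ℝ), integral o (betaForm P σ h h' (fun i => γ i (t i))) = 0 := by
  filter_upwards [eventually_forall_contMDiffAt_gaugeMap hσ hγ h] with t ht
  rw [integral_betaForm_eq o P h h' ht]
  refine Finset.sum_eq_zero fun x₀ hx₀ => ?_
  refine setIntegral_eq_zero_of_forall_eq_zero fun z hz => ?_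
  rw [setIntegral_eq_zero_of_forall_eq_zero, smul_zero]
  intro s hs
  refine bssForm_eq_zero_of_top P h' _ _ (Finset.univ.map (Fin.castAddEmb q)) (by simpa using hkm) ?_
  intro l hl i
  induction l using Fin.addCases with
  | left b => exact absurd (by simp) hl
  | right c => exact gaugeVec_castSucc_right σ h γ x₀ c i (ht x₀ hx₀ (z, s) ⟨hz, hs⟩ _)

/-- The permutation of a disjoint union that is given by permutations of the two parts. -/
def blockPerm (ρ : Equiv.Perm (Fin k)) (ϖ : Equiv.Perm (Fin q)) : Equiv.Perm (Fin (k + q)) :=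
  finSumFinEquiv.permCongr (Equiv.Perm.sumCongr ρ ϖ)

lemma blockPerm_left (ρ : Equiv.Perm (Fin k)) (ϖ : Equiv.Perm (Fin q)) (b : Fin k) :
    blockPerm ρ ϖ (Fin.castAdd q b) = Fin.castAdd q (ρ b) := by
  simp [blockPerm, Equiv.permCongr_apply]

lemma blockPerm_right (ρ : Equiv.Perm (Fin k)) (ϖ : Equiv.Perm (Fin q)) (c : Fin q) :
    blockPerm ρ ϖ (Fin.natAdd k c) = Fin.natAdd k (ϖ c) := by
  simp [blockPerm, Equiv.permCongr_apply]

lemma sign_blockPerm (ρ : Equiv.Perm (Fin k)) (ϖ : Equiv.Perm (Fin q)) :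
    Equiv.Perm.sign (blockPerm ρ ϖ) = Equiv.Perm.sign ρ * Equiv.Perm.sign ϖ := by
  simp [blockPerm]

/-- If no element of the last block is sent to the first, then by finiteness the permutation
preserves both blocks. For this reason the variation of a simplex argument in a direction of X never
has to be computed. -/
lemma sum_perm_eq_sum_blockPerm {g : Equiv.Perm (Fin (k + q)) → ℂ}
    (hg : ∀ π : Equiv.Perm (Fin (k + q)), (∃ c b, π (Fin.natAdd k c) = Fin.castAdd q b) → g π = 0) :
    ∑ π, g π = ∑ ρ : Equiv.Perm (Fin k), ∑ ϖ : Equiv.Perm (Fin q), g (blockPerm ρ ϖ) := by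
  rw [← Fintype.sum_prod_type' (f := fun ρ ϖ => g (blockPerm ρ ϖ))]
  symm
  refine Fintype.sum_of_injective (fun x : Equiv.Perm (Fin k) × Equiv.Perm (Fin q) =>
    blockPerm x.1 x.2) ?_ _ _ ?_ fun _ => rfl
  · exact finSumFinEquiv.permCongr.injective.comp Equiv.Perm.sumCongrHom_injective
  · intro π hπ
    refine hg π ?_
    by_contra hne
    push Not at hne
    apply hπ
    have h1 : Set.MapsTo (finSumFinEquiv.permCongr.symm π) (Set.range Sum.inr) (Set.range Sum.inr) := by
      rintro _ ⟨c, rfl⟩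
      rcases h2 : (finSumFinEquiv.permCongr.symm π) (Sum.inr c) with b | c'
      · exfalso
        refine hne c b ?_
        have := congrArg finSumFinEquiv h2
        simpa [Equiv.permCongr_symm_apply] using this
      · exact ⟨c', rfl⟩
    obtain ⟨x, hx⟩ := Equiv.Perm.mem_sumCongrHom_range_of_perm_mapsTo_inl
      ((Equiv.Perm.perm_mapsTo_inl_iff_mapsTo_inr _).2 h1)
    exact ⟨x, by
      change finSumFinEquiv.permCongr (Equiv.Perm.sumCongrHom _ _ x) = π
      rw [hx]
      exact finSumFinEquiv.permCongr.apply_symm_apply π⟩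

end LocalCochain

/-! ### Summands of the leading term as forms on X -/

section BlockForm

variable {d k p q : ℕ} {G : Type*} [TopologicalSpace G] [ChartedSpace (Model d) G] [Group G]
  [LieGroup (𝓡 d) ∞ G] {X : Type*} [TopologicalSpace X]
  [ChartedSpace (Model k) X] [IsManifold (𝓡 k) ∞ X]
  {σ : ∀ l : ℕ, (Fin l → G) → (Fin l → ℝ) → G} {ξ : Fin (k + q) → X → LieAlg d G}

lemma append_update_right {V : Type*} (v : Fin k → V) (u : Fin q → V) (c : Fin q) (a : V) :
    Fin.append v (Function.update u c a) =
      Function.update (Fin.append v u) (Fin.natAdd k c) a := by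
  funext l
  induction l using Fin.addCases with
  | left b =>
    rw [Function.update_of_ne (fun h => by simp [Fin.ext_iff] at h; omega)]
    simp
  | right b =>
    by_cases hb : b = c
    · subst hb; simp
    · rw [Function.update_of_ne (fun h => hb (by simpa using h))]
      simp [hb]

/-- The Bott-Shulman-Stasheff form at the identity, as an alternating form in the last `q` vectors,
taken in the last copy of the Lie algebra. -/
def lastAlt (P : MultilinearMap ℝ (fun _ : Fin p => LieAlg d G) ℂ) (h : k + q + (k + 1) = 2 * p)
    (v : Fin k → Fin (k + 1) → LieAlg d G) : (Model d) [⋀^Fin q]→ₗ[ℝ] ℂ :=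
  have key : ∀ (u : Fin q → Model d) (c : Fin q) (a : Model d),
      (Fin.append v (fun c' => Pi.single (Fin.last k) (Function.update u c a c')) :
        Fin (k + q) → Fin (k + 1) → LieAlg d G) =
      Function.update (Fin.append v (fun c' => Pi.single (Fin.last k) (u c'))) (Fin.natAdd k c)
        (Pi.single (Fin.last k) a) := fun u c a => by
    rw [← append_update_right]
    congr 1
    funext c'
    by_cases hc : c' = c
    · subst hc; simp
    · simp [hc]
  { toFun := fun u => bssAlt P h (fun _ => 1) (Fin.append v (fun c => Pi.single (Fin.last k) (u c)))
    map_update_add' := fun {inst} u c a b => by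
      have := Subsingleton.elim inst (instDecidableEqFin q)
      subst this
      rw [key, key, key, ← AlternatingMap.map_update_add]
      exact congrArg (fun a => bssAlt P h (fun _ => 1) (Function.update _ _ a))
        (Pi.single_add (f := fun _ : Fin (k + 1) => LieAlg d G) (Fin.last k) a b)
    map_update_smul' := fun {inst} u c r a => by
      have := Subsingleton.elim inst (instDecidableEqFin q)
      subst this
      rw [key, key, ← AlternatingMap.map_update_smul]
      exact congrArg (fun a => bssAlt P h (fun _ => 1) (Function.update _ _ a))
        (Pi.single_smul (f := fun _ : Fin (k + 1) => LieAlg d G) (Fin.last k) r a)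
    map_eq_zero_of_eq' := fun u c c' hcc hne => by
      refine (bssAlt P h (fun _ => 1)).map_eq_zero_of_eq _ (i := Fin.natAdd k c)
        (j := Fin.natAdd k c') ?_ (fun h => hne (by simpa using h))
      simp [hcc] }

lemma contDiffAt_single {E : Type*} [NormedAddCommGroup E] [NormedSpace ℝ E] {m : ℕ} {f : E → Model d}
    {e : E} (hf : ContDiffAt ℝ ∞ f e) (i j : Fin m) :
    ContDiffAt ℝ ∞ (fun e => (Pi.single i (f e) : Fin m → Model d) j) e := by
  by_cases h : j = i
  · subst h; simpa using hf
  · simpa [h] using contDiffAt_const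

/-- The vectors `dξ_{ρ(b)}(w_b)`, in the copies `ρ(b)` of the Lie algebra. -/
def diffVec (ξ : Fin (k + q) → X → LieAlg d G) (ρ : Equiv.Perm (Fin k)) (x : X)
    (w : Fin k → TangentSpace (𝓡 k) x) (b : Fin k) : Fin (k + 1) → LieAlg d G :=
  Pi.single (ρ b).castSucc (diff (ξ (Fin.castAdd q (ρ b))) x (w b))

/-- A summand of the leading term of the local cochain, as a form on `X`. -/
def blockForm (P : MultilinearMap ℝ (fun _ : Fin p => LieAlg d G) ℂ)
    (σ : ∀ l : ℕ, (Fin l → G) → (Fin l → ℝ) → G) (h : k + q + (k + 1) = 2 * p)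
    (ξ : Fin (k + q) → X → LieAlg d G) (ρ : Equiv.Perm (Fin k)) (ϖ : Equiv.Perm (Fin q)) (x : X)
    (w : Fin k → TangentSpace (𝓡 k) x) : ℂ :=
  ∫ s in simplex q, lastAlt P h (diffVec ξ ρ x w) (fun c =>
    fderiv ℝ (fun s => simplexDeriv d σ q (ϖ c) s (ξ (Fin.natAdd k (ϖ c)) x)) s (Pi.single c 1))

lemma chartCoeff_blockForm (P : MultilinearMap ℝ (fun _ : Fin p => LieAlg d G) ℂ)
    (h : k + q + (k + 1) = 2 * p) (hξ : ∀ i, IsSmooth (k := k) (ξ i)) (ρ : Equiv.Perm (Fin k))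
    (ϖ : Equiv.Perm (Fin q)) (x₀ : X) {z : Model k} (hz : z ∈ (chartAt (Model k) x₀).target) :
    chartCoeff (blockForm P σ h ξ ρ ϖ) x₀ z = ∫ s in simplex q, bssForm P h (fun _ => 1)
      (Fin.append (fun b => Pi.single (ρ b).castSucc (fderiv ℝ (inChart x₀ (ξ (Fin.castAdd q (ρ b)))) z
          (EuclideanSpace.single b (1 : ℝ))))
        (fun c => Pi.single (Fin.last k) (fderiv ℝ (fun s => simplexDeriv d σ q (ϖ c) s
          (inChart x₀ (ξ (Fin.natAdd k (ϖ c))) z)) s (Pi.single c 1)))) := by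
  have : diffVec ξ ρ ((chartAt (Model k) x₀).symm z) (coordFrame x₀ z) =
      fun b => Pi.single (ρ b).castSucc (fderiv ℝ (inChart x₀ (ξ (Fin.castAdd q (ρ b)))) z
          (EuclideanSpace.single b (1 : ℝ))) := by
    funext b
    exact congrArg (Pi.single (M := fun _ => LieAlg d G) (ρ b).castSucc)
      (diff_coordFrame (hξ _) x₀ hz b)
  unfold chartCoeff blockForm
  rw [this]
  rfl

lemma isContForm_blockForm (P : MultilinearMap ℝ (fun _ : Fin p => LieAlg d G) ℂ)
    (hσ : IsLocalSimplexFamily (d := d) σ)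
    (h : k + q + (k + 1) = 2 * p) (hξ : ∀ i, IsSmooth (k := k) (ξ i)) (ρ : Equiv.Perm (Fin k))
    (ϖ : Equiv.Perm (Fin q)) : IsContForm (blockForm P σ h ξ ρ ϖ) := by
  intro x₀
  refine ContinuousOn.congr ?_ fun z hz => chartCoeff_blockForm P h hξ ρ ϖ x₀ hz
  intro z hz
  have ho := (chartAt (Model k) x₀).open_target
  have key := eventually_contDiffAt_simplexIntegral (e₀ := z) P h
    (a := fun _ : Model k × (Fin q → ℝ) => fun _ => (1 : G))
    (v := fun y => Fin.append (fun b => Pi.single (ρ b).castSucc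
        (fderiv ℝ (inChart x₀ (ξ (Fin.castAdd q (ρ b)))) y.1 (EuclideanSpace.single b (1 : ℝ))))
      (fun c => Pi.single (Fin.last k) (fderiv ℝ (fun s => simplexDeriv d σ q (ϖ c) s
        (inChart x₀ (ξ (Fin.natAdd k (ϖ c))) y.1)) y.2 (Pi.single c 1))))
    (fun s _ => Filter.Eventually.of_forall fun y i => contMDiffAt_const) (fun s hs => by
      have h1 : ∀ᶠ y : Model k × (Fin q → ℝ) in 𝓝 (z, s), y.1 ∈ (chartAt (Model k) x₀).target :=
        continuous_fst.continuousAt.eventually_mem (ho.mem_nhds hz)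
      have h2 : ∀ᶠ y : Model k × (Fin q → ℝ) in 𝓝 (z, s), ∀ c,
          ContDiffAt ℝ ∞ (simplexDeriv d σ q c) y.2 :=
        (continuous_snd.tendsto (z, s)).eventually
          (Filter.eventually_all.2 fun c => hσ.eventually_contDiffAt_simplexDeriv hs c)
      filter_upwards [h1, h2] with y hy1 hy2 l i
      have hin : ∀ i, ContDiffAt ℝ ∞ (inChart x₀ (ξ i)) y.1 := fun i =>
        (contDiffOn_inChart (hξ i) x₀).contDiffAt (ho.mem_nhds hy1)
      induction l using Fin.addCases with
      | left b =>
        simp only [Fin.append_left]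
        exact contDiffAt_single (((hin _).fderiv_right (m := ∞) (by simp)).comp y
          contDiffAt_fst |>.clm_apply contDiffAt_const) _ _
      | right c =>
        simp only [Fin.append_right]
        refine contDiffAt_single (ContDiffAt.clm_apply (ContDiffAt.fderiv (n := ∞)
          (f := fun (y : Model k × (Fin q → ℝ)) s => simplexDeriv d σ q (ϖ c) s
            (inChart x₀ (ξ (Fin.natAdd k (ϖ c))) y.1)) (g := fun y => y.2) ?_ contDiffAt_snd
            (by simp)) contDiffAt_const) _ _
        exact ((hy2 (ϖ c)).comp (f := fun y : (Model k × (Fin q → ℝ)) × (Fin q → ℝ) => y.2)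
          (y, y.2) contDiffAt_snd).clm_apply
          ((hin _).comp (f := fun y : (Model k × (Fin q → ℝ)) × (Fin q → ℝ) => y.1.1)
            (y, y.2) contDiffAt_fst.fst))
  exact key.self_of_nhds.continuousAt.continuousWithinAt

/-- The sum over `ϖ` carries no signs: the directions of the simplex stay in order, and the
alternating form absorbs the reordering of the arguments. -/
lemma sum_blockForm (P : MultilinearMap ℝ (fun _ : Fin p => LieAlg d G) ℂ)
    (hσ : IsLocalSimplexFamily (d := d) σ)
    (h : k + q + (k + 1) = 2 * p) (ξ : Fin (k + q) → X → LieAlg d G) (ρ : Equiv.Perm (Fin k)) (x : X)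
    (w : Fin k → TangentSpace (𝓡 k) x) :
    ∑ ϖ, blockForm P σ h ξ ρ ϖ x w = wedgeIntegral (simplexDeriv d σ)
      (lastAlt P h (diffVec ξ ρ x w)) (fun c => ξ (Fin.natAdd k c) x) := by
  unfold blockForm wedgeIntegral
  rw [← integral_finsetSum]
  · refine setIntegral_congr_fun (isCompact_simplex q).measurableSet fun s _ => ?_
    simp only [wedgeForm_apply]
  · intro ϖ _
    refine ContinuousOn.integrableOn_compact (isCompact_simplex q) fun s hs => ?_
    have h1 : ∀ c c', ContDiffAt ℝ ∞ (fun s => fderiv ℝ (fun s => simplexDeriv d σ q c s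
        (ξ (Fin.natAdd k c) x)) s (Pi.single c' 1)) s := fun c c' =>
      (((hσ.eventually_contDiffAt_simplexDeriv hs c).self_of_nhds.clm_apply
        contDiffAt_const).fderiv_right (m := ∞) (by simp)).clm_apply contDiffAt_const
    have h2 : ContinuousAt (fun s (c : Fin q) => fderiv ℝ (fun s => simplexDeriv d σ q (ϖ c) s
        (ξ (Fin.natAdd k (ϖ c)) x)) s (Pi.single c 1)) s :=
      continuousAt_pi.2 fun c => (h1 (ϖ c) c).continuousAt
    exact ((toCMM (lastAlt P h (diffVec ξ ρ x w)).toMultilinearMap).cont.continuousAt.comp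
      h2).continuousWithinAt

end BlockForm

/-! ### The mixed derivative of the summand with m = k + 1 -/

section Leading

variable {d k p q : ℕ} {G : Type*} [TopologicalSpace G] [ChartedSpace (Model d) G] [Group G]
  [LieGroup (𝓡 d) ∞ G] {X : Type*} [TopologicalSpace X] [T2Space X] [CompactSpace X]
  [ChartedSpace (Model k) X] [IsManifold (𝓡 k) ∞ X]
  {σ : ∀ l : ℕ, (Fin l → G) → (Fin l → ℝ) → G}
  {γ : Fin (k + q) → ℝ → X → G} {ξ : Fin (k + q) → X → LieAlg d G}

lemma nestedIntegral_blockPerm (hσ : IsLocalSimplexFamily (d := d) σ)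
    (hγ : ∀ i, IsGaugeCurve (d := d) (k := k) (γ i) (ξ i)) (hξ : ∀ i, IsSmooth (k := k) (ξ i)) (o : Orient k X)
    (P : MultilinearMap ℝ (fun _ : Fin p => LieAlg d G) ℂ) (h : k + q + (k + 1) = 2 * p)
    (ρ : Equiv.Perm (Fin k)) (ϖ : Equiv.Perm (Fin q)) :
    ∑ x₀ ∈ activeCharts k X, nestedIntegral (chartSupport k x₀) (chartWeight o x₀) P h
      (fun (_ : Model k × (Fin q → ℝ)) _ => 1)
      (fun y l j => fderiv (F := Model d) ℝ (fun x => gaugeVec σ rfl γ x₀ x l j) (0, y)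
        (Pi.single (blockPerm ρ ϖ l) 1, 0)) = integral o (blockForm P σ h ξ ρ ϖ) := by
  rw [integral_eq_sum]
  refine Finset.sum_congr rfl fun x₀ _ => ?_
  refine setIntegral_congr_fun (isCompact_chartSupport x₀).measurableSet fun z hz => ?_
  have hz' := chartSupport_subset x₀ hz
  simp only [Complex.real_smul, chartCoeff_blockForm P h hξ ρ ϖ x₀ hz']
  congr 1
  refine setIntegral_simplex_congr fun s hs => ?_
  congr 1
  funext l
  refine (funext fun j => fderiv_gaugeVec hσ hγ hz' hs (blockPerm ρ ϖ l) l j).trans ?_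
  induction l using Fin.addCases with
  | left b =>
    rw [blockPerm_left, Fin.append_left]
    exact fderiv_gaugeMapDeriv_left_left hξ hz' s b (ρ b)
  | right c =>
    rw [blockPerm_right, Fin.append_right]
    exact fderiv_gaugeMapDeriv_right_right hσ hξ hz' (interior_subset hs) c (ϖ c)

/-- One of the entries is the derivative of an X-dependent argument in a simplex direction, which is
zero. -/
lemma nestedIntegral_eq_zero_of_mixing (hσ : IsLocalSimplexFamily (d := d) σ)
    (hγ : ∀ i, IsGaugeCurve (d := d) (k := k) (γ i) (ξ i)) (hξ : ∀ i, IsSmooth (k := k) (ξ i)) (o : Orient k X)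
    (P : MultilinearMap ℝ (fun _ : Fin p => LieAlg d G) ℂ) (h : k + q + (k + 1) = 2 * p) (x₀ : X)
    {π : Fin (k + q) → Fin (k + q)} {c : Fin q} {b : Fin k} (hπ : π (Fin.natAdd k c) = Fin.castAdd q b) :
    nestedIntegral (chartSupport k x₀) (chartWeight o x₀) P h
      (fun (_ : Model k × (Fin q → ℝ)) _ => 1)
      (fun y l j => fderiv (F := Model d) ℝ (fun x => gaugeVec σ rfl γ x₀ x l j) (0, y)
        (Pi.single (π l) 1, 0)) = 0 := by
  refine setIntegral_eq_zero_of_forall_eq_zero fun z hz => ?_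
  have hz' := chartSupport_subset x₀ hz
  have h0 : ∫ s in simplex q, bssForm P h (fun _ => 1)
      (fun l j => (fderiv (F := Model d) ℝ (fun x => gaugeVec σ rfl γ x₀ x l j) (0, (z, s))
        (Pi.single (π l) 1, 0) : LieAlg d G)) = ∫ s in simplex q, (0 : ℂ) :=
    setIntegral_simplex_congr fun s hs => by
      refine (bssAlt P h (fun _ => 1)).map_coord_zero (Fin.natAdd k c) ?_
      refine (funext fun j => fderiv_gaugeVec hσ hγ hz' hs (π (Fin.natAdd k c)) _ j).trans ?_
      rw [hπ]
      exact fderiv_gaugeMapDeriv_right_left hξ hz' s c b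
  rw [h0]
  simp

/-- The mixed derivative at the identity of the summand of the local cochain with `m = k + 1`. -/
theorem iteratedFDeriv_betaForm (hσ : IsLocalSimplexFamily (d := d) σ)
    (hγ : ∀ i, IsGaugeCurve (d := d) (k := k) (γ i) (ξ i)) (hξ : ∀ i, IsSmooth (k := k) (ξ i)) (o : Orient k X)
    (P : MultilinearMap ℝ (fun _ : Fin p => LieAlg d G) ℂ) (h : k + q + (k + 1) = 2 * p)
    (τ : Equiv.Perm (Fin (k + q))) :
    iteratedFDeriv ℝ (k + q) (fun t : Fin (k + q) → ℝ =>
      integral o (betaForm P σ rfl h (fun i => γ i (t (τ i))))) 0 (fun i => Pi.single i 1) =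
      integral o (fun x w => ∑ ρ, wedgeIntegral (simplexDeriv d σ)
        (lastAlt P h (diffVec ξ ρ x w)) (fun c => ξ (Fin.natAdd k c) x)) := by
  rw [((hasLeadingTerms_betaForm hσ hγ o P rfl h).comp_perm τ).iteratedFDeriv_apply]
  refine (Fintype.sum_equiv (Equiv.mulLeft τ⁻¹) _ (fun π : Equiv.Perm (Fin (k + q)) =>
    ∑ x₀ ∈ activeCharts k X, nestedIntegral (chartSupport k x₀) (chartWeight o x₀) P h
      (fun (_ : Model k × (Fin q → ℝ)) _ => 1)
      (fun y l j => fderiv (F := Model d) ℝ (fun x => gaugeVec σ rfl γ x₀ x l j) (0, y)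
        (Pi.single (π l) 1, 0))) (fun π => rfl)).trans ?_
  -- Only block permutations survive; the sum over the second block assembles the wedge integral
  -- over the simplex.
  rw [sum_perm_eq_sum_blockPerm]
  · simp only [nestedIntegral_blockPerm hσ hγ hξ o P h]
    simp only [← sum_blockForm P hσ h]
    rw [integral_finset_sum']
    · refine Finset.sum_congr rfl fun ρ _ => ?_
      rw [integral_finset_sum']
      exact fun ϖ => isContForm_blockForm P hσ h hξ ρ ϖ
    · exact fun ρ => isContForm_sum _ fun ϖ => isContForm_blockForm P hσ h hξ ρ ϖ
  · rintro π ⟨c, b, hπ⟩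
    exact Finset.sum_eq_zero fun x₀ _ => nestedIntegral_eq_zero_of_mixing hσ hγ hξ o P h x₀ hπ

end Leading

/-! ### Skew-symmetrisation of the leading term and comparison with α -/

section SkewDerivative

variable {d k p q N : ℕ} {G : Type*} [TopologicalSpace G] [ChartedSpace (Model d) G] [Group G]
  [LieGroup (𝓡 d) ∞ G] {X : Type*} [TopologicalSpace X]
  [ChartedSpace (Model k) X] [IsManifold (𝓡 k) ∞ X]
  {σ : ∀ l : ℕ, (Fin l → G) → (Fin l → ℝ) → G}

lemma bssForm_perm {n m : ℕ} (P : MultilinearMap ℝ (fun _ : Fin p => LieAlg d G) ℂ)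
    (h : n + m = 2 * p) (a : Fin m → G) (v : Fin n → Fin m → LieAlg d G) (τ : Equiv.Perm (Fin n)) :
    bssForm P h a (fun l => v (τ l)) = ((Equiv.Perm.sign τ : ℤ) : ℂ) * bssForm P h a v := by
  have := (bssAlt P h a).map_perm v τ
  rw [units_smul_complex] at this
  exact this

/-- The permutation that exchanges the first `k` and the last `q` elements. -/
def blockSwap (k q : ℕ) : Equiv.Perm (Fin (k + q)) :=
  finAddFlip.trans (finCongr (Nat.add_comm q k))

lemma blockSwap_left (b : Fin k) :
    blockSwap k q (Fin.castAdd q b) = Fin.cast (Nat.add_comm q k) (Fin.natAdd q b) := by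
  simp [blockSwap]

lemma blockSwap_right (c : Fin q) :
    blockSwap k q (Fin.natAdd k c) = Fin.cast (Nat.add_comm q k) (Fin.castAdd k c) := by
  simp [blockSwap]

/-- The leading term of the local cochain, as a form on `X`. -/
def leadForm (P : MultilinearMap ℝ (fun _ : Fin p => LieAlg d G) ℂ)
    (σ : ∀ l : ℕ, (Fin l → G) → (Fin l → ℝ) → G) (h : k + q + (k + 1) = 2 * p)
    (ξ : Fin (k + q) → X → LieAlg d G) (x : X) (w : Fin k → TangentSpace (𝓡 k) x) : ℂ :=
  ∑ ρ, wedgeIntegral (simplexDeriv d σ) (lastAlt P h (diffVec ξ ρ x w))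
    (fun c => ξ (Fin.natAdd k c) x)

lemma isContForm_leadForm (P : MultilinearMap ℝ (fun _ : Fin p => LieAlg d G) ℂ)
    (hσ : IsLocalSimplexFamily (d := d) σ) (h : k + q + (k + 1) = 2 * p)
    {ξ : Fin (k + q) → X → LieAlg d G} (hξ : ∀ i, IsSmooth (k := k) (ξ i)) :
    IsContForm (leadForm P σ h ξ) := by
  unfold leadForm
  simp only [← sum_blockForm P hσ h]
  exact isContForm_sum _ fun ρ => isContForm_sum _ fun ϖ => isContForm_blockForm P hσ h hξ ρ ϖ

lemma isContForm_unitForm (P : MultilinearMap ℝ (fun _ : Fin p => LieAlg d G) ℂ)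
    (h : q + k + (k + 1) = 2 * p) (hN : q + k = N) {ξ : Fin N → X → LieAlg d G}
    (hξ : ∀ i, IsSmooth (k := k) (ξ i)) : IsContForm (unitForm P h hN ξ) := by
  have := isContForm_slotForm ((bssAlt P h fun _ => (1 : G)).toMultilinearMap.compLinearMap
    (Fin.append (fun _ : Fin q => LinearMap.single ℝ (fun _ : Fin (k + 1) => LieAlg d G) (Fin.last k))
      (fun j : Fin k => LinearMap.single ℝ (fun _ : Fin (k + 1) => LieAlg d G) j.castSucc)))
    (Fin.append (fun _ => none) some) (y := fun l => ξ (Fin.cast hN l)) (fun l => hξ _)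
  convert this using 1
  funext x w
  refine Finset.sum_congr rfl fun ρ _ => congrArg _ (congrArg (bssForm P h _) ?_)
  funext l
  induction l using Fin.addCases with
  | left i => simp [unitVec]
  | right j => simp [unitVec]

/-- The skew-symmetrisation over the last `q` arguments removes the simplices. -/
lemma sum_leadForm_blockPerm (P : MultilinearMap ℝ (fun _ : Fin p => LieAlg d G) ℂ)
    (hσ : IsLocalSimplexFamily (d := d) σ) (h : k + q + (k + 1) = 2 * p)
    (ξ : Fin (k + q) → X → LieAlg d G) (x : X) (w : Fin k → TangentSpace (𝓡 k) x) :
    ∑ ϖ : Equiv.Perm (Fin q), ((Equiv.Perm.sign ϖ : ℤ) : ℂ) *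
        leadForm P σ h (fun i => ξ (blockPerm 1 ϖ i)) x w =
      ∑ ρ, lastAlt P h (diffVec ξ ρ x w) (fun c => ξ (Fin.natAdd k c) x) := by
  unfold leadForm
  simp only [Finset.mul_sum]
  rw [Finset.sum_comm]
  refine Finset.sum_congr rfl fun ρ _ => ?_
  refine Eq.trans ?_ (hσ.isSimplexFamily.altSum_wedgeIntegral (lastAlt P h (diffVec ξ ρ x w))
    (fun c => ξ (Fin.natAdd k c) x))
  refine Finset.sum_congr rfl fun ϖ _ => ?_
  have h1 : diffVec (fun i => ξ (blockPerm 1 ϖ i)) ρ x w = diffVec ξ ρ x w := by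
    funext b
    exact congrArg (fun i => (Pi.single (ρ b).castSucc (diff (ξ i) x (w b)) :
      Fin (k + 1) → LieAlg d G)) (blockPerm_left 1 ϖ (ρ b))
  simp only [h1, blockPerm_right]

/-- The vectors on the two sides differ by the block swap composed with the block permutation of
`ρ`. The latter cancels the sign in `unitForm`, where the sum runs over `ρ⁻¹`: on one side vectors
are matched to forms, on the other forms to vectors. -/
lemma sum_lastAlt_blockSwap (P : MultilinearMap ℝ (fun _ : Fin p => LieAlg d G) ℂ)
    (h : k + q + (k + 1) = 2 * p) (h' : q + k + (k + 1) = 2 * p)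
    (ξ : Fin (k + q) → X → LieAlg d G) (x : X) (w : Fin k → TangentSpace (𝓡 k) x) :
    ∑ ρ, lastAlt P h (diffVec (fun i => ξ (blockSwap k q i)) ρ x w)
        (fun c => ξ (blockSwap k q (Fin.natAdd k c)) x) =
      ((Equiv.Perm.sign (blockSwap k q) : ℤ) : ℂ) * unitForm P h' (Nat.add_comm q k) ξ x w := by
  unfold unitForm
  rw [Finset.mul_sum]
  refine Fintype.sum_equiv (Equiv.inv _) _ _ fun ρ => ?_
  have h1 : (Fin.append (diffVec (fun i => ξ (blockSwap k q i)) ρ x w)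
      (fun c => Pi.single (Fin.last k) (ξ (blockSwap k q (Fin.natAdd k c)) x)) :
      Fin (k + q) → Fin (k + 1) → LieAlg d G) = fun l =>
      unitVec (fun i => ξ (Fin.cast (Nat.add_comm q k) (Fin.castAdd k i)) x)
        (fun j => diff (ξ (Fin.cast (Nat.add_comm q k) (Fin.natAdd q j))) x (w (ρ⁻¹ j)))
        (Fin.cast (Nat.add_comm k q) ((blockSwap k q * blockPerm ρ 1 : Equiv.Perm (Fin (k + q))) l)) := by
    funext l
    rw [Equiv.Perm.mul_apply]
    induction l using Fin.addCases with
    | left b =>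
      rw [blockPerm_left, blockSwap_left, Fin.append_left, Fin.cast_cast, Fin.cast_eq_self,
        unitVec_right]
      refine (congrArg (fun i => (Pi.single (ρ b).castSucc (diff (ξ i) x (w b)) :
        Fin (k + 1) → LieAlg d G)) (blockSwap_left (ρ b))).trans ?_
      simp
    | right c =>
      rw [blockPerm_right, Equiv.Perm.one_apply, blockSwap_right, Fin.append_right, Fin.cast_cast,
        Fin.cast_eq_self, unitVec_left, blockSwap_right]
  refine (congrArg (bssForm P h fun _ => 1) h1).trans ?_
  rw [bssForm_perm P h _ (fun l => unitVec
    (fun i => ξ (Fin.cast (Nat.add_comm q k) (Fin.castAdd k i)) x)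
    (fun j => diff (ξ (Fin.cast (Nat.add_comm q k) (Fin.natAdd q j))) x (w (ρ⁻¹ j)))
    (Fin.cast (Nat.add_comm k q) l)), bssForm_cast P (Nat.add_comm k q) h h', map_mul, sign_blockPerm]
  simp [mul_assoc]

/-- The skew-symmetrisation of the leading term of the local cochain. -/
theorem altSum_leadForm (P : MultilinearMap ℝ (fun _ : Fin p => LieAlg d G) ℂ)
    (hσ : IsLocalSimplexFamily (d := d) σ) (h : k + q + (k + 1) = 2 * p)
    (h' : q + k + (k + 1) = 2 * p) (ξ : Fin (k + q) → X → LieAlg d G) (x : X)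
    (w : Fin k → TangentSpace (𝓡 k) x) :
    altSum (fun ξ => leadForm P σ h ξ x w) ξ =
      ((q.factorial : ℂ))⁻¹ * altSum (fun ξ => unitForm P h' (Nat.add_comm q k) ξ x w) ξ := by
  have h1 : (q.factorial : ℂ) * altSum (fun ξ => leadForm P σ h ξ x w) ξ =
      altSum (fun ξ : Fin (k + q) → X → LieAlg d G =>
        ∑ ρ, lastAlt P h (diffVec ξ ρ x w) (fun c => ξ (Fin.natAdd k c) x)) ξ := by
    simp only [← sum_leadForm_blockPerm P hσ h, altSum_sum, altSum_const_mul]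
    have h2 : ∀ ϖ : Equiv.Perm (Fin q), ((Equiv.Perm.sign ϖ : ℤ) : ℂ) *
        altSum (fun ξ => leadForm P σ h (fun i => ξ (blockPerm 1 ϖ i)) x w) ξ =
        altSum (fun ξ => leadForm P σ h ξ x w) ξ := fun ϖ => by
      rw [altSum_comp (fun ξ => leadForm P σ h ξ x w), sign_blockPerm, map_one, one_mul, ← mul_assoc,
        sign_mul_self, one_mul]
    simp only [h2, Finset.sum_const, Finset.card_univ, Fintype.card_perm, Fintype.card_fin,
      nsmul_eq_mul]
  -- The block swap contributes its sign twice, once from exchanging the blocks of arguments and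
  -- once from exchanging the blocks of vectors, so no sign remains.
  have h3 := altSum_comp (fun ξ : Fin (k + q) → X → LieAlg d G =>
    ∑ ρ, lastAlt P h (diffVec ξ ρ x w) (fun c => ξ (Fin.natAdd k c) x)) ξ (blockSwap k q)
  simp only [sum_lastAlt_blockSwap P h h', altSum_const_mul] at h3
  have h4 := congrArg (((Equiv.Perm.sign (blockSwap k q) : ℤ) : ℂ) * ·) h3
  simp only [← mul_assoc, sign_mul_self, one_mul] at h4
  have hf : (q.factorial : ℂ) ≠ 0 := by exact_mod_cast Nat.factorial_ne_zero _
  rw [h4, ← h1, ← mul_assoc, inv_mul_cancel₀ hf, one_mul]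

variable [T2Space X] [CompactSpace X]

lemma sum_integral_leadForm (o : Orient k X) (P : MultilinearMap ℝ (fun _ : Fin p => LieAlg d G) ℂ)
    (hσ : IsLocalSimplexFamily (d := d) σ) (h : k + q + (k + 1) = 2 * p)
    (h' : q + k + (k + 1) = 2 * p) {ξ : Fin (k + q) → X → LieAlg d G}
    (hξ : ∀ i, IsSmooth (k := k) (ξ i)) :
    ∑ τ : Equiv.Perm (Fin (k + q)), ((Equiv.Perm.sign τ : ℤ) : ℂ) *
        integral o (leadForm P σ h (fun i => ξ (τ i))) =
      ((q.factorial : ℂ))⁻¹ * ∑ τ : Equiv.Perm (Fin (k + q)), ((Equiv.Perm.sign τ : ℤ) : ℂ) *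
        integral o (unitForm P h' (Nat.add_comm q k) (fun i => ξ (τ i))) := by
  have h1 : ∀ F : (Fin (k + q) → X → LieAlg d G) → ∀ x : X, (Fin k → TangentSpace (𝓡 k) x) → ℂ,
      (∀ τ : Equiv.Perm (Fin (k + q)), IsContForm (F (fun i => ξ (τ i)))) →
      ∑ τ : Equiv.Perm (Fin (k + q)), ((Equiv.Perm.sign τ : ℤ) : ℂ) * integral o (F (fun i => ξ (τ i))) =
        integral o (fun x w => altSum (fun ξ => F ξ x w) ξ) := fun F hF => by
    unfold altSum
    rw [integral_finset_sum' _ o fun τ => isContForm_const_mul _ (hF τ)]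
    exact Finset.sum_congr rfl fun τ _ => (integral_const_mul' o _ _).symm
  rw [h1 _ fun τ => isContForm_leadForm P hσ h fun i => hξ (τ i),
    h1 _ fun τ => isContForm_unitForm P h' _ fun i => hξ (τ i), ← integral_const_mul']
  exact integral_congr' o fun x w => altSum_leadForm P hσ h h' ξ x w

variable {ξ : Fin N → X → LieAlg d G} {γ : Fin N → ℝ → X → G}

/-- The contribution of the summand `c_{k + 1, q}` to the derivative of the local cochain. -/
lemma sum_iteratedFDeriv_betaForm (hσ : IsLocalSimplexFamily (d := d) σ)
    (hγ : ∀ i, IsGaugeCurve (d := d) (k := k) (γ i) (ξ i)) (hξ : ∀ i, IsSmooth (k := k) (ξ i))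
    (o : Orient k X) (P : MultilinearMap ℝ (fun _ : Fin p => LieAlg d G) ℂ) {q' : ℕ} (hq : q' = q)
    (h : k + q = N) (h' : k + q + (k + 1) = 2 * p) (h'' : q' + k + (k + 1) = 2 * p) (hN : q' + k = N) :
    ∑ τ : Equiv.Perm (Fin N), ((Equiv.Perm.sign τ : ℤ) : ℂ) *
        iteratedFDeriv ℝ N (fun t : Fin N → ℝ =>
          integral o (betaForm P σ h h' (fun i => γ (τ i) (t (τ i))))) 0 (fun i => Pi.single i 1) =
      ∑ τ : Equiv.Perm (Fin N), ((Equiv.Perm.sign τ : ℤ) : ℂ) *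
        (((q'.factorial : ℂ))⁻¹ * integral o (unitForm P h'' hN (fun i => ξ (τ i)))) := by
  subst hq h
  rw [Finset.sum_congr rfl fun τ _ => congrArg (_ * ·) (iteratedFDeriv_betaForm hσ
    (fun i => hγ (τ i)) (fun i => hξ (τ i)) o P h' τ)]
  refine (sum_integral_leadForm o P hσ h' h'' hξ).trans ?_
  rw [Finset.mul_sum]
  exact Finset.sum_congr rfl fun τ _ => by ring

/-- With the shifted index of the code, the summands with `m < k` vanish to an order larger than
`N`, those with `m > k` vanish identically near the identity, and the summand `m = k` gives the
skew-symmetrisation of α. -/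
theorem skewDerivative_localCochain (hk : k < p) (o : Orient k X)
    (P : MultilinearMap ℝ (fun _ : Fin p => LieAlg d G) ℂ)
    {σ : ∀ l : ℕ, (Fin l → G) → (Fin l → ℝ) → G} (hσ : IsLocalSimplexFamily (d := d) σ)
    {ξ : Fin (2 * p - k - 1) → X → LieAlg d G} (hξ : ∀ i, IsSmooth (k := k) (ξ i))
    {γ : Fin (2 * p - k - 1) → ℝ → X → G} (hγ : ∀ i, IsGaugeCurve (d := d) (k := k) (γ i) (ξ i)) :
    skewDerivative (localCochain hk P σ o) γ =
      ∑ τ : Equiv.Perm (Fin (2 * p - k - 1)), ((Equiv.Perm.sign τ : ℤ) : ℂ) *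
        integral o (alphaForm hk P (fun i => ξ (τ i))) := by
  have hlead := fun (τ : Equiv.Perm (Fin (2 * p - k - 1))) (m : Fin p) =>
    (hasLeadingTerms_betaForm hσ (fun i => hγ (τ i)) o P (m := m) (q := 2 * p - k - 1 - m)
      (by omega) (by omega)).comp_perm τ
  have hsmooth := fun (τ : Equiv.Perm (Fin (2 * p - k - 1))) (m : Fin p) =>
    ((hlead τ m).eventually_contDiffAt.self_of_nhds).of_le
      (show ((2 * p - k - 1 : ℕ) : WithTop ℕ∞) ≤ ∞ from WithTop.coe_le_coe.2 le_top)
  have hterm : ∀ (τ : Equiv.Perm (Fin (2 * p - k - 1))) (m : Fin p), m ≠ ⟨k, hk⟩ →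
      iteratedFDeriv ℝ (2 * p - k - 1) (fun t : Fin (2 * p - k - 1) → ℝ =>
        integral o (betaForm P σ (m := m) (q := 2 * p - k - 1 - m) (by omega) (by omega)
          (fun i => γ (τ i) (t (τ i))))) 0 (fun i => Pi.single i 1) = 0 := by
    intro τ m hm
    rcases lt_or_gt_of_ne (fun h => hm (Fin.ext h) : (m : ℕ) ≠ k) with hmk | hmk
    · rw [(hlead τ m).iteratedFDeriv_eq_zero (by omega)]
      rfl
    · have hc : Filter.Tendsto (fun (t : Fin (2 * p - k - 1) → ℝ) i => t (τ i)) (𝓝 0) (𝓝 0) :=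
        (by fun_prop : Continuous fun (t : Fin (2 * p - k - 1) → ℝ) i => t (τ i)).tendsto 0
      have h0 : (fun t : Fin (2 * p - k - 1) → ℝ =>
          integral o (betaForm P σ (m := m) (q := 2 * p - k - 1 - m) (by omega) (by omega)
            (fun i => γ (τ i) (t (τ i))))) =ᶠ[𝓝 0] fun _ => 0 :=
        hc.eventually (integral_betaForm_eventually_zero hσ (fun i => hγ (τ i)) o P _ _ hmk)
      rw [(h0.iteratedFDeriv ℝ _).eq_of_nhds, iteratedFDeriv_fun_zero]
      rfl
  unfold skewDerivative localCochain
  rw [iteratedFDeriv_fun_sum_apply fun τ _ => contDiffAt_const.mul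
    (ContDiffAt.sum fun m _ => hsmooth τ m), sum_apply]
  -- The dimension of the simplex is written `2p - k - 1 - k` in the cochain and `2p - 2k - 1` in α;
  -- since `k < p`, these agree.
  refine Eq.trans (Finset.sum_congr rfl fun τ _ => ?_) ((sum_iteratedFDeriv_betaForm hσ hγ hξ o P
    (show 2 * p - 2 * k - 1 = 2 * p - k - 1 - k by omega) (by omega) (by omega) (by omega)
    (by omega)).trans (Finset.sum_congr rfl fun τ _ => ?_))
  · have h1 := iteratedFDeriv_const_smul_apply (𝕜 := ℝ) (a := ((Equiv.Perm.sign τ : ℤ) : ℂ))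
      (ContDiffAt.sum fun m (_ : m ∈ Finset.univ) => hsmooth τ m)
    refine (congrArg (fun f => f fun i => Pi.single i 1) h1).trans ?_
    refine congrArg (fun z : ℂ => ((Equiv.Perm.sign τ : ℤ) : ℂ) * z) ?_
    refine (congrArg (fun f => f fun i => Pi.single i 1)
      (iteratedFDeriv_fun_sum_apply fun m _ => hsmooth τ m)).trans ?_
    refine (sum_apply _ _ _).trans ?_
    exact Finset.sum_eq_single (⟨k, hk⟩ : Fin p) (fun m _ hm => hterm τ m hm) (by simp)
  · rw [← integral_const_mul']
    rfl

end SkewDerivative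

end GaugeCocycle

end

open GaugeCocycle in
theorem proposition5p5 {d k p : ℕ} (hk : k < p)
    {G : Type*} [TopologicalSpace G] [ChartedSpace (Model d) G] [Group G] [LieGroup (𝓡 d) ∞ G]
    {X : Type*} [TopologicalSpace X] [T2Space X] [CompactSpace X] [ChartedSpace (Model k) X]
    [IsManifold (𝓡 k) ∞ X] (o : Orient k X)
    (P : MultilinearMap ℝ (fun _ : Fin p => LieAlg d G) ℂ) (hP : IsInvariantPolynomial P)
    (σ : ∀ l : ℕ, (Fin l → G) → (Fin l → ℝ) → G) (hσ : IsLocalSimplexFamily (d := d) σ) :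
    ∃ Φ : (gaugeLieAlgebra d k G X) [⋀^Fin (2 * p - k - 1)]→ₗ[ℝ] ℂ,
      IsLieCocycle Φ ∧
      (∀ (ξ : Fin (2 * p - k - 1) → gaugeLieAlgebra d k G X)
        (γ : Fin (2 * p - k - 1) → ℝ → X → G), (∀ i, IsGaugeCurve (d := d) (k := k) (γ i) (ξ i)) →
        ContDiffAt ℝ ∞ (fun t : Fin (2 * p - k - 1) → ℝ =>
          localCochain hk P σ o (fun i => γ i (t i))) 0 ∧
        skewDerivative (localCochain hk P σ o) γ = Φ ξ) ∧
      (∀ ξ : Fin (2 * p - k - 1) → gaugeLieAlgebra d k G X,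
        Φ ξ = ∑ τ : Equiv.Perm (Fin (2 * p - k - 1)), ((Equiv.Perm.sign τ : ℤ) : ℂ) *
          integral o (alphaForm hk P (fun i => (ξ (τ i) : X → LieAlg d G)))) ∧
      (∀ (hp : k + 1 = p) (ξ : Fin (2 * p - k - 1) → gaugeLieAlgebra d k G X),
        Φ ξ = (-1 : ℂ) ^ k * (Nat.factorial p : ℂ) *
          integral o (feiginForm hp P (fun i => (ξ i : X → LieAlg d G)))) ∧
      (∀ (hp : p = 2) (hk1 : k = 1) (ξ : Fin (2 * p - k - 1) → gaugeLieAlgebra d k G X),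
        Φ ξ = 2 * integral o (kacMoodyForm hp hk1 P (fun i => (ξ i : X → LieAlg d G)))) := by
  -- The `p` slots of the polynomial are one undifferentiated argument, `r` brackets and `k`
  -- differentials.
  obtain ⟨r, hr⟩ : ∃ r, p = r + k + 1 := ⟨p - k - 1, by omega⟩
  have hq : 2 * p - 2 * k - 1 = 2 * r + 1 := by omega
  have h : 2 * p - 2 * k - 1 + k + (k + 1) = 2 * p := by omega
  have hN : 2 * p - 2 * k - 1 + k = 2 * p - k - 1 := by omega
  obtain ⟨e₀⟩ : Nonempty (Slot r k ≃ Fin p) := ⟨Fintype.equivFinOfCardEq (by simp; omega)⟩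
  obtain ⟨σ₀⟩ : Nonempty (Unit ⊕ (Fin r ⊕ Fin r) ≃ Fin (2 * p - 2 * k - 1)) :=
    ⟨Fintype.equivFinOfCardEq (by simp; omega)⟩
  obtain ⟨C, hC⟩ := exists_bssForm_eq hP.1 h hq e₀ σ₀
  have hα := gaugeForm_eq_alphaForm (X := X) o hk hC
  have htop : ∀ (hp : k + 1 = p) (ξ : Fin (2 * p - k - 1) → gaugeLieAlgebra d k G X),
      gaugeForm o (slotPoly P e₀) (argEquiv hN σ₀) C ξ =
      (Nat.factorial (k + 1) : ℂ) *
        integral o (unitForm P h hN (fun i => (ξ i : X → LieAlg d G))) := by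
    intro hp ξ
    -- No brackets remain, so the integral is already alternating and skew-symmetrisation is
    -- multiplication by a factorial.
    obtain rfl : r = 0 := by omega
    exact gaugeForm_eq_unitForm o hP.1 hq hC hN ξ
  refine ⟨gaugeForm o (slotPoly P e₀) (argEquiv hN σ₀) C, ?_, ?_, hα, ?_, ?_⟩
  · exact isLieCocycle_gaugeForm o (slotPoly_symm hP.1 e₀) (hP.sum_slotPoly_bracket e₀) _ C
  · intro ξ γ hγ
    exact ⟨(contDiffAt_localCochain hk o P hσ hγ).self_of_nhds,
      (skewDerivative_localCochain hk o P hσ (fun i => isSmooth_coe (ξ i)) hγ).trans (hα ξ).symm⟩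
  · intro hp ξ
    rw [htop hp, integral_congr' o (feiginForm_eq hp hP.1 h hN _), integral_const_mul']
    subst hp
    ring
  · intro hp hk1 ξ
    rw [htop (by omega), integral_congr' o (kacMoodyForm_eq hp hk1 hP.1 h hN _)]
    subst hk1
    norm_num [Nat.factorial]
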